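/- Let $n\ge 2$, $\langle x\rangle=(1+|x|^2)^{1/2}$, and let $0<h\le 1$ be a semi-classical parameter, $\mathcal D_{x_j}=-ih\,\partial_{x_j}$. Let $P_0(h)$ be the self-adjoint realization of $-h^2\Delta$ on $L^2(\mathbf R^n)$ and consider $$P(h)=\sum_{i,j=1}^n\mathcal D_{x_i}a_{ij}(x,h)\mathcal D_{x_j}+\sum_{j=1}^n\bigl(b_j(x,h)\mathcal D_{x_j}+\mathcal D_{x_j}b_j(x,h)\bigr)+V(x,h),$$ with real-valued coefficients $a_{ij}=a^0_{ij}(x)+h\,a^1_{ij}(x,h)$, $b_j=b^0_j(x)+h\,b^1_j(x,h)$, $V=V^0(x)+h\,V^1(x,h)$, where $a_{ij}(\cdot,h),b_j(\cdot,h)\in C^1(\mathbf R^n)$, where $a^0_{ij},b^0_j,V^0\in C^1(\mathbf R^n)$ do not depend on $h$, and $a^1_{ij},b^1_j,V^1\in L^\infty(\mathbf R^n)$ uniformly in $h$. Put $a^\flat_{ij}=1$ if $i=j$ and $a^\flat_{ij}=0$ if $i\ne j$. Suppose that for each $h$ this operator has a self-adjoint realization on $L^2(\mathbf R^n)$, again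 denoted by $P(h)$, that the following two conditions hold with a constant $C>0$ and a $\delta>1$ independent of $h$: $$\sum_{|\alpha|\le 2}\bigl\|\mathcal D_x^\alpha(P(h)\pm i)^{-1}\bigr\|_{L^2\to L^2}\le C,\tag{1.3}$$ $$\sum_{i,j}\bigl|\partial_x^\alpha(a_{ij}(x,h)-a^\flat_{ij})\bigr|+\sum_j|\partial_x^\alpha b_j(x,h)|+|\partial_x^\alpha V^0(x)|+|V^1(x,h)|\le C\langle x\rangle^{-\delta},\quad |\alpha|\le 1,\tag{1.4}$$ and that, if $n\ge 4$, $$\sup_{x}\sum_{i,j}|a_{ij}(x,h)-a^\flat_{ij}|\le\gamma\quad\text{for all }0<h\le1,\tag{1.5}$$ where $\gamma>0$ is a sufficiently small constant depending only on $n$. Define $\nu\in\{0,1,2\}$ as follows. If $a^0_{ij}-a^\flat_{ij}\equiv b^0_j\equiv V^0\equiv 0$ and $\sum_{i,j}|a^1_{ij}(x,h)|+\sum_j|b^1_j(x,h)|+|V^1(x,h)|\le C'h\langle x\rangle^{-\delta}$ for some $C'$ independent of $x,h$, then $\nu=2$. Otherwise, if $a^0_{ij}-a^\flat_{ij}\equiv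 b^0_j\equiv V^0\equiv 0$ and the same sum is at most $C'\langle x\rangle^{-\delta}$ for some $C'$ independent of $x,h$, then $\nu=1$. In all other cases $\nu=0$. Let $\varphi\in C_0^\infty((0,+\infty))$ be independent of $h$. Then for all $0\le s,s_1,s_2\le\delta$ with $s_1+s_2\le\delta$ there is a constant $C>0$ such that for all $0<h\le 1$ $$\bigl\|\langle x\rangle^{-s}\varphi(P_0(h))\langle x\rangle^{s}\bigr\|_{L^2\to L^2}\le C,\qquad \bigl\|\langle x\rangle^{-s}\varphi(P(h))\langle x\rangle^{s}\bigr\|_{L^2\to L^2}\le C,$$ $$\bigl\|\langle x\rangle^{s_1}\bigl(\varphi(P(h))-\varphi(P_0(h))\bigr)\langle x\rangle^{s_2}\bigr\|_{L^2\to L^2}\le Ch^{\nu},$$ $$\bigl\|\langle x\rangle^{s_1}\varphi(P_0(h))\bigl(P(h)-P_0(h)\bigr)\varphi(P(h))\langle x\rangle^{s_2}\bigr\|_{L^2\to L^2}\le Ch^{\nu},$$ $$\bigl\|\bigl(\varphi(P(h))-\varphi(P_0(h))\bigr)\langle x\rangle^{s}\bigr\|_{L^2\to L^\infty}\le Ch^{\nu-n/2}.$$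 -/

import Mathlib

open MeasureTheory LineDeriv Laplacian
open scoped SchwartzMap ContDiff ComplexConjugate

noncomputable section

namespace SemiclassicalDispersive

/-- The Euclidean space `ℝⁿ`. -/
abbrev Eucl (n : ℕ) : Type := EuclideanSpace ℝ (Fin n)

/-- The complex Hilbert space `L²(ℝⁿ)` (Lebesgue measure). -/
abbrev L2 (n : ℕ) : Type := Lp ℂ 2 (volume : Measure (Eucl n))

/-- The `j`-th vector of the canonical basis of `ℝⁿ`. -/
def stdVec {n : ℕ} (j : Fin n) : Eucl n := EuclideanSpace.single j 1

/-- The weight `⟨x⟩ = (1 + |x|²)^{1/2}`. -/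
def japanese {n : ℕ} (x : Eucl n) : ℝ := Real.sqrt (1 + ‖x‖ ^ 2)

/-- The range `0 < h ≤ 1` of the semi-classical parameter. -/
def hRange : Set ℝ := Set.Ioc 0 1

/-- The classical partial derivative `∂f/∂x_k` of a real-valued function. -/
def partialDeriv {n : ℕ} (k : Fin n) (f : Eucl n → ℝ) (x : Eucl n) : ℝ :=
  fderiv ℝ f x (stdVec k)

/-! ### The coefficients -/

/-- The real coefficients: the `h`-independent parts `a⁰, b⁰, V⁰` and the remainders
`a¹(·,h), b¹(·,h), V¹(·,h)`. -/
structure Coefficients (n : ℕ) where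
  a0 : Fin n → Fin n → Eucl n → ℝ
  b0 : Fin n → Eucl n → ℝ
  V0 : Eucl n → ℝ
  a1 : ℝ → Fin n → Fin n → Eucl n → ℝ
  b1 : ℝ → Fin n → Eucl n → ℝ
  V1 : ℝ → Eucl n → ℝ

namespace Coefficients

variable {n : ℕ} (c : Coefficients n)

/-- `a_ij(x,h) = a⁰_ij(x) + h a¹_ij(x,h)`. -/
def a (h : ℝ) (i j : Fin n) (x : Eucl n) : ℝ := c.a0 i j x + h * c.a1 h i j x

/-- `b_j(x,h) = b⁰_j(x) + h b¹_j(x,h)`. -/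
def b (h : ℝ) (j : Fin n) (x : Eucl n) : ℝ := c.b0 j x + h * c.b1 h j x

/-- `V(x,h) = V⁰(x) + h V¹(x,h)`. -/
def V (h : ℝ) (x : Eucl n) : ℝ := c.V0 x + h * c.V1 h x

/-- The Euclidean metric `a♭_ij`. -/
def aFlat (i j : Fin n) : ℝ := if i = j then 1 else 0

/-- Regularity: `a⁰, b⁰, V⁰` and `a(·,h), b(·,h)` are `C¹`, and `a¹, b¹, V¹` are in `L^∞`
uniformly in `h`. -/
structure Regular : Prop where
  a0_C1 : ∀ i j, ContDiff ℝ 1 (c.a0 i j)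
  b0_C1 : ∀ j, ContDiff ℝ 1 (c.b0 j)
  V0_C1 : ContDiff ℝ 1 c.V0
  a_C1 : ∀ h ∈ hRange, ∀ i j, ContDiff ℝ 1 (c.a h i j)
  b_C1 : ∀ h ∈ hRange, ∀ j, ContDiff ℝ 1 (c.b h j)
  V1_meas : ∀ h ∈ hRange, AEStronglyMeasurable (c.V1 h) volume
  bounded : ∃ M : ℝ, ∀ h ∈ hRange, ∀ᵐ x : Eucl n,
    (∀ i j, |c.a1 h i j x| ≤ M) ∧ (∀ j, |c.b1 h j x| ≤ M) ∧ |c.V1 h x| ≤ M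

/-- The short-range condition: `a - a♭`, `b`, `V⁰` together with their first derivatives, and
`V¹`, are `O(⟨x⟩^{-δ})` uniformly in `h`. -/
def ShortRange (δ : ℝ) : Prop :=
  ∃ C : ℝ, ∀ h ∈ hRange, ∀ᵐ x : Eucl n,
    ((∑ i, ∑ j, |c.a h i j x - aFlat i j|) + (∑ j, |c.b h j x|) + |c.V0 x| + |c.V1 h x|
        ≤ C * japanese x ^ (-δ)) ∧
    ∀ k : Fin n,
      (∑ i, ∑ j, |partialDeriv k (fun y => c.a h i j y - aFlat i j) x|)
        + (∑ j, |partialDeriv k (c.b h j) x|) + |partialDeriv k c.V0 x| + |c.V1 h x|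
        ≤ C * japanese x ^ (-δ)

/-- `sup_x ∑_{i,j} |a_ij(x,h) - a♭_ij| ≤ γ` for all `h`. -/
def CloseToEuclidean (γ : ℝ) : Prop :=
  ∀ h ∈ hRange, ∀ x : Eucl n, ∑ i, ∑ j, |c.a h i j x - aFlat i j| ≤ γ

/-- `a⁰ = a♭`, `b⁰ = 0` and `V⁰ = 0` identically. -/
def TrivialPrincipalPart : Prop :=
  (∀ i j x, c.a0 i j x = aFlat i j) ∧ (∀ j x, c.b0 j x = 0) ∧ ∀ x, c.V0 x = 0

/-- The remainders `a¹, b¹, V¹` are `O(h^k ⟨x⟩^{-δ})`, uniformly in `x` and `h`. -/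
def RemainderDecay (δ : ℝ) (k : ℕ) : Prop :=
  ∃ C : ℝ, ∀ h ∈ hRange, ∀ᵐ x : Eucl n,
    (∑ i, ∑ j, |c.a1 h i j x|) + (∑ j, |c.b1 h j x|) + |c.V1 h x|
      ≤ C * h ^ k * japanese x ^ (-δ)

open Classical in
/-- The number `ν ∈ {0, 1, 2}`; `2 - ν` is the order of the perturbation `P(h) - P₀(h)`. -/
def nu (δ : ℝ) : ℕ :=
  if c.TrivialPrincipalPart ∧ c.RemainderDecay δ 1 then 2
  else if c.TrivialPrincipalPart ∧ c.RemainderDecay δ 0 then 1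
  else 0

end Coefficients

/-! ### The differential operator -/

/-- The classical derivative `𝒟_j f = -i h ∂f/∂x_j`. -/
def semiD {n : ℕ} (h : ℝ) (j : Fin n) (f : Eucl n → ℂ) (x : Eucl n) : ℂ :=
  -(Complex.I * h) * fderiv ℝ f x (stdVec j)

/-- The differential expression
`∑ 𝒟_i (a_ij 𝒟_j f) + ∑ (b_j 𝒟_j f + 𝒟_j (b_j f)) + V f`. -/
def diffExpr {n : ℕ} (h : ℝ) (a : Fin n → Fin n → Eucl n → ℝ) (b : Fin n → Eucl n → ℝ)
    (V : Eucl n → ℝ) (f : Eucl n → ℂ) (x : Eucl n) : ℂ :=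
  (∑ i, ∑ j, semiD h i (fun y => (a i j y : ℂ) * semiD h j f y) x)
    + (∑ j, ((b j x : ℂ) * semiD h j f x + semiD h j (fun y => (b j y : ℂ) * f y) x))
    + (V x : ℂ) * f x

/-- The operator `A` in `L²` acts on its domain as the differential expression with coefficients
`a, b, V` in the sense of distributions: for `u` in the domain and every test function `ψ`,
`⟨P†ψ, u⟩ = ⟨ψ, A u⟩`. The formal adjoint `P†` is the same expression with `a` transposed. -/
def ActsAs {n : ℕ} (A : L2 n →ₗ.[ℂ] L2 n) (h : ℝ) (a : Fin n → Fin n → Eucl n → ℝ)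
    (b : Fin n → Eucl n → ℝ) (V : Eucl n → ℝ) : Prop :=
  ∀ (u : A.domain) (ψ : Eucl n → ℂ), ContDiff ℝ ∞ ψ → HasCompactSupport ψ →
    ∫ x, conj (diffExpr h (fun i j => a j i) b V ψ x) * (u : L2 n) x
      = ∫ x, conj (ψ x) * (A u) x

/-- `A` is a self-adjoint realization of `P(h)` on `L²(ℝⁿ)`. -/
def IsSelfAdjointRealization {n : ℕ} (c : Coefficients n) (h : ℝ) (A : L2 n →ₗ.[ℂ] L2 n) :
    Prop :=
  IsSelfAdjoint A ∧ ActsAs A h (c.a h) (c.b h) (c.V h)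

/-- The graph of `-h²Δ` on `L²`: pairs `(u, g)` with `g = -h²Δu` as distributions. -/
def freeGraph (n : ℕ) (h : ℝ) : Submodule ℂ (L2 n × L2 n) where
  carrier := {p | (p.2 : 𝓢'(Eucl n, ℂ)) = (-(h : ℂ) ^ 2) • Δ (p.1 : 𝓢'(Eucl n, ℂ))}
  add_mem' := by
    intro p q hp hq
    simp only [Set.mem_ofPred_eq] at hp hq ⊢
    have key : ∀ f g : L2 n, ((f + g : L2 n) : 𝓢'(Eucl n, ℂ)) = (f : 𝓢'(Eucl n, ℂ)) + g :=
      fun f g => map_add (Lp.toTemperedDistributionCLM ℂ volume 2) f g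
    have hL : ∀ f g : 𝓢'(Eucl n, ℂ), Δ (f + g) = Δ f + Δ g := fun f g => by
      simp only [← TemperedDistribution.laplacianCLM_apply, map_add]
    rw [Prod.snd_add, Prod.fst_add, key, key, hL, smul_add, hp, hq]
  zero_mem' := by
    have key : ((0 : L2 n) : 𝓢'(Eucl n, ℂ)) = 0 :=
      map_zero (Lp.toTemperedDistributionCLM ℂ volume 2)
    have hL : Δ (0 : 𝓢'(Eucl n, ℂ)) = 0 := by
      simp only [← TemperedDistribution.laplacianCLM_apply, map_zero]
    simp only [Set.mem_ofPred_eq, Prod.snd_zero, Prod.fst_zero]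
    rw [key, hL, smul_zero]
  smul_mem' := by
    intro z p hp
    simp only [Set.mem_ofPred_eq] at hp ⊢
    have key : ∀ f : L2 n, ((z • f : L2 n) : 𝓢'(Eucl n, ℂ)) = z • (f : 𝓢'(Eucl n, ℂ)) :=
      fun f => map_smul (Lp.toTemperedDistributionCLM ℂ volume 2) z f
    have hL : ∀ f : 𝓢'(Eucl n, ℂ), Δ (z • f) = z • Δ f := fun f => by
      simp only [← TemperedDistribution.laplacianCLM_apply, map_smul]
    rw [Prod.smul_snd, Prod.smul_fst, key, key, hL, hp, smul_comm]

/-- `P₀(h)`, the self-adjoint realization of `-h²Δ`: its domain consists of the `u ∈ L²` with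
`Δu ∈ L²`. -/
def freeOp (n : ℕ) (h : ℝ) : L2 n →ₗ.[ℂ] L2 n := (freeGraph n h).toLinearPMap

/-! ### Resolvent and functional calculus of an unbounded operator -/

section Calculus

variable {H : Type*} [NormedAddCommGroup H] [InnerProductSpace ℂ H] [CompleteSpace H]

/-- The bounded operator `R` is the inverse of `A - z : D(A) → H`. -/
def IsResolventAt (A : H →ₗ.[ℂ] H) (z : ℂ) (R : H →L[ℂ] H) : Prop :=
  (∀ f : H, ∃ hf : R f ∈ A.domain, A ⟨R f, hf⟩ - z • R f = f) ∧
    ∀ u : A.domain, R (A u - z • (u : H)) = u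

open Classical in
/-- The resolvent `(A - z)⁻¹` (set to `0` if `z` is not in the resolvent set). -/
def resolventOp (A : H →ₗ.[ℂ] H) (z : ℂ) : H →L[ℂ] H :=
  if hR : ∃ R : H →L[ℂ] H, IsResolventAt A z R then hR.choose else 0

open Classical in
/-- `φ(A)` for a self-adjoint operator `A` and a compactly supported continuous `φ : ℝ → ℂ`.
It is the continuous functional calculus of the bounded normal operator `(A + i)⁻¹`: a point
`λ` of the spectrum of `A` corresponds to `w = (λ + i)⁻¹`, so that `λ = Re (w⁻¹)`, and `λ = ±∞`
corresponds to `w = 0`. -/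
def funCalc (A : H →ₗ.[ℂ] H) (φ : ℝ → ℂ) : H →L[ℂ] H :=
  cfc (fun w : ℂ => if w = 0 then 0 else φ (w⁻¹).re) (resolventOp A (-Complex.I))

/-- The operator `B A C` for bounded `B, C` and an unbounded `A`, with its natural domain
`{f | C f ∈ D(A)}`. -/
def sandwich (B : H →L[ℂ] H) (A : H →ₗ.[ℂ] H) (C : H →L[ℂ] H) : H →ₗ.[ℂ] H where
  domain := A.domain.comap C.toLinearMap
  toFun := B.toLinearMap ∘ₗ A.toFun ∘ₗ
    (C.toLinearMap.domRestrict (A.domain.comap C.toLinearMap)).codRestrict A.domain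
      (fun f => f.2)

/-- A bounded operator as an everywhere defined operator. -/
def everywhere (B : H →L[ℂ] H) : H →ₗ.[ℂ] H := B.toLinearMap.toPMap ⊤

end Calculus

/-! ### The ellipticity condition and weighted bounds -/

/-- The ellipticity condition: for `|α| ≤ 2` and both signs, `𝒟^α (P(h) ± i)⁻¹` is bounded on
`L²` uniformly in `h`. Derivatives are distributional, and `𝒟^α = (-ih)^k ∂_{m₁} ⋯ ∂_{m_k}` with
`k = |α|`. -/
def Elliptic {n : ℕ} (P : ℝ → L2 n →ₗ.[ℂ] L2 n) : Prop :=
  ∃ C : ℝ, ∀ h ∈ hRange, ∀ z : ℂ, (z = Complex.I ∨ z = -Complex.I) →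
    ∀ k : ℕ, k ≤ 2 → ∀ m : Fin k → Fin n, ∀ f : L2 n, ∃ g : L2 n,
      (g : 𝓢'(Eucl n, ℂ)) = (-(Complex.I * h)) ^ k •
        ∂^{fun i => stdVec (m i)} (resolventOp (P h) z f : 𝓢'(Eucl n, ℂ)) ∧
      ‖g‖ ≤ C * ‖f‖

/-- `‖⟨x⟩^{s₁} T ⟨x⟩^{s₂}‖_{L² → L^p} ≤ K`: for every `f ∈ L²` such that `⟨x⟩^{s₂} f ∈ L²`
(a dense set of `f`), the function `g = ⟨x⟩^{s₂} f` is in the domain of `T` and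
`‖⟨x⟩^{s₁} T g‖_{L^p} ≤ K ‖f‖_{L²}`. -/
def WeightedBound {n : ℕ} (p : ENNReal) (s₁ : ℝ) (T : L2 n →ₗ.[ℂ] L2 n) (s₂ K : ℝ) : Prop :=
  ∀ f g : L2 n, (∀ᵐ x, g x = ((japanese x ^ s₂ : ℝ) : ℂ) * f x) →
    ∃ hg : g ∈ T.domain,
      eLpNorm (fun x => ((japanese x ^ s₁ : ℝ) : ℂ) * (T ⟨g, hg⟩) x) p volume
        ≤ ENNReal.ofReal (K * ‖f‖)

end SemiclassicalDispersive

end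

open SemiclassicalDispersive

/-!
The bounds come from three ingredients.

*The operators on test functions.* The test functions form a core for `-h²Δ`, and ellipticity carries
this over to `P(h)`: for `z = ±i` the set `(P(h) - z)C_c^∞` is dense in `L²`, and the derivatives of
`ψ` up to the second order are bounded by `(P(h) - z)ψ`, uniformly in `h` (`isCore_free`,
`isCore_perturbed`). Identities between bounded operators can therefore be checked on test functions,
where everything is classical calculus.

*Weighted bounds.* The Cayley transform `U = (A - i)(A + i)⁻¹` of a self-adjoint operator is unitary,
and `φ(A) = ∑ c_k U^k`, where the `c_k` are the Fourier coefficients of `φ` in the angular variable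
and decrease rapidly (`funCalc_hasSum`). The commutator of the differential operator with the weight
`⟨x⟩^s` is of the first order and carries the weight `⟨x⟩^{s-1}`, so that by induction on `⌈s⌉` the
norm of `⟨x⟩^{-s}U^k⟨x⟩^s` grows at most polynomially in `k` (`exists_weighted_pow`). To keep all
operators bounded, `⟨x⟩^s` is replaced by `(p/(1 + εp))^{s/2}` with `p = 1 + |x|²`, and the bounds are
uniform in `ε`. Summation over `k` gives the bounds on `φ(P₀)` and `φ(P)`. The difference of the
resolvents, written in divergence form, contains only the coefficients of `P - P₀` and not their
derivatives (`resolvent_sub`), and these are `O(h^ν⟨x⟩^{-δ})` (`exists_coef_decay`). Telescoping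
`U^k - U₀^k` then gives the bound on `φ(P) - φ(P₀)`, and the sandwiched perturbation is reduced to the
resolvents by `φ(P₀)(P - P₀)φ(P) = ψ(P₀)(R₀ - R)ψ(P)` with `ψ(t) = (t + i)φ(t)`, where `R₀` and `R`
are the resolvents at `-i` (`sandwich_funCalc`).

*The bound from `L²` to `L^∞`.* Here `u_m = (φ_m(P) - φ_m(P₀))⟨x⟩^s f` with `φ_m(t) = (t + i)^m φ(t)`
is studied for all `m` at once. One has `(P + i)u_m = u_{m+1} - (P - P₀)c_m` with the free solution
`c_m = φ_m(P₀)⟨x⟩^s f`, which is explicit enough for a pointwise bound with its first derivatives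
(`exists_kernel_bound`, `exists_free_source_bound`). The equation is tested with `u_m τ²`, where
`τ = (1 - κ/|u_m|²)₊`. Only the coefficients enter, and no derivatives of them. Because they are real
and the principal part is close to the Euclidean one, this controls the energy on the set
`|u_m|² > κ` (`energy_test`). The Sobolev inequality `W^{1,1} ⊂ L^{n/(n-1)}` for `|u_m|²τ³` turns the
energy inequality into a nonlinear recursion between the masses `∫_{|u_m| > k} |u_m|²` for different
`k` and `m` (`exists_level_step`), in which the powers of `h` cancel after rescaling
(`level_scaling`). Iterating first over `m` yields an arbitrarily fast decay in `k`
(`levelDecay_power`), and then, as in De Giorgi's argument, the vanishing of the mass of `u_0` beyond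
a finite level (`exists_level_eq_zero`), which is a bound of `|u_0|`.

Closeness to the Euclidean metric is a hypothesis for `n ≥ 4`. For `n ≤ 3` it holds as soon as `h^ν`
is small against the constants. Otherwise `h^ν` is bounded from below, no gain from the perturbation
is needed, and it suffices that the free resolvent maps `L²` to `L^∞` with norm `O(h^{-n/2})`,
because its symbol is square integrable (`exists_sup_bound_of_le_three`).
-/

noncomputable section

namespace SemiclassicalDispersive

open Filter Topology FourierTransform

variable {n : ℕ}

/-! ### Elements of `L²` given by functions -/

open Classical in
/-- The class in `L²` of a square integrable function, and `0` for any other function. -/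
def lp (f : Eucl n → ℂ) : L2 n :=
  if hf : MemLp f 2 volume then hf.toLp f else 0

theorem coeFn_lp {f : Eucl n → ℂ} (hf : MemLp f 2 volume) : lp f =ᵐ[volume] f := by
  rw [lp, dif_pos hf]
  exact hf.coeFn_toLp

theorem lp_eq_toLp {f : Eucl n → ℂ} (hf : MemLp f 2 volume) : lp f = hf.toLp f := dif_pos hf

theorem lp_congr {f g : Eucl n → ℂ} (h : f =ᵐ[volume] g) : lp f = lp g := by
  by_cases hf : MemLp f 2 volume
  · have hg : MemLp g 2 volume := (memLp_congr_ae h).1 hf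
    rw [lp_eq_toLp hf, lp_eq_toLp hg]
    exact MemLp.toLp_congr hf hg h
  · have hg : ¬ MemLp g 2 volume := fun hg => hf ((memLp_congr_ae h).2 hg)
    rw [lp, lp, dif_neg hf, dif_neg hg]

@[simp] theorem lp_coe (f : L2 n) : lp (f : Eucl n → ℂ) = f := by
  rw [lp_eq_toLp (Lp.memLp f), Lp.toLp_coeFn]

theorem lp_eq_of_ae {f : Eucl n → ℂ} {u : L2 n} (h : f =ᵐ[volume] u) : lp f = u := by
  rw [lp_congr h, lp_coe]

theorem lp_add {f g : Eucl n → ℂ} (hf : MemLp f 2 volume) (hg : MemLp g 2 volume) :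
    lp (fun x => f x + g x) = lp f + lp g := by
  refine lp_eq_of_ae ?_
  filter_upwards [coeFn_lp hf, coeFn_lp hg, Lp.coeFn_add (lp f) (lp g)] with x h1 h2 h3
  rw [h3, Pi.add_apply, h1, h2]

theorem lp_smul (c : ℂ) {f : Eucl n → ℂ} (hf : MemLp f 2 volume) :
    lp (fun x => c * f x) = c • lp f := by
  refine lp_eq_of_ae ?_
  filter_upwards [coeFn_lp hf, Lp.coeFn_smul c (lp f)] with x h1 h3
  rw [h3, Pi.smul_apply, h1, smul_eq_mul]

theorem norm_L2_le_of_ae {u v : L2 n} {C : ℝ} (h : ∀ᵐ x, ‖u x‖ ≤ C * ‖v x‖) :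
    ‖u‖ ≤ C * ‖v‖ :=
  Lp.norm_le_mul_norm_of_ae_le_mul h

/-- The class of the pointwise norm, used to compare norms in `L²`. -/
theorem exists_L2_norm (v : L2 n) : ∃ w : L2 n, ‖w‖ = ‖v‖ ∧ ∀ᵐ x, w x = (‖v x‖ : ℂ) := by
  have hm : MemLp (fun x => (‖v x‖ : ℂ)) 2 volume := (Lp.memLp v).norm.ofReal
  refine ⟨lp fun x => (‖v x‖ : ℂ), le_antisymm ?_ ?_, coeFn_lp hm⟩
  · have := norm_L2_le_of_ae (u := lp fun x => (‖v x‖ : ℂ)) (v := v) (C := 1) (by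
      filter_upwards [coeFn_lp hm] with x hx
      rw [hx]; simp)
    simpa using this
  · have := norm_L2_le_of_ae (v := lp fun x => (‖v x‖ : ℂ)) (u := v) (C := 1) (by
      filter_upwards [coeFn_lp hm] with x hx
      rw [hx]; simp)
    simpa using this

/-- Domination of an `L²` norm by a finite sum of `L²` norms, from a pointwise bound. -/
theorem norm_L2_le_sum {ι : Type*} (s : Finset ι) {u : L2 n} {v : ι → L2 n} {C : ℝ} (hC : 0 ≤ C)
    (h : ∀ᵐ x, ‖u x‖ ≤ C * ∑ i ∈ s, ‖v i x‖) : ‖u‖ ≤ C * ∑ i ∈ s, ‖v i‖ := by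
  choose w hw1 hw2 using fun i => exists_L2_norm (v i)
  have h1 : ‖u‖ ≤ C * ‖∑ i ∈ s, w i‖ := by
    refine norm_L2_le_of_ae ?_
    have h2 : ∀ᵐ x, (∑ i ∈ s, w i : L2 n) x = ∑ i ∈ s, w i x := by
      filter_upwards [Lp.coeFn_finsetSum s w] with x hx
      simpa using hx
    have h3 : ∀ᵐ x, ∀ i ∈ s, w i x = (‖v i x‖ : ℂ) := by
      rw [Filter.eventually_all_finset]
      exact fun i _ => hw2 i
    filter_upwards [h, h2, h3] with x hx h2 h3
    refine hx.trans (le_of_eq ?_)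
    rw [h2, Finset.sum_congr rfl h3, ← Complex.ofReal_sum, Complex.norm_real, Real.norm_eq_abs,
      abs_of_nonneg (Finset.sum_nonneg fun i _ => norm_nonneg _)]
  refine h1.trans (mul_le_mul_of_nonneg_left ((norm_sum_le _ _).trans ?_) hC)
  exact Finset.sum_le_sum fun i _ => (hw1 i).le

/-! ### Multiplication operators -/

/-- Measurable and essentially bounded functions, the symbols of multiplication operators. -/
def BddMeas (w : Eucl n → ℂ) : Prop :=
  AEStronglyMeasurable w volume ∧ ∃ C : ℝ, ∀ᵐ x, ‖w x‖ ≤ C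

theorem BddMeas.memLp {w : Eucl n → ℂ} (h : BddMeas w) (f : L2 n) :
    MemLp (fun x => w x * f x) 2 volume := by
  obtain ⟨C, hC⟩ := h.2
  exact (Lp.memLp f).of_le_mul (c := C) (h.1.mul (Lp.aestronglyMeasurable f)) (by
    filter_upwards [hC] with x hx
    rw [norm_mul]; gcongr)

open Classical in
/-- Multiplication on `L²` by a measurable essentially bounded function, and `0` for any other
function. -/
def mulOp (w : Eucl n → ℂ) : L2 n →L[ℂ] L2 n :=
  if h : BddMeas w then
    LinearMap.mkContinuousOfExistsBound
      { toFun := fun f => lp fun x => w x * f x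
        map_add' := fun f g => by
          rw [← lp_add (h.memLp f) (h.memLp g)]
          refine lp_congr ?_
          filter_upwards [Lp.coeFn_add f g] with x hx
          rw [hx, Pi.add_apply, mul_add]
        map_smul' := fun c f => by
          rw [RingHom.id_apply, ← lp_smul c (h.memLp f)]
          refine lp_congr ?_
          filter_upwards [Lp.coeFn_smul c f] with x hx
          rw [hx, Pi.smul_apply, smul_eq_mul]
          ring }
      (by
        obtain ⟨C, hC⟩ := h.2
        refine ⟨C, fun f => ?_⟩
        refine norm_L2_le_of_ae ?_
        filter_upwards [coeFn_lp (h.memLp f), hC] with x hx h2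
        change ‖lp (fun x => w x * f x) x‖ ≤ _
        rw [hx, norm_mul]; gcongr)
  else 0

theorem mulOp_apply {w : Eucl n → ℂ} (h : BddMeas w) (f : L2 n) :
    mulOp w f = lp fun x => w x * f x := by
  rw [mulOp, dif_pos h]
  rfl

theorem coeFn_mulOp {w : Eucl n → ℂ} (h : BddMeas w) (f : L2 n) :
    ∀ᵐ x, mulOp w f x = w x * f x := by
  rw [mulOp_apply h]
  exact coeFn_lp (h.memLp f)

theorem norm_mulOp_apply_le {w : Eucl n → ℂ} (h : BddMeas w) {C : ℝ} (hC : ∀ᵐ x, ‖w x‖ ≤ C)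
    (f : L2 n) : ‖mulOp w f‖ ≤ C * ‖f‖ := by
  refine norm_L2_le_of_ae ?_
  filter_upwards [coeFn_mulOp h f, hC] with x hx h2
  rw [hx, norm_mul]
  gcongr

theorem norm_mulOp_le {w : Eucl n → ℂ} (h : BddMeas w) {C : ℝ} (h0 : 0 ≤ C)
    (hC : ∀ᵐ x, ‖w x‖ ≤ C) : ‖mulOp w‖ ≤ C :=
  ContinuousLinearMap.opNorm_le_bound _ h0 (norm_mulOp_apply_le h hC)

theorem BddMeas.mul {v w : Eucl n → ℂ} (hv : BddMeas v) (hw : BddMeas w) :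
    BddMeas fun x => v x * w x := by
  obtain ⟨C, hC⟩ := hv.2
  obtain ⟨D, hD⟩ := hw.2
  refine ⟨hv.1.mul hw.1, C * D, ?_⟩
  filter_upwards [hC, hD] with x h1 h2
  rw [norm_mul]
  exact mul_le_mul h1 h2 (norm_nonneg _) ((norm_nonneg _).trans h1)

theorem mulOp_mul {v w : Eucl n → ℂ} (hv : BddMeas v) (hw : BddMeas w) :
    mulOp v * mulOp w = mulOp fun x => v x * w x := by
  ext1 f
  rw [mul_apply_eq_comp]
  refine Lp.ext ?_
  filter_upwards [coeFn_mulOp hv (mulOp w f), coeFn_mulOp hw f, coeFn_mulOp (hv.mul hw) f]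
    with x h1 h2 h3
  rw [h1, h2, h3, mul_assoc]

theorem mulOp_one : mulOp (fun _ : Eucl n => (1 : ℂ)) = 1 := by
  ext1 f
  have h : BddMeas fun _ : Eucl n => (1 : ℂ) := ⟨aestronglyMeasurable_const, 1, by simp⟩
  refine Lp.ext ?_
  filter_upwards [coeFn_mulOp h f] with x h1
  rw [h1, one_mul]; rfl

theorem inner_mulOp {w : Eucl n → ℂ} (hw : BddMeas w) (f g : L2 n) :
    inner ℂ f (mulOp w g) = inner ℂ (mulOp (fun x => conj (w x)) f) g := by
  have hw' : BddMeas fun x => conj (w x) := by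
    refine ⟨Complex.continuous_conj.comp_aestronglyMeasurable hw.1, ?_⟩
    obtain ⟨C, hC⟩ := hw.2
    exact ⟨C, by simpa using hC⟩
  rw [L2.inner_def, L2.inner_def]
  refine integral_congr_ae ?_
  filter_upwards [coeFn_mulOp hw g, coeFn_mulOp hw' f] with x h1 h2
  simp only [RCLike.inner_apply, h1, h2, map_mul, Complex.conj_conj]
  ring

theorem adjoint_mulOp {w : Eucl n → ℂ} (hw : BddMeas w) :
    ContinuousLinearMap.adjoint (mulOp w) = mulOp fun x => conj (w x) := by
  rw [eq_comm, ContinuousLinearMap.eq_adjoint_iff]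
  intro f g
  exact (inner_mulOp hw f g).symm

/-- A continuous bounded function is the symbol of a multiplication operator. -/
theorem BddMeas.of_continuous {w : Eucl n → ℂ} (hw : Continuous w) {C : ℝ}
    (hC : ∀ x, ‖w x‖ ≤ C) : BddMeas w :=
  ⟨hw.aestronglyMeasurable, C, Eventually.of_forall hC⟩

theorem norm_sq_L2 (v : L2 n) : ‖v‖ ^ 2 = ∫ x, ‖v x‖ ^ 2 := by
  have h := inner_self_eq_norm_sq_to_K (𝕜 := ℂ) v
  rw [L2.inner_def] at h
  have h2 : ∀ x, inner ℂ (v x) (v x) = ((‖v x‖ ^ 2 : ℝ) : ℂ) := fun x => by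
    rw [inner_self_eq_norm_sq_to_K]; norm_cast
  simp only [h2] at h
  rw [integral_complex_ofReal] at h
  have h3 : ((‖v‖ ^ 2 : ℝ) : ℂ) = ((∫ x, ‖v x‖ ^ 2 : ℝ) : ℂ) := by
    rw [Complex.ofReal_pow]; exact h.symm
  exact Complex.ofReal_injective h3

/-- Dominated convergence in `L²`. -/
theorem tendsto_L2_of_dominated {u : ℕ → L2 n} {v g : L2 n}
    (hb : ∀ k, ∀ᵐ x, ‖u k x - v x‖ ≤ ‖g x‖)
    (hlim : ∀ᵐ x, Tendsto (fun k => u k x) atTop (𝓝 (v x))) : Tendsto u atTop (𝓝 v) := by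
  rw [tendsto_iff_norm_sub_tendsto_zero]
  have h1 : Tendsto (fun k => ‖u k - v‖ ^ 2) atTop (𝓝 0) := by
    simp only [norm_sq_L2]
    have h0 : (0 : ℝ) = ∫ x : Eucl n, (0 : ℝ) := by simp
    rw [h0]
    refine tendsto_integral_of_dominated_convergence (fun x => ‖g x‖ ^ 2) ?_ ?_ ?_ ?_
    · intro k
      exact ((Lp.aestronglyMeasurable _).norm.pow 2)
    · exact (Lp.memLp g).integrable_norm_pow (by norm_num)
    · intro k
      filter_upwards [hb k, Lp.coeFn_sub (u k) v] with x hx h2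
      rw [h2, Pi.sub_apply, Real.norm_eq_abs, abs_of_nonneg (by positivity)]
      gcongr
    · have h3 : ∀ᵐ x, ∀ k, (u k - v : L2 n) x = u k x - v x := by
        rw [ae_all_iff]; exact fun k => Lp.coeFn_sub (u k) v
      filter_upwards [hlim, h3] with x hx h3
      have h4 : Tendsto (fun k => u k x - v x) atTop (𝓝 0) := by
        simpa using hx.sub_const (v x)
      simp only [h3]
      simpa using (h4.norm.pow 2)
  have h5 := h1.sqrt
  simpa [Real.sqrt_sq (norm_nonneg _)] using h5

/-! ### Test functions and their derivatives -/

/-- The space `C_c^∞(ℝⁿ)` of complex valued test functions. -/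
def testSpace (n : ℕ) : Submodule ℂ (Eucl n → ℂ) where
  carrier := {ψ | ContDiff ℝ ∞ ψ ∧ HasCompactSupport ψ}
  add_mem' := fun h1 h2 => ⟨h1.1.add h2.1, h1.2.add h2.2⟩
  zero_mem' := ⟨contDiff_const, HasCompactSupport.zero⟩
  smul_mem' := fun c _ h => ⟨contDiff_const.smul h.1, h.2.smul_left (f := fun _ => c)⟩

/-- The type of test functions. -/
abbrev Test (n : ℕ) : Type := testSpace n

theorem Test.contDiff (ψ : Test n) : ContDiff ℝ ∞ (ψ : Eucl n → ℂ) := ψ.2.1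

theorem Test.hasCompactSupport (ψ : Test n) : HasCompactSupport (ψ : Eucl n → ℂ) := ψ.2.2

theorem Test.differentiable (ψ : Test n) : Differentiable ℝ (ψ : Eucl n → ℂ) :=
  ψ.contDiff.differentiable (by simp)

theorem Test.continuous (ψ : Test n) : Continuous (ψ : Eucl n → ℂ) :=
  ψ.contDiff.continuous

theorem Test.memLp (ψ : Test n) : MemLp (ψ : Eucl n → ℂ) 2 volume :=
  ψ.continuous.memLp_of_hasCompactSupport ψ.hasCompactSupport

theorem semiD_mul {h : ℝ} {j : Fin n} {f g : Eucl n → ℂ} {x : Eucl n}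
    (hf : DifferentiableAt ℝ f x) (hg : DifferentiableAt ℝ g x) :
    semiD h j (fun y => f y * g y) x = semiD h j f x * g x + f x * semiD h j g x := by
  simp only [semiD]
  rw [fderiv_fun_mul hf hg]
  simp only [_root_.add_apply, _root_.smul_apply, smul_eq_mul]
  ring

theorem semiD_add {h : ℝ} {j : Fin n} {f g : Eucl n → ℂ} {x : Eucl n}
    (hf : DifferentiableAt ℝ f x) (hg : DifferentiableAt ℝ g x) :
    semiD h j (fun y => f y + g y) x = semiD h j f x + semiD h j g x := by
  simp only [semiD]
  rw [fderiv_fun_add hf hg]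
  simp only [_root_.add_apply]
  ring

theorem semiD_const_mul {h : ℝ} {j : Fin n} (c : ℂ) {f : Eucl n → ℂ} {x : Eucl n}
    (hf : DifferentiableAt ℝ f x) :
    semiD h j (fun y => c * f y) x = c * semiD h j f x := by
  simp only [semiD]
  rw [fderiv_const_mul hf]
  simp only [_root_.smul_apply, smul_eq_mul]
  ring

theorem fderiv_ofReal {f : Eucl n → ℝ} {x : Eucl n} (hf : DifferentiableAt ℝ f x) (v : Eucl n) :
    fderiv ℝ (fun y => (f y : ℂ)) x v = (fderiv ℝ f x v : ℝ) := by
  have h := (Complex.ofRealCLM.hasFDerivAt.comp x hf.hasFDerivAt).fderiv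
  change fderiv ℝ (fun y => (f y : ℂ)) x = _ at h
  rw [h]; rfl

theorem semiD_ofReal {h : ℝ} {j : Fin n} {f : Eucl n → ℝ} {x : Eucl n}
    (hf : DifferentiableAt ℝ f x) :
    semiD h j (fun y => (f y : ℂ)) x = -(Complex.I * h) * (partialDeriv j f x : ℝ) := by
  rw [semiD, fderiv_ofReal hf, partialDeriv]

theorem semiD_eq_zero_of_notMem {h : ℝ} {j : Fin n} {f : Eucl n → ℂ} {x : Eucl n}
    (hx : x ∉ tsupport f) : semiD h j f x = 0 := by
  have : f =ᶠ[𝓝 x] fun _ => 0 := notMem_tsupport_iff_eventuallyEq.1 hx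
  rw [semiD, this.fderiv_eq]
  simp

theorem HasCompactSupport.semiD {h : ℝ} {j : Fin n} {f : Eucl n → ℂ} (hf : HasCompactSupport f) :
    HasCompactSupport (semiD h j f) := by
  refine HasCompactSupport.intro hf.isCompact (fun x hx => semiD_eq_zero_of_notMem hx)

theorem continuous_semiD {h : ℝ} {j : Fin n} {f : Eucl n → ℂ} (hf : ContDiff ℝ 1 f) :
    Continuous (semiD h j f) := by
  have := hf.continuous_fderiv (by simp)
  unfold SemiclassicalDispersive.semiD
  fun_prop

theorem contDiff_semiD {h : ℝ} {j : Fin n} {f : Eucl n → ℂ} (hf : ContDiff ℝ ∞ f) :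
    ContDiff ℝ ∞ (semiD h j f) := by
  have := hf.fderiv_right (m := ∞) (by simp)
  unfold SemiclassicalDispersive.semiD
  fun_prop

/-- The semi-classical derivative `𝒟_j` on test functions. -/
def testD (h : ℝ) (j : Fin n) : Test n →ₗ[ℂ] Test n where
  toFun ψ := ⟨semiD h j ψ, contDiff_semiD ψ.contDiff, ψ.hasCompactSupport.semiD⟩
  map_add' φ ψ := by
    ext x
    exact semiD_add (φ.differentiable x) (ψ.differentiable x)
  map_smul' c ψ := by
    ext x
    exact semiD_const_mul c (ψ.differentiable x)

@[simp] theorem testD_apply (h : ℝ) (j : Fin n) (ψ : Test n) (x : Eucl n) :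
    (testD h j ψ : Eucl n → ℂ) x = semiD h j ψ x := rfl

theorem coe_testD (h : ℝ) (j : Fin n) (ψ : Test n) :
    (testD h j ψ : Eucl n → ℂ) = semiD h j ψ := rfl

/-- The inclusion of the test functions in `L²`. -/
def testLp : Test n →ₗ[ℂ] L2 n where
  toFun ψ := lp ψ
  map_add' φ ψ := lp_add φ.memLp ψ.memLp
  map_smul' c ψ := lp_smul c ψ.memLp

theorem testLp_apply (ψ : Test n) : testLp ψ = lp (ψ : Eucl n → ℂ) := rfl

theorem coeFn_testLp (ψ : Test n) : testLp ψ =ᵐ[volume] (ψ : Eucl n → ℂ) := coeFn_lp ψ.memLp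

/-- A test function as a Schwartz function. -/
def testToSchwartz (ψ : Test n) : 𝓢(Eucl n, ℂ) :=
  ψ.hasCompactSupport.toSchwartzMap ψ.contDiff

@[simp] theorem testToSchwartz_apply (ψ : Test n) (x : Eucl n) :
    testToSchwartz ψ x = (ψ : Eucl n → ℂ) x := rfl

theorem toLp_testToSchwartz (ψ : Test n) : (testToSchwartz ψ).toLp 2 = testLp ψ := by
  rw [testLp_apply, lp_eq_toLp ψ.memLp]; rfl

/-! ### The Fourier transform of derivatives -/

/-- The symbol `2πhξ_j` of `𝒟_j`. -/
def symD (h : ℝ) (j : Fin n) (ξ : Eucl n) : ℝ := 2 * Real.pi * h * ξ j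

/-- The symbol `4π²h²|ξ|²` of `-h²Δ`. -/
def symLap (h : ℝ) (ξ : Eucl n) : ℝ := (2 * Real.pi * h) ^ 2 * ‖ξ‖ ^ 2

theorem symLap_eq_sum (h : ℝ) (ξ : Eucl n) : symLap h ξ = ∑ j, symD h j ξ ^ 2 := by
  simp only [symLap, symD, mul_pow, EuclideanSpace.real_norm_sq_eq, Finset.mul_sum]

theorem symLap_nonneg (h : ℝ) (ξ : Eucl n) : 0 ≤ symLap h ξ := by
  unfold symLap; positivity

theorem sq_symD_le (h : ℝ) (j : Fin n) (ξ : Eucl n) : symD h j ξ ^ 2 ≤ symLap h ξ := by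
  rw [symLap_eq_sum]
  exact Finset.single_le_sum (f := fun j => symD h j ξ ^ 2) (fun i _ => sq_nonneg _)
    (Finset.mem_univ j)

/-- The semi-classical derivative of a Schwartz function. -/
def schwartzD (h : ℝ) (j : Fin n) (f : 𝓢(Eucl n, ℂ)) : 𝓢(Eucl n, ℂ) :=
  (-(Complex.I * h)) • ∂_{(stdVec j : Eucl n)} f

theorem schwartzD_apply (h : ℝ) (j : Fin n) (f : 𝓢(Eucl n, ℂ)) (x : Eucl n) :
    schwartzD h j f x = semiD h j f x := rfl

theorem inner_stdVec (ξ : Eucl n) (j : Fin n) : inner ℝ ξ (stdVec j) = ξ j := by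
  rw [stdVec, EuclideanSpace.inner_single_right]; simp

theorem fourier_schwartzD (h : ℝ) (j : Fin n) (f : 𝓢(Eucl n, ℂ)) (ξ : Eucl n) :
    𝓕 (schwartzD h j f) ξ = symD h j ξ * 𝓕 f ξ := by
  rw [schwartzD, FourierTransform.fourier_smul, SchwartzMap.fourier_lineDerivOp_eq,
    _root_.smul_apply, _root_.smul_apply, SchwartzMap.smulLeftCLM_apply_apply (by fun_prop),
    inner_stdVec, symD]
  simp only [smul_eq_mul, Complex.real_smul]
  push_cast
  linear_combination (-(2 * Real.pi * h * ξ j * 𝓕 f ξ) : ℂ) * Complex.I_sq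

theorem schwartzD_testToSchwartz (h : ℝ) (j : Fin n) (ψ : Test n) :
    schwartzD h j (testToSchwartz ψ) = testToSchwartz (testD h j ψ) := by
  ext x; rfl

theorem fourier_testD (h : ℝ) (j : Fin n) (ψ : Test n) :
    ∀ᵐ ξ, 𝓕 (testLp (testD h j ψ)) ξ = symD h j ξ * 𝓕 (testLp ψ) ξ := by
  rw [← toLp_testToSchwartz, ← toLp_testToSchwartz, ← schwartzD_testToSchwartz,
    SchwartzMap.toLp_fourier_eq, SchwartzMap.toLp_fourier_eq]
  filter_upwards [SchwartzMap.coeFn_toLp (𝓕 (schwartzD h j (testToSchwartz ψ))) 2 volume,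
    SchwartzMap.coeFn_toLp (𝓕 (testToSchwartz ψ)) 2 volume] with ξ h1 h2
  rw [h1, h2, fourier_schwartzD]

/-- `-h²Δ` on test functions. -/
def testLap (h : ℝ) : Test n →ₗ[ℂ] Test n := ∑ j, testD h j ∘ₗ testD h j

theorem testLap_apply (h : ℝ) (ψ : Test n) : testLap h ψ = ∑ j, testD h j (testD h j ψ) := by
  simp [testLap]

theorem fourier_testLap (h : ℝ) (ψ : Test n) :
    ∀ᵐ ξ, 𝓕 (testLp (testLap h ψ)) ξ = symLap h ξ * 𝓕 (testLp ψ) ξ := by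
  have h1 : ∀ᵐ ξ, ∀ j, 𝓕 (testLp (testD h j (testD h j ψ))) ξ
      = (symD h j ξ : ℂ) ^ 2 * 𝓕 (testLp ψ) ξ := by
    rw [ae_all_iff]
    intro j
    filter_upwards [fourier_testD h j (testD h j ψ), fourier_testD h j ψ] with ξ h1 h2
    rw [h1, h2]; ring
  have h2 : 𝓕 (testLp (testLap h ψ)) = ∑ j, 𝓕 (testLp (testD h j (testD h j ψ))) := by
    rw [testLap_apply, map_sum]
    exact map_sum (Lp.fourierTransformₗᵢ (Eucl n) ℂ) _ _
  rw [h2]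
  filter_upwards [h1, Lp.coeFn_finsetSum Finset.univ
    fun j => 𝓕 (testLp (testD h j (testD h j ψ)))] with ξ h1 h3
  rw [h3, Finset.sum_apply, Finset.sum_congr rfl fun j _ => h1 j, ← Finset.sum_mul, symLap_eq_sum]
  push_cast
  rfl

/-! ### The free operator in Fourier variables -/

theorem L2_dist_injective {u v : L2 n} (h : (u : 𝓢'(Eucl n, ℂ)) = (v : 𝓢'(Eucl n, ℂ))) : u = v := by
  have hk := Lp.ker_toTemperedDistributionCLM_eq_bot (E := Eucl n) (F := ℂ) (μ := volume) (p := 2)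
  rw [LinearMap.ker_eq_bot] at hk
  exact hk h

theorem hasTemperateGrowth_symLap (h : ℝ) :
    (fun ξ : Eucl n => (symLap h ξ : ℂ)).HasTemperateGrowth := by
  unfold symLap; fun_prop

/-- Equality of an `L²` function with the product, as distributions, of `u` and a function of
temperate growth, from equality almost everywhere. -/
theorem dist_eq_smulLeft_iff {σ : Eucl n → ℂ} (hσ : σ.HasTemperateGrowth) {u g : L2 n}
    (h : ∀ᵐ ξ, g ξ = σ ξ * u ξ) :
    (g : 𝓢'(Eucl n, ℂ)) = TemperedDistribution.smulLeftCLM ℂ σ (u : 𝓢'(Eucl n, ℂ)) := by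
  ext f
  simp only [Lp.toTemperedDistribution_apply, TemperedDistribution.smulLeftCLM_apply_apply]
  refine integral_congr_ae ?_
  filter_upwards [h] with ξ hξ
  rw [hξ, SchwartzMap.smulLeftCLM_apply_apply hσ]
  simp only [smul_eq_mul]
  ring

/-- Conversely, if `g` is the product of `u` and the symbol of `-h²Δ` in the sense of distributions,
then it is so almost everywhere. -/
theorem ae_eq_of_dist_eq_smulLeft {h : ℝ} {u g : L2 n}
    (hd : (g : 𝓢'(Eucl n, ℂ)) =
      TemperedDistribution.smulLeftCLM ℂ (fun ξ => (symLap h ξ : ℂ)) (u : 𝓢'(Eucl n, ℂ))) :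
    ∀ᵐ ξ, g ξ = symLap h ξ * u ξ := by
  -- After multiplication by `(1 + |ξ|²)⁻¹` both sides are square integrable functions.
  set J : Eucl n → ℂ := fun ξ => (((1 + ‖ξ‖ ^ 2) ^ (-1 : ℝ) : ℝ) : ℂ) with hJ
  have hJt : J.HasTemperateGrowth := by rw [hJ]; fun_prop
  have hLt := hasTemperateGrowth_symLap (n := n) h
  have hJn : ∀ ξ, ‖J ξ‖ = (1 + ‖ξ‖ ^ 2)⁻¹ := fun ξ => by
    rw [hJ, Complex.norm_real, Real.rpow_neg_one, Real.norm_eq_abs, abs_of_nonneg (by positivity)]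
  have hJb : BddMeas J := BddMeas.of_continuous hJt.1.continuous (C := 1) fun ξ => by
    rw [hJn]; exact inv_le_one_of_one_le₀ (by nlinarith [norm_nonneg ξ])
  have hKb : BddMeas (J * fun ξ => (symLap h ξ : ℂ)) :=
    BddMeas.of_continuous (hJt.1.continuous.mul hLt.1.continuous) (C := (2 * Real.pi * h) ^ 2)
      fun ξ => by
        have h1 : ‖((symLap h ξ : ℝ) : ℂ)‖ = (2 * Real.pi * h) ^ 2 * ‖ξ‖ ^ 2 := by
          rw [Complex.norm_real, Real.norm_eq_abs, abs_of_nonneg (symLap_nonneg h ξ), symLap]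
        rw [Pi.mul_apply, norm_mul, hJn, h1, inv_mul_le_iff₀ (by positivity)]
        nlinarith [sq_nonneg (2 * Real.pi * h)]
  have e1 : mulOp J g = mulOp (J * fun ξ => (symLap h ξ : ℂ)) u := by
    apply L2_dist_injective
    rw [dist_eq_smulLeft_iff hJt (coeFn_mulOp hJb g),
      dist_eq_smulLeft_iff (hJt.mul hLt) (coeFn_mulOp hKb u), hd,
      TemperedDistribution.smulLeftCLM_smulLeftCLM_apply hLt hJt, mul_comm]
  filter_upwards [coeFn_mulOp hJb g, coeFn_mulOp hKb u] with ξ h1 h2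
  rw [e1, h2, Pi.mul_apply, mul_assoc] at h1
  have hne : J ξ ≠ 0 := by
    rw [← norm_pos_iff, hJn]; positivity
  exact (mul_left_cancel₀ hne h1).symm

theorem freeGraph_dist (h : ℝ) (u : 𝓢'(Eucl n, ℂ)) :
    (-(h : ℂ) ^ 2) • Δ u =
      TemperedDistribution.fourierMultiplierCLM ℂ (fun ξ => (symLap h ξ : ℂ)) u := by
  have h1 : (fun ξ : Eucl n => (symLap h ξ : ℂ))
      = (((2 * Real.pi * h) ^ 2 : ℝ) : ℂ) • fun ξ : Eucl n => ((‖ξ‖ ^ 2 : ℝ) : ℂ) := by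
    ext ξ; simp [symLap]
  rw [h1, TemperedDistribution.fourierMultiplierCLM_smul (by fun_prop),
    TemperedDistribution.laplacian_eq_fourierMultiplierCLM, ← Complex.coe_smul, smul_smul]
  simp only [_root_.smul_apply]
  congr 1
  push_cast
  ring

/-- The graph of `-h²Δ` in Fourier variables, where the operator is multiplication by its symbol on
the largest possible domain. -/
theorem mem_freeGraph_iff {h : ℝ} {u g : L2 n} :
    (u, g) ∈ freeGraph n h ↔ ∀ᵐ ξ, 𝓕 g ξ = symLap h ξ * 𝓕 u ξ := by
  have h0 : (u, g) ∈ freeGraph n h ↔ ((𝓕 g : L2 n) : 𝓢'(Eucl n, ℂ))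
      = TemperedDistribution.smulLeftCLM ℂ (fun ξ => (symLap h ξ : ℂ))
        ((𝓕 u : L2 n) : 𝓢'(Eucl n, ℂ)) := by
    change (g : 𝓢'(Eucl n, ℂ)) = (-(h : ℂ) ^ 2) • Δ (u : 𝓢'(Eucl n, ℂ)) ↔ _
    rw [freeGraph_dist, TemperedDistribution.fourierMultiplierCLM_apply,
      ← Lp.fourier_toTemperedDistribution_eq, ← Lp.fourier_toTemperedDistribution_eq]
    constructor
    · intro hg
      rw [hg, fourier_fourierInv_eq]
    · intro hg
      rw [← hg, fourierInv_fourier_eq]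
  rw [h0]
  exact ⟨ae_eq_of_dist_eq_smulLeft, dist_eq_smulLeft_iff (hasTemperateGrowth_symLap h)⟩

theorem norm_le_of_fourier {u v : L2 n} {C : ℝ} (h : ∀ᵐ ξ, ‖𝓕 u ξ‖ ≤ C * ‖𝓕 v ξ‖) :
    ‖u‖ ≤ C * ‖v‖ := by
  have := norm_L2_le_of_ae h
  rwa [Lp.norm_fourier_eq, Lp.norm_fourier_eq] at this

theorem fourier_L2_sub (u v : L2 n) : 𝓕 (u - v) = 𝓕 u - 𝓕 v :=
  map_sub (Lp.fourierTransformₗᵢ (Eucl n) ℂ) u v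

theorem fourier_L2_add (u v : L2 n) : 𝓕 (u + v) = 𝓕 u + 𝓕 v :=
  map_add (Lp.fourierTransformₗᵢ (Eucl n) ℂ) u v

theorem fourier_L2_smul (c : ℂ) (u : L2 n) : 𝓕 (c • u) = c • 𝓕 u :=
  map_smul (Lp.fourierTransformₗᵢ (Eucl n) ℂ) c u

/-- The Fourier transform of `(-h²Δ - z)ψ`. -/
theorem fourier_testLap_sub (h : ℝ) (z : ℂ) (ψ : Test n) :
    ∀ᵐ ξ, 𝓕 (testLp (testLap h ψ) - z • testLp ψ) ξ = (symLap h ξ - z) * 𝓕 (testLp ψ) ξ := by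
  rw [fourier_L2_sub, fourier_L2_smul]
  filter_upwards [fourier_testLap h ψ, Lp.coeFn_sub (𝓕 (testLp (testLap h ψ))) (z • 𝓕 (testLp ψ)),
    Lp.coeFn_smul z (𝓕 (testLp ψ))] with ξ h1 h2 h3
  rw [h2, Pi.sub_apply, h3, Pi.smul_apply, h1, smul_eq_mul]
  ring

/-- The points `z = ±i` and `z = -1` at which resolvents are used all satisfy
`1 + p ≤ 2 |p - z|` for `p ≥ 0`. -/
def IsFar (z : ℂ) : Prop := ∀ p : ℝ, 0 ≤ p → 1 + p ≤ 2 * ‖(p : ℂ) - z‖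

theorem isFar_of_sq {z : ℂ} (h1 : z.re ≤ 0) (h2 : ‖z‖ = 1) : IsFar z := by
  intro p hp
  have h3 : ‖(p : ℂ) - z‖ ^ 2 = p ^ 2 - 2 * p * z.re + 1 := by
    have h4 : ‖z‖ ^ 2 = z.re * z.re + z.im * z.im := by
      rw [← Complex.normSq_eq_norm_sq, Complex.normSq_apply]
    rw [← Complex.normSq_eq_norm_sq, Complex.normSq_apply]
    simp only [Complex.sub_re, Complex.ofReal_re, Complex.sub_im, Complex.ofReal_im]
    rw [h2] at h4
    nlinarith
  have h5 := norm_nonneg ((p : ℂ) - z)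
  by_contra hc
  push Not at hc
  nlinarith [mul_nonneg hp (neg_nonneg.2 h1), sq_nonneg (p - 1)]

theorem isFar_I : IsFar Complex.I := isFar_of_sq (by simp) (by simp)

theorem isFar_neg_I : IsFar (-Complex.I) := isFar_of_sq (by simp) (by simp)

theorem isFar_neg_one : IsFar (-1) := isFar_of_sq (by simp) (by simp)

theorem norm_testLp_le_free {z : ℂ} (hz : IsFar z) (h : ℝ) (ψ : Test n) :
    ‖testLp ψ‖ ≤ 2 * ‖testLp (testLap h ψ) - z • testLp ψ‖ := by
  refine norm_le_of_fourier ?_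
  filter_upwards [fourier_testLap_sub h z ψ] with ξ h1
  rw [h1, norm_mul]
  have := hz _ (symLap_nonneg h ξ)
  have h2 := symLap_nonneg h ξ
  nlinarith [norm_nonneg (𝓕 (testLp ψ) ξ), mul_nonneg h2 (norm_nonneg (𝓕 (testLp ψ) ξ))]

theorem norm_testD_le_free {z : ℂ} (hz : IsFar z) (h : ℝ) (j : Fin n) (ψ : Test n) :
    ‖testLp (testD h j ψ)‖ ≤ 2 * ‖testLp (testLap h ψ) - z • testLp ψ‖ := by
  refine norm_le_of_fourier ?_
  filter_upwards [fourier_testLap_sub h z ψ, fourier_testD h j ψ] with ξ h1 h2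
  rw [h1, h2, norm_mul, norm_mul, ← mul_assoc]
  refine mul_le_mul_of_nonneg_right ?_ (norm_nonneg _)
  refine le_trans ?_ (hz _ (symLap_nonneg h ξ))
  rw [Complex.norm_real, Real.norm_eq_abs]
  have := sq_symD_le h j ξ
  nlinarith [sq_abs (symD h j ξ), sq_nonneg (|symD h j ξ| - 1)]

theorem norm_testD_testD_le_free {z : ℂ} (hz : IsFar z) (h : ℝ) (i j : Fin n) (ψ : Test n) :
    ‖testLp (testD h i (testD h j ψ))‖ ≤ 2 * ‖testLp (testLap h ψ) - z • testLp ψ‖ := by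
  refine norm_le_of_fourier ?_
  filter_upwards [fourier_testLap_sub h z ψ, fourier_testD h j ψ,
    fourier_testD h i (testD h j ψ)] with ξ h1 h2 h3
  rw [h1, h3, h2, norm_mul, norm_mul, norm_mul, ← mul_assoc, ← mul_assoc]
  refine mul_le_mul_of_nonneg_right ?_ (norm_nonneg _)
  refine le_trans ?_ (hz _ (symLap_nonneg h ξ))
  rw [Complex.norm_real, Real.norm_eq_abs, Complex.norm_real, Real.norm_eq_abs]
  have h4 := sq_symD_le h j ξ
  have h5 := sq_symD_le h i ξ
  nlinarith [sq_abs (symD h j ξ), sq_abs (symD h i ξ), sq_nonneg (|symD h j ξ| - |symD h i ξ|)]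

/-! ### Density of the range of the free operator on test functions -/

/-- A smooth bump function, equal to one on the unit ball and supported in the ball of radius two. -/
def cutBump : ContDiffBump (0 : Eucl n) := ⟨1, 2, by norm_num, by norm_num⟩

/-- A fixed cutoff function, equal to one at the origin. -/
def cutoffFun (x : Eucl n) : ℂ := ((cutBump x : ℝ) : ℂ)

theorem cutoffFun_mem : (cutoffFun : Eucl n → ℂ) ∈ testSpace n := by
  refine ⟨Complex.ofRealCLM.contDiff.comp (cutBump (n := n)).contDiff, ?_⟩
  have h := (cutBump (n := n)).hasCompactSupport
  exact h.comp_left (g := fun t : ℝ => (t : ℂ)) Complex.ofReal_zero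

/-- The cutoff as a test function. -/
def cutoff : Test n := ⟨cutoffFun, cutoffFun_mem⟩

theorem cutoff_zero : ((cutoff : Test n) : Eucl n → ℂ) 0 = 1 := by
  change (((cutBump (n := n)) 0 : ℝ) : ℂ) = 1
  have h : (cutBump (n := n)) 0 = 1 :=
    (cutBump (n := n)).one_of_mem_closedBall (Metric.mem_closedBall_self zero_le_one)
  rw [h, Complex.ofReal_one]

/-- The scale `1/(N+1)`. -/
def cutScale (N : ℕ) : ℝ := 1 / ((N : ℝ) + 1)

theorem cutScale_pos (N : ℕ) : 0 < cutScale N := by unfold cutScale; positivity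

theorem cutScale_le (N : ℕ) : cutScale N ≤ 1 := by
  unfold cutScale
  rw [div_le_one (by positivity)]
  linarith [(Nat.cast_nonneg N : (0 : ℝ) ≤ N)]

theorem tendsto_cutScale : Tendsto cutScale atTop (𝓝 0) := tendsto_one_div_add_atTop_nhds_zero_nat

theorem semiD_comp_smul (h c : ℝ) (j : Fin n) (f : Eucl n → ℂ) (x : Eucl n) :
    semiD h j (fun y => f (c • y)) x = c * semiD h j f (c • x) := by
  simp only [semiD, fderiv_comp_smul, _root_.smul_apply, Complex.real_smul]
  ring

theorem Test.bounded (ψ : Test n) : ∃ C : ℝ, 0 ≤ C ∧ ∀ x, ‖(ψ : Eucl n → ℂ) x‖ ≤ C := by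
  obtain ⟨C, hC⟩ := ψ.hasCompactSupport.exists_bound_of_continuous ψ.continuous
  exact ⟨C, (norm_nonneg _).trans (hC 0), hC⟩

theorem Test.comp_smul (ψ : Test n) {c : ℝ} (hc : c ≠ 0) :
    (fun x => (ψ : Eucl n → ℂ) (c • x)) ∈ testSpace n :=
  ⟨ψ.contDiff.comp (contDiff_const_smul c), ψ.hasCompactSupport.comp_homeomorph
    (Homeomorph.smulOfNeZero c hc)⟩

theorem mul_mem_testSpace (ψ : Test n) {f : Eucl n → ℂ} (hf : ContDiff ℝ ∞ f) :
    (fun x => (ψ : Eucl n → ℂ) x * f x) ∈ testSpace n :=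
  ⟨ψ.contDiff.mul hf, ψ.hasCompactSupport.mul_right⟩

/-- The truncation of a Schwartz function by the cutoff at scale `N + 1`. -/
def truncate (S : 𝓢(Eucl n, ℂ)) (N : ℕ) : Test n :=
  ⟨fun x => ((cutoff : Test n) : Eucl n → ℂ) (cutScale N • x) * S x,
    mul_mem_testSpace ⟨_, cutoff.comp_smul (cutScale_pos N).ne'⟩ (S.smooth ⊤)⟩

theorem tendsto_cutScale_comp (ψ : Test n) (x : Eucl n) :
    Tendsto (fun N => (ψ : Eucl n → ℂ) (cutScale N • x)) atTop (𝓝 ((ψ : Eucl n → ℂ) 0)) := by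
  have h1 : Tendsto (fun N => cutScale N • x) atTop (𝓝 0) := by
    simpa using tendsto_cutScale.smul_const x
  exact (ψ.continuous.tendsto 0).comp h1

/-- Truncation converges in `L²`. -/
theorem tendsto_truncate (S : 𝓢(Eucl n, ℂ)) :
    Tendsto (fun N => testLp (truncate S N)) atTop (𝓝 (S.toLp 2)) := by
  obtain ⟨C, hC0, hC⟩ := Test.bounded (cutoff (n := n))
  have hg : MemLp (fun x => ((C + 1 : ℝ) : ℂ) * S x) 2 volume :=
    (S.memLp 2 volume).const_mul ((C + 1 : ℝ) : ℂ)
  refine tendsto_L2_of_dominated (g := lp fun x => ((C + 1 : ℝ) : ℂ) * S x) (fun N => ?_) ?_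
  · filter_upwards [coeFn_lp hg, coeFn_testLp (truncate S N), S.coeFn_toLp 2 volume]
      with x h1 h2 h3
    rw [h1, h2, h3]
    change ‖((cutoff : Test n) : Eucl n → ℂ) (cutScale N • x) * S x - S x‖ ≤ _
    have h4 : ‖((C + 1 : ℝ) : ℂ) * S x‖ = (C + 1) * ‖S x‖ := by
      rw [norm_mul, Complex.norm_real, Real.norm_eq_abs, abs_of_nonneg (by positivity)]
    rw [h4]
    refine (norm_sub_le _ _).trans ?_
    rw [norm_mul, add_mul, one_mul]
    gcongr
    exact hC _
  · have h2 : ∀ᵐ x, ∀ N, testLp (truncate S N) x = (truncate S N : Eucl n → ℂ) x := by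
      rw [ae_all_iff]; exact fun N => coeFn_testLp _
    filter_upwards [h2, S.coeFn_toLp 2 volume] with x h2 h3
    simp only [h2, h3]
    have := (tendsto_cutScale_comp cutoff x).mul_const (S x)
    rwa [cutoff_zero, one_mul] at this

theorem semiD_semiD_truncate (h : ℝ) (j : Fin n) (S : 𝓢(Eucl n, ℂ)) (N : ℕ) (x : Eucl n) :
    (testD h j (testD h j (truncate S N)) : Eucl n → ℂ) x =
      ((cutoff : Test n) : Eucl n → ℂ) (cutScale N • x) * schwartzD h j (schwartzD h j S) x
      + (cutScale N * (2 * ((testD h j cutoff : Test n) : Eucl n → ℂ) (cutScale N • x)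
          * schwartzD h j S x
        + cutScale N * ((testD h j (testD h j cutoff) : Test n) : Eucl n → ℂ) (cutScale N • x)
          * S x)) := by
  set c := cutScale N
  have hd : ∀ (ψ : Test n) (y : Eucl n),
      DifferentiableAt ℝ (fun y => (ψ : Eucl n → ℂ) (c • y)) y := fun ψ y =>
    (ψ.contDiff.comp (contDiff_const_smul c)).differentiable (by simp) y
  have h1 : (testD h j (truncate S N) : Eucl n → ℂ) = fun x =>
      (c * ((testD h j cutoff : Test n) : Eucl n → ℂ) (c • x)) * S x
        + ((cutoff : Test n) : Eucl n → ℂ) (c • x) * schwartzD h j S x := by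
    ext y
    rw [testD_apply]
    change semiD h j (fun y => ((cutoff : Test n) : Eucl n → ℂ) (c • y) * S y) y = _
    rw [semiD_mul (hd _ y) S.differentiableAt, semiD_comp_smul, schwartzD_apply, testD_apply]
  have h2 : DifferentiableAt ℝ
      (fun y => (c : ℂ) * ((testD h j cutoff : Test n) : Eucl n → ℂ) (c • y) * S y) x :=
    ((hd _ x).const_mul _).mul S.differentiableAt
  have h3 : DifferentiableAt ℝ
      (fun y => ((cutoff : Test n) : Eucl n → ℂ) (c • y) * schwartzD h j S y) x :=
    (hd _ x).mul (SchwartzMap.differentiableAt _)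
  rw [testD_apply, h1, semiD_add h2 h3, semiD_mul ((hd _ x).const_mul _)
    S.differentiableAt, semiD_mul (hd _ x) (SchwartzMap.differentiableAt _),
    semiD_const_mul _ (hd _ x), semiD_comp_smul, semiD_comp_smul]
  simp only [schwartzD_apply, testD_apply]
  ring

theorem tendsto_testD_testD_truncate (h : ℝ) (j : Fin n) (S : 𝓢(Eucl n, ℂ)) :
    Tendsto (fun N => testLp (testD h j (testD h j (truncate S N)))) atTop
      (𝓝 ((schwartzD h j (schwartzD h j S)).toLp 2)) := by
  obtain ⟨C0, hC00, hC0⟩ := Test.bounded (cutoff (n := n))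
  obtain ⟨C1, hC10, hC1⟩ := Test.bounded (testD h j (cutoff (n := n)))
  obtain ⟨C2, hC20, hC2⟩ := Test.bounded (testD h j (testD h j (cutoff (n := n))))
  set S1 := schwartzD h j S
  set S2 := schwartzD h j S1
  set G : Eucl n → ℝ := fun x => (C0 + 1) * ‖S2 x‖ + (2 * C1 * ‖S1 x‖ + C2 * ‖S x‖) with hG
  have hGm : MemLp (fun x => (G x : ℂ)) 2 volume := by
    refine MemLp.ofReal ?_
    have hn : ∀ F : 𝓢(Eucl n, ℂ), MemLp (fun x => ‖F x‖) 2 volume := fun F =>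
      (F.memLp 2 volume).norm
    exact ((hn S2).const_mul _).add (((hn S1).const_mul _).add ((hn S).const_mul _))
  refine tendsto_L2_of_dominated (g := lp fun x => (G x : ℂ)) (fun N => ?_) ?_
  · filter_upwards [coeFn_lp hGm, coeFn_testLp (testD h j (testD h j (truncate S N))),
      S2.coeFn_toLp 2 volume] with x h1 h2 h3
    rw [h1, h2, h3, semiD_semiD_truncate]
    have hc0 := (cutScale_pos N).le
    have hc1 := cutScale_le N
    have hGx : ‖(G x : ℂ)‖ = G x := by
      rw [Complex.norm_real, Real.norm_eq_abs, abs_of_nonneg (by positivity)]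
    rw [hGx, add_sub_right_comm]
    refine (norm_add_le _ _).trans ?_
    refine add_le_add ?_ ?_
    · refine (norm_sub_le _ _).trans ?_
      rw [norm_mul, add_mul, one_mul]
      gcongr
      exact hC0 _
    · rw [norm_mul, Complex.norm_real, Real.norm_eq_abs, abs_of_nonneg hc0]
      refine (mul_le_of_le_one_left (norm_nonneg _) hc1).trans ?_
      refine (norm_add_le _ _).trans ?_
      simp only [norm_mul, Complex.norm_real, Real.norm_eq_abs, abs_of_nonneg hc0,
        Complex.norm_ofNat]
      gcongr
      · exact hC1 _
      · exact (mul_le_of_le_one_left (norm_nonneg _) hc1).trans (hC2 _)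
  · have h2 : ∀ᵐ x, ∀ N, testLp (testD h j (testD h j (truncate S N))) x =
        (testD h j (testD h j (truncate S N)) : Eucl n → ℂ) x := by
      rw [ae_all_iff]; exact fun N => coeFn_testLp _
    filter_upwards [h2, S2.coeFn_toLp 2 volume] with x h2 h3
    simp only [h2, h3, semiD_semiD_truncate]
    have hc : Tendsto (fun N => (cutScale N : ℂ)) atTop (𝓝 ((0 : ℝ) : ℂ)) :=
      (Complex.continuous_ofReal.tendsto 0).comp tendsto_cutScale
    have t0 := (tendsto_cutScale_comp cutoff x).mul_const (S2 x)
    have t1 := ((tendsto_cutScale_comp (testD h j cutoff) x).const_mul 2).mul_const (S1 x)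
    have t2 := (hc.mul (tendsto_cutScale_comp (testD h j (testD h j cutoff)) x)).mul_const (S x)
    have t3 := t0.add (hc.mul (t1.add t2))
    simpa [cutoff_zero] using t3

theorem tendsto_testLap_truncate (h : ℝ) (S : 𝓢(Eucl n, ℂ)) :
    Tendsto (fun N => testLp (testLap h (truncate S N))) atTop
      (𝓝 (∑ j, (schwartzD h j (schwartzD h j S)).toLp 2)) := by
  simp only [testLap_apply, map_sum]
  exact tendsto_finsetSum _ fun j _ => tendsto_testD_testD_truncate h j S

/-- The Schwartz function with Fourier transform `(1 + |ξ|²)⁻¹ 𝓕 q`. -/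
theorem exists_schwartz_bessel (q : 𝓢(Eucl n, ℂ)) : ∃ S : 𝓢(Eucl n, ℂ),
    ∀ ξ, 𝓕 S ξ = (((1 + ‖ξ‖ ^ 2)⁻¹ : ℝ) : ℂ) * 𝓕 q ξ := by
  set J : Eucl n → ℂ := fun ξ => (((1 + ‖ξ‖ ^ 2) ^ (-1 : ℝ) : ℝ) : ℂ) with hJ
  have hJt : J.HasTemperateGrowth := by rw [hJ]; fun_prop
  refine ⟨𝓕⁻ (SchwartzMap.smulLeftCLM ℂ J (𝓕 q)), fun ξ => ?_⟩
  have hS : 𝓕 (𝓕⁻ (SchwartzMap.smulLeftCLM ℂ J (𝓕 q))) = SchwartzMap.smulLeftCLM ℂ J (𝓕 q) :=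
    fourier_fourierInv_eq _
  rw [hS, SchwartzMap.smulLeftCLM_apply_apply hJt, hJ, smul_eq_mul]
  simp only [Real.rpow_neg_one]

/-- The class in `L²` of a Schwartz function. -/
def schLp (S : 𝓢(Eucl n, ℂ)) : L2 n := S.toLp 2 volume

theorem fourier_schLp (q : 𝓢(Eucl n, ℂ)) : ∀ᵐ ξ, 𝓕 (schLp q) ξ = 𝓕 q ξ := by
  rw [schLp, SchwartzMap.toLp_fourier_eq]
  exact (𝓕 q).coeFn_toLp 2 volume

theorem fourier_schwartzLap (h : ℝ) (z : ℂ) (S : 𝓢(Eucl n, ℂ)) :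
    ∀ᵐ ξ, 𝓕 ((∑ j, schLp (schwartzD h j (schwartzD h j S))) - z • schLp S : L2 n) ξ
      = (symLap h ξ - z) * 𝓕 S ξ := by
  have h1 : ∀ᵐ ξ, ∀ j, 𝓕 (schLp (schwartzD h j (schwartzD h j S))) ξ
      = (symD h j ξ : ℂ) ^ 2 * 𝓕 S ξ := by
    rw [ae_all_iff]
    intro j
    filter_upwards [fourier_schLp (schwartzD h j (schwartzD h j S))] with ξ h1
    rw [h1, fourier_schwartzD, fourier_schwartzD]; ring
  have h2 : 𝓕 (∑ j, schLp (schwartzD h j (schwartzD h j S)) : L2 n)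
      = ∑ j, 𝓕 (schLp (schwartzD h j (schwartzD h j S))) :=
    map_sum (Lp.fourierTransformₗᵢ (Eucl n) ℂ) _ _
  rw [fourier_L2_sub, fourier_L2_smul, h2]
  filter_upwards [h1, fourier_schLp S, Lp.coeFn_finsetSum Finset.univ
    fun j => 𝓕 (schLp (schwartzD h j (schwartzD h j S))),
    Lp.coeFn_sub (∑ j, 𝓕 (schLp (schwartzD h j (schwartzD h j S))))
      (z • 𝓕 (schLp S)), Lp.coeFn_smul z (𝓕 (schLp S))] with ξ h1 h3 h4 h5 h6
  rw [h5, Pi.sub_apply, h6, Pi.smul_apply, h3, h4, Finset.sum_apply,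
    Finset.sum_congr rfl fun j _ => h1 j, ← Finset.sum_mul, symLap_eq_sum, smul_eq_mul]
  push_cast
  ring

/-- The ratio of the symbols of `-h²Δ - z` and `1 - Δ/(4π²)`. -/
def symRatio (h : ℝ) (z : ℂ) (ξ : Eucl n) : ℂ := (symLap h ξ - z) * (((1 + ‖ξ‖ ^ 2)⁻¹ : ℝ) : ℂ)

theorem continuous_symRatio (h : ℝ) (z : ℂ) : Continuous (symRatio h z : Eucl n → ℂ) := by
  have h1 := (hasTemperateGrowth_symLap (n := n) h).1.continuous
  have h2 : Continuous fun ξ : Eucl n => (((1 + ‖ξ‖ ^ 2)⁻¹ : ℝ) : ℂ) := by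
    refine Complex.continuous_ofReal.comp ?_
    exact Continuous.inv₀ (by fun_prop) fun ξ => by positivity
  exact (h1.sub continuous_const).mul h2

theorem bddMeas_symRatio (h : ℝ) (z : ℂ) : BddMeas (symRatio h z : Eucl n → ℂ) := by
  refine BddMeas.of_continuous (continuous_symRatio h z) (C := (2 * Real.pi * h) ^ 2 + ‖z‖)
    fun ξ => ?_
  rw [symRatio, norm_mul, Complex.norm_real, Real.norm_eq_abs, abs_of_nonneg (by positivity),
    mul_inv_le_iff₀ (by positivity)]
  have h1 : ‖((symLap h ξ : ℝ) : ℂ) - z‖ ≤ symLap h ξ + ‖z‖ := by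
    refine (norm_sub_le _ _).trans (le_of_eq ?_)
    rw [Complex.norm_real, Real.norm_eq_abs, abs_of_nonneg (symLap_nonneg h ξ)]
  refine h1.trans ?_
  rw [symLap]
  nlinarith [mul_nonneg (norm_nonneg z) (sq_nonneg ‖ξ‖), sq_nonneg (2 * Real.pi * h)]

theorem symLap_sub_ne_zero {z : ℂ} (hz : IsFar z) (h : ℝ) (ξ : Eucl n) :
    (symLap h ξ : ℂ) - z ≠ 0 := by
  rw [← norm_pos_iff]
  have := hz _ (symLap_nonneg h ξ)
  linarith [symLap_nonneg h ξ]

theorem symRatio_ne_zero {z : ℂ} (hz : IsFar z) (h : ℝ) (ξ : Eucl n) : symRatio h z ξ ≠ 0 := by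
  refine mul_ne_zero (symLap_sub_ne_zero hz h ξ) ?_
  rw [Complex.ofReal_ne_zero]
  positivity

theorem bddMeas_inv_symRatio {h : ℝ} (hh : 0 < h) {z : ℂ} (hz : IsFar z) :
    BddMeas fun ξ : Eucl n => (symRatio h z ξ)⁻¹ := by
  refine BddMeas.of_continuous ((continuous_symRatio h z).inv₀ (symRatio_ne_zero hz h))
    (C := 2 * (1 + (2 * Real.pi * h)⁻¹ ^ 2)) fun ξ => ?_
  have hp : 0 < 2 * Real.pi * h := by positivity
  have h1 := hz _ (symLap_nonneg h ξ)
  have h2 : 0 < ‖(symLap h ξ : ℂ) - z‖ := norm_pos_iff.2 (symLap_sub_ne_zero hz h ξ)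
  rw [norm_inv, symRatio, norm_mul, Complex.norm_real, Real.norm_eq_abs,
    abs_of_nonneg (by positivity), mul_inv, inv_inv, inv_mul_le_iff₀ h2]
  have h3 : ‖ξ‖ ^ 2 = (2 * Real.pi * h)⁻¹ ^ 2 * symLap h ξ := by
    rw [symLap, ← mul_assoc, ← mul_pow, inv_mul_cancel₀ hp.ne']; simp
  have h4 : (1 : ℝ) + ‖ξ‖ ^ 2 ≤ (1 + (2 * Real.pi * h)⁻¹ ^ 2) * (1 + symLap h ξ) := by
    rw [h3]; nlinarith [symLap_nonneg h ξ, sq_nonneg (2 * Real.pi * h)⁻¹]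
  nlinarith [sq_nonneg (2 * Real.pi * h)⁻¹]

/-- `(-h²Δ - z)C_c^∞` is dense in `L²`: the symbol `4π²h²|ξ|² - z` is comparable to `1 + |ξ|²`, so
every function whose Fourier transform is `(4π²h²|ξ|² - z)(1 + |ξ|²)⁻¹ 𝓕q` with a Schwartz function
`q` is in the closure, and these functions are dense. -/
theorem dense_free {h : ℝ} (hh : 0 < h) {z : ℂ} (hz : IsFar z) (g : L2 n) {ε : ℝ} (hε : 0 < ε) :
    ∃ ψ : Test n, ‖testLp (testLap h ψ) - z • testLp ψ - g‖ < ε := by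
  set m := symRatio (n := n) h z
  have hm := bddMeas_symRatio (n := n) h z
  have hmi := bddMeas_inv_symRatio (n := n) hh hz
  set G0 : L2 n := mulOp (fun ξ => (symRatio h z ξ)⁻¹) (𝓕 g)
  have hG0 : mulOp m G0 = 𝓕 g := by
    refine Lp.ext ?_
    filter_upwards [coeFn_mulOp hm G0, coeFn_mulOp hmi (𝓕 g)] with ξ h1 h2
    rw [h1, h2, ← mul_assoc, mul_inv_cancel₀ (symRatio_ne_zero hz h ξ), one_mul]
  obtain ⟨q, hq⟩ : ∃ q : 𝓢(Eucl n, ℂ), ‖schLp q - (𝓕⁻ G0 : L2 n)‖ < ε / 2 / (‖mulOp m‖ + 1) := by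
    have hd := SchwartzMap.denseRange_toLpCLM (E := Eucl n) (F := ℂ) (p := 2)
      (μ := volume) (by simp)
    obtain ⟨q, hq⟩ := hd.exists_dist_lt (𝓕⁻ G0 : L2 n) (ε := ε / 2 / (‖mulOp m‖ + 1))
      (by positivity)
    refine ⟨q, ?_⟩
    rw [dist_comm, dist_eq_norm] at hq
    exact hq
  obtain ⟨S, hS⟩ := exists_schwartz_bessel q
  set w : L2 n := (∑ j, schLp (schwartzD h j (schwartzD h j S))) - z • schLp S
  have hw : ‖w - g‖ < ε / 2 := by
    have e1 : 𝓕 w = mulOp m (𝓕 (schLp q)) := by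
      refine Lp.ext ?_
      filter_upwards [fourier_schwartzLap h z S, fourier_schLp q,
        coeFn_mulOp hm (𝓕 (schLp q))] with ξ h1 h2 h3
      rw [h1, h3, h2, hS]
      change _ = (symLap h ξ - z) * (((1 + ‖ξ‖ ^ 2)⁻¹ : ℝ) : ℂ) * _
      ring
    have e2 : 𝓕 (w - g) = mulOp m (𝓕 (schLp q - (𝓕⁻ G0 : L2 n))) := by
      rw [fourier_L2_sub w g, fourier_L2_sub (schLp q), ContinuousLinearMap.map_sub, e1, fourier_fourierInv_eq,
        hG0]
    rw [← Lp.norm_fourier_eq, e2]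
    refine ((mulOp m).le_opNorm _).trans_lt ?_
    rw [Lp.norm_fourier_eq]
    rw [lt_div_iff₀ (by positivity)] at hq
    nlinarith [norm_nonneg (schLp q - (𝓕⁻ G0 : L2 n))]
  have ht : Tendsto (fun N => testLp (testLap h (truncate S N)) - z • testLp (truncate S N)) atTop
      (𝓝 w) := (tendsto_testLap_truncate h S).sub ((tendsto_truncate S).const_smul z)
  obtain ⟨N, hN⟩ := (Metric.tendsto_nhds.1 ht (ε / 2) (by positivity)).exists
  rw [dist_eq_norm] at hN
  refine ⟨truncate S N, ?_⟩
  calc _ = ‖(testLp (testLap h (truncate S N)) - z • testLp (truncate S N) - w) + (w - g)‖ := by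
        congr 1; abel
    _ ≤ _ := norm_add_le _ _
    _ < ε := by linarith

/-- Test functions are a core for `-h²Δ`: every pair in its graph is a limit of pairs
`(ψ, -h²Δψ)`. -/
theorem exists_test_of_mem_freeGraph {h : ℝ} (hh : 0 < h) {u g : L2 n}
    (hug : (u, g) ∈ freeGraph n h) : ∃ ψ : ℕ → Test n,
      Tendsto (fun k => testLp (ψ k)) atTop (𝓝 u) ∧
      Tendsto (fun k => testLp (testLap h (ψ k))) atTop (𝓝 g) := by
  rw [mem_freeGraph_iff] at hug
  have hpos : ∀ k : ℕ, (0 : ℝ) < 1 / ((k : ℝ) + 1) := fun k => by positivity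
  choose ψ hψ using fun k : ℕ => dense_free hh isFar_neg_one (g - (-1 : ℂ) • u) (hpos k)
  have h1 : ∀ k, ‖testLp (ψ k) - u‖
      ≤ 2 * ‖testLp (testLap h (ψ k)) - (-1 : ℂ) • testLp (ψ k) - (g - (-1 : ℂ) • u)‖ := by
    intro k
    refine norm_le_of_fourier ?_
    rw [fourier_L2_sub, fourier_L2_sub (_ - _), fourier_L2_sub g, fourier_L2_smul]
    filter_upwards [hug, fourier_testLap_sub h (-1) (ψ k),
      Lp.coeFn_sub (𝓕 (testLp (ψ k))) (𝓕 u),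
      Lp.coeFn_sub (𝓕 (testLp (testLap h (ψ k)) - (-1 : ℂ) • testLp (ψ k)))
        (𝓕 g - (-1 : ℂ) • 𝓕 u), Lp.coeFn_sub (𝓕 g) ((-1 : ℂ) • 𝓕 u),
      Lp.coeFn_smul (-1 : ℂ) (𝓕 u)] with ξ a1 a2 a3 a4 a5 a6
    rw [a3, a4, Pi.sub_apply, Pi.sub_apply, a5, Pi.sub_apply, a6, a1, a2, Pi.smul_apply, smul_eq_mul]
    have e : ((symLap h ξ : ℂ) - -1) * 𝓕 (testLp (ψ k)) ξ - (symLap h ξ * 𝓕 u ξ - -1 * 𝓕 u ξ)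
        = (symLap h ξ - (-1)) * (𝓕 (testLp (ψ k)) ξ - 𝓕 u ξ) := by ring
    rw [e, norm_mul]
    have b1 := isFar_neg_one _ (symLap_nonneg h ξ)
    have b2 := symLap_nonneg h ξ
    have b3 := norm_nonneg (𝓕 (testLp (ψ k)) ξ - 𝓕 u ξ)
    nlinarith [mul_nonneg b2 b3]
  have hz : Tendsto (fun k : ℕ => testLp (testLap h (ψ k)) - (-1 : ℂ) • testLp (ψ k)) atTop
      (𝓝 (g - (-1 : ℂ) • u)) := by
    rw [tendsto_iff_norm_sub_tendsto_zero]
    exact squeeze_zero (fun _ => norm_nonneg _) (fun k => (hψ k).le)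
      tendsto_one_div_add_atTop_nhds_zero_nat
  have hu : Tendsto (fun k => testLp (ψ k)) atTop (𝓝 u) := by
    rw [tendsto_iff_norm_sub_tendsto_zero] at hz ⊢
    refine squeeze_zero (fun _ => norm_nonneg _) h1 ?_
    simpa using hz.const_mul 2
  refine ⟨ψ, hu, ?_⟩
  have := hz.add (hu.const_smul (-1 : ℂ))
  simpa using this

/-! ### Resolvents of self-adjoint operators and the Cayley transform -/

section Resolvents

set_option linter.unusedSectionVars false

variable {H : Type*} [NormedAddCommGroup H] [InnerProductSpace ℂ H] [CompleteSpace H]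

theorem IsResolventAt.unique {A : H →ₗ.[ℂ] H} {z : ℂ} {R R' : H →L[ℂ] H}
    (h : IsResolventAt A z R) (h' : IsResolventAt A z R') : R = R' := by
  ext f
  obtain ⟨hf, e⟩ := h'.1 f
  have := h.2 ⟨R' f, hf⟩
  rwa [e] at this

theorem resolventOp_eq {A : H →ₗ.[ℂ] H} {z : ℂ} {R : H →L[ℂ] H} (h : IsResolventAt A z R) :
    resolventOp A z = R := by
  have hex : ∃ R : H →L[ℂ] H, IsResolventAt A z R := ⟨R, h⟩
  rw [resolventOp, dif_pos hex]
  exact hex.choose_spec.unique h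

/-- `R` is the resolvent of `A` at `-i`, and its adjoint is the resolvent at `i`. -/
structure IsResolventPair (A : H →ₗ.[ℂ] H) (R : H →L[ℂ] H) : Prop where
  neg : IsResolventAt A (-Complex.I) R
  pos : IsResolventAt A Complex.I (star R)

theorem inner_selfAdjoint {A : H →ₗ.[ℂ] H} (hA : IsSelfAdjoint A) (u v : A.domain) :
    inner ℂ (A u) (v : H) = inner ℂ (u : H) (A v) := by
  have h := LinearPMap.adjoint_isFormalAdjoint hA.dense_domain
  rw [LinearPMap.isSelfAdjoint_def.1 hA] at h
  exact h u v

theorem norm_sq_sub_smul {A : H →ₗ.[ℂ] H} (hA : IsSelfAdjoint A) {z : ℂ} (hz : z.re = 0)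
    (hz1 : ‖z‖ = 1) (u : A.domain) : ‖A u - z • (u : H)‖ ^ 2 = ‖A u‖ ^ 2 + ‖(u : H)‖ ^ 2 := by
  have h1 : (inner ℂ (A u) (u : H) : ℂ).im = 0 := by
    rw [← Complex.conj_eq_iff_im, inner_conj_symm]
    exact (inner_selfAdjoint hA u u).symm
  rw [norm_sub_sq (𝕜 := ℂ), inner_smul_right, norm_smul, hz1]
  simp [hz, h1]

theorem norm_le_sub_smul {A : H →ₗ.[ℂ] H} (hA : IsSelfAdjoint A) {z : ℂ} (hz : z.re = 0)
    (hz1 : ‖z‖ = 1) (u : A.domain) : ‖(u : H)‖ ≤ ‖A u - z • (u : H)‖ := by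
  have := norm_sq_sub_smul hA hz hz1 u
  exact le_of_sq_le_sq (by nlinarith [sq_nonneg ‖A u‖]) (norm_nonneg _)

/-- The map `A - z` on the domain of `A`. -/
def shiftMap (A : H →ₗ.[ℂ] H) (z : ℂ) : A.domain →ₗ[ℂ] H := A.toFun - z • A.domain.subtype

theorem shiftMap_apply (A : H →ₗ.[ℂ] H) (z : ℂ) (u : A.domain) :
    shiftMap A z u = A u - z • (u : H) := rfl

theorem isClosed_range_shiftMap {A : H →ₗ.[ℂ] H} (hA : IsSelfAdjoint A) {z : ℂ} (hz : z.re = 0)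
    (hz1 : ‖z‖ = 1) : IsClosed (LinearMap.range (shiftMap A z) : Set H) := by
  refine IsSeqClosed.isClosed fun v w hv hw => ?_
  choose u hu using hv
  have hc : CauchySeq fun k => (u k : H) := by
    have hv := hw.cauchySeq
    rw [Metric.cauchySeq_iff] at hv ⊢
    intro ε hε
    obtain ⟨N, hN⟩ := hv ε hε
    refine ⟨N, fun k hk l hl => lt_of_le_of_lt ?_ (hN k hk l hl)⟩
    have := norm_le_sub_smul hA hz hz1 (u k - u l)
    rw [← shiftMap_apply, map_sub, hu, hu] at this
    rwa [dist_eq_norm, dist_eq_norm]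
  obtain ⟨x, hx⟩ := cauchySeq_tendsto_of_complete hc
  have hAu : Tendsto (fun k => A (u k)) atTop (𝓝 (w + z • x)) := by
    have := hw.add (hx.const_smul z)
    refine this.congr fun k => ?_
    rw [← hu k, shiftMap_apply, sub_add_cancel]
  have hg : (x, w + z • x) ∈ A.graph := by
    have hcl : IsClosed (A.graph : Set (H × H)) := hA.isClosed
    exact hcl.mem_of_tendsto (hx.prodMk_nhds hAu) (Eventually.of_forall fun k => A.mem_graph (u k))
  obtain ⟨y, hy1, hy2⟩ := (LinearPMap.mem_graph_iff A).1 hg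
  refine ⟨y, ?_⟩
  rw [shiftMap_apply]
  simp only at hy1 hy2
  rw [hy1, hy2, add_sub_cancel_right]

/-- Half of the basic criterion of self-adjointness: `A - z` is onto for `z = ±i`. -/
theorem range_shiftMap {A : H →ₗ.[ℂ] H} (hA : IsSelfAdjoint A) {z : ℂ} (hz : z.re = 0)
    (hz1 : ‖z‖ = 1) : LinearMap.range (shiftMap A z) = ⊤ := by
  have hcomplete : IsComplete (LinearMap.range (shiftMap A z) : Set H) :=
    (isClosed_range_shiftMap hA hz hz1).isComplete
  have : CompleteSpace (LinearMap.range (shiftMap A z)) := hcomplete.completeSpace_coe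
  rw [← Submodule.orthogonal_eq_bot_iff, Submodule.eq_bot_iff]
  intro g hg
  rw [Submodule.mem_orthogonal'] at hg
  have hg' : ∀ u : A.domain, inner ℂ (conj z • g) (u : H) = inner ℂ g (A u) := fun u => by
    have := hg _ (LinearMap.mem_range_self _ u)
    rw [shiftMap_apply, inner_sub_right, inner_smul_right, sub_eq_zero] at this
    rw [this, inner_smul_left, Complex.conj_conj]
  -- A vector `g` orthogonal to the range lies in the domain of the adjoint, which is `A`, and is
  -- an eigenvector with the non-real eigenvalue `z̄`; hence it vanishes.
  have hgd : g ∈ A.domain := by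
    have := LinearPMap.mem_adjoint_domain_of_exists (T := A) g ⟨_, hg'⟩
    rwa [LinearPMap.isSelfAdjoint_def.1 hA] at this
  have hAg : A ⟨g, hgd⟩ = conj z • g := by
    refine hA.dense_domain.eq_of_inner_left (𝕜 := ℂ) fun v hv => ?_
    rw [hg' ⟨v, hv⟩]
    exact inner_selfAdjoint hA ⟨g, hgd⟩ ⟨v, hv⟩
  have hzc : conj z = -z := by
    apply Complex.ext <;> simp [hz]
  have hb := norm_le_sub_smul hA (z := -z) (by simp [hz]) (by simpa using hz1) ⟨g, hgd⟩
  rw [hAg, hzc] at hb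
  simpa using hb

/-- The resolvent of a self-adjoint operator at `±i` exists. -/
theorem exists_isResolventAt {A : H →ₗ.[ℂ] H} (hA : IsSelfAdjoint A) {z : ℂ} (hz : z.re = 0)
    (hz1 : ‖z‖ = 1) : ∃ R : H →L[ℂ] H, IsResolventAt A z R := by
  have hinj : Function.Injective (shiftMap A z) := by
    rw [← LinearMap.ker_eq_bot, LinearMap.ker_eq_bot']
    intro u hu
    have := norm_le_sub_smul hA hz hz1 u
    rw [← shiftMap_apply, hu, norm_zero] at this
    exact Subtype.ext (norm_le_zero_iff.1 this)
  let e := LinearEquiv.ofBijective (shiftMap A z)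
    ⟨hinj, LinearMap.range_eq_top.1 (range_shiftMap hA hz hz1)⟩
  have he : ∀ f, shiftMap A z (e.symm f) = f := fun f => e.apply_symm_apply f
  refine ⟨LinearMap.mkContinuous (A.domain.subtype ∘ₗ e.symm.toLinearMap) 1 fun f => ?_,
    fun f => ⟨(e.symm f).2, he f⟩, fun u => ?_⟩
  · rw [one_mul]
    have := norm_le_sub_smul hA hz hz1 (e.symm f)
    rwa [← shiftMap_apply, he] at this
  · change ((e.symm (shiftMap A z u) : A.domain) : H) = u
    rw [show shiftMap A z u = e u from rfl, e.symm_apply_apply]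

theorem isResolventAt_resolventOp {A : H →ₗ.[ℂ] H} (hA : IsSelfAdjoint A) {z : ℂ} (hz : z.re = 0)
    (hz1 : ‖z‖ = 1) : IsResolventAt A z (resolventOp A z) := by
  obtain ⟨R, hR⟩ := exists_isResolventAt hA hz hz1
  rwa [resolventOp_eq hR]

theorem isResolventPair_of_isSelfAdjoint {A : H →ₗ.[ℂ] H} (hA : IsSelfAdjoint A) :
    IsResolventPair A (resolventOp A (-Complex.I)) := by
  have h1 := isResolventAt_resolventOp hA (z := -Complex.I) (by simp) (by simp)
  have h2 := isResolventAt_resolventOp hA (z := Complex.I) (by simp) (by simp)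
  refine ⟨h1, ?_⟩
  suffices h : star (resolventOp A (-Complex.I)) = resolventOp A Complex.I by rwa [h]
  rw [ContinuousLinearMap.star_eq_adjoint, eq_comm, ContinuousLinearMap.eq_adjoint_iff]
  intro f g
  obtain ⟨hf, ef⟩ := h2.1 f
  obtain ⟨hg, eg⟩ := h1.1 g
  conv_lhs => rw [← eg]
  conv_rhs => rw [← ef]
  rw [inner_sub_right, inner_sub_left, inner_smul_left, inner_smul_right,
    ← inner_selfAdjoint hA ⟨_, hf⟩ ⟨_, hg⟩]
  simp

variable {A : H →ₗ.[ℂ] H} {R : H →L[ℂ] H}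

theorem IsResolventPair.mem_domain (h : IsResolventPair A R) (f : H) : R f ∈ A.domain :=
  (h.neg.1 f).1

theorem IsResolventPair.apply (h : IsResolventPair A R) (f : H) :
    A ⟨R f, h.mem_domain f⟩ = f - Complex.I • R f := by
  obtain ⟨hf, e⟩ := h.neg.1 f
  rw [neg_smul, sub_neg_eq_add] at e
  exact eq_sub_of_add_eq e

/-- The resolvent identity `R - R* = -2i R* R`. -/
theorem IsResolventPair.sub_star (h : IsResolventPair A R) :
    R - star R = -(2 * Complex.I) • (star R * R) := by
  ext f
  have h1 := h.pos.2 ⟨R f, h.mem_domain f⟩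
  rw [h.apply] at h1
  have h2 : f - Complex.I • R f - Complex.I • R f = f - (2 * Complex.I) • R f := by
    rw [sub_sub, ← add_smul]; ring_nf
  simp only at h1
  rw [h2, map_sub, map_smul] at h1
  change R f - star R f = -(2 * Complex.I) • star R (R f)
  conv_lhs => rw [← h1]
  rw [neg_smul]; abel

theorem IsResolventPair.symm_sub_star (h : IsResolventPair A R) :
    R - star R = -(2 * Complex.I) • (R * star R) := by
  ext f
  obtain ⟨hf, e⟩ := h.pos.1 f
  have h1 := h.neg.2 ⟨star R f, hf⟩
  have h2 : A ⟨star R f, hf⟩ - (-Complex.I) • star R f = f + (2 * Complex.I) • star R f := by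
    rw [sub_eq_iff_eq_add.1 e, neg_smul, two_mul, add_smul]; abel
  simp only at h1
  rw [h2, map_add, map_smul] at h1
  change R f - star R f = -(2 * Complex.I) • R (star R f)
  conv_lhs => rw [← h1]
  rw [neg_smul]; abel

/-- The Cayley transform `1 - 2iR = (A - i)(A + i)⁻¹`. -/
def cayley (R : H →L[ℂ] H) : H →L[ℂ] H := 1 - (2 * Complex.I) • R

theorem star_cayley (R : H →L[ℂ] H) : star (cayley R) = 1 + (2 * Complex.I) • star R := by
  rw [cayley, star_sub, star_one, star_smul]
  simp [sub_eq_add_neg]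

/-- The Cayley transform is unitary, by the resolvent identities. -/
theorem IsResolventPair.cayley_mem_unitary (h : IsResolventPair A R) :
    cayley R ∈ unitary (H →L[ℂ] H) := by
  rw [Unitary.mem_iff, star_cayley, cayley]
  have h4 : (2 * Complex.I) * (2 * Complex.I) = -4 := by
    linear_combination 4 * Complex.I_sq
  have key : ∀ T : H →L[ℂ] H, R - star R = -(2 * Complex.I) • T →
      (2 * Complex.I) • star R - (2 * Complex.I) • R = ((2 * Complex.I) * (2 * Complex.I)) • T := by
    intro T hT
    rw [← smul_sub, ← neg_sub R, hT, neg_smul, neg_neg, smul_smul]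
  constructor
  · have := key _ h.sub_star
    rw [add_mul, one_mul, mul_sub, mul_one, smul_mul_smul_comm]
    rw [h4] at this ⊢
    rw [sub_eq_iff_eq_add] at this
    rw [this]
    module
  · have := key _ h.symm_sub_star
    rw [sub_mul, one_mul, mul_add, mul_one, smul_mul_smul_comm]
    rw [h4] at this ⊢
    rw [sub_eq_iff_eq_add] at this
    rw [this]
    module

theorem IsResolventPair.isStarNormal (h : IsResolventPair A R) : IsStarNormal R := by
  refine ⟨?_⟩
  have h1 := h.sub_star.symm.trans h.symm_sub_star
  exact smul_right_injective _ (by simp : -(2 * Complex.I) ≠ 0) h1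

theorem IsResolventPair.norm_cayley_apply (h : IsResolventPair A R) (f : H) :
    ‖cayley R f‖ = ‖f‖ :=
  ContinuousLinearMap.norm_map_of_mem_unitary h.cayley_mem_unitary f

theorem IsResolventPair.norm_star_cayley_apply (h : IsResolventPair A R) (f : H) :
    ‖star (cayley R) f‖ = ‖f‖ :=
  ContinuousLinearMap.norm_map_of_mem_unitary (Unitary.star_mem h.cayley_mem_unitary) f

/-- On the spectrum of `R`, the Cayley transform has modulus one. -/
theorem IsResolventPair.norm_of_mem_spectrum (h : IsResolventPair A R) {w : ℂ}
    (hw : w ∈ spectrum ℂ R) : ‖1 - 2 * Complex.I * w‖ = 1 := by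
  have h1 : 1 - 2 * Complex.I * w ∈ spectrum ℂ (cayley R) := by
    set p : Polynomial ℂ := Polynomial.C 1 - Polynomial.C (2 * Complex.I) * Polynomial.X with hp
    have e : Polynomial.aeval R p = cayley R := by
      rw [hp, map_sub, map_mul, Polynomial.aeval_C, Polynomial.aeval_C, Polynomial.aeval_X,
        map_one, ← Algebra.smul_def, cayley]
    rw [← e]
    refine spectrum.subset_polynomial_aeval R p ⟨w, hw, ?_⟩
    simp [hp]
  have := spectrum.subset_circle_of_unitary h.cayley_mem_unitary h1
  simpa using this

end Resolvents

/-! ### Fourier series on the circle and the functional calculus -/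

/-- The `k`-th Fourier coefficient of a `2π`-periodic function. -/
def circleCoeff (g : ℝ → ℂ) (k : ℤ) : ℂ := fourierCoeffOn Real.two_pi_pos g k

theorem norm_circleCoeff_le {g : ℝ → ℂ} {K : ℝ} (hK : ∀ x, ‖g x‖ ≤ K) (k : ℤ) :
    ‖circleCoeff g k‖ ≤ K := by
  rw [circleCoeff, fourierCoeffOn_eq_integral, norm_smul]
  have h1 : ‖∫ x in (0 : ℝ)..2 * Real.pi, fourier (-k) (x : AddCircle (2 * Real.pi - 0)) • g x‖
      ≤ K * |2 * Real.pi - 0| := by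
    refine intervalIntegral.norm_integral_le_of_norm_le_const fun x _ => ?_
    rw [norm_smul, fourier_apply, Circle.norm_coe, one_mul]
    exact hK x
  have h2 : (0 : ℝ) < 2 * Real.pi := Real.two_pi_pos
  rw [sub_zero, abs_of_pos h2] at h1
  rw [sub_zero, Real.norm_eq_abs, abs_of_pos (by positivity), one_div, inv_mul_le_iff₀ h2]
  linarith

theorem bounded_of_periodic {g : ℝ → ℂ} (hg : Continuous g)
    (hp : Function.Periodic g (2 * Real.pi)) : ∃ K, 0 ≤ K ∧ ∀ x, ‖g x‖ ≤ K := by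
  obtain ⟨K, hK⟩ := (isCompact_Icc (a := (0 : ℝ)) (b := 2 * Real.pi)).exists_bound_of_continuousOn
    hg.continuousOn
  refine ⟨K, (norm_nonneg _).trans (hK 0 ⟨le_rfl, Real.two_pi_pos.le⟩), fun x => ?_⟩
  obtain ⟨y, hy, e⟩ := hp.exists_mem_Ico₀ Real.two_pi_pos x
  rw [e]
  exact hK y ⟨hy.1, hy.2.le⟩

/-- The Fourier coefficients of a smooth periodic function decay faster than any power. -/
theorem circleCoeff_decay (N : ℕ) {g : ℝ → ℂ} (hg : ContDiff ℝ ∞ g)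
    (hp : Function.Periodic g (2 * Real.pi)) :
    ∃ K, 0 ≤ K ∧ ∀ k : ℤ, |(k : ℝ)| ^ N * ‖circleCoeff g k‖ ≤ K := by
  induction N generalizing g with
  | zero =>
    obtain ⟨K, hK0, hK⟩ := bounded_of_periodic hg.continuous hp
    exact ⟨K, hK0, fun k => by simpa using norm_circleCoeff_le hK k⟩
  | succ N ih =>
    have hg' : ContDiff ℝ ∞ (deriv g) := (contDiff_infty_iff_deriv.1 hg).2
    have hp' : Function.Periodic (deriv g) (2 * Real.pi) := fun x => by
      rw [← deriv_comp_add_const]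
      congr 1
      exact funext hp
    obtain ⟨K, hK0, hK⟩ := ih hg' hp'
    refine ⟨K, hK0, fun k => ?_⟩
    by_cases hk : k = 0
    · simp [hk, hK0]
    have h1 : circleCoeff g k = 1 / (-2 * Real.pi * Complex.I * k) *
        (fourier (-k) ((0 : ℝ) : AddCircle (2 * Real.pi - 0)) * (g (2 * Real.pi) - g 0)
          - ((2 * Real.pi : ℝ) - (0 : ℝ)) * circleCoeff (deriv g) k) :=
      fourierCoeffOn_of_hasDerivAt Real.two_pi_pos hk
        (fun x _ => (hg.differentiable (by simp) x).hasDerivAt)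
        (hg'.continuous.intervalIntegrable _ _)
    have h2 : g (2 * Real.pi) = g 0 := by simpa using hp 0
    have hk' : (k : ℂ) ≠ 0 := Int.cast_ne_zero.2 hk
    have hpi : (Real.pi : ℂ) ≠ 0 := Complex.ofReal_ne_zero.2 Real.pi_ne_zero
    have h3 : (k : ℂ) * circleCoeff g k = -Complex.I * circleCoeff (deriv g) k := by
      rw [h1, h2]
      push_cast
      field_simp
      linear_combination (2 * Real.pi * circleCoeff (deriv g) k : ℂ) * Complex.I_sq
    have h4 : |(k : ℝ)| * ‖circleCoeff g k‖ = ‖circleCoeff (deriv g) k‖ := by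
      have := congrArg norm h3
      rw [norm_mul, norm_mul, norm_neg, Complex.norm_I, one_mul] at this
      rw [← this]
      congr 1
      simp
    rw [pow_succ, mul_assoc, h4]
    exact hK k

theorem circleCoeff_summable (N : ℕ) {g : ℝ → ℂ} (hg : ContDiff ℝ ∞ g)
    (hp : Function.Periodic g (2 * Real.pi)) :
    Summable fun k : ℤ => ‖circleCoeff g k‖ * (1 + |(k : ℝ)|) ^ N := by
  obtain ⟨K, hK0, hK⟩ := circleCoeff_decay (N + 2) hg hp
  have hs : Summable fun k : ℤ => 2 ^ N * K * (1 / (k : ℝ) ^ 2) :=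
    (Real.summable_one_div_int_pow.2 one_lt_two).mul_left _
  refine Summable.of_norm_bounded_eventually hs ?_
  have h0 : ∀ᶠ k : ℤ in cofinite, k ≠ 0 := by
    rw [eventually_cofinite]; simp
  filter_upwards [h0] with k hk
  have hk1 : 1 ≤ |(k : ℝ)| := by
    rw [← Int.cast_abs]; exact_mod_cast Int.one_le_abs hk
  rw [Real.norm_eq_abs, abs_of_nonneg (by positivity), mul_one_div, le_div_iff₀ (by positivity)]
  have h1 : (1 + |(k : ℝ)|) ^ N ≤ 2 ^ N * |(k : ℝ)| ^ N := by
    rw [← mul_pow]; gcongr; linarith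
  calc _ ≤ ‖circleCoeff g k‖ * (2 ^ N * |(k : ℝ)| ^ N) * (k : ℝ) ^ 2 := by gcongr
    _ = 2 ^ N * (|(k : ℝ)| ^ (N + 2) * ‖circleCoeff g k‖) := by rw [pow_add, sq_abs]; ring
    _ ≤ _ := by gcongr; exact hK k

/-- The Fourier series of a smooth periodic function converges to it pointwise. -/
theorem circleCoeff_hasSum {g : ℝ → ℂ} (hg : ContDiff ℝ ∞ g)
    (hp : Function.Periodic g (2 * Real.pi)) (θ : ℝ) :
    HasSum (fun k : ℤ => circleCoeff g k * Complex.exp (Complex.I * k * θ)) (g θ) := by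
  have : Fact (0 < 2 * Real.pi) := ⟨Real.two_pi_pos⟩
  let F : C(AddCircle (2 * Real.pi), ℂ) :=
    ⟨hp.lift, continuous_coinduced_dom.2 (by change Continuous g; exact hg.continuous)⟩
  have hF : ∀ x : ℝ, F (x : AddCircle (2 * Real.pi)) = g x := fun x => hp.lift_coe x
  have hc : ∀ k, fourierCoeff F k = circleCoeff g k := by
    intro k
    rw [circleCoeff, fourierCoeffOn_eq_integral, fourierCoeff_eq_intervalIntegral _ _ 0, zero_add]
    simp only [hF, fourier_coe_apply, sub_zero]
  have hsum : Summable (fourierCoeff F) := by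
    refine Summable.of_norm ?_
    simp only [hc]
    simpa using circleCoeff_summable 0 hg hp
  have := has_pointwise_sum_fourier_series_of_summable hsum (θ : AddCircle (2 * Real.pi))
  rw [hF] at this
  have e : (fun k : ℤ => circleCoeff g k * Complex.exp (Complex.I * k * θ))
      = fun k => fourierCoeff F k • fourier k (θ : AddCircle (2 * Real.pi)) := by
    ext k
    rw [hc, fourier_coe_apply, smul_eq_mul]
    congr 2
    have hpi : (Real.pi : ℂ) ≠ 0 := Complex.ofReal_ne_zero.2 Real.pi_ne_zero
    push_cast
    field_simp
  rw [e]
  exact this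

/-- The powers `u^k` of a unitary element, the adjoint being used as the inverse. -/
def cayPow {M : Type*} [Monoid M] [Star M] (u : M) : ℤ → M
  | .ofNat k => u ^ k
  | .negSucc k => star u ^ (k + 1)

theorem cayPow_exp (θ : ℝ) (k : ℤ) :
    cayPow (Complex.exp (Complex.I * θ)) k = Complex.exp (Complex.I * k * θ) := by
  cases k with
  | ofNat k =>
    simp only [cayPow, ← Complex.exp_nat_mul]
    congr 1; rw [Int.ofNat_eq_natCast]; push_cast; ring
  | negSucc k =>
    simp only [cayPow]
    rw [RCLike.star_def, ← Complex.exp_conj, ← Complex.exp_nat_mul]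
    congr 1
    simp only [map_mul, Complex.conj_I, Complex.conj_ofReal]
    push_cast; ring

theorem norm_cayPow {u : ℂ} (hu : ‖u‖ = 1) (k : ℤ) : ‖cayPow u k‖ = 1 := by
  cases k <;> simp [cayPow, hu]

/-- The function of which `funCalc` takes the continuous functional calculus. -/
def resolventFun (φ : ℝ → ℂ) (w : ℂ) : ℂ := if w = 0 then 0 else φ (w⁻¹).re

/-- The function `φ` in the angular variable `θ` of the Cayley transform: `e^{iθ} = (λ - i)/(λ + i)`
corresponds to `λ = -cot(θ/2)`, and `λ = ±∞` to `θ = 0`. -/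
def angularFun (φ : ℝ → ℂ) (θ : ℝ) : ℂ :=
  if Real.sin (θ / 2) = 0 then 0 else φ (-Real.cos (θ / 2) / Real.sin (θ / 2))

theorem angularFun_periodic (φ : ℝ → ℂ) : Function.Periodic (angularFun φ) (2 * Real.pi) := by
  intro θ
  have h : (θ + 2 * Real.pi) / 2 = θ / 2 + Real.pi := by ring
  simp only [angularFun, h, Real.sin_add_pi, Real.cos_add_pi, neg_eq_zero, neg_div_neg_eq]

/-- The function in the angular variable is smooth: it vanishes near `θ = 0`, since `φ` has compact
support. -/
theorem angularFun_contDiff {φ : ℝ → ℂ} (hφ : ContDiff ℝ ∞ φ) (hc : HasCompactSupport φ) :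
    ContDiff ℝ ∞ (angularFun φ) := by
  rw [contDiff_iff_contDiffAt]
  intro θ
  by_cases hs : Real.sin (θ / 2) = 0
  · obtain ⟨B, hB⟩ : ∃ B : ℝ, ∀ x, B < |x| → φ x = 0 := by
      obtain ⟨B, hB⟩ := hc.isCompact.isBounded.exists_norm_le
      refine ⟨B, fun x hx => ?_⟩
      by_contra hne
      exact absurd (hB x (subset_tsupport _ hne)) (not_le.2 hx)
    have hcs : Real.cos (θ / 2) ^ 2 = 1 := by
      have := Real.sin_sq_add_cos_sq (θ / 2)
      rw [hs] at this; linarith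
    -- Close to a zero of `sin(t/2)` the argument `-cot(t/2)` of `φ` is outside the support.
    have hev : ∀ᶠ t in 𝓝 θ, B * |Real.sin (t / 2)| < |Real.cos (t / 2)| := by
      refine ContinuousAt.eventually_lt (by fun_prop) (by fun_prop) ?_
      have : |Real.cos (θ / 2)| = 1 := by
        rw [← Real.sqrt_sq_eq_abs, hcs, Real.sqrt_one]
      rw [hs, this]; simp
    have : angularFun φ =ᶠ[𝓝 θ] fun _ => 0 := by
      filter_upwards [hev] with t ht
      rw [angularFun]
      split_ifs with h0
      · rfl
      · apply hB
        rw [abs_div, abs_neg, lt_div_iff₀ (abs_pos.2 h0)]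
        exact ht
    exact contDiffAt_const.congr_of_eventuallyEq this
  · have hev : ∀ᶠ t in 𝓝 θ, Real.sin (t / 2) ≠ 0 :=
      ContinuousAt.eventually_ne (g := fun t : ℝ => Real.sin (t / 2)) (by fun_prop) hs
    have : angularFun φ =ᶠ[𝓝 θ] fun t => φ (-Real.cos (t / 2) / Real.sin (t / 2)) := by
      filter_upwards [hev] with t ht
      rw [angularFun, if_neg ht]
    refine ContDiffAt.congr_of_eventuallyEq ?_ this
    refine hφ.contDiffAt.comp θ (f := fun t : ℝ => -Real.cos (t / 2) / Real.sin (t / 2)) ?_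
    refine ContDiffAt.div ?_ ?_ hs
    · exact (Real.contDiff_cos.comp (contDiff_id.div_const 2)).neg.contDiffAt
    · exact (Real.contDiff_sin.comp (contDiff_id.div_const 2)).contDiffAt

/-- On the circle `|1 - 2iw| = 1` the function `resolventFun φ` is `angularFun φ` of the argument of
`1 - 2iw`. -/
theorem resolventFun_eq {φ : ℝ → ℂ} {w : ℂ} {θ : ℝ}
    (h : 1 - 2 * Complex.I * w = Complex.exp (Complex.I * θ)) :
    resolventFun φ w = angularFun φ θ := by
  set s := Real.sin (θ / 2) with hs
  set c := Real.cos (θ / 2) with hc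
  have hsc : s ^ 2 + c ^ 2 = 1 := Real.sin_sq_add_cos_sq _
  have he : Complex.exp (Complex.I * θ) = (c + s * Complex.I) ^ 2 := by
    rw [hs, hc, Complex.ofReal_cos, Complex.ofReal_sin, ← Complex.exp_mul_I, ← Complex.exp_nat_mul]
    congr 1; push_cast; ring
  have hsc' : (s : ℂ) ^ 2 + (c : ℂ) ^ 2 = 1 := by exact_mod_cast hsc
  have hw : w = -s * (c + s * Complex.I) := by
    rw [he] at h
    have h2 : 2 * Complex.I * w = 2 * Complex.I * (-s * (c + s * Complex.I)) := by
      linear_combination -h - hsc' + (s ^ 2 : ℂ) * Complex.I_sq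
    exact mul_left_cancel₀ (by simp) h2
  have hne : (c + s * Complex.I : ℂ) ≠ 0 := by
    intro h0
    have := Complex.exp_ne_zero (Complex.I * θ)
    rw [he, h0] at this
    simp at this
  rw [resolventFun, angularFun, ← hs, ← hc]
  by_cases h0 : s = 0
  · rw [if_pos h0, if_pos (by rw [hw, h0]; simp)]
  · have h0' : (s : ℂ) ≠ 0 := Complex.ofReal_ne_zero.2 h0
    rw [if_neg h0, if_neg (by rw [hw]; exact mul_ne_zero (neg_ne_zero.2 h0') hne)]
    congr 1
    have : w⁻¹ = ((-c / s : ℝ) : ℂ) + Complex.I := by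
      rw [hw]
      refine inv_eq_of_mul_eq_one_right ?_
      push_cast
      field_simp
      linear_combination hsc' + (- s ^ 2 : ℂ) * Complex.I_sq
    rw [this]; simp

/-- The coefficients of `φ(A)` as a series in the powers of the Cayley transform of `A`. -/
def cayCoeff (φ : ℝ → ℂ) : ℤ → ℂ := circleCoeff (angularFun φ)

theorem cayCoeff_summable (N : ℕ) {φ : ℝ → ℂ} (hφ : ContDiff ℝ ∞ φ) (hc : HasCompactSupport φ) :
    Summable fun k : ℤ => ‖cayCoeff φ k‖ * (1 + |(k : ℝ)|) ^ N :=
  circleCoeff_summable N (angularFun_contDiff hφ hc) (angularFun_periodic φ)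

theorem resolventFun_hasSum {φ : ℝ → ℂ} (hφ : ContDiff ℝ ∞ φ) (hc : HasCompactSupport φ) {w : ℂ}
    (hw : ‖1 - 2 * Complex.I * w‖ = 1) :
    HasSum (fun k : ℤ => cayCoeff φ k * cayPow (1 - 2 * Complex.I * w) k) (resolventFun φ w) := by
  have he : 1 - 2 * Complex.I * w = Complex.exp (Complex.I * (1 - 2 * Complex.I * w).arg) := by
    conv_lhs => rw [← Complex.norm_mul_exp_arg_mul_I (1 - 2 * Complex.I * w), hw]
    rw [Complex.ofReal_one, one_mul, mul_comm]
  rw [resolventFun_eq he]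
  have e : (fun k : ℤ => cayCoeff φ k * cayPow (1 - 2 * Complex.I * w) k) = fun k : ℤ =>
      circleCoeff (angularFun φ) k *
        Complex.exp (Complex.I * k * (1 - 2 * Complex.I * w).arg) := by
    ext k
    rw [← cayPow_exp, ← he, cayCoeff]
  rw [e]
  exact circleCoeff_hasSum (angularFun_contDiff hφ hc) (angularFun_periodic φ) _

section Calculus

variable {H : Type*} [NormedAddCommGroup H] [InnerProductSpace ℂ H] [CompleteSpace H]
  {A : H →ₗ.[ℂ] H} {R : H →L[ℂ] H}

theorem funCalc_eq (h : IsResolventPair A R) (φ : ℝ → ℂ) :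
    funCalc A φ = cfc (resolventFun φ) R := by
  rw [funCalc, resolventOp_eq h.neg]; rfl

theorem continuous_cayPow (k : ℤ) : Continuous fun u : ℂ => cayPow u k := by
  cases k <;> simp only [cayPow] <;> fun_prop

theorem cfc_cayPow (h : IsResolventPair A R) (k : ℤ) :
    cfc (fun w : ℂ => cayPow (1 - 2 * Complex.I * w) k) R = cayPow (cayley R) k := by
  have := h.isStarNormal
  have h1 : cfc (fun w : ℂ => 1 - 2 * Complex.I * w) R = cayley R := by
    rw [cfc_sub _ _ R, cfc_const_one ℂ R, cfc_const_mul_id (2 * Complex.I) R, cayley]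
  cases k with
  | ofNat k =>
    simp only [cayPow]
    rw [cfc_pow _ k R, h1]
  | negSucc k =>
    simp only [cayPow]
    rw [cfc_pow _ (k + 1) R, cfc_star, h1]

/-- The Fourier series converges uniformly on the spectrum of `R`, as the continuous functional
calculus requires. -/
theorem tendstoUniformlyOn_resolventFun (h : IsResolventPair A R) {φ : ℝ → ℂ}
    (hφ : ContDiff ℝ ∞ φ) (hc : HasCompactSupport φ) :
    TendstoUniformlyOn (fun (t : Finset ℤ) w => ∑ k ∈ t, cayCoeff φ k *
      cayPow (1 - 2 * Complex.I * w) k) (resolventFun φ) atTop (spectrum ℂ R) := by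
  have hs : Summable fun k : ℤ => ‖cayCoeff φ k‖ := by simpa using cayCoeff_summable 0 hφ hc
  refine (tendstoUniformlyOn_tsum hs (s := spectrum ℂ R)
    (f := fun k w => cayCoeff φ k * cayPow (1 - 2 * Complex.I * w) k) fun k w hw => ?_).congr_right
    fun w hw => ?_
  · rw [norm_mul, norm_cayPow (h.norm_of_mem_spectrum hw), mul_one]
  · exact (resolventFun_hasSum hφ hc (h.norm_of_mem_spectrum hw)).tsum_eq

theorem continuousOn_partialSum (t : Finset ℤ) (c : ℤ → ℂ) (s : Set ℂ) :
    ContinuousOn (fun w : ℂ => ∑ k ∈ t, c k * cayPow (1 - 2 * Complex.I * w) k) s := by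
  refine Continuous.continuousOn (continuous_finsetSum _ fun k _ => continuous_const.mul ?_)
  exact (continuous_cayPow k).comp (by fun_prop)

theorem continuousOn_resolventFun (h : IsResolventPair A R) {φ : ℝ → ℂ}
    (hφ : ContDiff ℝ ∞ φ) (hc : HasCompactSupport φ) :
    ContinuousOn (resolventFun φ) (spectrum ℂ R) :=
  (tendstoUniformlyOn_resolventFun h hφ hc).continuousOn
    (Frequently.of_forall fun t => continuousOn_partialSum t _ _)

/-- `φ(A) = ∑ c_k U^k` with the Cayley transform `U` of `A` and rapidly decreasing coefficients. -/
theorem funCalc_hasSum (h : IsResolventPair A R) {φ : ℝ → ℂ} (hφ : ContDiff ℝ ∞ φ)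
    (hc : HasCompactSupport φ) :
    HasSum (fun k : ℤ => cayCoeff φ k • cayPow (cayley R) k) (funCalc A φ) := by
  have := h.isStarNormal
  rw [funCalc_eq h]
  have ht := tendsto_cfc_fun (a := R) (tendstoUniformlyOn_resolventFun h hφ hc)
    (Eventually.of_forall fun t => continuousOn_partialSum t _ _)
  refine ht.congr fun t => ?_
  have e : (fun w : ℂ => ∑ k ∈ t, cayCoeff φ k * cayPow (1 - 2 * Complex.I * w) k)
      = ∑ k ∈ t, fun w : ℂ => cayCoeff φ k * cayPow (1 - 2 * Complex.I * w) k := by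
    ext w; rw [Finset.sum_apply]
  have hk : ∀ k : ℤ, Continuous fun w : ℂ => cayPow (1 - 2 * Complex.I * w) k := fun k =>
    (continuous_cayPow k).comp (by fun_prop)
  rw [e, cfc_sum (fun k w => cayCoeff φ k * cayPow (1 - 2 * Complex.I * w) k) R t
    fun k _ => (continuous_const.mul (hk k)).continuousOn]
  refine Finset.sum_congr rfl fun k _ => ?_
  rw [cfc_const_mul _ _ R (hk k).continuousOn, cfc_cayPow h]

/-- The function `(t + i)φ(t)`. -/
def addI (φ : ℝ → ℂ) (t : ℝ) : ℂ := (t + Complex.I) * φ t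

theorem addI_contDiff {φ : ℝ → ℂ} (hφ : ContDiff ℝ ∞ φ) : ContDiff ℝ ∞ (addI φ) :=
  (Complex.ofRealCLM.contDiff.add contDiff_const).mul hφ

theorem addI_hasCompactSupport {φ : ℝ → ℂ} (hc : HasCompactSupport φ) :
    HasCompactSupport (addI φ) := hc.mul_left

theorem resolventFun_addI (h : IsResolventPair A R) (φ : ℝ → ℂ) {w : ℂ}
    (hw : w ∈ spectrum ℂ R) : resolventFun φ w = w * resolventFun (addI φ) w := by
  rw [resolventFun, resolventFun]
  split_ifs with h0
  · simp
  have h1 := h.norm_of_mem_spectrum hw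
  have h2 : (w⁻¹).im = 1 := by
    have h3 : Complex.normSq (1 - 2 * Complex.I * w) = 1 := by
      rw [Complex.normSq_eq_norm_sq, h1]; norm_num
    have h4 : Complex.normSq w = -w.im := by
      rw [Complex.normSq_apply] at h3 ⊢
      simp at h3
      nlinarith
    rw [Complex.inv_im, h4, div_self]
    rw [← h4]
    exact fun h => h0 (Complex.normSq_eq_zero.1 h)
  have h3 : ((w⁻¹).re : ℂ) + Complex.I = w⁻¹ := by
    apply Complex.ext <;> simp [h2]
  rw [addI, h3, ← mul_assoc, mul_inv_cancel₀ h0, one_mul]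

/-- A function of `A` gains a resolvent: `φ(A) = (A + i)⁻¹ψ(A)` with `ψ(t) = (t + i)φ(t)`. -/
theorem funCalc_eq_mul (h : IsResolventPair A R) {φ : ℝ → ℂ} (hφ : ContDiff ℝ ∞ φ)
    (hc : HasCompactSupport φ) : funCalc A φ = R * funCalc A (addI φ) := by
  have := h.isStarNormal
  have hcont := continuousOn_resolventFun h (addI_contDiff hφ) (addI_hasCompactSupport hc)
  rw [funCalc_eq h, funCalc_eq h, cfc_congr fun w hw => resolventFun_addI h φ hw,
    cfc_mul (fun w => w) _ R continuousOn_id hcont, cfc_id' ℂ R]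

theorem funCalc_eq_mul' (h : IsResolventPair A R) {φ : ℝ → ℂ} (hφ : ContDiff ℝ ∞ φ)
    (hc : HasCompactSupport φ) : funCalc A φ = funCalc A (addI φ) * R := by
  have := h.isStarNormal
  have hcont := continuousOn_resolventFun h (addI_contDiff hφ) (addI_hasCompactSupport hc)
  rw [funCalc_eq h, funCalc_eq h, cfc_congr fun w hw =>
    (resolventFun_addI h φ hw).trans (mul_comm _ _),
    cfc_mul _ (fun w => w) R hcont continuousOn_id, cfc_id' ℂ R]

end Calculus

/-! ### Fourier multipliers and the free resolvent -/

/-- The Fourier multiplier with symbol `w`. -/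
def fmul (w : Eucl n → ℂ) : L2 n →L[ℂ] L2 n :=
  ((Lp.fourierTransformₗᵢ (Eucl n) ℂ).symm.toContinuousLinearEquiv : L2 n →L[ℂ] L2 n) ∘L mulOp w ∘L
    ((Lp.fourierTransformₗᵢ (Eucl n) ℂ).toContinuousLinearEquiv : L2 n →L[ℂ] L2 n)

theorem fmul_apply (w : Eucl n → ℂ) (f : L2 n) : fmul w f = 𝓕⁻ (mulOp w (𝓕 f)) := rfl

theorem fourier_fmul (w : Eucl n → ℂ) (f : L2 n) : 𝓕 (fmul w f) = mulOp w (𝓕 f) := by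
  rw [fmul_apply, fourier_fourierInv_eq]

theorem L2_fourier_injective {u v : L2 n} (h : 𝓕 u = 𝓕 v) : u = v := by
  exact (Lp.fourierTransformₗᵢ (Eucl n) ℂ).injective h

theorem fmul_eq_iff {w : Eucl n → ℂ} (hw : BddMeas w) {f g : L2 n} :
    fmul w f = g ↔ ∀ᵐ ξ, 𝓕 g ξ = w ξ * 𝓕 f ξ := by
  constructor
  · rintro rfl
    rw [fourier_fmul]
    exact coeFn_mulOp hw _
  · intro h
    apply L2_fourier_injective
    rw [fourier_fmul]
    refine Lp.ext ?_
    filter_upwards [h, coeFn_mulOp hw (𝓕 f)] with ξ h1 h2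
    rw [h1, h2]

theorem star_fmul {w : Eucl n → ℂ} (hw : BddMeas w) :
    star (fmul w) = fmul fun ξ => conj (w ξ) := by
  rw [ContinuousLinearMap.star_eq_adjoint, eq_comm, ContinuousLinearMap.eq_adjoint_iff]
  intro f g
  rw [← Lp.inner_fourier_eq, fourier_fmul, ← Lp.inner_fourier_eq f, fourier_fmul, inner_mulOp hw]

/-- The symbol `(4π²h²|ξ|² - z)⁻¹` of the free resolvent. -/
def resSym (h : ℝ) (z : ℂ) (ξ : Eucl n) : ℂ := ((symLap h ξ : ℂ) - z)⁻¹

theorem bddMeas_resSym (h : ℝ) {z : ℂ} (hz : IsFar z) : BddMeas (resSym h z : Eucl n → ℂ) := by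
  have hc := (hasTemperateGrowth_symLap (n := n) h).1.continuous
  refine BddMeas.of_continuous (C := 2) ((hc.sub continuous_const).inv₀
    (symLap_sub_ne_zero hz h)) fun ξ => ?_
  rw [resSym, norm_inv, inv_le_comm₀ (norm_pos_iff.2 (symLap_sub_ne_zero hz h ξ)) (by norm_num)]
  have := hz _ (symLap_nonneg h ξ)
  linarith [symLap_nonneg h ξ]

theorem freeGraph_inj {h : ℝ} : ∀ p ∈ freeGraph n h, p.1 = 0 → p.2 = 0 := by
  rintro ⟨u, g⟩ hp hu
  simp only at hu ⊢
  subst hu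
  rw [mem_freeGraph_iff] at hp
  apply L2_fourier_injective
  refine Lp.ext ?_
  have h0 : 𝓕 (0 : L2 n) = 0 := map_zero (Lp.fourierTransformₗᵢ (Eucl n) ℂ)
  rw [h0] at hp ⊢
  filter_upwards [hp, Lp.coeFn_zero ℂ 2 (volume : Measure (Eucl n))] with ξ h1 h2
  rw [h1, h2]; simp

theorem freeOp_graph (h : ℝ) : (freeOp n h).graph = freeGraph n h :=
  Submodule.toLinearPMap_graph_eq _ freeGraph_inj

theorem freeOp_of_mem {h : ℝ} {u g : L2 n} (hug : (u, g) ∈ freeGraph n h) :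
    ∃ hu : u ∈ (freeOp n h).domain, freeOp n h ⟨u, hu⟩ = g := by
  rw [← freeOp_graph, LinearPMap.mem_graph_iff] at hug
  obtain ⟨y, h1, h2⟩ := hug
  simp only at h1 h2
  subst h1
  exact ⟨y.2, h2⟩

/-- The resolvent of `-h²Δ` is a Fourier multiplier. -/
theorem isResolventAt_free (h : ℝ) {z : ℂ} (hz : IsFar z) :
    IsResolventAt (freeOp n h) z (fmul (resSym h z)) := by
  have hb := bddMeas_resSym (n := n) h hz
  constructor
  · intro f
    have hg : (fmul (resSym h z) f, f + z • fmul (resSym h z) f) ∈ freeGraph n h := by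
      rw [mem_freeGraph_iff, fourier_L2_add, fourier_L2_smul]
      filter_upwards [(fmul_eq_iff hb).1 (rfl : fmul (resSym h z) f = _),
        Lp.coeFn_add (𝓕 f) (z • 𝓕 (fmul (resSym h z) f)),
        Lp.coeFn_smul z (𝓕 (fmul (resSym h z) f))] with ξ h1 h2 h3
      rw [h2, Pi.add_apply, h3, Pi.smul_apply, h1, resSym, smul_eq_mul]
      have := symLap_sub_ne_zero hz h ξ
      field_simp
      ring
    obtain ⟨hu, e⟩ := freeOp_of_mem hg
    exact ⟨hu, by rw [e, add_sub_cancel_right]⟩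
  · intro u
    rw [fmul_eq_iff hb]
    have hg : ((u : L2 n), freeOp n h u) ∈ freeGraph n h := by
      rw [← freeOp_graph]; exact LinearPMap.mem_graph _ u
    rw [mem_freeGraph_iff] at hg
    rw [fourier_L2_sub, fourier_L2_smul]
    filter_upwards [hg, Lp.coeFn_sub (𝓕 (freeOp n h u)) (z • 𝓕 (u : L2 n)),
      Lp.coeFn_smul z (𝓕 (u : L2 n))] with ξ h1 h2 h3
    rw [h2, Pi.sub_apply, h3, Pi.smul_apply, h1, resSym, smul_eq_mul]
    have := symLap_sub_ne_zero hz h ξ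
    field_simp

theorem isResolventPair_free (h : ℝ) :
    IsResolventPair (freeOp n h) (fmul (resSym h (-Complex.I))) := by
  refine ⟨isResolventAt_free h isFar_neg_I, ?_⟩
  have h1 : (fun ξ : Eucl n => conj (resSym h (-Complex.I) ξ)) = resSym h Complex.I := by
    ext ξ; simp [resSym, sub_eq_add_neg]
  rw [star_fmul (bddMeas_resSym h isFar_neg_I), h1]
  exact isResolventAt_free h isFar_I

theorem testLp_mem_freeGraph (h : ℝ) (ψ : Test n) :
    (testLp ψ, testLp (testLap h ψ)) ∈ freeGraph n h := by
  rw [mem_freeGraph_iff]; exact fourier_testLap h ψ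

/-! ### Differential operators with bounded coefficients -/

/-- A semi-classical second order operator in divergence form whose coefficients, together with
the first derivatives of those of positive order, are bounded by `B`. -/
structure DiffOp (n : ℕ) where
  h : ℝ
  a : Fin n → Fin n → Eucl n → ℝ
  b : Fin n → Eucl n → ℝ
  V : Eucl n → ℝ
  B : ℝ
  h_pos : 0 < h
  h_le : h ≤ 1
  B_nonneg : 0 ≤ B
  a_C1 : ∀ i j, ContDiff ℝ 1 (a i j)
  b_C1 : ∀ j, ContDiff ℝ 1 (b j)
  V_meas : AEStronglyMeasurable V volume
  a_le : ∀ᵐ x, ∀ i j, |a i j x| ≤ B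
  da_le : ∀ᵐ x, ∀ k i j, |partialDeriv k (a i j) x| ≤ B
  b_le : ∀ᵐ x, ∀ j, |b j x| ≤ B
  db_le : ∀ᵐ x, ∀ k j, |partialDeriv k (b j) x| ≤ B
  V_le : ∀ᵐ x, |V x| ≤ B

namespace DiffOp

variable (L : DiffOp n)

theorem bddMeas_a (i j : Fin n) : BddMeas fun x => (L.a i j x : ℂ) := by
  refine ⟨(Complex.continuous_ofReal.comp (L.a_C1 i j).continuous).aestronglyMeasurable, L.B, ?_⟩
  filter_upwards [L.a_le] with x hx
  simpa using hx i j

theorem bddMeas_b (j : Fin n) : BddMeas fun x => (L.b j x : ℂ) := by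
  refine ⟨(Complex.continuous_ofReal.comp (L.b_C1 j).continuous).aestronglyMeasurable, L.B, ?_⟩
  filter_upwards [L.b_le] with x hx
  simpa using hx j

theorem bddMeas_V : BddMeas fun x => (L.V x : ℂ) := by
  refine ⟨Complex.continuous_ofReal.comp_aestronglyMeasurable L.V_meas, L.B, ?_⟩
  filter_upwards [L.V_le] with x hx
  simpa using hx

theorem contDiff_ofReal {f : Eucl n → ℝ} (hf : ContDiff ℝ 1 f) :
    ContDiff ℝ 1 fun x => (f x : ℂ) := Complex.ofRealCLM.contDiff.comp hf

theorem norm_semiD_le {h B : ℝ} (h0 : 0 < h) (h1 : h ≤ 1) {f : Eucl n → ℝ} {x : Eucl n} {j : Fin n}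
    (hf : ContDiff ℝ 1 f) (hx : |partialDeriv j f x| ≤ B) :
    ‖semiD h j (fun y => (f y : ℂ)) x‖ ≤ B := by
  rw [semiD_ofReal (hf.differentiable (by simp) x), norm_mul, norm_neg, norm_mul, Complex.norm_I,
    one_mul, Complex.norm_real, Complex.norm_real, Real.norm_eq_abs, Real.norm_eq_abs, abs_of_pos h0]
  exact (mul_le_of_le_one_left (abs_nonneg _) h1).trans hx

theorem bddMeas_da (i j : Fin n) : BddMeas (semiD L.h i fun x => (L.a i j x : ℂ)) := by
  refine ⟨(continuous_semiD (contDiff_ofReal (L.a_C1 i j))).aestronglyMeasurable, L.B, ?_⟩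
  filter_upwards [L.da_le] with x hx
  exact norm_semiD_le L.h_pos L.h_le (L.a_C1 i j) (hx i i j)

theorem bddMeas_db (j : Fin n) : BddMeas (semiD L.h j fun x => (L.b j x : ℂ)) := by
  refine ⟨(continuous_semiD (contDiff_ofReal (L.b_C1 j))).aestronglyMeasurable, L.B, ?_⟩
  filter_upwards [L.db_le] with x hx
  exact norm_semiD_le L.h_pos L.h_le (L.b_C1 j) (hx j j)

/-- The differential expression without derivatives of products. -/
theorem diffExpr_eq (ψ : Test n) (x : Eucl n) : diffExpr L.h L.a L.b L.V ψ x =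
    (∑ i, ∑ j, ((L.a i j x : ℂ) * semiD L.h i (semiD L.h j ψ) x
        + semiD L.h i (fun y => (L.a i j y : ℂ)) x * semiD L.h j ψ x))
      + (∑ j, (2 * (L.b j x : ℂ) * semiD L.h j ψ x
          + semiD L.h j (fun y => (L.b j y : ℂ)) x * (ψ : Eucl n → ℂ) x))
      + (L.V x : ℂ) * (ψ : Eucl n → ℂ) x := by
  have hd : ∀ {f : Eucl n → ℝ}, ContDiff ℝ 1 f → DifferentiableAt ℝ (fun y => (f y : ℂ)) x :=
    fun hf => (contDiff_ofReal hf).differentiable (by simp) x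
  rw [diffExpr]
  congr 2
  · refine Finset.sum_congr rfl fun i _ => Finset.sum_congr rfl fun j _ => ?_
    have := semiD_mul (h := L.h) (j := i) (hd (L.a_C1 i j)) ((testD L.h j ψ).differentiable x)
    simp only [coe_testD] at this
    rw [this]
    ring
  · refine Finset.sum_congr rfl fun j _ => ?_
    rw [semiD_mul (hd (L.b_C1 j)) (ψ.differentiable x)]
    ring

/-- The operator on test functions, with values in `L²`. -/
def op : Test n →ₗ[ℂ] L2 n :=
  (∑ i, ∑ j, ((mulOp fun x => (L.a i j x : ℂ)).toLinearMap ∘ₗ testLp ∘ₗ testD L.h i ∘ₗ testD L.h j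
      + (mulOp (semiD L.h i fun x => (L.a i j x : ℂ))).toLinearMap ∘ₗ testLp ∘ₗ testD L.h j))
    + (∑ j, ((2 : ℂ) • (mulOp fun x => (L.b j x : ℂ)).toLinearMap ∘ₗ testLp ∘ₗ testD L.h j
      + (mulOp (semiD L.h j fun x => (L.b j x : ℂ))).toLinearMap ∘ₗ testLp))
    + (mulOp fun x => (L.V x : ℂ)).toLinearMap ∘ₗ testLp

theorem op_apply (ψ : Test n) : L.op ψ =
    (∑ i, ∑ j, ((mulOp fun x => (L.a i j x : ℂ)) (testLp (testD L.h i (testD L.h j ψ)))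
      + mulOp (semiD L.h i fun x => (L.a i j x : ℂ)) (testLp (testD L.h j ψ))))
    + (∑ j, ((2 : ℂ) • (mulOp fun x => (L.b j x : ℂ)) (testLp (testD L.h j ψ))
      + mulOp (semiD L.h j fun x => (L.b j x : ℂ)) (testLp ψ)))
    + (mulOp fun x => (L.V x : ℂ)) (testLp ψ) := by
  simp [op]

theorem coeFn_sum {ι : Type*} {s : Finset ι} {f : ι → L2 n} {g : ι → Eucl n → ℂ}
    (h : ∀ i ∈ s, f i =ᵐ[volume] g i) :
    (∑ i ∈ s, f i : L2 n) =ᵐ[volume] fun x => ∑ i ∈ s, g i x := by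
  have h3 : ∀ᵐ x, ∀ i ∈ s, f i x = g i x := by
    rw [Filter.eventually_all_finset]; exact h
  filter_upwards [Lp.coeFn_finsetSum s f, h3] with x h1 h2
  rw [h1, Finset.sum_apply, Finset.sum_congr rfl h2]

theorem coeFn_add {f g : L2 n} {f' g' : Eucl n → ℂ} (hf : f =ᵐ[volume] f')
    (hg : g =ᵐ[volume] g') : (f + g : L2 n) =ᵐ[volume] fun x => f' x + g' x := by
  filter_upwards [Lp.coeFn_add f g, hf, hg] with x h1 h2 h3
  rw [h1, Pi.add_apply, h2, h3]

theorem coeFn_smul (c : ℂ) {f : L2 n} {f' : Eucl n → ℂ} (hf : f =ᵐ[volume] f') :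
    (c • f : L2 n) =ᵐ[volume] fun x => c * f' x := by
  filter_upwards [Lp.coeFn_smul c f, hf] with x h1 h2
  rw [h1, Pi.smul_apply, h2, smul_eq_mul]

theorem coeFn_mulOp_test {w : Eucl n → ℂ} (hw : BddMeas w) (ψ : Test n) :
    mulOp w (testLp ψ) =ᵐ[volume] fun x => w x * (ψ : Eucl n → ℂ) x := by
  filter_upwards [coeFn_mulOp hw (testLp ψ), coeFn_testLp ψ] with x h1 h2
  rw [h1, h2]

theorem coeFn_op (ψ : Test n) : L.op ψ =ᵐ[volume] diffExpr L.h L.a L.b L.V ψ := by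
  rw [op_apply]
  have := coeFn_add (coeFn_add (coeFn_sum (s := Finset.univ) fun i _ =>
      coeFn_sum (s := Finset.univ) fun j _ => coeFn_add
        (coeFn_mulOp_test (L.bddMeas_a i j) (testD L.h i (testD L.h j ψ)))
        (coeFn_mulOp_test (L.bddMeas_da i j) (testD L.h j ψ)))
      (coeFn_sum (s := Finset.univ) fun j _ => coeFn_add
        (coeFn_smul 2 (coeFn_mulOp_test (L.bddMeas_b j) (testD L.h j ψ)))
        (coeFn_mulOp_test (L.bddMeas_db j) ψ))) (coeFn_mulOp_test L.bddMeas_V ψ)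
  refine this.trans (Eventually.of_forall fun x => ?_)
  simp only
  rw [diffExpr_eq]
  simp only [coe_testD, mul_assoc]

/-- `(L - z)ψ` as an element of `L²`. -/
def shift (z : ℂ) : Test n →ₗ[ℂ] L2 n := L.op - z • testLp

theorem shift_apply (z : ℂ) (ψ : Test n) : L.shift z ψ = L.op ψ - z • testLp ψ := rfl

end DiffOp

/-- The derivatives `1`, `𝒟_j` and `𝒟_i𝒟_j` on test functions. -/
inductive Mono (n : ℕ)
  | one : Mono n
  | D (j : Fin n) : Mono n
  | DD (i j : Fin n) : Mono n

/-- The action of a monomial on test functions. -/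
def Mono.act (h : ℝ) : Mono n → Test n →ₗ[ℂ] Test n
  | .one => LinearMap.id
  | .D j => testD h j
  | .DD i j => testD h i ∘ₗ testD h j

/-- The set `(L - z)C_c^∞` is dense in `L²`, `R` is the inverse of `L - z` on it, and the
derivatives up to the second order of `ψ` are bounded by `(L - z)ψ`. -/
structure IsCore (L : DiffOp n) (z : ℂ) (R : L2 n →L[ℂ] L2 n) (C : ℝ) : Prop where
  C_nonneg : 0 ≤ C
  left_inv : ∀ ψ, R (L.shift z ψ) = testLp ψ
  dense : DenseRange (L.shift z)
  bound : ∀ (Q : Mono n) (ψ : Test n), ‖testLp (Q.act L.h ψ)‖ ≤ C * ‖L.shift z ψ‖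

/-! ### The free operator -/

theorem partialDeriv_const (k : Fin n) (c : ℝ) (x : Eucl n) :
    partialDeriv k (fun _ => c) x = 0 := by
  simp [partialDeriv]

theorem abs_aFlat_le (i j : Fin n) : |Coefficients.aFlat i j| ≤ 1 := by
  unfold Coefficients.aFlat; split_ifs <;> simp

/-- The operator `-h²Δ`. -/
def freeDiffOp (n : ℕ) (h : ℝ) (hh : h ∈ hRange) : DiffOp n where
  h := h
  a i j _ := Coefficients.aFlat i j
  b _ _ := 0
  V _ := 0
  B := 1
  h_pos := hh.1
  h_le := hh.2
  B_nonneg := zero_le_one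
  a_C1 _ _ := contDiff_const
  b_C1 _ := contDiff_const
  V_meas := aestronglyMeasurable_const
  a_le := Eventually.of_forall fun _ => abs_aFlat_le
  da_le := Eventually.of_forall fun x k i j => by rw [partialDeriv_const]; simp
  b_le := Eventually.of_forall fun _ _ => by simp
  db_le := Eventually.of_forall fun x k j => by rw [partialDeriv_const]; simp
  V_le := Eventually.of_forall fun _ => by simp

theorem semiD_const (h : ℝ) (j : Fin n) (c : ℂ) (x : Eucl n) : semiD h j (fun _ => c) x = 0 := by
  simp [semiD]

theorem freeDiffOp_op {h : ℝ} (hh : h ∈ hRange) (ψ : Test n) :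
    (freeDiffOp n h hh).op ψ = testLp (testLap h ψ) := by
  refine Lp.ext ?_
  filter_upwards [(freeDiffOp n h hh).coeFn_op ψ, coeFn_testLp (testLap h ψ)] with x h1 h2
  rw [h1, h2, DiffOp.diffExpr_eq]
  have hl : (testLap h ψ : Eucl n → ℂ) x = ∑ j, semiD h j (semiD h j ψ) x := by
    rw [testLap_apply, Submodule.coe_sum, Finset.sum_apply]; rfl
  rw [hl]
  simp only [freeDiffOp, semiD_const, Coefficients.aFlat, Complex.ofReal_zero, mul_zero, zero_mul,
    add_zero, Finset.sum_const_zero]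
  refine Finset.sum_congr rfl fun i _ => ?_
  rw [Finset.sum_eq_single i (fun j _ hj => by rw [if_neg hj.symm]; simp) (by simp)]
  simp

theorem DenseRange.of_exists_norm_lt {E F : Type*} [NormedAddCommGroup F] {f : E → F}
    (h : ∀ (g : F) (ε : ℝ), 0 < ε → ∃ x, ‖f x - g‖ < ε) : DenseRange f := by
  intro g
  rw [Metric.mem_closure_iff]
  intro ε hε
  obtain ⟨x, hx⟩ := h g ε hε
  exact ⟨f x, ⟨x, rfl⟩, by rw [dist_comm, dist_eq_norm]; exact hx⟩

theorem freeDiffOp_shift {h : ℝ} (hh : h ∈ hRange) (z : ℂ) (ψ : Test n) :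
    (freeDiffOp n h hh).shift z ψ = testLp (testLap h ψ) - z • testLp ψ := by
  rw [DiffOp.shift_apply, freeDiffOp_op]

/-- Test functions form a core for `-h²Δ`, with second derivatives controlled by the symbol. -/
theorem isCore_free {h : ℝ} (hh : h ∈ hRange) {z : ℂ} (hz : IsFar z) :
    IsCore (freeDiffOp n h hh) z (fmul (resSym h z)) 2 where
  C_nonneg := zero_le_two
  left_inv ψ := by
    obtain ⟨hu, e⟩ := freeOp_of_mem (testLp_mem_freeGraph h ψ)
    have := (isResolventAt_free h hz).2 ⟨_, hu⟩
    rwa [e, ← freeDiffOp_shift hh] at this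
  dense := DenseRange.of_exists_norm_lt fun g ε hε => by
    obtain ⟨ψ, hψ⟩ := dense_free hh.1 hz g hε
    exact ⟨ψ, by rwa [freeDiffOp_shift]⟩
  bound Q ψ := by
    rw [freeDiffOp_shift]
    cases Q with
    | one => exact norm_testLp_le_free hz h ψ
    | D j => exact norm_testD_le_free hz h j ψ
    | DD i j => exact norm_testD_testD_le_free hz h i j ψ

/-! ### The perturbed operator -/

/-- Test functions are in the domain of a self-adjoint realization, on which they act classically:
the weak formulation says that they are in the domain of the adjoint. It involves the transposed
principal coefficients, and so does `L`. -/
theorem testLp_mem_domain {A : L2 n →ₗ.[ℂ] L2 n} {c : Coefficients n} {L : DiffOp n}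
    (hA : IsSelfAdjointRealization c L.h A) (ha : L.a = fun i j => c.a L.h j i)
    (hb : L.b = c.b L.h) (hV : L.V = c.V L.h) (ψ : Test n) :
    ∃ hu : testLp ψ ∈ A.domain, A ⟨testLp ψ, hu⟩ = L.op ψ := by
  have key : ∀ u : A.domain, inner ℂ (L.op ψ) (u : L2 n) = inner ℂ (testLp ψ) (A u) := by
    intro u
    have h1 := hA.2 u ψ ψ.contDiff ψ.hasCompactSupport
    rw [L2.inner_def, L2.inner_def]
    refine Eq.trans (integral_congr_ae ?_) (h1.trans (integral_congr_ae ?_))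
    · filter_upwards [L.coeFn_op ψ] with x hx
      rw [RCLike.inner_apply, hx, ha, hb, hV, mul_comm]
    · filter_upwards [coeFn_testLp ψ] with x hx
      rw [RCLike.inner_apply, hx, mul_comm]
  have hu : testLp ψ ∈ A.domain := by
    have := LinearPMap.mem_adjoint_domain_of_exists (T := A) (testLp ψ) ⟨_, key⟩
    rwa [LinearPMap.isSelfAdjoint_def.1 hA.1] at this
  refine ⟨hu, ?_⟩
  refine hA.1.dense_domain.eq_of_inner_left (𝕜 := ℂ) fun v hv => ?_
  rw [key ⟨v, hv⟩]
  exact inner_selfAdjoint hA.1 ⟨_, hu⟩ ⟨v, hv⟩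

theorem dist_testD (h : ℝ) (j : Fin n) (ψ : Test n) :
    (testLp (testD h j ψ) : 𝓢'(Eucl n, ℂ)) =
      (-(Complex.I * h)) • ∂_{(stdVec j : Eucl n)} (testLp ψ : 𝓢'(Eucl n, ℂ)) := by
  rw [← toLp_testToSchwartz, ← toLp_testToSchwartz, ← schwartzD_testToSchwartz]
  have key : ∀ f : 𝓢(Eucl n, ℂ), ((f.toLp 2 volume : L2 n) : 𝓢'(Eucl n, ℂ)) =
      SchwartzMap.toTemperedDistributionCLM (Eucl n) ℂ volume f := fun f => by
    ext g
    simp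
  rw [key, key, TemperedDistribution.lineDerivOp_toTemperedDistributionCLM_eq, ← map_smul, schwartzD]

theorem dist_testD_testD (h : ℝ) (i j : Fin n) (ψ : Test n) :
    (testLp (testD h i (testD h j ψ)) : 𝓢'(Eucl n, ℂ)) =
      (-(Complex.I * h)) ^ 2 • ∂_{(stdVec i : Eucl n)} (∂_{(stdVec j : Eucl n)}
        (testLp ψ : 𝓢'(Eucl n, ℂ))) := by
  rw [dist_testD, dist_testD, LineDeriv.lineDerivOp_smul, smul_smul, sq]

theorem laplacian_eq (u : 𝓢'(Eucl n, ℂ)) :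
    Δ u = ∑ j, ∂_{(stdVec j : Eucl n)} (∂_{(stdVec j : Eucl n)} u) := by
  rw [TemperedDistribution.laplacian_eq_sum (EuclideanSpace.basisFun (Fin n) ℝ)]
  simp [EuclideanSpace.basisFun_apply, stdVec]

/-- If all second derivatives of `u` are square integrable then `u` is in the domain of `-h²Δ`. -/
theorem mem_freeGraph_of_second {h : ℝ} {u : L2 n} {g : Fin n → L2 n}
    (hg : ∀ j, (g j : 𝓢'(Eucl n, ℂ)) = (-(Complex.I * h)) ^ 2 •
      ∂_{(stdVec j : Eucl n)} (∂_{(stdVec j : Eucl n)} (u : 𝓢'(Eucl n, ℂ)))) :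
    (u, ∑ j, g j) ∈ freeGraph n h := by
  change ((∑ j, g j : L2 n) : 𝓢'(Eucl n, ℂ)) = (-(h : ℂ) ^ 2) • Δ (u : 𝓢'(Eucl n, ℂ))
  have h1 : ((∑ j, g j : L2 n) : 𝓢'(Eucl n, ℂ)) = ∑ j, (g j : 𝓢'(Eucl n, ℂ)) :=
    map_sum (Lp.toTemperedDistributionCLM ℂ volume 2) _ _
  have h2 : (-(Complex.I * h)) ^ 2 = -(h : ℂ) ^ 2 := by
    linear_combination (h : ℂ) ^ 2 * Complex.I_sq
  rw [h1, laplacian_eq, Finset.smul_sum]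
  exact Finset.sum_congr rfl fun j _ => by rw [hg, h2]

theorem cauchySeq_of_sub_le {ψ : ℕ → Test n} {T : Test n →ₗ[ℂ] Test n} {h : ℝ} {u g : L2 n}
    (hT : ∀ ψ : Test n, ‖testLp (T ψ)‖ ≤ 2 * ‖testLp (testLap h ψ) - (-1 : ℂ) • testLp ψ‖)
    (h1 : Tendsto (fun k => testLp (ψ k)) atTop (𝓝 u))
    (h2 : Tendsto (fun k => testLp (testLap h (ψ k))) atTop (𝓝 g)) :
    ∃ v, Tendsto (fun k => testLp (T (ψ k))) atTop (𝓝 v) := by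
  refine cauchySeq_tendsto_of_complete ?_
  have hc := (h2.sub (h1.const_smul (-1 : ℂ))).cauchySeq
  rw [Metric.cauchySeq_iff] at hc ⊢
  intro ε hε
  obtain ⟨N, hN⟩ := hc (ε / 2) (by positivity)
  refine ⟨N, fun k hk l hl => ?_⟩
  have e1 := hN k hk l hl
  rw [dist_eq_norm] at e1 ⊢
  have e2 := hT (ψ k - ψ l)
  simp only [map_sub] at e2
  refine e2.trans_lt ?_
  have e3 : testLp (testLap h (ψ k)) - testLp (testLap h (ψ l))
      - (-1 : ℂ) • (testLp (ψ k) - testLp (ψ l))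
      = testLp (testLap h (ψ k)) - (-1 : ℂ) • testLp (ψ k)
        - (testLp (testLap h (ψ l)) - (-1 : ℂ) • testLp (ψ l)) := by
    rw [smul_sub]; abel
  rw [e3]
  linarith

/-- An operator with bounded coefficients converges along sequences converging in the graph norm of
the Laplacian. -/
theorem DiffOp.exists_tendsto_op (L : DiffOp n) {ψ : ℕ → Test n} {u g : L2 n}
    (h1 : Tendsto (fun k => testLp (ψ k)) atTop (𝓝 u))
    (h2 : Tendsto (fun k => testLp (testLap L.h (ψ k))) atTop (𝓝 g)) :
    ∃ v, Tendsto (fun k => L.op (ψ k)) atTop (𝓝 v) := by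
  choose v1 hv1 using fun j => cauchySeq_of_sub_le
    (fun ψ => norm_testD_le_free isFar_neg_one L.h j ψ) h1 h2
  choose v2 hv2 using fun i j => cauchySeq_of_sub_le (T := testD L.h i ∘ₗ testD L.h j)
    (fun ψ => norm_testD_testD_le_free isFar_neg_one L.h i j ψ) h1 h2
  simp only [L.op_apply]
  exact ⟨_, ((tendsto_finsetSum _ fun i _ => tendsto_finsetSum _ fun j _ =>
    (((mulOp _).continuous.tendsto _).comp (hv2 i j)).add
      (((mulOp _).continuous.tendsto _).comp (hv1 j))).add
    (tendsto_finsetSum _ fun j _ => ((((mulOp _).continuous.tendsto _).comp (hv1 j)).const_smul 2).add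
      (((mulOp _).continuous.tendsto _).comp h1))).add (((mulOp _).continuous.tendsto _).comp h1)⟩

/-- Ellipticity makes the test functions a core for the perturbed operator. The resolvent maps into
the domain of the Laplacian, where test functions are dense in the graph norm, and `L` is continuous
in that norm because its coefficients are bounded. -/
theorem isCore_perturbed {A : L2 n →ₗ.[ℂ] L2 n} {c : Coefficients n} {L : DiffOp n}
    (hA : IsSelfAdjointRealization c L.h A) (ha : L.a = fun i j => c.a L.h j i)
    (hb : L.b = c.b L.h) (hV : L.V = c.V L.h) {z : ℂ} (hz : z.re = 0) (hz1 : ‖z‖ = 1) {C : ℝ}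
    (hC : 0 ≤ C)
    (hell : ∀ k : ℕ, k ≤ 2 → ∀ m : Fin k → Fin n, ∀ f : L2 n, ∃ g : L2 n,
      (g : 𝓢'(Eucl n, ℂ)) = (-(Complex.I * L.h)) ^ k •
        ∂^{fun i => stdVec (m i)} (resolventOp A z f : 𝓢'(Eucl n, ℂ)) ∧ ‖g‖ ≤ C * ‖f‖) :
    IsCore L z (resolventOp A z) C := by
  have hres := isResolventAt_resolventOp hA.1 hz hz1
  have hinv : ∀ ψ, resolventOp A z (L.shift z ψ) = testLp ψ := fun ψ => by
    obtain ⟨hu, e⟩ := testLp_mem_domain hA ha hb hV ψ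
    have := hres.2 ⟨_, hu⟩
    rwa [e] at this
  refine ⟨hC, hinv, ?_, ?_⟩
  · refine DenseRange.of_exists_norm_lt fun f ε hε => ?_
    choose g hg _ using fun j : Fin n => hell 2 le_rfl (fun _ => j) f
    set u := resolventOp A z f
    have hmem : (u, ∑ j, g j) ∈ freeGraph n L.h := mem_freeGraph_of_second fun j => hg j
    obtain ⟨ψ, h1, h2⟩ := exists_test_of_mem_freeGraph L.h_pos hmem
    obtain ⟨v, hv⟩ := L.exists_tendsto_op h1 h2
    -- The graph of `A` is closed, which identifies the limit `v` of `Lψ_k` with `Au`.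
    have hgr : (u, v) ∈ A.graph := by
      have hcl : IsClosed (A.graph : Set (L2 n × L2 n)) := hA.1.isClosed
      refine hcl.mem_of_tendsto (h1.prodMk_nhds hv) (Eventually.of_forall fun k => ?_)
      obtain ⟨hu, e⟩ := testLp_mem_domain hA ha hb hV (ψ k)
      rw [← e]
      exact A.mem_graph ⟨_, hu⟩
    obtain ⟨hf, e⟩ := hres.1 f
    have hgr' : (u, A ⟨u, hf⟩) ∈ A.graph := A.mem_graph ⟨u, hf⟩
    have hv' : v = A ⟨u, hf⟩ := A.mem_graph_snd_inj hgr hgr' rfl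
    have ht : Tendsto (fun k => L.shift z (ψ k)) atTop (𝓝 f) := by
      rw [← e, ← hv']
      exact hv.sub (h1.const_smul z)
    obtain ⟨k, hk⟩ := (Metric.tendsto_nhds.1 ht ε hε).exists
    exact ⟨ψ k, by rwa [dist_eq_norm] at hk⟩
  · intro Q ψ
    cases Q with
    | one =>
      obtain ⟨g, hg, hgn⟩ := hell 0 (by norm_num) Fin.elim0 (L.shift z ψ)
      rw [hinv, pow_zero, one_smul, LineDeriv.iteratedLineDerivOp_fin_zero] at hg
      have e : testLp ψ = g := (L2_dist_injective hg).symm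
      simpa [Mono.act, e] using hgn
    | D j =>
      obtain ⟨g, hg, hgn⟩ := hell 1 (by norm_num) (fun _ => j) (L.shift z ψ)
      rw [hinv, pow_one, LineDeriv.iteratedLineDerivOp_one, ← dist_testD] at hg
      have e : testLp (testD L.h j ψ) = g := (L2_dist_injective hg).symm
      simpa [Mono.act, e] using hgn
    | DD i j =>
      obtain ⟨g, hg, hgn⟩ := hell 2 le_rfl ![i, j] (L.shift z ψ)
      rw [hinv, LineDeriv.iteratedLineDerivOp_succ_left, LineDeriv.iteratedLineDerivOp_one] at hg
      have e : testLp (testD L.h i (testD L.h j ψ)) = g := by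
        refine (L2_dist_injective (hg.trans ?_)).symm
        rw [dist_testD_testD]
        rfl
      simpa [Mono.act, e] using hgn

/-! ### Regularized weights -/

/-- The square of the regularized weight, `p / (1 + εp)` with `p = 1 + |x|²`. -/
def wtSq (ε : ℝ) (x : Eucl n) : ℝ := (1 + ‖x‖ ^ 2) / (1 + ε * (1 + ‖x‖ ^ 2))

/-- The `s`-th power of the regularized weight. It is bounded and tends to `⟨x⟩^s` as `ε → 0`. -/
def wt (ε s : ℝ) (x : Eucl n) : ℝ := wtSq ε x ^ (s / 2)

section Weights

variable {ε : ℝ} (h0 : 0 < ε) (h1 : ε ≤ 1)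

include h0

theorem one_add_eps_pos (x : Eucl n) : 0 < 1 + ε * (1 + ‖x‖ ^ 2) := by positivity

theorem wtSq_pos (x : Eucl n) : 0 < wtSq ε x := by
  unfold wtSq; positivity

theorem wt_pos (s : ℝ) (x : Eucl n) : 0 < wt ε s x := Real.rpow_pos_of_pos (wtSq_pos h0 x) _

theorem wtSq_le_inv (x : Eucl n) : wtSq ε x ≤ ε⁻¹ := by
  rw [wtSq, div_le_iff₀ (by positivity)]
  have : ε⁻¹ * (1 + ε * (1 + ‖x‖ ^ 2)) = ε⁻¹ + (1 + ‖x‖ ^ 2) := by field_simp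
  rw [this]
  have : 0 < ε⁻¹ := by positivity
  linarith

theorem wtSq_le (x : Eucl n) : wtSq ε x ≤ 1 + ‖x‖ ^ 2 := by
  rw [wtSq, div_le_iff₀ (by positivity)]
  nlinarith [mul_pos h0 (by positivity : (0 : ℝ) < 1 + ‖x‖ ^ 2), sq_nonneg ‖x‖]

include h1 in
theorem half_le_wtSq (x : Eucl n) : 1 / 2 ≤ wtSq ε x := by
  rw [wtSq, div_le_div_iff₀ (by norm_num) (by positivity)]
  nlinarith [sq_nonneg ‖x‖]

theorem wt_add (s t : ℝ) (x : Eucl n) : wt ε (s + t) x = wt ε s x * wt ε t x := by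
  rw [wt, wt, wt, add_div, Real.rpow_add (wtSq_pos h0 x)]

theorem contDiff_wt (s : ℝ) : ContDiff ℝ ∞ (wt ε s : Eucl n → ℝ) := by
  unfold wt wtSq
  refine ContDiff.rpow_const_of_ne (ContDiff.div ?_ ?_ fun x => ?_) fun x => ?_
  · exact contDiff_const.add (contDiff_norm_sq ℝ)
  · exact contDiff_const.add (contDiff_const.mul (contDiff_const.add (contDiff_norm_sq ℝ)))
  · exact (one_add_eps_pos h0 x).ne'
  · exact (wtSq_pos h0 x).ne'

include h1 in
/-- Powers between `-1` and `0` of the weight are bounded. -/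
theorem wt_le_two {s : ℝ} (hs : -1 ≤ s) (hs0 : s ≤ 0) (x : Eucl n) : wt ε s x ≤ 2 := by
  have hy := half_le_wtSq h0 h1 x
  have e1 : wt ε s x ≤ (1 / 2 : ℝ) ^ (s / 2) :=
    Real.rpow_le_rpow_of_nonpos (by norm_num) hy (by linarith)
  refine e1.trans ?_
  have e2 : (1 / 2 : ℝ) ^ (s / 2) ≤ (1 / 2 : ℝ) ^ (-1 : ℝ) :=
    Real.rpow_le_rpow_of_exponent_ge (by norm_num) (by norm_num) (by linarith)
  refine e2.trans ?_
  rw [Real.rpow_neg_one]; norm_num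

include h1 in
theorem wt_bounded (s : ℝ) : ∃ K, ∀ x : Eucl n, wt ε s x ≤ K := by
  by_cases hs : 0 ≤ s
  · exact ⟨ε⁻¹ ^ (s / 2), fun x => Real.rpow_le_rpow (wtSq_pos h0 x).le (wtSq_le_inv h0 x)
      (by linarith)⟩
  · exact ⟨(1 / 2 : ℝ) ^ (s / 2), fun x => Real.rpow_le_rpow_of_nonpos (by norm_num)
      (half_le_wtSq h0 h1 x) (by linarith)⟩

include h1 in
theorem bddMeas_wt (s : ℝ) : BddMeas fun x : Eucl n => (wt ε s x : ℂ) := by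
  obtain ⟨K, hK⟩ := wt_bounded (n := n) h0 h1 s
  refine BddMeas.of_continuous (C := K)
    (Complex.continuous_ofReal.comp (contDiff_wt h0 s).continuous) fun x => ?_
  rw [Complex.norm_real, Real.norm_eq_abs, abs_of_pos (wt_pos h0 s x)]
  exact hK x

omit h0 in
theorem hasFDerivAt_weightBase (x : Eucl n) :
    HasFDerivAt (fun x : Eucl n => 1 + ‖x‖ ^ 2) (2 • innerSL ℝ x) x :=
  (hasStrictFDerivAt_norm_sq x).hasFDerivAt.const_add 1

omit h0 in
theorem abs_coord_le (x : Eucl n) (j : Fin n) : |x j| ≤ ‖x‖ := by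
  simpa using PiLp.norm_apply_le x j

/-- The factor `(1 + εp)^{-m}`. -/
def damp (ε : ℝ) (m : ℕ) (x : Eucl n) : ℝ := ((1 + ε * (1 + ‖x‖ ^ 2)) ^ m)⁻¹

theorem hasFDerivAt_damp (m : ℕ) (x : Eucl n) :
    HasFDerivAt (damp ε m : Eucl n → ℝ)
      ((-(m : ℝ) * ε * damp ε (m + 1) x) • ((2 : ℕ) • innerSL ℝ x)) x := by
  have hp := one_add_eps_pos h0 x
  have hg : HasDerivAt (fun t : ℝ => ((1 + ε * t) ^ m)⁻¹)
      (-(m : ℝ) * ε * damp ε (m + 1) x) (1 + ‖x‖ ^ 2) := by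
    have e1 : HasDerivAt (fun t : ℝ => (1 + ε * t) ^ m)
        (m * (1 + ε * (1 + ‖x‖ ^ 2)) ^ (m - 1) * ε) (1 + ‖x‖ ^ 2) := by
      have := (((hasDerivAt_id (1 + ‖x‖ ^ 2)).const_mul ε).const_add 1).fun_pow m
      simpa using this
    have e2 := e1.fun_inv (pow_ne_zero m hp.ne')
    refine e2.congr_deriv ?_
    rw [damp]
    cases m with
    | zero => simp
    | succ m =>
      rw [Nat.add_sub_cancel]
      field_simp
      ring
  exact HasDerivAt.comp_hasFDerivAt (f := fun x : Eucl n => 1 + ‖x‖ ^ 2) x hg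
    (hasFDerivAt_weightBase x)

theorem hasFDerivAt_wtSq (x : Eucl n) :
    HasFDerivAt (wtSq ε : Eucl n → ℝ) (damp ε 2 x • ((2 : ℕ) • innerSL ℝ x)) x := by
  have hp := one_add_eps_pos h0 x
  have hg : HasDerivAt (fun t : ℝ => t / (1 + ε * t)) (damp ε 2 x) (1 + ‖x‖ ^ 2) := by
    have e1 := (hasDerivAt_id (1 + ‖x‖ ^ 2)).fun_div
      (((hasDerivAt_id (1 + ‖x‖ ^ 2)).const_mul ε).const_add 1) hp.ne'
    refine e1.congr_deriv ?_
    rw [damp]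
    simp only [id_eq]
    field_simp
    ring
  exact HasDerivAt.comp_hasFDerivAt (f := fun x : Eucl n => 1 + ‖x‖ ^ 2) x hg
    (hasFDerivAt_weightBase x)

theorem hasFDerivAt_wtSq_rpow (r : ℝ) (x : Eucl n) :
    HasFDerivAt (fun x : Eucl n => wtSq ε x ^ r)
      ((r * wtSq ε x ^ (r - 1)) • (damp ε 2 x • ((2 : ℕ) • innerSL ℝ x))) x :=
  (hasFDerivAt_wtSq h0 x).rpow_const (Or.inl (wtSq_pos h0 x).ne')

omit h0 in
theorem inner_stdVec' (x : Eucl n) (j : Fin n) : innerSL ℝ x (stdVec j) = x j := by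
  rw [innerSL_apply_apply, inner_stdVec]

theorem partialDeriv_wtSq_rpow (r : ℝ) (j : Fin n) :
    partialDeriv j (fun x : Eucl n => wtSq ε x ^ r) =
      fun x => r * wtSq ε x ^ (r - 1) * damp ε 2 x * (2 * x j) := by
  ext x
  rw [partialDeriv, (hasFDerivAt_wtSq_rpow h0 r x).fderiv]
  simp only [_root_.smul_apply, inner_stdVec', smul_eq_mul, nsmul_eq_mul, Nat.cast_ofNat]
  ring

theorem partialDeriv_partialDeriv_wtSq_rpow (r : ℝ) (i j : Fin n) (x : Eucl n) :
    partialDeriv i (partialDeriv j (fun x : Eucl n => wtSq ε x ^ r)) x =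
      r * ((r - 1) * wtSq ε x ^ (r - 2) * (damp ε 2 x * (2 * x i)) * (damp ε 2 x * (2 * x j))
        + wtSq ε x ^ (r - 1) * (-2 * ε * damp ε 3 x * (2 * x i)) * (2 * x j)
        + wtSq ε x ^ (r - 1) * damp ε 2 x * (2 * (stdVec i : Eucl n) j)) := by
  rw [partialDeriv_wtSq_rpow h0]
  have e1 := hasFDerivAt_wtSq_rpow h0 (r - 1) x
  have e2 := hasFDerivAt_damp h0 2 x
  have e3 : HasFDerivAt (fun x : Eucl n => 2 * x j)
      ((2 : ℝ) • (EuclideanSpace.proj j : Eucl n →L[ℝ] ℝ)) x :=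
    ((EuclideanSpace.proj j : Eucl n →L[ℝ] ℝ).hasFDerivAt).const_mul 2
  have e4 := ((e1.const_mul r).mul e2).mul e3
  have e5 : (fun x : Eucl n => r * wtSq ε x ^ (r - 1) * damp ε 2 x * (2 * x j)) =
    ((fun y => r * wtSq ε y ^ (r - 1)) * damp ε 2 * fun x : Eucl n => 2 * x j) := rfl
  rw [partialDeriv, e5, e4.fderiv]
  have e6 : r - 1 - 1 = r - 2 := by ring
  have e7 : (EuclideanSpace.proj j : Eucl n →L[ℝ] ℝ) (stdVec i) = (stdVec i : Eucl n) j := rfl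
  simp only [_root_.smul_apply, _root_.add_apply, inner_stdVec', smul_eq_mul, nsmul_eq_mul,
    Nat.cast_ofNat, e6, e7, Pi.mul_apply]
  ring

theorem damp_mul_le (m : ℕ) (x : Eucl n) : 0 < damp ε m x ∧ damp ε m x ≤ 1 := by
  have h2 : 1 ≤ 1 + ε * (1 + ‖x‖ ^ 2) := by
    have : 0 ≤ ε * (1 + ‖x‖ ^ 2) := by positivity
    linarith
  have hp := one_add_eps_pos h0 x
  exact ⟨by unfold damp; positivity, inv_le_one_of_one_le₀ (one_le_pow₀ h2)⟩

theorem damp_mul_coord_le (x : Eucl n) (j : Fin n) :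
    |damp ε 2 x * (2 * x j)| ≤ 2 * wtSq ε x ^ (1 / 2 : ℝ) := by
  have hp := one_add_eps_pos h0 x
  have h2 : 1 ≤ 1 + ε * (1 + ‖x‖ ^ 2) := by
    have : 0 ≤ ε * (1 + ‖x‖ ^ 2) := by positivity
    linarith
  obtain ⟨hd0, hd1⟩ := damp_mul_le h0 2 x
  rw [abs_mul, abs_mul, abs_two, abs_of_pos hd0, ← Real.sqrt_eq_rpow]
  have key : damp ε 2 x * |x j| ≤ √(wtSq ε x) := by
    refine Real.le_sqrt_of_sq_le ?_
    rw [mul_pow, sq_abs]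
    have e1 : x j ^ 2 ≤ 1 + ‖x‖ ^ 2 := by
      have := abs_coord_le x j
      have := sq_le_sq' (by linarith [abs_nonneg (x j), norm_nonneg x]) this
      rw [sq_abs] at this; linarith
    have e2 : damp ε 2 x ^ 2 ≤ (1 + ε * (1 + ‖x‖ ^ 2))⁻¹ := by
      rw [damp, ← inv_pow, ← pow_mul]
      exact pow_le_of_le_one (by positivity) (inv_le_one_of_one_le₀ h2) (by norm_num)
    calc damp ε 2 x ^ 2 * x j ^ 2 ≤ (1 + ε * (1 + ‖x‖ ^ 2))⁻¹ * (1 + ‖x‖ ^ 2) := by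
          gcongr
      _ = wtSq ε x := by rw [wtSq, inv_mul_eq_div]
  linarith

/-- The constant in the derivative bounds of the weights. -/
def wtConst (s : ℝ) : ℝ := |s| * (2 * |s| + 14)

omit h0 in
theorem wtConst_nonneg (s : ℝ) : 0 ≤ wtConst s := by unfold wtConst; positivity

theorem abs_partialDeriv_wt_le (s : ℝ) (j : Fin n) (x : Eucl n) :
    |partialDeriv j (wt ε s) x| ≤ wtConst s * wt ε (s - 1) x := by
  have e : (wt ε s : Eucl n → ℝ) = fun x => wtSq ε x ^ (s / 2) := rfl
  rw [e, partialDeriv_wtSq_rpow h0]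
  simp only
  rw [mul_assoc, abs_mul, abs_mul,
    abs_of_pos (Real.rpow_pos_of_pos (wtSq_pos h0 x) _)]
  have h2 := damp_mul_coord_le h0 x j
  have h3 : wtSq ε x ^ (s / 2 - 1) * wtSq ε x ^ (1 / 2 : ℝ) = wt ε (s - 1) x := by
    rw [wt, ← Real.rpow_add (wtSq_pos h0 x)]; congr 1; ring
  have h4 : |s / 2| = |s| / 2 := by rw [abs_div, abs_two]
  have h5 := wt_pos h0 (s - 1) x
  have h6 := Real.rpow_pos_of_pos (wtSq_pos h0 x) (s / 2 - 1)
  calc |s / 2| * wtSq ε x ^ (s / 2 - 1) * |damp ε 2 x * (2 * x j)|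
      ≤ |s / 2| * wtSq ε x ^ (s / 2 - 1) * (2 * wtSq ε x ^ (1 / 2 : ℝ)) := by gcongr
    _ = |s| * wt ε (s - 1) x := by rw [← h3, h4]; ring
    _ ≤ wtConst s * wt ε (s - 1) x := by
        unfold wtConst
        gcongr
        nlinarith [abs_nonneg s]

include h1 in
theorem abs_partialDeriv_partialDeriv_wt_le (s : ℝ) (i j : Fin n) (x : Eucl n) :
    |partialDeriv i (partialDeriv j (wt ε s)) x| ≤ wtConst s * wt ε (s - 1) x := by
  have e : (wt ε s : Eucl n → ℝ) = fun x => wtSq ε x ^ (s / 2) := rfl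
  rw [e, partialDeriv_partialDeriv_wtSq_rpow h0]
  set r := s / 2 with hr
  have hy := wtSq_pos h0 x
  set y := wtSq ε x
  have hA := damp_mul_coord_le h0 x i
  have hB := damp_mul_coord_le h0 x j
  have hd2 := damp_mul_le h0 2 x
  have hd3 := damp_mul_le h0 3 x
  have hz := Real.rpow_pos_of_pos hy (r - 1)
  have hz2 := Real.rpow_pos_of_pos hy (r - 2)
  have hhalf : y ^ (1 / 2 : ℝ) * y ^ (1 / 2 : ℝ) = y := by
    rw [← Real.rpow_add hy]; norm_num
  have hr2 : y ^ (r - 2) * y = y ^ (r - 1) := by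
    conv_lhs => rw [← Real.rpow_one y]
    rw [Real.rpow_one, ← Real.rpow_add_one hy.ne']; congr 1; ring
  have t1 : |(r - 1) * y ^ (r - 2) * (damp ε 2 x * (2 * x i)) * (damp ε 2 x * (2 * x j))|
      ≤ 4 * |r - 1| * y ^ (r - 1) := by
    rw [abs_mul, abs_mul, abs_mul, abs_of_pos hz2]
    calc |r - 1| * y ^ (r - 2) * |damp ε 2 x * (2 * x i)| * |damp ε 2 x * (2 * x j)|
        ≤ |r - 1| * y ^ (r - 2) * (2 * y ^ (1 / 2 : ℝ)) * (2 * y ^ (1 / 2 : ℝ)) := by gcongr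
      _ = 4 * |r - 1| * (y ^ (r - 2) * (y ^ (1 / 2 : ℝ) * y ^ (1 / 2 : ℝ))) := by ring
      _ = _ := by rw [hhalf, hr2]
  have t2 : |y ^ (r - 1) * (-2 * ε * damp ε 3 x * (2 * x i)) * (2 * x j)| ≤ 8 * y ^ (r - 1) := by
    have e1 : |x i| * |x j| ≤ ‖x‖ ^ 2 := by
      rw [sq]; exact mul_le_mul (abs_coord_le x i) (abs_coord_le x j) (abs_nonneg _) (norm_nonneg _)
    have e2 : ε * damp ε 3 x * ‖x‖ ^ 2 ≤ 1 := by
      have hp := one_add_eps_pos h0 x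
      have e3 : damp ε 3 x ≤ (1 + ε * (1 + ‖x‖ ^ 2))⁻¹ := by
        rw [damp, ← inv_pow]
        refine pow_le_of_le_one (by positivity) (inv_le_one_of_one_le₀ ?_) (by norm_num)
        have : 0 ≤ ε * (1 + ‖x‖ ^ 2) := by positivity
        linarith
      calc ε * damp ε 3 x * ‖x‖ ^ 2 ≤ ε * (1 + ε * (1 + ‖x‖ ^ 2))⁻¹ * ‖x‖ ^ 2 := by gcongr
        _ = (ε * ‖x‖ ^ 2) * (1 + ε * (1 + ‖x‖ ^ 2))⁻¹ := by ring
        _ ≤ 1 := by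
          rw [mul_inv_le_iff₀ hp]; nlinarith
    have e4 : |y ^ (r - 1) * (-2 * ε * damp ε 3 x * (2 * x i)) * (2 * x j)|
        = 8 * y ^ (r - 1) * (ε * damp ε 3 x * (|x i| * |x j|)) := by
      simp only [abs_mul, abs_neg, abs_two, abs_of_pos hz, abs_of_pos h0, abs_of_pos hd3.1]; ring
    rw [e4]
    have e5 : ε * damp ε 3 x * (|x i| * |x j|) ≤ ε * damp ε 3 x * ‖x‖ ^ 2 :=
      mul_le_mul_of_nonneg_left e1 (mul_nonneg h0.le hd3.1.le)
    nlinarith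
  have t3 : |y ^ (r - 1) * damp ε 2 x * (2 * (stdVec i : Eucl n) j)| ≤ 2 * y ^ (r - 1) := by
    have e1 : |(stdVec i : Eucl n) j| ≤ 1 := by
      rw [stdVec, PiLp.single_apply]; split_ifs <;> simp
    rw [abs_mul, abs_mul, abs_mul, abs_two, abs_of_pos hz, abs_of_pos hd2.1]
    calc y ^ (r - 1) * damp ε 2 x * (2 * |(stdVec i : Eucl n) j|)
        ≤ y ^ (r - 1) * 1 * (2 * 1) := by gcongr; exact hd2.2
      _ = _ := by ring
  have hz' : y ^ (r - 1) ≤ 2 * wt ε (s - 1) x := by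
    have e1 : y ^ (r - 1) = wt ε (-1) x * wt ε (s - 1) x := by
      rw [← wt_add h0, wt]; congr 1; rw [hr]; ring
    rw [e1]
    have := wt_le_two h0 h1 (s := -1) le_rfl (by norm_num) x
    have h5 := wt_pos h0 (s - 1) x
    gcongr
  have hrs : |r| = |s| / 2 := by rw [hr, abs_div, abs_two]
  have hrs1 : |r - 1| ≤ |s| / 2 + 1 := by
    rw [← hrs]
    calc |r - 1| ≤ |r| + |1| := abs_sub _ _
      _ = _ := by simp
  have h5 := wt_pos h0 (s - 1) x
  rw [abs_mul]
  calc |r| * |_ + _ + _| ≤ |r| * (4 * |r - 1| * y ^ (r - 1) + 8 * y ^ (r - 1) + 2 * y ^ (r - 1)) := by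
        gcongr
        refine (abs_add_le _ _).trans (add_le_add ((abs_add_le _ _).trans (add_le_add t1 t2)) t3)
    _ = |r| * (4 * |r - 1| + 10) * y ^ (r - 1) := by ring
    _ ≤ |r| * (4 * (|s| / 2 + 1) + 10) * (2 * wt ε (s - 1) x) := by gcongr
    _ = wtConst s * wt ε (s - 1) x := by rw [hrs, wtConst]; ring

theorem semiD_wt (h : ℝ) (s : ℝ) (j : Fin n) :
    semiD h j (fun x : Eucl n => (wt ε s x : ℂ)) =
      fun x => -(Complex.I * h) * (partialDeriv j (wt ε s) x : ℝ) := by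
  ext x
  exact semiD_ofReal ((contDiff_wt h0 s).differentiable (by simp) x)

theorem differentiable_partialDeriv_wt (s : ℝ) (j : Fin n) :
    Differentiable ℝ (partialDeriv j (wt ε s : Eucl n → ℝ)) := by
  have h2 := (contDiff_wt (n := n) h0 s).fderiv_right (m := ∞) (by simp)
  have h3 : ContDiff ℝ ∞ (partialDeriv j (wt ε s : Eucl n → ℝ)) := by
    unfold partialDeriv; fun_prop
  exact h3.differentiable (by simp)

theorem norm_semiD_wt_le {h : ℝ} (hh : h ∈ hRange) (s : ℝ) (j : Fin n) (x : Eucl n) :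
    ‖semiD h j (fun x : Eucl n => (wt ε s x : ℂ)) x‖ ≤ wtConst s * wt ε (s - 1) x :=
  DiffOp.norm_semiD_le hh.1 hh.2 ((contDiff_wt h0 s).of_le (by simp)) (abs_partialDeriv_wt_le h0 s j x)

include h1 in
theorem norm_semiD_semiD_wt_le {h : ℝ} (hh : h ∈ hRange) (s : ℝ) (i j : Fin n) (x : Eucl n) :
    ‖semiD h i (semiD h j (fun x : Eucl n => (wt ε s x : ℂ))) x‖ ≤ wtConst s * wt ε (s - 1) x := by
  have hd := differentiable_partialDeriv_wt h0 s j x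
  have hd' : DifferentiableAt ℝ (fun y : Eucl n => ((partialDeriv j (wt ε s) y : ℝ) : ℂ)) x :=
    Complex.ofRealCLM.differentiableAt.comp x hd
  rw [semiD_wt h0, semiD_const_mul _ hd', semiD_ofReal hd]
  have hI : ‖-(Complex.I * (h : ℂ))‖ ≤ 1 := by
    rw [norm_neg, norm_mul, Complex.norm_I, one_mul, Complex.norm_real, Real.norm_eq_abs,
      abs_of_pos hh.1]
    exact hh.2
  rw [norm_mul, norm_mul, Complex.norm_real, Real.norm_eq_abs]
  have h2 := abs_partialDeriv_partialDeriv_wt_le h0 h1 s i j x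
  have h3 := abs_nonneg (partialDeriv i (partialDeriv j (wt ε s)) x)
  calc _ ≤ 1 * (1 * |partialDeriv i (partialDeriv j (wt ε s)) x|) := by gcongr
    _ ≤ _ := by linarith

end Weights

/-! ### Weighted bounds for resolvents and Cayley transforms -/

/-- Multiplication by the `s`-th power of the regularized weight. -/
def wop (n : ℕ) (ε s : ℝ) : L2 n →L[ℂ] L2 n := mulOp fun x => (wt ε s x : ℂ)

section Basic

variable {ε : ℝ} (h0 : 0 < ε) (h1 : ε ≤ 1)

include h0 h1

theorem wop_mul (s t : ℝ) : wop n ε s * wop n ε t = wop n ε (s + t) := by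
  rw [wop, wop, mulOp_mul (bddMeas_wt h0 h1 s) (bddMeas_wt h0 h1 t), wop]
  congr 1
  ext x
  rw [wt_add h0]; push_cast; rfl

theorem wop_wop (s t : ℝ) (f : L2 n) : wop n ε s (wop n ε t f) = wop n ε (s + t) f := by
  rw [← wop_mul h0 h1]; rfl

omit h0 h1 in
theorem wop_zero : wop n ε 0 = 1 := by
  rw [wop, ← mulOp_one]
  congr 1
  ext x
  simp [wt]

theorem star_wop (s : ℝ) : star (wop n ε s) = wop n ε s := by
  rw [wop, ContinuousLinearMap.star_eq_adjoint, adjoint_mulOp (bddMeas_wt h0 h1 s)]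
  congr 1
  ext x
  simp

theorem norm_wop_le {s : ℝ} (hs : -1 ≤ s) (hs0 : s ≤ 0) : ‖wop n ε s‖ ≤ 2 := by
  refine norm_mulOp_le (bddMeas_wt h0 h1 s) zero_le_two (Eventually.of_forall fun x => ?_)
  rw [Complex.norm_real, Real.norm_eq_abs, abs_of_pos (wt_pos h0 s x)]
  exact wt_le_two h0 h1 hs hs0 x

omit h1 in
theorem mem_testSpace_wt_mul (s : ℝ) (ψ : Test n) :
    (fun x => (wt ε s x : ℂ) * (ψ : Eucl n → ℂ) x) ∈ testSpace n :=
  ⟨(Complex.ofRealCLM.contDiff.comp (contDiff_wt h0 s)).mul ψ.contDiff,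
    ψ.hasCompactSupport.mul_left⟩

end Basic

open Classical in
/-- Multiplication of test functions by a power of the weight. -/
def wtTest (n : ℕ) {ε : ℝ} (h0 : 0 < ε) (s : ℝ) : Test n →ₗ[ℂ] Test n where
  toFun ψ := ⟨_, mem_testSpace_wt_mul h0 s ψ⟩
  map_add' φ ψ := by
    ext x
    exact mul_add _ _ _
  map_smul' c ψ := by
    ext x
    change _ * (c * _) = c * (_ * _)
    ring

section Comm

variable {ε : ℝ} (h0 : 0 < ε) (h1 : ε ≤ 1)

theorem wtTest_apply (s : ℝ) (ψ : Test n) (x : Eucl n) :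
    (wtTest n h0 s ψ : Eucl n → ℂ) x = (wt ε s x : ℂ) * (ψ : Eucl n → ℂ) x := rfl

include h1 in
theorem testLp_wtTest (s : ℝ) (ψ : Test n) : testLp (wtTest n h0 s ψ) = wop n ε s (testLp ψ) := by
  refine Lp.ext ?_
  filter_upwards [coeFn_testLp (wtTest n h0 s ψ), DiffOp.coeFn_mulOp_test (bddMeas_wt h0 h1 s) ψ]
    with x e1 e2
  rw [e1, wop, e2, wtTest_apply]

include h0 in
theorem differentiable_wt (s : ℝ) : Differentiable ℝ fun x : Eucl n => (wt ε s x : ℂ) :=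
  (Complex.ofRealCLM.contDiff.comp (contDiff_wt h0 s)).differentiable (n := ∞) (by simp)

include h0 in
theorem differentiable_semiD_wt (h s : ℝ) (j : Fin n) :
    Differentiable ℝ (semiD h j fun x : Eucl n => (wt ε s x : ℂ)) :=
  (contDiff_semiD (Complex.ofRealCLM.contDiff.comp (contDiff_wt h0 s))).differentiable (by simp)

theorem semiD_wtTest (h s : ℝ) (j : Fin n) (ψ : Test n) :
    semiD h j (wtTest n h0 s ψ) = fun x =>
      semiD h j (fun x : Eucl n => (wt ε s x : ℂ)) x * (ψ : Eucl n → ℂ) x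
        + (wt ε s x : ℂ) * semiD h j ψ x := by
  ext x
  exact semiD_mul (differentiable_wt h0 s x) (ψ.differentiable x)

theorem semiD_semiD_wtTest (h s : ℝ) (i j : Fin n) (ψ : Test n) (x : Eucl n) :
    semiD h i (semiD h j (wtTest n h0 s ψ)) x =
      semiD h i (semiD h j fun x : Eucl n => (wt ε s x : ℂ)) x * (ψ : Eucl n → ℂ) x
        + semiD h j (fun x : Eucl n => (wt ε s x : ℂ)) x * semiD h i ψ x
        + semiD h i (fun x : Eucl n => (wt ε s x : ℂ)) x * semiD h j ψ x
        + (wt ε s x : ℂ) * semiD h i (semiD h j ψ) x := by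
  rw [semiD_wtTest]
  have d1 := differentiable_wt (n := n) h0 s x
  have d2 := differentiable_semiD_wt (n := n) h0 h s j x
  have d3 := ψ.differentiable x
  have d4 : DifferentiableAt ℝ (semiD h j ψ) x := (testD h j ψ).differentiable x
  have d5 : DifferentiableAt ℝ (fun x => semiD h j (fun x : Eucl n => (wt ε s x : ℂ)) x
      * (ψ : Eucl n → ℂ) x) x := d2.mul d3
  have d6 : DifferentiableAt ℝ (fun x => (wt ε s x : ℂ) * semiD h j ψ x) x := d1.mul d4
  rw [semiD_add d5 d6, semiD_mul d2 d3, semiD_mul d1 d4]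
  ring

/-- The monomials of order at most one. -/
def lowMono : Option (Fin n) → Mono n
  | none => .one
  | some j => .D j

/-- The sum of `|𝒟^α ψ|` over `|α| ≤ 1`. -/
def lowSum (h : ℝ) (ψ : Test n) (x : Eucl n) : ℝ :=
  ∑ o : Option (Fin n), ‖((lowMono o).act h ψ : Eucl n → ℂ) x‖

theorem norm_le_lowSum (h : ℝ) (ψ : Test n) (x : Eucl n) :
    ‖(ψ : Eucl n → ℂ) x‖ ≤ lowSum h ψ x :=
  Finset.single_le_sum (f := fun o => ‖((lowMono o).act h ψ : Eucl n → ℂ) x‖)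
    (fun _ _ => norm_nonneg _) (Finset.mem_univ none)

theorem norm_semiD_le_lowSum (h : ℝ) (ψ : Test n) (j : Fin n) (x : Eucl n) :
    ‖semiD h j ψ x‖ ≤ lowSum h ψ x :=
  Finset.single_le_sum (f := fun o => ‖((lowMono o).act h ψ : Eucl n → ℂ) x‖)
    (fun _ _ => norm_nonneg _) (Finset.mem_univ (some j))

theorem lowSum_nonneg (h : ℝ) (ψ : Test n) (x : Eucl n) : 0 ≤ lowSum h ψ x :=
  Finset.sum_nonneg fun _ _ => norm_nonneg _

/-- The commutator of `L` with a power of the weight. -/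
def opComm (L : DiffOp n) (s : ℝ) : Test n →ₗ[ℂ] L2 n :=
  L.op ∘ₗ wtTest n h0 s - (wop n ε s).toLinearMap ∘ₗ L.op

/-- The commutator of a monomial with a power of the weight. -/
def monoComm (L : DiffOp n) (s : ℝ) (Q : Mono n) : Test n →ₗ[ℂ] L2 n :=
  testLp ∘ₗ Q.act L.h ∘ₗ wtTest n h0 s - (wop n ε s).toLinearMap ∘ₗ testLp ∘ₗ Q.act L.h

theorem opComm_apply (L : DiffOp n) (s : ℝ) (ψ : Test n) :
    opComm h0 L s ψ = L.op (wtTest n h0 s ψ) - wop n ε s (L.op ψ) := rfl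

theorem monoComm_apply (L : DiffOp n) (s : ℝ) (Q : Mono n) (ψ : Test n) :
    monoComm h0 L s Q ψ =
      testLp (Q.act L.h (wtTest n h0 s ψ)) - wop n ε s (testLp (Q.act L.h ψ)) := rfl

theorem DiffOp.mem_hRange (L : DiffOp n) : L.h ∈ hRange := ⟨L.h_pos, L.h_le⟩

include h1 in
/-- The commutator of `L` with `⟨x⟩^s` is of the first order and carries the weight `⟨x⟩^{s-1}`. -/
theorem opComm_le (L : DiffOp n) (s : ℝ) (ψ : Test n) : ∀ᵐ x, ‖opComm h0 L s ψ x‖ ≤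
    (L.B * (4 * (n : ℝ) ^ 2 + 2 * n) * wtConst s) * wt ε (s - 1) x * lowSum L.h ψ x := by
  filter_upwards [L.coeFn_op (wtTest n h0 s ψ), L.coeFn_op ψ,
    coeFn_mulOp (bddMeas_wt h0 h1 s) (L.op ψ),
    Lp.coeFn_sub (L.op (wtTest n h0 s ψ)) (wop n ε s (L.op ψ)), L.a_le, L.da_le, L.b_le]
    with x e1 e2 e3 e4 ha hda hb
  rw [opComm_apply, e4, Pi.sub_apply, e1, wop, e3, e2, L.diffExpr_eq, L.diffExpr_eq]
  set om : Eucl n → ℂ := fun x => (wt ε s x : ℂ) with hom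
  set κ := wtConst s * wt ε (s - 1) x with hκ
  set S := lowSum L.h ψ x
  have hκ0 : 0 ≤ κ := mul_nonneg (wtConst_nonneg s) (wt_pos h0 _ x).le
  have hS := lowSum_nonneg L.h ψ x
  have k1 : ∀ j, ‖semiD L.h j om x‖ ≤ κ := fun j => norm_semiD_wt_le h0 L.mem_hRange s j x
  have k2 : ∀ i j, ‖semiD L.h i (semiD L.h j om) x‖ ≤ κ := fun i j =>
    norm_semiD_semiD_wt_le h0 h1 L.mem_hRange s i j x
  have p0 : ‖(ψ : Eucl n → ℂ) x‖ ≤ S := norm_le_lowSum _ _ _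
  have p1 : ∀ j, ‖semiD L.h j ψ x‖ ≤ S := fun j => norm_semiD_le_lowSum _ _ _ _
  have hB := L.B_nonneg
  have e5 : ∀ X Y Z X' Y' Z' w : ℂ, X + Y + Z - w * (X' + Y' + Z')
      = (X - w * X') + (Y - w * Y') + (Z - w * Z') := fun _ _ _ _ _ _ _ => by ring
  rw [e5, Finset.mul_sum, Finset.mul_sum, ← Finset.sum_sub_distrib, ← Finset.sum_sub_distrib]
  have e6 : (L.V x : ℂ) * (wtTest n h0 s ψ : Eucl n → ℂ) x
      - (wt ε s x : ℂ) * ((L.V x : ℂ) * (ψ : Eucl n → ℂ) x) = 0 := by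
    rw [wtTest_apply]; ring
  rw [e6, add_zero]
  have hA : ∀ i j, ‖(L.a i j x : ℂ)‖ ≤ L.B := fun i j => by simpa using ha i j
  have hDA : ∀ i j, ‖semiD L.h i (fun y => (L.a i j y : ℂ)) x‖ ≤ L.B := fun i j =>
    DiffOp.norm_semiD_le L.h_pos L.h_le (L.a_C1 i j) (hda i i j)
  have hBB : ∀ j, ‖(L.b j x : ℂ)‖ ≤ L.B := fun j => by simpa using hb j
  have b1 : ∀ u v w : ℂ, ‖u‖ ≤ L.B → ‖v‖ ≤ κ → ‖w‖ ≤ S → ‖u * (v * w)‖ ≤ L.B * (κ * S) := by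
    intro u v w hu hv hw
    rw [norm_mul, norm_mul]
    gcongr
  refine (norm_add_le _ _).trans ?_
  have q1 : ‖∑ i, (∑ j, ((L.a i j x : ℂ) * semiD L.h i (semiD L.h j (wtTest n h0 s ψ)) x
        + semiD L.h i (fun y => (L.a i j y : ℂ)) x * semiD L.h j (wtTest n h0 s ψ) x)
      - (wt ε s x : ℂ) * ∑ j, ((L.a i j x : ℂ) * semiD L.h i (semiD L.h j ψ) x
        + semiD L.h i (fun y => (L.a i j y : ℂ)) x * semiD L.h j ψ x))‖
      ≤ ∑ _i : Fin n, ∑ _j : Fin n, 4 * (L.B * (κ * S)) := by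
    refine norm_sum_le_of_le _ fun i _ => ?_
    rw [Finset.mul_sum, ← Finset.sum_sub_distrib]
    refine norm_sum_le_of_le _ fun j _ => ?_
    rw [semiD_semiD_wtTest, semiD_wtTest]
    have e7 : (L.a i j x : ℂ) * (semiD L.h i (semiD L.h j om) x * (ψ : Eucl n → ℂ) x
          + semiD L.h j om x * semiD L.h i ψ x + semiD L.h i om x * semiD L.h j ψ x
          + (wt ε s x : ℂ) * semiD L.h i (semiD L.h j ψ) x)
        + semiD L.h i (fun y => (L.a i j y : ℂ)) x * (semiD L.h j om x * (ψ : Eucl n → ℂ) x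
          + (wt ε s x : ℂ) * semiD L.h j ψ x)
        - (wt ε s x : ℂ) * ((L.a i j x : ℂ) * semiD L.h i (semiD L.h j ψ) x
          + semiD L.h i (fun y => (L.a i j y : ℂ)) x * semiD L.h j ψ x)
        = (L.a i j x : ℂ) * (semiD L.h i (semiD L.h j om) x * (ψ : Eucl n → ℂ) x)
          + (L.a i j x : ℂ) * (semiD L.h j om x * semiD L.h i ψ x)
          + (L.a i j x : ℂ) * (semiD L.h i om x * semiD L.h j ψ x)
          + semiD L.h i (fun y => (L.a i j y : ℂ)) x * (semiD L.h j om x * (ψ : Eucl n → ℂ) x) := by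
      ring
    rw [e7]
    have c1 := b1 _ _ _ (hA i j) (k2 i j) p0
    have c2 := b1 _ _ _ (hA i j) (k1 j) (p1 i)
    have c3 := b1 _ _ _ (hA i j) (k1 i) (p1 j)
    have c4 := b1 _ _ _ (hDA i j) (k1 j) p0
    refine (norm_add_le _ _).trans ?_
    have := norm_add₃_le (a := (L.a i j x : ℂ) * (semiD L.h i (semiD L.h j om) x * (ψ : Eucl n → ℂ) x))
      (b := (L.a i j x : ℂ) * (semiD L.h j om x * semiD L.h i ψ x))
      (c := (L.a i j x : ℂ) * (semiD L.h i om x * semiD L.h j ψ x))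
    linarith
  have q2 : ‖∑ j, ((2 * (L.b j x : ℂ) * semiD L.h j (wtTest n h0 s ψ) x
        + semiD L.h j (fun y => (L.b j y : ℂ)) x * (wtTest n h0 s ψ : Eucl n → ℂ) x)
      - (wt ε s x : ℂ) * (2 * (L.b j x : ℂ) * semiD L.h j ψ x
        + semiD L.h j (fun y => (L.b j y : ℂ)) x * (ψ : Eucl n → ℂ) x))‖
      ≤ ∑ _j : Fin n, 2 * (L.B * (κ * S)) := by
    refine norm_sum_le_of_le _ fun j _ => ?_
    rw [semiD_wtTest, wtTest_apply]
    have e7 : 2 * (L.b j x : ℂ) * (semiD L.h j om x * (ψ : Eucl n → ℂ) x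
          + (wt ε s x : ℂ) * semiD L.h j ψ x)
        + semiD L.h j (fun y => (L.b j y : ℂ)) x * ((wt ε s x : ℂ) * (ψ : Eucl n → ℂ) x)
        - (wt ε s x : ℂ) * (2 * (L.b j x : ℂ) * semiD L.h j ψ x
          + semiD L.h j (fun y => (L.b j y : ℂ)) x * (ψ : Eucl n → ℂ) x)
        = 2 * ((L.b j x : ℂ) * (semiD L.h j om x * (ψ : Eucl n → ℂ) x)) := by ring
    rw [e7, norm_mul, Complex.norm_ofNat]
    have := b1 _ _ _ (hBB j) (k1 j) p0
    linarith
  refine (add_le_add q1 q2).trans (le_of_eq ?_)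
  simp only [Finset.sum_const, Finset.card_univ, Fintype.card_fin, nsmul_eq_mul]
  rw [hκ]
  ring

include h1 in
/-- The commutators of derivatives of order at most two with `⟨x⟩^s` have the same property. -/
theorem monoComm_le (L : DiffOp n) (s : ℝ) (Q : Mono n) (ψ : Test n) :
    ∀ᵐ x, ‖monoComm h0 L s Q ψ x‖ ≤
      (3 * wtConst s) * wt ε (s - 1) x * lowSum L.h ψ x := by
  filter_upwards [coeFn_testLp (Q.act L.h (wtTest n h0 s ψ)),
    DiffOp.coeFn_mulOp_test (bddMeas_wt h0 h1 s) (Q.act L.h ψ),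
    Lp.coeFn_sub (testLp (Q.act L.h (wtTest n h0 s ψ))) (wop n ε s (testLp (Q.act L.h ψ)))]
    with x e1 e2 e3
  rw [monoComm_apply, e3, Pi.sub_apply, e1, wop, e2]
  set om : Eucl n → ℂ := fun x => (wt ε s x : ℂ) with hom
  rw [mul_assoc 3]
  set κ := wtConst s * wt ε (s - 1) x with hκ
  set S := lowSum L.h ψ x
  have hκ0 : 0 ≤ κ := mul_nonneg (wtConst_nonneg s) (wt_pos h0 _ x).le
  have hS := lowSum_nonneg L.h ψ x
  have k1 : ∀ j, ‖semiD L.h j om x‖ ≤ κ := fun j => norm_semiD_wt_le h0 L.mem_hRange s j x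
  have k2 : ∀ i j, ‖semiD L.h i (semiD L.h j om) x‖ ≤ κ := fun i j =>
    norm_semiD_semiD_wt_le h0 h1 L.mem_hRange s i j x
  have p0 : ‖(ψ : Eucl n → ℂ) x‖ ≤ S := norm_le_lowSum _ _ _
  have p1 : ∀ j, ‖semiD L.h j ψ x‖ ≤ S := fun j => norm_semiD_le_lowSum _ _ _ _
  have b1 : ∀ v w : ℂ, ‖v‖ ≤ κ → ‖w‖ ≤ S → ‖v * w‖ ≤ κ * S := by
    intro v w hv hw
    rw [norm_mul]
    gcongr
  have hκS : 0 ≤ κ * S := mul_nonneg hκ0 hS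
  cases Q with
  | one =>
    simp only [Mono.act, LinearMap.id_apply, wtTest_apply, sub_self, norm_zero]
    positivity
  | D j =>
    simp only [Mono.act, testD_apply, semiD_wtTest, add_sub_cancel_right]
    have := b1 _ _ (k1 j) p0
    linarith
  | DD i j =>
    simp only [Mono.act, LinearMap.comp_apply, testD_apply, coe_testD, semiD_semiD_wtTest,
      add_sub_cancel_right]
    refine norm_add₃_le.trans ?_
    have c1 := b1 _ _ (k2 i j) p0
    have c2 := b1 _ _ (k1 j) (p1 i)
    have c3 := b1 _ _ (k1 i) (p1 j)
    linarith

include h0 h1 in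
/-- A map with values bounded by `⟨x⟩^{s-1}` times first derivatives is bounded by `(L - z)ψ` after
division by `⟨x⟩^t`, when `s - 1 ≤ t ≤ s`. -/
theorem norm_wop_comm_le {L : DiffOp n} {z : ℂ} {R : L2 n →L[ℂ] L2 n} {C : ℝ}
    (hc : IsCore L z R C) {s t K : ℝ} (hK : 0 ≤ K) (ht1 : s - 1 ≤ t) (ht2 : t ≤ s)
    {T : Test n →ₗ[ℂ] L2 n}
    (hT : ∀ ψ : Test n, ∀ᵐ x, ‖T ψ x‖ ≤ K * wt ε (s - 1) x * lowSum L.h ψ x) (ψ : Test n) :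
    ‖wop n ε (-t) (T ψ)‖ ≤ 2 * K * ((n + 1) * C) * ‖L.shift z ψ‖ := by
  have e1 : ‖wop n ε (-t) (T ψ)‖ ≤
      (2 * K) * ∑ o : Option (Fin n), ‖testLp ((lowMono o).act L.h ψ)‖ := by
    refine norm_L2_le_sum _ (by positivity) ?_
    have h2 : ∀ᵐ x, ∀ o : Option (Fin n), testLp ((lowMono o).act L.h ψ) x
        = ((lowMono o).act L.h ψ : Eucl n → ℂ) x := by
      rw [ae_all_iff]; exact fun o => coeFn_testLp _
    filter_upwards [hT ψ, coeFn_mulOp (bddMeas_wt h0 h1 (-t)) (T ψ), h2] with x a1 a2 a3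
    rw [wop, a2, norm_mul, Complex.norm_real, Real.norm_eq_abs, abs_of_pos (wt_pos h0 _ x)]
    have hS := lowSum_nonneg L.h ψ x
    have a4 : wt ε (-t) x * wt ε (s - 1) x ≤ 2 := by
      rw [← wt_add h0]
      exact wt_le_two h0 h1 (by linarith) (by linarith) x
    calc wt ε (-t) x * ‖T ψ x‖ ≤ wt ε (-t) x * (K * wt ε (s - 1) x * lowSum L.h ψ x) :=
          mul_le_mul_of_nonneg_left a1 (wt_pos h0 _ x).le
      _ = (wt ε (-t) x * wt ε (s - 1) x) * (K * lowSum L.h ψ x) := by ring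
      _ ≤ 2 * (K * lowSum L.h ψ x) := by gcongr
      _ = _ := by rw [lowSum]; simp only [a3]; ring
  refine e1.trans ?_
  have e2 : ∑ o : Option (Fin n), ‖testLp ((lowMono o).act L.h ψ)‖
      ≤ ∑ _o : Option (Fin n), C * ‖L.shift z ψ‖ :=
    Finset.sum_le_sum fun o _ => hc.bound _ ψ
  have e3 : ∑ _o : Option (Fin n), C * ‖L.shift z ψ‖ = (n + 1) * C * ‖L.shift z ψ‖ := by
    simp; ring
  rw [e3] at e2
  calc _ ≤ 2 * K * ((n + 1) * C * ‖L.shift z ψ‖) := by gcongr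
    _ = _ := by ring

end Comm

/-! ### Extension from the core -/

/-- The bounded operator which maps `(L - z)ψ` to `Tψ`. -/
def coreExt (L : DiffOp n) (z : ℂ) (T : Test n →ₗ[ℂ] L2 n) : L2 n →L[ℂ] L2 n :=
  T.extendOfNorm (L.shift z)

theorem coreExt_apply {L : DiffOp n} {z : ℂ} {R : L2 n →L[ℂ] L2 n} {C : ℝ} (hc : IsCore L z R C)
    {T : Test n →ₗ[ℂ] L2 n} {K : ℝ} (hT : ∀ ψ, ‖T ψ‖ ≤ K * ‖L.shift z ψ‖) (ψ : Test n) :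
    coreExt L z T (L.shift z ψ) = T ψ :=
  LinearMap.extendOfNorm_eq hc.dense ⟨K, hT⟩ ψ

theorem norm_coreExt_le {L : DiffOp n} {z : ℂ} {R : L2 n →L[ℂ] L2 n} {C : ℝ} (hc : IsCore L z R C)
    {T : Test n →ₗ[ℂ] L2 n} {K : ℝ} (hK : 0 ≤ K) (hT : ∀ ψ, ‖T ψ‖ ≤ K * ‖L.shift z ψ‖) :
    ‖coreExt L z T‖ ≤ K :=
  LinearMap.opNorm_extendOfNorm_le hc.dense hK hT

theorem IsCore.ext {L : DiffOp n} {z : ℂ} {R : L2 n →L[ℂ] L2 n} {C : ℝ} (hc : IsCore L z R C)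
    {A B : L2 n →L[ℂ] L2 n} (h : ∀ ψ, A (L.shift z ψ) = B (L.shift z ψ)) : A = B :=
  ContinuousLinearMap.coeFn_injective (hc.dense.equalizer A.continuous B.continuous (funext h))

/-- The operator `𝒟^α(L - z)⁻¹`. -/
def derivRes (L : DiffOp n) (z : ℂ) (Q : Mono n) : L2 n →L[ℂ] L2 n :=
  coreExt L z (testLp ∘ₗ Q.act L.h)

section Core

variable {L : DiffOp n} {z : ℂ} {R : L2 n →L[ℂ] L2 n} {C : ℝ} (hc : IsCore L z R C)

include hc

theorem derivRes_apply (Q : Mono n) (ψ : Test n) :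
    derivRes L z Q (L.shift z ψ) = testLp (Q.act L.h ψ) := by
  have hb : ∀ ψ, ‖(testLp ∘ₗ Q.act L.h) ψ‖ ≤ C * ‖L.shift z ψ‖ := hc.bound Q
  rw [derivRes, coreExt_apply hc hb]
  rfl

theorem norm_derivRes_le (Q : Mono n) : ‖derivRes L z Q‖ ≤ C := by
  have hb : ∀ ψ, ‖(testLp ∘ₗ Q.act L.h) ψ‖ ≤ C * ‖L.shift z ψ‖ := hc.bound Q
  exact norm_coreExt_le hc hc.C_nonneg hb

theorem derivRes_one : derivRes L z .one = R :=
  hc.ext fun ψ => by rw [derivRes_apply hc, hc.left_inv]; rfl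

/-- Constants for the commutators of `L` and of monomials with the weights. -/
def commConst (n : ℕ) (B C s : ℝ) : ℝ :=
  2 * (B * (4 * (n : ℝ) ^ 2 + 2 * n) * wtConst s + 3 * wtConst s) * ((n + 1) * C)

omit hc in
theorem commConst_nonneg {B C : ℝ} (hB : 0 ≤ B) (hC : 0 ≤ C) (s : ℝ) : 0 ≤ commConst n B C s := by
  have := wtConst_nonneg s
  unfold commConst; positivity

/-- Commuting a weight with a resolvent, or with derivatives of it, leaves a bounded operator and a
weight which is lower by at most one. -/
theorem exists_commutators {ε : ℝ} (h0 : 0 < ε) (h1 : ε ≤ 1) {B s t : ℝ} (hB : L.B ≤ B)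
    (ht1 : s - 1 ≤ t) (ht2 : t ≤ s) : ∃ M : L2 n →L[ℂ] L2 n, ‖M‖ ≤ commConst n B C s ∧
      R * wop n ε s = wop n ε s * R - R * wop n ε t * M ∧
      ∀ Q, ∃ MQ : L2 n →L[ℂ] L2 n, ‖MQ‖ ≤ commConst n B C s ∧
        derivRes L z Q * wop n ε s = wop n ε s * derivRes L z Q + wop n ε t * MQ
          - derivRes L z Q * wop n ε t * M := by
  have hw := wtConst_nonneg s
  have hB0 := L.B_nonneg.trans hB
  have hC := hc.C_nonneg
  have key1 : ∀ ψ, ‖((wop n ε (-t)).toLinearMap ∘ₗ opComm h0 L s) ψ‖ ≤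
      commConst n B C s * ‖L.shift z ψ‖ := fun ψ => by
    refine (norm_wop_comm_le h0 h1 hc (K := L.B * (4 * (n : ℝ) ^ 2 + 2 * n) * wtConst s)
      (by have := L.B_nonneg; positivity) ht1 ht2 (opComm_le h0 h1 L s) ψ).trans ?_
    unfold commConst
    gcongr
    have : L.B * (4 * (n : ℝ) ^ 2 + 2 * n) * wtConst s ≤ B * (4 * (n : ℝ) ^ 2 + 2 * n) * wtConst s := by
      gcongr
    linarith
  have key2 : ∀ Q ψ, ‖((wop n ε (-t)).toLinearMap ∘ₗ monoComm h0 L s Q) ψ‖ ≤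
      commConst n B C s * ‖L.shift z ψ‖ := fun Q ψ => by
    refine (norm_wop_comm_le h0 h1 hc (K := 3 * wtConst s) (by positivity) ht1 ht2
      (monoComm_le h0 h1 L s Q) ψ).trans ?_
    unfold commConst
    gcongr
    have : 0 ≤ B * (4 * (n : ℝ) ^ 2 + 2 * n) * wtConst s := by positivity
    linarith
  have hcc := commConst_nonneg (n := n) hB0 hC s
  have hW : ∀ f, wop n ε t (wop n ε (-t) f) = f := fun f => by
    rw [wop_wop h0 h1, add_neg_cancel, wop_zero]; rfl
  refine ⟨coreExt L z ((wop n ε (-t)).toLinearMap ∘ₗ opComm h0 L s), norm_coreExt_le hc hcc key1, ?_⟩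
  have main : ∀ Q, derivRes L z Q * wop n ε s = wop n ε s * derivRes L z Q
      + wop n ε t * coreExt L z ((wop n ε (-t)).toLinearMap ∘ₗ monoComm h0 L s Q)
      - derivRes L z Q * wop n ε t *
        coreExt L z ((wop n ε (-t)).toLinearMap ∘ₗ opComm h0 L s) := by
    intro Q
    refine hc.ext fun ψ => ?_
    simp only [mul_apply_eq_comp, _root_.sub_apply, _root_.add_apply]
    rw [coreExt_apply hc key1, coreExt_apply hc (key2 Q), derivRes_apply hc]
    simp only [LinearMap.comp_apply, ContinuousLinearMap.coe_coe, hW]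
    have e1 : wop n ε s (L.shift z ψ) = L.shift z (wtTest n h0 s ψ) - opComm h0 L s ψ := by
      rw [opComm_apply, L.shift_apply, L.shift_apply, testLp_wtTest h0 h1, map_sub, map_smul]
      abel
    rw [e1, map_sub, derivRes_apply hc, monoComm_apply]
    abel
  refine ⟨?_, fun Q => ⟨_, norm_coreExt_le hc hcc (key2 Q), main Q⟩⟩
  have e2 : coreExt L z ((wop n ε (-t)).toLinearMap ∘ₗ monoComm h0 L s .one) = 0 := by
    refine hc.ext fun ψ => ?_
    rw [coreExt_apply hc (key2 .one)]
    simp [monoComm_apply, Mono.act, testLp_wtTest h0 h1]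
  have := main .one
  rwa [e2, mul_zero, add_zero, derivRes_one hc] at this

end Core

/-! ### Bounds uniform in the regularization of the weight -/

theorem norm_mul₃_le' {A B C : L2 n →L[ℂ] L2 n} {a b c : ℝ} (ha : ‖A‖ ≤ a) (hb : ‖B‖ ≤ b)
    (hc : ‖C‖ ≤ c) : ‖A * B * C‖ ≤ a * b * c := by
  have ha0 := (norm_nonneg _).trans ha
  have hb0 := (norm_nonneg _).trans hb
  exact (norm_mul_le _ _).trans (mul_le_mul ((norm_mul_le _ _).trans
    (mul_le_mul ha hb (norm_nonneg _) ha0)) hc (norm_nonneg _) (mul_nonneg ha0 hb0))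

/-- The lower weight in the commutator formulas: it is lower by one, but not below zero. -/
def lowerWt (s : ℝ) : ℝ := max (s - 1) 0

theorem lowerWt_nonneg (s : ℝ) : 0 ≤ lowerWt s := le_max_right _ _

theorem lowerWt_le_nat {s : ℝ} {N : ℕ} (hs : s ≤ (N + 1 : ℕ)) : lowerWt s ≤ N := by
  push_cast at hs
  exact max_le (by linarith) (Nat.cast_nonneg N)

theorem lowerWt_le {s : ℝ} (hs : 0 ≤ s) : lowerWt s ≤ s := max_le (by linarith) hs

theorem le_lowerWt (s : ℝ) : s - 1 ≤ lowerWt s := le_max_left _ _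

section Basic

variable {ε : ℝ} (h0 : 0 < ε) (h1 : ε ≤ 1)

include h0 h1

theorem wop_neg_mul (s : ℝ) : wop n ε (-s) * wop n ε s = 1 := by
  rw [wop_mul h0 h1, neg_add_cancel, wop_zero]

theorem wop_mul_neg (s : ℝ) : wop n ε s * wop n ε (-s) = 1 := by
  rw [wop_mul h0 h1, add_neg_cancel, wop_zero]

/-- Conjugation of a resolvent with the weight `s` in terms of conjugation with the lower weight
`t`. -/
theorem conj_identity {s t : ℝ} {E R' M MQ : L2 n →L[ℂ] L2 n}
    (h : E * wop n ε s = wop n ε s * R' + wop n ε t * MQ - E * wop n ε t * M) :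
    wop n ε (-s) * E * wop n ε s = R' + wop n ε (t - s) * MQ
      - wop n ε (t - s) * (wop n ε (-t) * E * wop n ε t) * M := by
  have e1 : wop n ε (-s) = wop n ε (t - s) * wop n ε (-t) := by
    rw [wop_mul h0 h1]; congr 1; ring
  have e2 : wop n ε (-s) * wop n ε t = wop n ε (t - s) := by
    rw [wop_mul h0 h1]; congr 1; ring
  rw [mul_assoc, h, mul_sub, mul_add, ← mul_assoc, wop_neg_mul h0 h1, one_mul, ← mul_assoc, e2]
  congr 1
  rw [e1]
  simp only [mul_assoc]

end Basic

/-- The derivatives of order at most two of the resolvent are bounded in weighted spaces. -/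
theorem exists_weighted_derivRes {B C : ℝ} (hB : 0 ≤ B) (hC : 0 ≤ C) (N : ℕ) :
    ∀ s : ℝ, 0 ≤ s → s ≤ N → ∃ K : ℝ, 0 ≤ K ∧ ∀ (L : DiffOp n) (z : ℂ) (R : L2 n →L[ℂ] L2 n),
      L.B ≤ B → IsCore L z R C → ∀ ε : ℝ, 0 < ε → ε ≤ 1 → ∀ Q,
        ‖wop n ε (-s) * derivRes L z Q * wop n ε s‖ ≤ K := by
  induction N with
  | zero =>
    intro s hs hs'
    have : s = 0 := le_antisymm (by simpa using hs') hs
    subst this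
    refine ⟨C, hC, fun L z R _ hc ε _ _ Q => ?_⟩
    rw [neg_zero, wop_zero, one_mul, mul_one]
    exact norm_derivRes_le hc Q
  | succ N ih =>
    intro s hs hs'
    obtain ⟨K, hK, hb⟩ := ih (lowerWt s) (lowerWt_nonneg s) (lowerWt_le_nat hs')
    set κ := commConst n B C s
    have hκ : 0 ≤ κ := commConst_nonneg hB hC s
    refine ⟨C + 2 * κ + 2 * K * κ, by positivity, fun L z R hL hc ε h0 h1 Q => ?_⟩
    obtain ⟨M, hM, -, hQ⟩ := exists_commutators hc h0 h1 hL (le_lowerWt s) (lowerWt_le hs)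
    obtain ⟨MQ, hMQ, hE⟩ := hQ Q
    rw [conj_identity h0 h1 hE]
    have hw : ‖wop n ε (lowerWt s - s)‖ ≤ 2 :=
      norm_wop_le h0 h1 (by linarith [le_lowerWt s]) (by linarith [lowerWt_le hs])
    refine (norm_sub_le _ _).trans (add_le_add ((norm_add_le _ _).trans (add_le_add
      (norm_derivRes_le hc Q) ((norm_mul_le _ _).trans ?_))) ?_)
    · exact mul_le_mul hw hMQ (norm_nonneg _) zero_le_two
    · exact norm_mul₃_le' hw (hb L z R hL hc ε h0 h1 Q) hM

/-- The powers of the Cayley transform grow at most polynomially in weighted spaces. -/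
theorem exists_weighted_pow {B C : ℝ} (hB : 0 ≤ B) (hC : 0 ≤ C) (N : ℕ) :
    ∀ s : ℝ, 0 ≤ s → s ≤ N → ∃ K : ℝ, 0 ≤ K ∧ ∀ (L : DiffOp n) (z : ℂ) (R : L2 n →L[ℂ] L2 n),
      L.B ≤ B → IsCore L z R C → ‖z‖ ≤ 1 → ‖1 + (2 * z) • R‖ ≤ 1 →
      ∀ ε : ℝ, 0 < ε → ε ≤ 1 → ∀ k : ℕ,
        ‖wop n ε (-s) * (1 + (2 * z) • R) ^ k * wop n ε s‖ ≤ K * (1 + k) ^ N := by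
  induction N with
  | zero =>
    intro s hs hs'
    have : s = 0 := le_antisymm (by simpa using hs') hs
    subst this
    refine ⟨1, zero_le_one, fun L z R _ hc _ hU ε _ _ k => ?_⟩
    rw [neg_zero, wop_zero, one_mul, mul_one, pow_zero, mul_one]
    cases k with
    | zero => rw [pow_zero]; exact ContinuousLinearMap.norm_id_le
    | succ k =>
      exact (norm_pow_le' _ (Nat.succ_pos k)).trans (pow_le_one₀ (norm_nonneg _) hU)
  | succ N ih =>
    intro s hs hs'
    obtain ⟨K, hK, hb⟩ := ih (lowerWt s) (lowerWt_nonneg s) (lowerWt_le_nat hs')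
    obtain ⟨K', hK', hb'⟩ := exists_weighted_derivRes (n := n) hB hC N (lowerWt s)
      (lowerWt_nonneg s) (lowerWt_le_nat hs')
    set κ := commConst n B C s
    have hκ : 0 ≤ κ := commConst_nonneg hB hC s
    set D := 2 * (2 * K * (K' * κ)) with hD
    have hD0 : 0 ≤ D := by positivity
    refine ⟨1 + D, by positivity, fun L z R hL hc hz hU ε h0 h1 k => ?_⟩
    obtain ⟨M, hM, hR, -⟩ := exists_commutators hc h0 h1 hL (le_lowerWt s) (lowerWt_le hs)
    set t := lowerWt s
    set U := 1 + (2 * z) • R with hUdef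
    have hw : ‖wop n ε (t - s)‖ ≤ 2 :=
      norm_wop_le h0 h1 (by linarith [le_lowerWt s]) (by linarith [lowerWt_le hs])
    have hUs : U * wop n ε s = wop n ε s * U - (2 * z) • (R * wop n ε t * M) := by
      rw [hUdef, add_mul, mul_add, one_mul, mul_one, smul_mul_assoc, hR, mul_smul_comm, smul_sub]
      abel
    -- Commuting the weight with one factor `U` after the other produces `k` terms with the lower
    -- weight, each of which is `O((1 + k)^N)` by the induction hypothesis.
    have step : ∀ k : ℕ, ‖wop n ε (-s) * U ^ k * wop n ε s‖ ≤ 1 + k * (D * (1 + k) ^ N) := by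
      intro k
      induction k with
      | zero =>
        rw [pow_zero, mul_one, wop_neg_mul h0 h1]
        exact (ContinuousLinearMap.norm_id_le : ‖(1 : L2 n →L[ℂ] L2 n)‖ ≤ 1).trans (by simp)
      | succ k ihk =>
        have e1 : wop n ε (-s) * U ^ (k + 1) * wop n ε s =
            (wop n ε (-s) * U ^ k * wop n ε s) * U
            - (2 * z) • (wop n ε (t - s) * (wop n ε (-t) * U ^ k * wop n ε t)
              * ((wop n ε (-t) * R * wop n ε t) * M)) := by
          have e2 : wop n ε (-s) = wop n ε (t - s) * wop n ε (-t) := by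
            rw [wop_mul h0 h1]; congr 1; ring
          have e3 : wop n ε (t - s) * (wop n ε (-t) * U ^ k * wop n ε t)
              * ((wop n ε (-t) * R * wop n ε t) * M)
              = wop n ε (-s) * U ^ k * (R * wop n ε t * M) := by
            have e4 : wop n ε t * (wop n ε (-t) * (R * (wop n ε t * M)))
                = R * (wop n ε t * M) := by
              rw [← mul_assoc (wop n ε t), wop_mul_neg h0 h1, one_mul]
            rw [e2]
            simp only [mul_assoc, e4]
          rw [e3, pow_succ, mul_assoc, mul_assoc, hUs, mul_sub, mul_sub]
          simp only [mul_assoc, mul_smul_comm]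
        rw [e1]
        have hb2 := hb' L z R hL hc ε h0 h1 .one
        rw [derivRes_one hc] at hb2
        have hz2 : ‖2 * z‖ ≤ 2 := by rw [norm_mul, Complex.norm_ofNat]; linarith
        have hmono : K * (1 + (k : ℝ)) ^ N ≤ K * (1 + ((k + 1 : ℕ) : ℝ)) ^ N := by
          push_cast; gcongr; linarith
        have hmono' : (1 + (k : ℝ)) ^ N ≤ (1 + ((k + 1 : ℕ) : ℝ)) ^ N := by
          push_cast; gcongr; linarith
        have n1 : ‖(wop n ε (-s) * U ^ k * wop n ε s) * U‖ ≤ 1 + k * (D * (1 + k) ^ N) := by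
          refine (norm_mul_le _ _).trans ?_
          calc _ ≤ ‖wop n ε (-s) * U ^ k * wop n ε s‖ * 1 := by gcongr
            _ ≤ _ := by rw [mul_one]; exact ihk
        have n2 : ‖(2 * z) • (wop n ε (t - s) * (wop n ε (-t) * U ^ k * wop n ε t)
              * ((wop n ε (-t) * R * wop n ε t) * M))‖ ≤ D * (1 + k) ^ N := by
          rw [norm_smul]
          have := norm_mul₃_le' hw (hb L z R hL hc hz hU ε h0 h1 k)
            ((norm_mul_le _ _).trans (mul_le_mul hb2 hM (norm_nonneg _) hK'))
          calc _ ≤ 2 * (2 * (K * (1 + k) ^ N) * (K' * κ)) :=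
                mul_le_mul hz2 this (norm_nonneg _) zero_le_two
            _ = _ := by rw [hD]; ring
        refine (norm_sub_le _ _).trans ((add_le_add n1 n2).trans ?_)
        push_cast at hmono' ⊢
        nlinarith [mul_le_mul_of_nonneg_left hmono' hD0, Nat.cast_nonneg (α := ℝ) k,
          mul_le_mul_of_nonneg_left (mul_le_mul_of_nonneg_left hmono' hD0)
            (Nat.cast_nonneg (α := ℝ) k)]
    refine (step k).trans ?_
    have hk : (1 : ℝ) ≤ (1 + k) ^ N := one_le_pow₀ (by linarith [Nat.cast_nonneg (α := ℝ) k])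
    have hk0 := Nat.cast_nonneg (α := ℝ) k
    rw [pow_succ]
    have h3 : (1 : ℝ) ≤ (1 + k) ^ N * (1 + k) := by nlinarith
    have h4 : 0 ≤ D * (1 + (k : ℝ)) ^ N := by positivity
    nlinarith

/-! ### The functional calculus in weighted spaces -/

section Series

variable {H : Type*} [NormedAddCommGroup H] [InnerProductSpace ℂ H] [CompleteSpace H]

theorem star_cayPow {M : Type*} [Monoid M] [StarMul M] (u : M) (k : ℤ) :
    star (cayPow u k) = cayPow u (-k) := by
  rcases k with (k | k) | k
  · change star (u ^ 0) = u ^ 0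
    simp
  · change star (u ^ (k + 1)) = star u ^ (k + 1)
    exact star_pow u _
  · change star (star u ^ (k + 1)) = u ^ (k + 1)
    rw [star_pow, star_star]

/-- The constant in bounds for functions of an operator in terms of powers of its Cayley
transform. -/
def cayConst (φ : ℝ → ℂ) (N : ℕ) : ℝ := ∑' k : ℤ, ‖cayCoeff φ k‖ * (1 + |(k : ℝ)|) ^ N

theorem cayConst_nonneg (φ : ℝ → ℂ) (N : ℕ) : 0 ≤ cayConst φ N :=
  tsum_nonneg fun k => by positivity

theorem norm_cayley_series_le {E : Type*} [NormedAddCommGroup E] [NormedSpace ℂ E] {φ : ℝ → ℂ}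
    (hφ : ContDiff ℝ ∞ φ) (hc : HasCompactSupport φ) {T : ℤ → E} {S : E}
    (hS : HasSum (fun k => cayCoeff φ k • T k) S) {K : ℝ} {N : ℕ}
    (hT : ∀ k : ℤ, ‖T k‖ ≤ K * (1 + |(k : ℝ)|) ^ N) : ‖S‖ ≤ K * cayConst φ N := by
  rw [← hS.tsum_eq, cayConst, ← tsum_mul_left]
  refine tsum_of_norm_bounded ((cayCoeff_summable N hφ hc).mul_left K).hasSum fun k => ?_
  rw [norm_smul]
  calc _ ≤ ‖cayCoeff φ k‖ * (K * (1 + |(k : ℝ)|) ^ N) := by gcongr; exact hT k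
    _ = _ := by ring

/-- A bound on `Xφ(A)Y` from polynomial bounds on `XU^kY`. -/
theorem norm_conj_funCalc_le {A : H →ₗ.[ℂ] H} {R : H →L[ℂ] H} (h : IsResolventPair A R) {φ : ℝ → ℂ}
    (hφ : ContDiff ℝ ∞ φ) (hc : HasCompactSupport φ) {X Y : H →L[ℂ] H} {K : ℝ} {N : ℕ}
    (hT : ∀ k : ℤ, ‖X * cayPow (cayley R) k * Y‖ ≤ K * (1 + |(k : ℝ)|) ^ N) :
    ‖X * funCalc A φ * Y‖ ≤ K * cayConst φ N := by
  refine norm_cayley_series_le hφ hc (T := fun k => X * cayPow (cayley R) k * Y) ?_ hT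
  simpa only [mul_smul_comm, smul_mul_assoc] using
    ((funCalc_hasSum h hφ hc).mul_left X).mul_right Y

theorem norm_conj_funCalc_sub_le {A A' : H →ₗ.[ℂ] H} {R R' : H →L[ℂ] H} (h : IsResolventPair A R)
    (h' : IsResolventPair A' R') {φ : ℝ → ℂ}
    (hφ : ContDiff ℝ ∞ φ) (hc : HasCompactSupport φ) {X Y : H →L[ℂ] H} {K : ℝ} {N : ℕ}
    (hT : ∀ k : ℤ, ‖X * (cayPow (cayley R) k - cayPow (cayley R') k) * Y‖
      ≤ K * (1 + |(k : ℝ)|) ^ N) :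
    ‖X * (funCalc A φ - funCalc A' φ) * Y‖ ≤ K * cayConst φ N := by
  refine norm_cayley_series_le hφ hc
    (T := fun k => X * (cayPow (cayley R) k - cayPow (cayley R') k) * Y) ?_ hT
  simpa only [mul_smul_comm, smul_mul_assoc, ← smul_sub] using
    (((funCalc_hasSum h hφ hc).sub (funCalc_hasSum h' hφ hc)).mul_left X).mul_right Y

end Series

/-- `A` is an operator with resolvent pair `R, R*` which is given by `L` on the core `C_c^∞`. -/
structure Realizes (L : DiffOp n) (A : L2 n →ₗ.[ℂ] L2 n) (R : L2 n →L[ℂ] L2 n) (C : ℝ) : Prop where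
  pair : IsResolventPair A R
  neg : IsCore L (-Complex.I) R C
  pos : IsCore L Complex.I (star R) C

theorem IsCore.mono {L : DiffOp n} {z : ℂ} {R : L2 n →L[ℂ] L2 n} {C C' : ℝ} (h : IsCore L z R C)
    (hC : C ≤ C') : IsCore L z R C' where
  C_nonneg := h.C_nonneg.trans hC
  left_inv := h.left_inv
  dense := h.dense
  bound Q ψ := (h.bound Q ψ).trans (by gcongr)

theorem Realizes.mono {L : DiffOp n} {A : L2 n →ₗ.[ℂ] L2 n} {R : L2 n →L[ℂ] L2 n} {C C' : ℝ}
    (h : Realizes L A R C) (hC : C ≤ C') : Realizes L A R C' :=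
  ⟨h.pair, h.neg.mono hC, h.pos.mono hC⟩

theorem star_fmul_resSym (h : ℝ) :
    star (fmul (resSym h (-Complex.I)) : L2 n →L[ℂ] L2 n) = fmul (resSym h Complex.I) := by
  have h1 : (fun ξ : Eucl n => conj (resSym h (-Complex.I) ξ)) = resSym h Complex.I := by
    ext ξ; simp [resSym, sub_eq_add_neg]
  rw [star_fmul (bddMeas_resSym h isFar_neg_I), h1]

theorem realizes_free {h : ℝ} (hh : h ∈ hRange) :
    Realizes (freeDiffOp n h hh) (freeOp n h) (fmul (resSym h (-Complex.I))) 2 := by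
  refine ⟨isResolventPair_free h, isCore_free hh isFar_neg_I, ?_⟩
  rw [star_fmul_resSym]
  exact isCore_free hh isFar_I

theorem cayley_eq (R : L2 n →L[ℂ] L2 n) : cayley R = 1 + (2 * -Complex.I) • R := by
  rw [cayley, mul_neg, neg_smul, sub_eq_add_neg]

theorem norm_le_one_of_apply {T : L2 n →L[ℂ] L2 n} (h : ∀ f, ‖T f‖ = ‖f‖) : ‖T‖ ≤ 1 :=
  T.opNorm_le_bound zero_le_one fun f => by rw [h, one_mul]

/-- Integer powers of the Cayley transform, from the powers of `U` and of `U*`. Taking adjoints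
exchanges the two weights. -/
theorem exists_weighted_cayPow {B C : ℝ} (hB : 0 ≤ B) (hC : 0 ≤ C) {s : ℝ} (hs : 0 ≤ s) :
    ∃ K : ℝ, 0 ≤ K ∧ ∃ N : ℕ, ∀ (L : DiffOp n) (A : L2 n →ₗ.[ℂ] L2 n) (R : L2 n →L[ℂ] L2 n),
      L.B ≤ B → Realizes L A R C → ∀ ε : ℝ, 0 < ε → ε ≤ 1 → ∀ k : ℤ,
        ‖wop n ε (-s) * cayPow (cayley R) k * wop n ε s‖ ≤ K * (1 + |(k : ℝ)|) ^ N ∧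
        ‖wop n ε s * cayPow (cayley R) k * wop n ε (-s)‖ ≤ K * (1 + |(k : ℝ)|) ^ N := by
  obtain ⟨K, hK, hb⟩ := exists_weighted_pow (n := n) hB hC ⌈s⌉₊ s hs (Nat.le_ceil s)
  refine ⟨K, hK, ⌈s⌉₊, fun L A R hL hR ε h0 h1 => ?_⟩
  have key : ∀ k : ℤ, ‖wop n ε (-s) * cayPow (cayley R) k * wop n ε s‖
      ≤ K * (1 + |(k : ℝ)|) ^ ⌈s⌉₊ := by
    rintro (k | k)
    · have := hb L (-Complex.I) R hL hR.neg (by simp)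
        (by rw [← cayley_eq]; exact norm_le_one_of_apply hR.pair.norm_cayley_apply) ε h0 h1 k
      rw [← cayley_eq] at this
      simpa [cayPow] using this
    · have := hb L Complex.I (star R) hL hR.pos (by simp)
        (by rw [← star_cayley]; exact norm_le_one_of_apply hR.pair.norm_star_cayley_apply) ε h0 h1
        (k + 1)
      rw [← star_cayley] at this
      have e : |((Int.negSucc k : ℤ) : ℝ)| = ((k + 1 : ℕ) : ℝ) := by
        rw [Int.cast_negSucc, abs_neg, abs_of_nonneg (Nat.cast_nonneg _)]
      rw [e]
      exact this
  refine fun k => ⟨key k, ?_⟩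
  have h2 := key (-k)
  rw [← norm_star, star_mul, star_mul, star_wop h0 h1, star_wop h0 h1, star_cayPow, neg_neg,
    ← mul_assoc] at h2
  simpa using h2

/-- `φ(A)` is bounded in weighted spaces. -/
theorem exists_weighted_funCalc {B C : ℝ} (hB : 0 ≤ B) (hC : 0 ≤ C) {s : ℝ} (hs : 0 ≤ s)
    {φ : ℝ → ℂ} (hφ : ContDiff ℝ ∞ φ) (hc : HasCompactSupport φ) :
    ∃ K : ℝ, 0 ≤ K ∧ ∀ (L : DiffOp n) (A : L2 n →ₗ.[ℂ] L2 n) (R : L2 n →L[ℂ] L2 n),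
      L.B ≤ B → Realizes L A R C → ∀ ε : ℝ, 0 < ε → ε ≤ 1 →
        ‖wop n ε (-s) * funCalc A φ * wop n ε s‖ ≤ K ∧
        ‖wop n ε s * funCalc A φ * wop n ε (-s)‖ ≤ K := by
  obtain ⟨K, hK, N, hb⟩ := exists_weighted_cayPow (n := n) hB hC hs
  refine ⟨K * cayConst φ N, mul_nonneg hK (cayConst_nonneg _ _), fun L A R hL hR ε h0 h1 => ?_⟩
  exact ⟨norm_conj_funCalc_le hR.pair hφ hc fun k => (hb L A R hL hR ε h0 h1 k).1,
    norm_conj_funCalc_le hR.pair hφ hc fun k => (hb L A R hL hR ε h0 h1 k).2⟩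

/-! ### Removing the regularization of the weights -/

theorem japanese_rpow (s : ℝ) (x : Eucl n) : japanese x ^ s = (1 + ‖x‖ ^ 2) ^ (s / 2) := by
  rw [japanese, Real.sqrt_eq_rpow, ← Real.rpow_mul (by positivity)]
  congr 1; ring

theorem tendsto_wt (s : ℝ) (x : Eucl n) {ε : ℕ → ℝ} (hε : Tendsto ε atTop (𝓝 0)) :
    Tendsto (fun k => wt (ε k) s x) atTop (𝓝 (japanese x ^ s)) := by
  have hp : 0 < 1 + ‖x‖ ^ 2 := by positivity
  rw [japanese_rpow]
  have h1 : Tendsto (fun k => wtSq (ε k) x) atTop (𝓝 (1 + ‖x‖ ^ 2)) := by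
    have : Tendsto (fun k => (1 + ‖x‖ ^ 2) / (1 + ε k * (1 + ‖x‖ ^ 2))) atTop
        (𝓝 ((1 + ‖x‖ ^ 2) / (1 + 0 * (1 + ‖x‖ ^ 2)))) :=
      tendsto_const_nhds.div ((hε.mul_const _).const_add 1) (by simp)
    simpa [wtSq] using this
  exact h1.rpow_const (Or.inl hp.ne')

/-- The regularized weight removes the weight `⟨x⟩^s` from `g = ⟨x⟩^s f` in the limit. -/
theorem tendsto_wop_neg {s : ℝ} (hs : 0 ≤ s) {ε : ℕ → ℝ} (h0 : ∀ k, 0 < ε k) (h1 : ∀ k, ε k ≤ 1)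
    (hε : Tendsto ε atTop (𝓝 0)) {f g : L2 n}
    (hg : ∀ᵐ x, g x = ((japanese x ^ s : ℝ) : ℂ) * f x) :
    Tendsto (fun k => wop n (ε k) (-s) g) atTop (𝓝 f) := by
  set c : ℝ := (1 / 2 : ℝ) ^ (-s / 2) + 1 with hcdef
  have hc : 0 < c := by positivity
  refine tendsto_L2_of_dominated (g := (c : ℂ) • g) (fun k => ?_) ?_
  · filter_upwards [hg, coeFn_mulOp (bddMeas_wt (h0 k) (h1 k) (-s)) g, Lp.coeFn_smul (c : ℂ) g]
      with x e1 e2 e3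
    rw [wop, e2, e3, Pi.smul_apply, norm_smul, Complex.norm_real, Real.norm_of_nonneg hc.le]
    have hJ : 1 ≤ japanese x ^ s := Real.one_le_rpow
      (by rw [japanese, Real.one_le_sqrt]; nlinarith [sq_nonneg ‖x‖]) hs
    have h2 : ‖f x‖ ≤ ‖g x‖ := by
      rw [e1, norm_mul, Complex.norm_real, Real.norm_of_nonneg (by linarith)]
      exact le_mul_of_one_le_left (norm_nonneg _) hJ
    have h3 : wt (ε k) (-s) x ≤ (1 / 2 : ℝ) ^ (-s / 2) :=
      Real.rpow_le_rpow_of_nonpos (by norm_num) (half_le_wtSq (h0 k) (h1 k) x) (by linarith)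
    refine (norm_sub_le _ _).trans ?_
    rw [norm_mul, Complex.norm_real, Real.norm_of_nonneg (wt_pos (h0 k) _ x).le, hcdef, add_mul,
      one_mul]
    exact add_le_add (mul_le_mul_of_nonneg_right h3 (norm_nonneg _)) h2
  · have hall : ∀ᵐ x, ∀ k, wop n (ε k) (-s) g x = (wt (ε k) (-s) x : ℂ) * g x := by
      rw [ae_all_iff]
      exact fun k => coeFn_mulOp (bddMeas_wt (h0 k) (h1 k) (-s)) g
    filter_upwards [hg, hall] with x e1 e2
    simp only [e2]
    have h2 := ((Complex.continuous_ofReal.tendsto _).comp (tendsto_wt (-s) x hε)).mul_const (g x)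
    have hJ : 0 < japanese x := Real.sqrt_pos.2 (by positivity)
    have e3 : ((japanese x ^ (-s) : ℝ) : ℂ) * g x = f x := by
      rw [e1, ← mul_assoc, ← Complex.ofReal_mul, ← Real.rpow_add hJ, neg_add_cancel, Real.rpow_zero]
      simp
    rwa [e3] at h2

/-- The parameters used to remove the regularization of the weights. -/
def regSeq (k : ℕ) : ℝ := 1 / ((k : ℝ) + 1)

theorem regSeq_pos (k : ℕ) : 0 < regSeq k := Nat.one_div_pos_of_nat

theorem regSeq_le (k : ℕ) : regSeq k ≤ 1 := by
  rw [regSeq, div_le_one (by positivity)]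
  linarith [Nat.cast_nonneg (α := ℝ) k]

theorem tendsto_regSeq : Tendsto regSeq atTop (𝓝 0) := tendsto_one_div_add_atTop_nhds_zero_nat

/-- A bound of `⟨x⟩^{s₁}T⟨x⟩^{s₂}` which is uniform in the regularization of the weights holds for
the weights themselves. The left weight is treated by Fatou's lemma. -/
theorem eLpNorm_le_of_weights {s₁ s₂ : ℝ} (hs₂ : 0 ≤ s₂) {T : L2 n →L[ℂ] L2 n} {K : ℝ}
    (hT : ∀ ε : ℝ, 0 < ε → ε ≤ 1 → ‖wop n ε s₁ * T * wop n ε s₂‖ ≤ K) {f g : L2 n}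
    (hg : ∀ᵐ x, g x = ((japanese x ^ s₂ : ℝ) : ℂ) * f x) :
    eLpNorm (fun x => ((japanese x ^ s₁ : ℝ) : ℂ) * T g x) 2 volume
      ≤ ENNReal.ofReal (K * ‖f‖) := by
  have hall : ∀ᵐ x, ∀ k, wop n (regSeq k) s₁ (T g) x = (wt (regSeq k) s₁ x : ℂ) * T g x := by
    rw [ae_all_iff]
    exact fun k => coeFn_mulOp (bddMeas_wt (regSeq_pos k) (regSeq_le k) s₁) _
  refine (Lp.eLpNorm_lim_le_liminf_eLpNorm (f := fun k => (wop n (regSeq k) s₁ (T g) : Eucl n → ℂ))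
    (fun k => Lp.aestronglyMeasurable _) _ ?_).trans ?_
  · filter_upwards [hall] with x hx
    simp only [hx]
    exact ((Complex.continuous_ofReal.tendsto _).comp (tendsto_wt s₁ x tendsto_regSeq)).mul_const _
  · have hlim : Tendsto (fun k => ENNReal.ofReal (K * ‖wop n (regSeq k) (-s₂) g‖)) atTop
        (𝓝 (ENNReal.ofReal (K * ‖f‖))) :=
      ENNReal.tendsto_ofReal
        ((tendsto_wop_neg hs₂ regSeq_pos regSeq_le tendsto_regSeq hg).norm.const_mul K)
    rw [← hlim.liminf_eq]
    refine liminf_le_liminf (Eventually.of_forall fun k => ?_)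
    have e1 : wop n (regSeq k) s₁ (T g) =
        (wop n (regSeq k) s₁ * T * wop n (regSeq k) s₂) (wop n (regSeq k) (-s₂) g) := by
      simp only [mul_apply_eq_comp]
      rw [wop_wop (regSeq_pos k) (regSeq_le k), add_neg_cancel, wop_zero]
      rfl
    rw [← Lp.enorm_def, ← ofReal_norm, e1]
    exact ENNReal.ofReal_le_ofReal
      (ContinuousLinearMap.le_of_opNorm_le _ (hT _ (regSeq_pos k) (regSeq_le k)) _)

/-- A weighted bound on `L²` which is uniform in the regularization of the weights. -/
theorem weightedBound_two {s₁ s₂ : ℝ} (hs₂ : 0 ≤ s₂) {T : L2 n →L[ℂ] L2 n} {K : ℝ}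
    (hT : ∀ ε : ℝ, 0 < ε → ε ≤ 1 → ‖wop n ε s₁ * T * wop n ε s₂‖ ≤ K) :
    WeightedBound 2 s₁ (everywhere T) s₂ K := fun _ _ hg =>
  ⟨trivial, eLpNorm_le_of_weights hs₂ hT hg⟩

/-- A bound of `T⟨x⟩^s` from `L²` to `L^∞` which is uniform in the regularization of the weight. -/
theorem weightedBound_top {s : ℝ} (hs : 0 ≤ s) {T : L2 n →L[ℂ] L2 n} {K : ℝ}
    (hT : ∀ ε : ℝ, 0 < ε → ε ≤ 1 → ∀ f : L2 n, ∀ᵐ x, ‖T (wop n ε s f) x‖ ≤ K * ‖f‖) :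
    WeightedBound ⊤ 0 (everywhere T) s K := fun f g hg => by
  refine ⟨trivial, ?_⟩
  have hall : ∀ᵐ x, ∀ k, ‖T g x‖ ≤ K * ‖wop n (regSeq k) (-s) g‖ := by
    rw [ae_all_iff]
    intro k
    have := hT _ (regSeq_pos k) (regSeq_le k) (wop n (regSeq k) (-s) g)
    rw [wop_wop (regSeq_pos k) (regSeq_le k), add_neg_cancel, wop_zero] at this
    exact this
  have hlim : Tendsto (fun k => K * ‖wop n (regSeq k) (-s) g‖) atTop (𝓝 (K * ‖f‖)) :=
    (tendsto_wop_neg hs regSeq_pos regSeq_le tendsto_regSeq hg).norm.const_mul K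
  rw [eLpNorm_exponent_top]
  refine eLpNormEssSup_le_of_ae_bound ?_
  filter_upwards [hall] with x hx
  change ‖((japanese x ^ (0 : ℝ) : ℝ) : ℂ) * T g x‖ ≤ _
  rw [Real.rpow_zero, Complex.ofReal_one, one_mul]
  exact ge_of_tendsto' hlim hx

/-! ### The difference of the resolvents -/

/-- Integration by parts: `𝒟_j` is symmetric. -/
theorem integral_conj_semiD_mul {F G : Eucl n → ℂ} (hF : ContDiff ℝ 1 F) (hG : ContDiff ℝ 1 G)
    (hc : HasCompactSupport F) (h : ℝ) (j : Fin n) :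
    ∫ x, conj (semiD h j F x) * G x = ∫ x, conj (F x) * semiD h j G x := by
  set F' : Eucl n → ℂ := fun x => conj (F x) with hF'
  have hF'1 : ContDiff ℝ 1 F' := Complex.conjCLE.contDiff.comp hF
  have hF'c : HasCompactSupport F' := hc.comp_left (map_zero _)
  have hd : ∀ x, fderiv ℝ F' x (stdVec j) = conj (fderiv ℝ F x (stdVec j)) := fun x => by
    have : fderiv ℝ F' x = (Complex.conjCLE : ℂ →L[ℝ] ℂ) ∘L fderiv ℝ F x :=
      ((Complex.conjCLE : ℂ →L[ℝ] ℂ).hasFDerivAt.comp x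
        (hF.differentiable (by simp) x).hasFDerivAt).fderiv
    rw [this]; rfl
  have c1 : Continuous fun x => fderiv ℝ F' x (stdVec j) :=
    (hF'1.continuous_fderiv (by simp)).clm_apply continuous_const
  have c2 : Continuous fun x => fderiv ℝ G x (stdVec j) :=
    (hG.continuous_fderiv (by simp)).clm_apply continuous_const
  have s1 : HasCompactSupport fun x => fderiv ℝ F' x (stdVec j) :=
    (hF'c.fderiv (𝕜 := ℝ)).comp_left (g := fun l : Eucl n →L[ℝ] ℂ => l (stdVec j)) rfl
  have i1 : Integrable (fun x => fderiv ℝ F' x (stdVec j) * G x) volume :=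
    (c1.mul hG.continuous).integrable_of_hasCompactSupport s1.mul_right
  have i2 : Integrable (fun x => F' x * fderiv ℝ G x (stdVec j)) volume :=
    (hF'1.continuous.mul c2).integrable_of_hasCompactSupport hF'c.mul_right
  have i3 : Integrable (fun x => F' x * G x) volume :=
    (hF'1.continuous.mul hG.continuous).integrable_of_hasCompactSupport hF'c.mul_right
  have key := integral_mul_fderiv_eq_neg_fderiv_mul_of_integrable i1 i2 i3
    (fun x _ => hF'1.differentiable (by simp) x) (fun x _ => hG.differentiable (by simp) x)
  have e1 : ∀ x, conj (semiD h j F x) * G x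
      = (Complex.I * h) * (fderiv ℝ F' x (stdVec j) * G x) := fun x => by
    rw [semiD, map_mul, map_neg, map_mul, Complex.conj_I, Complex.conj_ofReal, hd]; ring
  have e2 : ∀ x, conj (F x) * semiD h j G x
      = -(Complex.I * h) * (F' x * fderiv ℝ G x (stdVec j)) := fun x => by
    rw [semiD]; ring
  simp only [e1, e2]
  rw [integral_const_mul, integral_const_mul, key]
  ring

namespace DiffOp

variable (L : DiffOp n)

/-- The coefficients of `L + h²Δ` as a sesquilinear form in the derivatives of order at most one. -/
def pertCoef : Option (Fin n) → Option (Fin n) → Eucl n → ℝ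
  | some i, some j => fun x => L.a i j x - Coefficients.aFlat i j
  | some j, none => L.b j
  | none, some j => L.b j
  | none, none => L.V

theorem bddMeas_pertCoef (o o' : Option (Fin n)) : BddMeas fun x => (L.pertCoef o o' x : ℂ) := by
  rcases o with _ | i <;> rcases o' with _ | j
  · exact L.bddMeas_V
  · exact L.bddMeas_b j
  · exact L.bddMeas_b i
  · refine ⟨(Complex.continuous_ofReal.comp ((L.a_C1 i j).continuous.sub
      continuous_const)).aestronglyMeasurable, L.B + 1, ?_⟩
    filter_upwards [L.a_le] with x hx
    rw [Complex.norm_real, Real.norm_eq_abs]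
    exact (abs_sub _ _).trans (add_le_add (hx i j) (abs_aFlat_le i j))

end DiffOp

theorem inner_testLp_left {u : L2 n} {F : Eucl n → ℂ} (hu : u =ᵐ[volume] F) (ψ : Test n) :
    inner ℂ u (testLp ψ) = ∫ x, conj (F x) * (ψ : Eucl n → ℂ) x := by
  rw [L2.inner_def]
  refine integral_congr_ae ?_
  filter_upwards [hu, coeFn_testLp ψ] with x h1 h2
  rw [RCLike.inner_apply, h1, h2, mul_comm]

theorem integral_sum₃ {ι : Type*} [Fintype ι] {f : ι → ι → Eucl n → ℂ} {g g' : ι → Eucl n → ℂ}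
    {k : Eucl n → ℂ} (hf : ∀ i j, Integrable (f i j)) (hg : ∀ j, Integrable (g j))
    (hg' : ∀ j, Integrable (g' j)) (hk : Integrable k) :
    ∫ x, ((∑ i, ∑ j, f i j x) + (∑ j, (g j x + g' j x)) + k x) =
      (∑ i, ∑ j, ∫ x, f i j x) + (∑ j, ((∫ x, g j x) + ∫ x, g' j x)) + ∫ x, k x := by
  have h1 : ∀ i, Integrable fun x => ∑ j, f i j x := fun i => integrable_finsetSum _ fun j _ => hf i j
  have h2 : Integrable fun x => ∑ i, ∑ j, f i j x := integrable_finsetSum _ fun i _ => h1 i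
  have h3 : ∀ j, Integrable fun x => g j x + g' j x := fun j => (hg j).add (hg' j)
  have h4 : Integrable fun x => ∑ j, (g j x + g' j x) := integrable_finsetSum _ fun j _ => h3 j
  have h5 : Integrable fun x => (∑ i, ∑ j, f i j x) + ∑ j, (g j x + g' j x) := h2.add h4
  rw [integral_add h5 hk, integral_add h2 h4, integral_finsetSum _ fun i _ => h1 i,
    integral_finsetSum _ fun j _ => h3 j]
  simp only [fun i => integral_finsetSum Finset.univ fun j _ => hf i j,
    fun j => integral_add (hg j) (hg' j)]

/-- The sesquilinear form of `L`. -/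
theorem integral_conj_diffExpr_mul (L : DiffOp n) (χ : Test n) {G : Eucl n → ℂ}
    (hG : ContDiff ℝ 1 G) (hc : HasCompactSupport G) :
    ∫ x, conj (diffExpr L.h L.a L.b L.V χ x) * G x =
    (∑ i, ∑ j, ∫ x, conj ((L.a i j x : ℂ) * semiD L.h j χ x) * semiD L.h i G x)
    + (∑ j, ((∫ x, conj ((L.b j x : ℂ) * semiD L.h j χ x) * G x)
      + ∫ x, conj ((L.b j x : ℂ) * (χ : Eucl n → ℂ) x) * semiD L.h j G x))
    + ∫ x, conj ((L.V x : ℂ) * (χ : Eucl n → ℂ) x) * G x := by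
  have hχ1 : ContDiff ℝ 1 (χ : Eucl n → ℂ) := χ.contDiff.of_le (by simp)
  have hDχ1 : ∀ j : Fin n, ContDiff ℝ 1 (semiD L.h j χ) := fun j =>
    (testD L.h j χ).contDiff.of_le (by simp)
  have hDχc : ∀ j : Fin n, HasCompactSupport (semiD L.h j χ) := fun j => χ.hasCompactSupport.semiD
  have ha : ∀ i j : Fin n, ContDiff ℝ 1 fun y => (L.a i j y : ℂ) * semiD L.h j χ y := fun i j =>
    (DiffOp.contDiff_ofReal (L.a_C1 i j)).mul (hDχ1 j)
  have hb : ∀ j, ContDiff ℝ 1 fun y => (L.b j y : ℂ) * (χ : Eucl n → ℂ) y := fun j =>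
    (DiffOp.contDiff_ofReal (L.b_C1 j)).mul hχ1
  have int : ∀ F : Eucl n → ℂ, Continuous F → Integrable fun x => conj (F x) * G x :=
    fun F hF => ((Complex.continuous_conj.comp hF).mul hG.continuous).integrable_of_hasCompactSupport
      hc.mul_left
  have i1 : ∀ i j : Fin n, Integrable fun x => conj (semiD L.h i
      (fun y => (L.a i j y : ℂ) * semiD L.h j χ y) x) * G x := fun i j =>
    int _ (continuous_semiD (ha i j))
  have i2 : ∀ j : Fin n, Integrable fun x => conj ((L.b j x : ℂ) * semiD L.h j χ x) * G x := fun j =>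
    int _ ((Complex.continuous_ofReal.comp (L.b_C1 j).continuous).mul (hDχ1 j).continuous)
  have i3 : ∀ j, Integrable fun x => conj (semiD L.h j
      (fun y => (L.b j y : ℂ) * (χ : Eucl n → ℂ) y) x) * G x := fun j =>
    int _ (continuous_semiD (hb j))
  have i4 : Integrable fun x => conj ((L.V x : ℂ) * (χ : Eucl n → ℂ) x) * G x := by
    obtain ⟨K, hK⟩ := L.bddMeas_V.2
    have := (int (χ : Eucl n → ℂ) hχ1.continuous).bdd_mul (c := K) L.bddMeas_V.1 hK
    refine this.congr (Eventually.of_forall fun x => ?_)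
    simp only [map_mul, Complex.conj_ofReal]
    ring
  have e1 : ∀ x, conj (diffExpr L.h L.a L.b L.V χ x) * G x =
      (∑ i, ∑ j, conj (semiD L.h i (fun y => (L.a i j y : ℂ) * semiD L.h j χ y) x) * G x)
      + (∑ j, (conj ((L.b j x : ℂ) * semiD L.h j χ x) * G x
        + conj (semiD L.h j (fun y => (L.b j y : ℂ) * (χ : Eucl n → ℂ) y) x) * G x))
      + conj ((L.V x : ℂ) * (χ : Eucl n → ℂ) x) * G x := fun x => by
    rw [diffExpr]
    simp only [map_add, map_sum, add_mul, Finset.sum_mul]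
  rw [integral_congr_ae (Eventually.of_forall e1), integral_sum₃ i1 i2 i3 i4]
  have q1 : ∀ i j : Fin n, ∫ x, conj (semiD L.h i (fun y => (L.a i j y : ℂ) * semiD L.h j χ y) x) * G x
      = ∫ x, conj ((L.a i j x : ℂ) * semiD L.h j χ x) * semiD L.h i G x := fun i j =>
    integral_conj_semiD_mul (ha i j) hG (hDχc j).mul_left L.h i
  have q2 : ∀ j, ∫ x, conj (semiD L.h j (fun y => (L.b j y : ℂ) * (χ : Eucl n → ℂ) y) x) * G x
      = ∫ x, conj ((L.b j x : ℂ) * (χ : Eucl n → ℂ) x) * semiD L.h j G x := fun j =>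
    integral_conj_semiD_mul (hb j) hG χ.hasCompactSupport.mul_left L.h j
  simp only [q1, q2]

theorem inner_op (L : DiffOp n) (χ ψ : Test n) : inner ℂ (L.op χ) (testLp ψ) =
    (∑ i, ∑ j, ∫ x, conj ((L.a i j x : ℂ) * semiD L.h j χ x) * semiD L.h i ψ x)
    + (∑ j, ((∫ x, conj ((L.b j x : ℂ) * semiD L.h j χ x) * (ψ : Eucl n → ℂ) x)
      + ∫ x, conj ((L.b j x : ℂ) * (χ : Eucl n → ℂ) x) * semiD L.h j ψ x))
    + ∫ x, conj ((L.V x : ℂ) * (χ : Eucl n → ℂ) x) * (ψ : Eucl n → ℂ) x := by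
  rw [inner_testLp_left (L.coeFn_op χ)]
  exact integral_conj_diffExpr_mul L χ (ψ.contDiff.of_le (by simp)) ψ.hasCompactSupport

theorem integral_eq_inner {w : Eucl n → ℝ} (hw : BddMeas fun x => (w x : ℂ)) (χ ψ : Test n) :
    ∫ x, conj ((w x : ℂ) * (χ : Eucl n → ℂ) x) * (ψ : Eucl n → ℂ) x
      = inner ℂ (testLp χ) (mulOp (fun x => (w x : ℂ)) (testLp ψ)) := by
  rw [inner_mulOp hw, inner_testLp_left (F := fun x => (w x : ℂ) * (χ : Eucl n → ℂ) x)]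
  have : (fun x => conj (w x : ℂ)) = fun x : Eucl n => (w x : ℂ) := by ext x; simp
  rw [this]
  exact DiffOp.coeFn_mulOp_test hw χ

/-- The form of `L + h²Δ` contains only the coefficients and derivatives of order at most one. -/
theorem inner_op_sub (L : DiffOp n) (χ ψ : Test n) :
    inner ℂ (L.op χ) (testLp ψ) - inner ℂ (testLp χ) (testLp (testLap L.h ψ)) =
      ∑ o : Option (Fin n), ∑ o' : Option (Fin n),
        inner ℂ (testLp ((lowMono o').act L.h χ)) (mulOp (fun x => (L.pertCoef o o' x : ℂ))
          (testLp ((lowMono o).act L.h ψ))) := by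
  have h1 : inner ℂ (testLp χ) (testLp (testLap L.h ψ))
      = ∑ i, inner ℂ (testLp (testD L.h i χ)) (testLp (testD L.h i ψ)) := by
    rw [testLap_apply, map_sum, inner_sum]
    refine Finset.sum_congr rfl fun i _ => ?_
    have := integral_conj_semiD_mul (F := χ) (G := testD L.h i ψ) (χ.contDiff.of_le (by simp))
      ((testD L.h i ψ).contDiff.of_le (by simp)) χ.hasCompactSupport L.h i
    rw [inner_testLp_left (coeFn_testLp _), inner_testLp_left (coeFn_testLp _)]
    simpa only [coe_testD] using this.symm
  have h2 : ∀ i j, inner ℂ (testLp (testD L.h j χ)) (mulOp (fun x => (L.pertCoef (some i) (some j) x : ℂ))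
      (testLp (testD L.h i ψ))) = inner ℂ (testLp (testD L.h j χ))
        (mulOp (fun x => (L.a i j x : ℂ)) (testLp (testD L.h i ψ)))
        - (Coefficients.aFlat i j : ℂ) * inner ℂ (testLp (testD L.h j χ)) (testLp (testD L.h i ψ)) := by
    intro i j
    rw [← inner_smul_right, ← inner_sub_right]
    congr 1
    refine Lp.ext ?_
    filter_upwards [coeFn_mulOp (L.bddMeas_pertCoef (some i) (some j)) (testLp (testD L.h i ψ)),
      coeFn_mulOp (L.bddMeas_a i j) (testLp (testD L.h i ψ)), Lp.coeFn_sub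
        (mulOp (fun x => (L.a i j x : ℂ)) (testLp (testD L.h i ψ)))
        ((Coefficients.aFlat i j : ℂ) • testLp (testD L.h i ψ)),
      Lp.coeFn_smul (Coefficients.aFlat i j : ℂ) (testLp (testD L.h i ψ))] with x e1 e2 e3 e4
    rw [e1, e3, Pi.sub_apply, e2, e4, Pi.smul_apply, smul_eq_mul, DiffOp.pertCoef]
    push_cast; ring
  have h3 : ∑ i, inner ℂ (testLp (testD L.h i χ)) (testLp (testD L.h i ψ)) = ∑ i, ∑ j,
      (Coefficients.aFlat i j : ℂ) * inner ℂ (testLp (testD L.h j χ)) (testLp (testD L.h i ψ)) := by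
    refine Finset.sum_congr rfl fun i _ => ?_
    rw [Finset.sum_eq_single i (fun j _ hj => by simp [Coefficients.aFlat, hj.symm]) (by simp)]
    simp [Coefficients.aFlat]
  rw [inner_op, h1, h3]
  simp only [Fintype.sum_option, lowMono, Mono.act, LinearMap.id_apply, h2,
    Finset.sum_sub_distrib, Finset.sum_add_distrib]
  have k1 : ∀ i j : Fin n, ∫ x, conj ((L.a i j x : ℂ) * semiD L.h j χ x) * semiD L.h i ψ x = _ :=
    fun i j => integral_eq_inner (L.bddMeas_a i j) (testD L.h j χ) (testD L.h i ψ)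
  have k2 : ∀ j : Fin n, ∫ x, conj ((L.b j x : ℂ) * semiD L.h j χ x) * (ψ : Eucl n → ℂ) x = _ :=
    fun j => integral_eq_inner (L.bddMeas_b j) (testD L.h j χ) ψ
  have k3 : ∀ j : Fin n, ∫ x, conj ((L.b j x : ℂ) * (χ : Eucl n → ℂ) x) * semiD L.h j ψ x = _ :=
    fun j => integral_eq_inner (L.bddMeas_b j) χ (testD L.h j ψ)
  have k4 := integral_eq_inner L.bddMeas_V χ ψ
  simp only [k1, k2, k3, k4, DiffOp.pertCoef]
  ring

/-- The difference of the resolvents, in divergence form: only the coefficients of the perturbation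
enter, not their derivatives. -/
theorem resolvent_sub {L : DiffOp n} {A : L2 n →ₗ.[ℂ] L2 n} {R : L2 n →L[ℂ] L2 n} {C : ℝ}
    (hR : Realizes L A R C) :
    fmul (resSym L.h (-Complex.I)) - R = ∑ o : Option (Fin n), ∑ o' : Option (Fin n),
      star (derivRes L Complex.I (lowMono o')) * (mulOp fun x => (L.pertCoef o o' x : ℂ))
        * derivRes (freeDiffOp n L.h L.mem_hRange) (-Complex.I) (lowMono o) := by
  have h0 := realizes_free (n := n) L.mem_hRange
  refine h0.neg.ext fun ψ => ?_
  refine hR.pos.dense.eq_of_inner_right ℂ fun χ => ?_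
  have e1 : fmul (resSym L.h (-Complex.I)) ((freeDiffOp n L.h L.mem_hRange).shift (-Complex.I) ψ)
      = testLp ψ := h0.neg.left_inv ψ
  rw [_root_.sub_apply, inner_sub_right, e1]
  have e2 : inner ℂ (L.shift Complex.I χ)
      (R ((freeDiffOp n L.h L.mem_hRange).shift (-Complex.I) ψ)) = inner ℂ (testLp χ)
      ((freeDiffOp n L.h L.mem_hRange).shift (-Complex.I) ψ) := by
    rw [← ContinuousLinearMap.adjoint_inner_left, ← ContinuousLinearMap.star_eq_adjoint,
      hR.pos.left_inv]
  have e3 : inner ℂ (L.shift Complex.I χ) (testLp ψ) - inner ℂ (testLp χ)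
      ((freeDiffOp n L.h L.mem_hRange).shift (-Complex.I) ψ)
      = inner ℂ (L.op χ) (testLp ψ) - inner ℂ (testLp χ) (testLp (testLap L.h ψ)) := by
    rw [DiffOp.shift_apply, freeDiffOp_shift, inner_sub_left, inner_sub_right, inner_smul_left,
      inner_smul_right, Complex.conj_I]
    ring
  rw [e2, e3, inner_op_sub]
  simp only [_root_.sum_apply, inner_sum, mul_apply_eq_comp]
  refine Finset.sum_congr rfl fun o _ => Finset.sum_congr rfl fun o' _ => ?_
  have e4 : derivRes (freeDiffOp n L.h L.mem_hRange) (-Complex.I) (lowMono o)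
      ((freeDiffOp n L.h L.mem_hRange).shift (-Complex.I) ψ) = testLp ((lowMono o).act L.h ψ) :=
    derivRes_apply h0.neg _ ψ
  rw [e4, ContinuousLinearMap.star_eq_adjoint, ContinuousLinearMap.adjoint_inner_right,
    derivRes_apply hR.pos]

/-- The coefficients of the perturbation `L + h²Δ` are `O(e⟨x⟩^{-δ})`, and their derivatives are
`O(D⟨x⟩^{-δ})`. -/
structure DiffOp.Decay (L : DiffOp n) (δ D e : ℝ) : Prop where
  coef : ∀ᵐ x, ∀ o o', |L.pertCoef o o' x| ≤ e * japanese x ^ (-δ)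
  da : ∀ᵐ x, ∀ i j, |partialDeriv i (L.a i j) x| ≤ D * japanese x ^ (-δ)
  db : ∀ᵐ x, ∀ j, |partialDeriv j (L.b j) x| ≤ D * japanese x ^ (-δ)

theorem one_le_japanese (x : Eucl n) : 1 ≤ japanese x := by
  rw [japanese, Real.one_le_sqrt]; nlinarith [sq_nonneg ‖x‖]

theorem wt_le_japanese {ε : ℝ} (h0 : 0 < ε) {s δ : ℝ} (hs : 0 ≤ s) (hδ : s ≤ δ) (x : Eucl n) :
    wt ε s x ≤ japanese x ^ δ := by
  refine le_trans ?_ (Real.rpow_le_rpow_of_exponent_le (one_le_japanese x) hδ)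
  rw [japanese_rpow]
  exact Real.rpow_le_rpow (wtSq_pos h0 x).le (wtSq_le h0 x) (by linarith)

theorem japanese_rpow_neg_mul (s : ℝ) (x : Eucl n) : japanese x ^ (-s) * japanese x ^ s = 1 := by
  rw [← Real.rpow_add (zero_lt_one.trans_le (one_le_japanese x)), neg_add_cancel, Real.rpow_zero]

/-- Weights of total order at most `δ` are absorbed by a coefficient which is `O(⟨x⟩^{-δ})`. -/
theorem norm_wop_mulOp_wop_le {ε : ℝ} (h0 : 0 < ε) (h1 : ε ≤ 1) {s₁ s₂ δ e : ℝ} (hs₁ : 0 ≤ s₁)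
    (hs₂ : 0 ≤ s₂) (hδ : s₁ + s₂ ≤ δ) (he : 0 ≤ e) {w : Eucl n → ℂ} (hw : BddMeas w)
    (hd : ∀ᵐ x, ‖w x‖ ≤ e * japanese x ^ (-δ)) : ‖wop n ε s₁ * mulOp w * wop n ε s₂‖ ≤ e := by
  have b1 := bddMeas_wt (n := n) h0 h1 s₁
  have b2 := bddMeas_wt (n := n) h0 h1 s₂
  rw [wop, wop, mulOp_mul b1 hw, mulOp_mul (b1.mul hw) b2]
  refine norm_mulOp_le ((b1.mul hw).mul b2) he ?_
  filter_upwards [hd] with x hx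
  rw [norm_mul, norm_mul, Complex.norm_real, Complex.norm_real, Real.norm_of_nonneg
    (wt_pos h0 _ x).le, Real.norm_of_nonneg (wt_pos h0 _ x).le]
  have h3 := wt_le_japanese h0 (add_nonneg hs₁ hs₂) hδ x
  rw [wt_add h0] at h3
  have h4 := wt_pos h0 s₁ x
  have h5 := wt_pos h0 s₂ x
  have h6 : 0 ≤ japanese x ^ (-δ) := Real.rpow_nonneg (Real.sqrt_nonneg _) _
  calc wt ε s₁ x * ‖w x‖ * wt ε s₂ x ≤ wt ε s₁ x * (e * japanese x ^ (-δ)) * wt ε s₂ x := by gcongr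
    _ = e * japanese x ^ (-δ) * (wt ε s₁ x * wt ε s₂ x) := by ring
    _ ≤ e * japanese x ^ (-δ) * japanese x ^ δ := by gcongr
    _ = e := by rw [mul_assoc, japanese_rpow_neg_mul, mul_one]

theorem norm_sum_option_le {E : Type*} [SeminormedAddCommGroup E] {f : Option (Fin n) → E} {c : ℝ}
    (h : ∀ o, ‖f o‖ ≤ c) : ‖∑ o, f o‖ ≤ (n + 1) * c := by
  refine (norm_sum_le_of_le _ fun o _ => h o).trans (le_of_eq ?_)
  simp

/-- The difference of the resolvents gains the decay of the coefficients. -/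
theorem exists_weighted_resolvent_sub {B C : ℝ} (hB : 1 ≤ B) (hC : 2 ≤ C) {s₁ s₂ δ : ℝ}
    (hs₁ : 0 ≤ s₁) (hs₂ : 0 ≤ s₂) (hδ : s₁ + s₂ ≤ δ) :
    ∃ K : ℝ, 0 ≤ K ∧ ∀ (L : DiffOp n) (A : L2 n →ₗ.[ℂ] L2 n) (R : L2 n →L[ℂ] L2 n) (D e : ℝ),
      0 ≤ e → L.B ≤ B → Realizes L A R C → L.Decay δ D e → ∀ ε : ℝ, 0 < ε → ε ≤ 1 →
        ‖wop n ε s₁ * (fmul (resSym L.h (-Complex.I)) - R) * wop n ε s₂‖ ≤ K * e := by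
  obtain ⟨K₁, hK₁, hb₁⟩ := exists_weighted_derivRes (n := n) (zero_le_one.trans hB)
    (zero_le_two.trans hC) ⌈s₁⌉₊ s₁ hs₁ (Nat.le_ceil _)
  obtain ⟨K₂, hK₂, hb₂⟩ := exists_weighted_derivRes (n := n) (zero_le_one.trans hB)
    (zero_le_two.trans hC) ⌈s₂⌉₊ s₂ hs₂ (Nat.le_ceil _)
  refine ⟨(n + 1) * ((n + 1) * (K₁ * K₂)), by positivity,
    fun L A R D e he hL hR hdec ε h0 h1 => ?_⟩
  have hF := (realizes_free (n := n) L.mem_hRange).mono hC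
  rw [resolvent_sub hR]
  simp only [Finset.mul_sum, Finset.sum_mul]
  rw [show ((n : ℝ) + 1) * ((n + 1) * (K₁ * K₂)) * e = (n + 1) * ((n + 1) * (K₁ * e * K₂)) by ring]
  refine norm_sum_option_le fun o => norm_sum_option_le fun o' => ?_
  set X := derivRes L Complex.I (lowMono o')
  set Y := derivRes (freeDiffOp n L.h L.mem_hRange) (-Complex.I) (lowMono o)
  set M := mulOp fun x => (L.pertCoef o o' x : ℂ)
  have e1 : wop n ε s₁ * (star X * M * Y) * wop n ε s₂ =
      (wop n ε s₁ * star X * wop n ε (-s₁)) * (wop n ε s₁ * M * wop n ε s₂)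
        * (wop n ε (-s₂) * Y * wop n ε s₂) := by
    have a1 : ∀ T : L2 n →L[ℂ] L2 n, wop n ε (-s₁) * (wop n ε s₁ * T) = T := fun T => by
      rw [← mul_assoc, wop_neg_mul h0 h1, one_mul]
    have a2 : ∀ T : L2 n →L[ℂ] L2 n, wop n ε s₂ * (wop n ε (-s₂) * T) = T := fun T => by
      rw [← mul_assoc, wop_mul_neg h0 h1, one_mul]
    simp only [mul_assoc, a1, a2]
  rw [e1]
  refine norm_mul₃_le' ?_ ?_ (hb₂ _ _ _ hB hF.neg ε h0 h1 _)
  · have := hb₁ L _ _ hL hR.pos ε h0 h1 (lowMono o')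
    rwa [← norm_star, star_mul, star_mul, star_wop h0 h1, star_wop h0 h1, ← mul_assoc] at this
  · refine norm_wop_mulOp_wop_le h0 h1 hs₁ hs₂ hδ he (L.bddMeas_pertCoef o o') ?_
    filter_upwards [hdec.coef] with x hx
    rw [Complex.norm_real, Real.norm_eq_abs]
    exact hx o o'

/-! ### Differences of functions of the operators -/

theorem pow_sub_pow_eq_sum {M : Type*} [Ring M] (u v : M) (k : ℕ) :
    u ^ k - v ^ k = ∑ l ∈ Finset.range k, u ^ l * (u - v) * v ^ (k - 1 - l) := by
  induction k with
  | zero => simp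
  | succ k ih =>
    have h1 : u ^ (k + 1) - v ^ (k + 1) = (u ^ k - v ^ k) * v + u ^ k * (u - v) := by
      rw [pow_succ, pow_succ]; noncomm_ring
    rw [h1, ih, Finset.sum_range_succ, Finset.sum_mul]
    congr 1
    · refine Finset.sum_congr rfl fun l hl => ?_
      have : k + 1 - 1 - l = (k - 1 - l) + 1 := by have := Finset.mem_range.1 hl; omega
      rw [this, pow_succ, mul_assoc _ _ v]
    · simp

/-- Weighted bounds on `U^k - V^k` by telescoping: the powers of `U` and `V` grow polynomially with
one weight each, and the single factor `U - V` carries both. -/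
theorem norm_weighted_pow_sub_le {ε : ℝ} (h0 : 0 < ε) (h1 : ε ≤ 1) {s₁ s₂ K₁ K₂ d : ℝ} {N₁ N₂ : ℕ}
    {U V : L2 n →L[ℂ] L2 n} (hK₁ : 0 ≤ K₁) (hK₂ : 0 ≤ K₂)
    (hU : ∀ k : ℕ, ‖wop n ε s₁ * U ^ k * wop n ε (-s₁)‖ ≤ K₁ * (1 + k) ^ N₁)
    (hV : ∀ k : ℕ, ‖wop n ε (-s₂) * V ^ k * wop n ε s₂‖ ≤ K₂ * (1 + k) ^ N₂)
    (hd : ‖wop n ε s₁ * (U - V) * wop n ε s₂‖ ≤ d) (k : ℕ) :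
    ‖wop n ε s₁ * (U ^ k - V ^ k) * wop n ε s₂‖ ≤ K₁ * d * K₂ * (1 + k) ^ (N₁ + N₂ + 1) := by
  have hd0 : 0 ≤ d := (norm_nonneg _).trans hd
  rw [pow_sub_pow_eq_sum, Finset.mul_sum, Finset.sum_mul]
  have hk : (0 : ℝ) ≤ k := Nat.cast_nonneg k
  have key : ∀ l ∈ Finset.range k, ‖wop n ε s₁ * (U ^ l * (U - V) * V ^ (k - 1 - l)) * wop n ε s₂‖
      ≤ K₁ * d * K₂ * (1 + k) ^ (N₁ + N₂) := by
    intro l hl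
    have hl' : (l : ℝ) ≤ k := by exact_mod_cast (Finset.mem_range.1 hl).le
    have hl2 : ((k - 1 - l : ℕ) : ℝ) ≤ k := by exact_mod_cast (by omega : k - 1 - l ≤ k)
    have e1 : wop n ε s₁ * (U ^ l * (U - V) * V ^ (k - 1 - l)) * wop n ε s₂ =
        (wop n ε s₁ * U ^ l * wop n ε (-s₁)) * (wop n ε s₁ * (U - V) * wop n ε s₂)
          * (wop n ε (-s₂) * V ^ (k - 1 - l) * wop n ε s₂) := by
      have a1 : ∀ T : L2 n →L[ℂ] L2 n, wop n ε (-s₁) * (wop n ε s₁ * T) = T := fun T => by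
        rw [← mul_assoc, wop_neg_mul h0 h1, one_mul]
      have a2 : ∀ T : L2 n →L[ℂ] L2 n, wop n ε s₂ * (wop n ε (-s₂) * T) = T := fun T => by
        rw [← mul_assoc, wop_mul_neg h0 h1, one_mul]
      simp only [mul_assoc, a1, a2]
    rw [e1]
    refine (norm_mul₃_le' (hU l) hd (hV _)).trans ?_
    calc K₁ * (1 + l) ^ N₁ * d * (K₂ * (1 + ((k - 1 - l : ℕ) : ℝ)) ^ N₂)
        ≤ K₁ * (1 + k) ^ N₁ * d * (K₂ * (1 + k) ^ N₂) := by gcongr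
      _ = _ := by rw [pow_add]; ring
  refine (norm_sum_le_of_le _ key).trans ?_
  rw [Finset.sum_const, Finset.card_range, nsmul_eq_mul, pow_succ _ (N₁ + N₂)]
  have : 0 ≤ K₁ * d * K₂ * (1 + (k : ℝ)) ^ (N₁ + N₂) := by positivity
  nlinarith

/-- `φ(A) - φ(P₀)` gains the decay of the coefficients. -/
theorem exists_weighted_funCalc_sub {B C : ℝ} (hB : 1 ≤ B) (hC : 2 ≤ C) {s₁ s₂ δ : ℝ}
    (hs₁ : 0 ≤ s₁) (hs₂ : 0 ≤ s₂) (hδ : s₁ + s₂ ≤ δ)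
    {φ : ℝ → ℂ} (hφ : ContDiff ℝ ∞ φ) (hc : HasCompactSupport φ) :
    ∃ K : ℝ, 0 ≤ K ∧ ∀ (L : DiffOp n) (A : L2 n →ₗ.[ℂ] L2 n) (R : L2 n →L[ℂ] L2 n) (D e : ℝ),
      0 ≤ e → L.B ≤ B → Realizes L A R C → L.Decay δ D e → ∀ ε : ℝ, 0 < ε → ε ≤ 1 →
        ‖wop n ε s₁ * (funCalc A φ - funCalc (freeOp n L.h) φ) * wop n ε s₂‖ ≤ K * e := by
  have hB0 := zero_le_one.trans hB
  have hC0 := zero_le_two.trans hC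
  obtain ⟨K₁, hK₁, N₁, hb₁⟩ := exists_weighted_cayPow (n := n) hB0 hC0 hs₁
  obtain ⟨K₂, hK₂, N₂, hb₂⟩ := exists_weighted_cayPow (n := n) hB0 hC0 hs₂
  obtain ⟨K, hK, hb⟩ := exists_weighted_resolvent_sub (n := n) hB hC hs₁ hs₂ hδ
  obtain ⟨K', hK', hb'⟩ := exists_weighted_resolvent_sub (n := n) (δ := δ) hB hC hs₂ hs₁
    (by rwa [add_comm])
  refine ⟨K₁ * (2 * (K + K')) * K₂ * cayConst φ (N₁ + N₂ + 1), by
    have := cayConst_nonneg φ (N₁ + N₂ + 1); positivity,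
    fun L A R D e he hL hR hdec ε h0 h1 => ?_⟩
  have hF := (realizes_free (n := n) L.mem_hRange).mono hC
  set R₀ := fmul (resSym (n := n) L.h (-Complex.I))
  have hUV : cayley R - cayley R₀ = (2 * Complex.I) • (R₀ - R) := by
    rw [cayley, cayley, smul_sub]; abel
  have n2 : ‖2 * Complex.I‖ = 2 := by simp
  have d1 : ‖wop n ε s₁ * (cayley R - cayley R₀) * wop n ε s₂‖ ≤ 2 * (K + K') * e := by
    rw [hUV, mul_smul_comm, smul_mul_assoc, norm_smul, n2]
    have := hb L A R D e he hL hR hdec ε h0 h1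
    nlinarith [mul_nonneg hK' he]
  have d2 : ‖wop n ε s₂ * (cayley R - cayley R₀) * wop n ε s₁‖ ≤ 2 * (K + K') * e := by
    rw [hUV, mul_smul_comm, smul_mul_assoc, norm_smul, n2]
    have := hb' L A R D e he hL hR hdec ε h0 h1
    nlinarith [mul_nonneg hK he]
  have c1 : ∀ k : ℕ, |(((k : ℤ) : ℝ))| = k := fun k => by simp
  have c2 : ∀ (u : L2 n →L[ℂ] L2 n) (k : ℕ), cayPow u (k : ℤ) = u ^ k := fun _ _ => rfl
  have main : ∀ k : ℤ, ‖wop n ε s₁ * (cayPow (cayley R) k - cayPow (cayley R₀) k) * wop n ε s₂‖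
      ≤ K₁ * (2 * (K + K') * e) * K₂ * (1 + |(k : ℝ)|) ^ (N₁ + N₂ + 1) := by
    -- Negative powers are the adjoints of positive ones, with the two weights exchanged.
    rintro (k | k)
    · have := norm_weighted_pow_sub_le h0 h1 hK₁ hK₂
        (fun k => by simpa only [c1, c2] using (hb₁ L A R hL hR ε h0 h1 (k : ℤ)).2)
        (fun k => by simpa only [c1, c2] using (hb₂ _ _ R₀ hB hF ε h0 h1 (k : ℤ)).1) d1 k
      simpa [cayPow] using this
    · have := norm_weighted_pow_sub_le h0 h1 hK₂ hK₁
        (fun k => by simpa only [c1, c2] using (hb₂ L A R hL hR ε h0 h1 (k : ℤ)).2)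
        (fun k => by simpa only [c1, c2] using (hb₁ _ _ R₀ hB hF ε h0 h1 (k : ℤ)).1) d2 (k + 1)
      rw [← norm_star, star_mul, star_mul, star_wop h0 h1, star_wop h0 h1, star_sub, star_pow,
        star_pow, ← mul_assoc] at this
      have e : |((Int.negSucc k : ℤ) : ℝ)| = ((k + 1 : ℕ) : ℝ) := by
        rw [Int.cast_negSucc, abs_neg, abs_of_nonneg (Nat.cast_nonneg _)]
      rw [e]
      refine this.trans (le_of_eq ?_)
      rw [add_comm N₂]; ring
  refine (norm_conj_funCalc_sub_le hR.pair hF.pair hφ hc main).trans (le_of_eq ?_)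
  ring

/-! ### The sandwiched perturbation -/

/-- The resolvent of `L` maps into the domain of `-h²Δ`, because it factors through the free
resolvent. -/
theorem IsCore.eq_free_mul {L : DiffOp n} {z : ℂ} {R : L2 n →L[ℂ] L2 n} {C : ℝ}
    (hc : IsCore L z R C) : R = fmul (resSym L.h (-Complex.I)) *
      ((∑ j, derivRes L z (.DD j j)) + Complex.I • R) := by
  have hF := realizes_free (n := n) L.mem_hRange
  refine hc.ext fun ψ => ?_
  simp only [mul_apply_eq_comp, _root_.add_apply, _root_.sum_apply, _root_.smul_apply,
    derivRes_apply hc, hc.left_inv]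
  have h1 := hF.neg.left_inv ψ
  rw [freeDiffOp_shift, testLap_apply, map_sum, neg_smul, sub_neg_eq_add] at h1
  exact h1.symm

theorem IsCore.mem_free_domain {L : DiffOp n} {z : ℂ} {R : L2 n →L[ℂ] L2 n} {C : ℝ}
    (hc : IsCore L z R C) (f : L2 n) : R f ∈ (freeOp n L.h).domain := by
  rw [hc.eq_free_mul]
  exact (realizes_free L.mem_hRange).pair.mem_domain _

/-- `φ(P₀)(A - P₀)φ(A)` is everywhere defined and is given by the difference of the resolvents. -/
theorem sandwich_funCalc {L : DiffOp n} {A : L2 n →ₗ.[ℂ] L2 n} {R : L2 n →L[ℂ] L2 n} {C : ℝ}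
    (hR : Realizes L A R C) {φ : ℝ → ℂ} (hφ : ContDiff ℝ ∞ φ) (hc : HasCompactSupport φ) (g : L2 n) :
    ∃ hg : g ∈ (sandwich (funCalc (freeOp n L.h) φ) (A - freeOp n L.h) (funCalc A φ)).domain,
      sandwich (funCalc (freeOp n L.h) φ) (A - freeOp n L.h) (funCalc A φ) ⟨g, hg⟩ =
        (funCalc (freeOp n L.h) (addI φ) * (fmul (resSym L.h (-Complex.I)) - R)
          * funCalc A (addI φ) : L2 n →L[ℂ] L2 n) g := by
  have hF := realizes_free (n := n) L.mem_hRange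
  set R₀ := fmul (resSym (n := n) L.h (-Complex.I))
  set v := funCalc A (addI φ) g
  have e1 : funCalc A φ g = R v := by rw [funCalc_eq_mul hR.pair hφ hc]; rfl
  have m1 := hR.pair.mem_domain v
  have m2 := hR.neg.mem_free_domain v
  have hg : g ∈ (sandwich (funCalc (freeOp n L.h) φ) (A - freeOp n L.h) (funCalc A φ)).domain := by
    change funCalc A φ g ∈ A.domain ⊓ (freeOp n L.h).domain
    rw [e1]
    exact ⟨m1, m2⟩
  refine ⟨hg, ?_⟩
  have congrA : ∀ (T : L2 n →ₗ.[ℂ] L2 n) (u u' : T.domain), (u : L2 n) = u' → T u = T u' :=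
    fun T u u' h => congrArg T (Subtype.ext h)
  have m1' : funCalc A φ g ∈ A.domain := by rwa [e1]
  have m2' : funCalc A φ g ∈ (freeOp n L.h).domain := by rwa [e1]
  change funCalc (freeOp n L.h) φ (A ⟨funCalc A φ g, m1'⟩ - freeOp n L.h ⟨funCalc A φ g, m2'⟩) = _
  rw [congrA A ⟨_, m1'⟩ ⟨R v, m1⟩ e1, congrA (freeOp n L.h) ⟨_, m2'⟩ ⟨R v, m2⟩ e1, hR.pair.apply,
    funCalc_eq_mul' hF.pair hφ hc]
  have e2 := hF.pair.neg.2 ⟨R v, m2⟩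
  simp only [neg_smul, sub_neg_eq_add] at e2
  simp only [mul_apply_eq_comp, _root_.sub_apply]
  congr 1
  have e3 : v - Complex.I • R v - freeOp n L.h ⟨R v, m2⟩
      = v - (freeOp n L.h ⟨R v, m2⟩ + Complex.I • R v) := by abel
  rw [e3, map_sub, e2]

/-- `φ(P₀)(A - P₀)φ(A) = ψ(P₀)(R₀ - R)ψ(A)` with `ψ(t) = (t + i)φ(t)` gains the decay of the
coefficients. -/
theorem exists_weighted_sandwich {B C : ℝ} (hB : 1 ≤ B) (hC : 2 ≤ C) {s₁ s₂ δ : ℝ}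
    (hs₁ : 0 ≤ s₁) (hs₂ : 0 ≤ s₂) (hδ : s₁ + s₂ ≤ δ)
    {φ : ℝ → ℂ} (hφ : ContDiff ℝ ∞ φ) (hc : HasCompactSupport φ) :
    ∃ K : ℝ, 0 ≤ K ∧ ∀ (L : DiffOp n) (A : L2 n →ₗ.[ℂ] L2 n) (R : L2 n →L[ℂ] L2 n) (D e : ℝ),
      0 ≤ e → L.B ≤ B → Realizes L A R C → L.Decay δ D e →
        WeightedBound 2 s₁ (sandwich (funCalc (freeOp n L.h) φ) (A - freeOp n L.h) (funCalc A φ)) s₂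
          (K * e) := by
  have hB0 := zero_le_one.trans hB
  have hC0 := zero_le_two.trans hC
  have hφ' := addI_contDiff hφ
  have hc' := addI_hasCompactSupport hc
  obtain ⟨K₁, hK₁, hb₁⟩ := exists_weighted_funCalc (n := n) hB0 hC0 hs₁ hφ' hc'
  obtain ⟨K₂, hK₂, hb₂⟩ := exists_weighted_funCalc (n := n) hB0 hC0 hs₂ hφ' hc'
  obtain ⟨K, hK, hb⟩ := exists_weighted_resolvent_sub (n := n) hB hC hs₁ hs₂ hδ
  refine ⟨K₁ * K * K₂, by positivity, fun L A R D e he hL hR hdec f g hfg => ?_⟩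
  obtain ⟨hg, hgT⟩ := sandwich_funCalc hR hφ hc g
  refine ⟨hg, ?_⟩
  rw [hgT]
  refine eLpNorm_le_of_weights hs₂ (fun ε h0 h1 => ?_) hfg
  have hF := (realizes_free (n := n) L.mem_hRange).mono hC
  set X := funCalc (freeOp n L.h) (addI φ)
  set Y := funCalc A (addI φ)
  set M := fmul (resSym (n := n) L.h (-Complex.I)) - R
  have e1 : wop n ε s₁ * (X * M * Y) * wop n ε s₂ =
      (wop n ε s₁ * X * wop n ε (-s₁)) * (wop n ε s₁ * M * wop n ε s₂)
        * (wop n ε (-s₂) * Y * wop n ε s₂) := by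
    have a1 : ∀ T : L2 n →L[ℂ] L2 n, wop n ε (-s₁) * (wop n ε s₁ * T) = T := fun T => by
      rw [← mul_assoc, wop_neg_mul h0 h1, one_mul]
    have a2 : ∀ T : L2 n →L[ℂ] L2 n, wop n ε s₂ * (wop n ε (-s₂) * T) = T := fun T => by
      rw [← mul_assoc, wop_mul_neg h0 h1, one_mul]
    simp only [mul_assoc, a1, a2]
  rw [e1]
  refine (norm_mul₃_le' (hb₁ _ _ _ hB hF ε h0 h1).2 (hb L A R D e he hL hR hdec ε h0 h1)
    (hb₂ L A R hL hR ε h0 h1).1).trans (le_of_eq ?_)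
  ring

/-! ### The operators of the given family -/

theorem le_of_sum₄ {ι : Type*} [Fintype ι] {f : ι → ι → ℝ} {g : ι → ℝ} {v w c : ℝ}
    (hf : ∀ i j, 0 ≤ f i j) (hg : ∀ j, 0 ≤ g j) (hv : 0 ≤ v) (hw : 0 ≤ w)
    (h : (∑ i, ∑ j, f i j) + (∑ j, g j) + v + w ≤ c) :
    (∀ i j, f i j ≤ c) ∧ (∀ j, g j ≤ c) ∧ v + w ≤ c := by
  have h1 : 0 ≤ ∑ i, ∑ j, f i j := Finset.sum_nonneg fun i _ => Finset.sum_nonneg fun j _ => hf i j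
  have h2 : 0 ≤ ∑ j, g j := Finset.sum_nonneg fun j _ => hg j
  refine ⟨fun i j => ?_, fun j => ?_, by linarith⟩
  · have h3 : f i j ≤ ∑ j, f i j :=
      Finset.single_le_sum (f := fun j => f i j) (fun j _ => hf i j) (Finset.mem_univ j)
    have h4 : ∑ j, f i j ≤ ∑ i, ∑ j, f i j :=
      Finset.single_le_sum (f := fun i => ∑ j, f i j) (fun i _ => Finset.sum_nonneg fun j _ => hf i j)
        (Finset.mem_univ i)
    linarith
  · have h3 : g j ≤ ∑ j, g j := Finset.single_le_sum (fun j _ => hg j) (Finset.mem_univ j)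
    linarith

/-- All coefficients of the perturbation are `O(h^ν⟨x⟩^{-δ})`. -/
theorem exists_coef_decay {c : Coefficients n} {δ : ℝ} (hs : c.ShortRange δ) :
    ∃ E : ℝ, 0 ≤ E ∧ ∀ h ∈ hRange, ∀ᵐ x : Eucl n,
      (∀ i j, |c.a h i j x - Coefficients.aFlat i j| ≤ E * h ^ c.nu δ * japanese x ^ (-δ)) ∧
      (∀ j, |c.b h j x| ≤ E * h ^ c.nu δ * japanese x ^ (-δ)) ∧
      |c.V h x| ≤ E * h ^ c.nu δ * japanese x ^ (-δ) := by
  have hJ : ∀ x : Eucl n, 0 ≤ japanese x ^ (-δ) := fun x => Real.rpow_nonneg (Real.sqrt_nonneg _) _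
  -- If the principal part is trivial, the coefficients are `h` times the remainders, which are
  -- `O(h^k)` with `k = ν - 1`.
  have small : ∀ k : ℕ, c.TrivialPrincipalPart → c.RemainderDecay δ k →
      ∃ E : ℝ, 0 ≤ E ∧ ∀ h ∈ hRange, ∀ᵐ x : Eucl n,
      (∀ i j, |c.a h i j x - Coefficients.aFlat i j| ≤ E * h ^ (k + 1) * japanese x ^ (-δ)) ∧
      (∀ j, |c.b h j x| ≤ E * h ^ (k + 1) * japanese x ^ (-δ)) ∧
      |c.V h x| ≤ E * h ^ (k + 1) * japanese x ^ (-δ) := by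
    rintro k ⟨ha, hb, hV⟩ ⟨C, hC⟩
    refine ⟨|C|, abs_nonneg C, fun h hh => ?_⟩
    filter_upwards [hC h hh] with x hx
    have h0 := hh.1
    have hx' : (∑ i, ∑ j, |c.a1 h i j x|) + (∑ j, |c.b1 h j x|) + |c.V1 h x| + 0
        ≤ |C| * h ^ k * japanese x ^ (-δ) := by
      rw [add_zero]
      refine hx.trans ?_
      have := hJ x
      gcongr
      exact le_abs_self C
    obtain ⟨k1, k2, k3⟩ := le_of_sum₄ (fun _ _ => abs_nonneg _) (fun _ => abs_nonneg _)
      (abs_nonneg _) le_rfl hx'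
    have key : ∀ t : ℝ, |t| ≤ |C| * h ^ k * japanese x ^ (-δ) →
        |h * t| ≤ |C| * h ^ (k + 1) * japanese x ^ (-δ) := fun t ht => by
      rw [abs_mul, abs_of_pos h0, pow_succ]
      calc h * |t| ≤ h * (|C| * h ^ k * japanese x ^ (-δ)) := by gcongr
        _ = _ := by ring
    refine ⟨fun i j => ?_, fun j => ?_, ?_⟩
    · rw [Coefficients.a, ha, add_sub_cancel_left]; exact key _ (k1 i j)
    · rw [Coefficients.b, hb, zero_add]; exact key _ (k2 j)
    · rw [Coefficients.V, hV, zero_add]; exact key _ (by linarith)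
  unfold Coefficients.nu
  split_ifs with h2 h1
  · exact small 1 h2.1 h2.2
  · exact small 0 h1.1 h1.2
  · obtain ⟨C, hC⟩ := hs
    refine ⟨|C|, abs_nonneg C, fun h hh => ?_⟩
    filter_upwards [hC h hh] with x hx
    obtain ⟨k1, k2, k3⟩ := le_of_sum₄ (fun _ _ => abs_nonneg _) (fun _ => abs_nonneg _)
      (abs_nonneg _) (abs_nonneg _) hx.1
    have hC' : C * japanese x ^ (-δ) ≤ |C| * h ^ 0 * japanese x ^ (-δ) := by
      rw [pow_zero, mul_one]
      exact mul_le_mul_of_nonneg_right (le_abs_self C) (hJ x)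
    refine ⟨fun i j => (k1 i j).trans hC', fun j => (k2 j).trans hC', ?_⟩
    refine ((abs_add_le _ _).trans ?_).trans (k3.trans hC')
    rw [abs_mul, abs_of_pos hh.1]
    have := mul_le_of_le_one_left (abs_nonneg (c.V1 h x)) hh.2
    linarith

theorem partialDeriv_sub_const (k : Fin n) (f : Eucl n → ℝ) (t : ℝ) (x : Eucl n) :
    partialDeriv k (fun y => f y - t) x = partialDeriv k f x := by
  rw [partialDeriv, partialDeriv, fderiv_sub_const]

/-- The operators `P(h)` as differential operators with uniformly bounded coefficients. The
principal coefficients are transposed, as in the formal adjoint. -/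
theorem exists_diffOp {c : Coefficients n} {δ : ℝ} (hδ : 0 ≤ δ) (hr : c.Regular)
    (hs : c.ShortRange δ) : ∃ D : ℝ, 0 ≤ D ∧ ∀ h ∈ hRange, ∃ L : DiffOp n, L.h = h ∧
      (L.a = fun i j => c.a h j i) ∧ L.b = c.b h ∧ L.V = c.V h ∧ L.B = D + 1 ∧
      L.Decay δ D (D * h ^ c.nu δ) := by
  obtain ⟨E, hE, hcoef⟩ := exists_coef_decay hs
  obtain ⟨C, hC⟩ := hs
  set D := |C| + E with hD
  have hCD : |C| ≤ D := by linarith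
  have hED : E ≤ D := by linarith [abs_nonneg C]
  have hD0 : 0 ≤ D := hE.trans hED
  refine ⟨D, hD0, fun h hh => ?_⟩
  have h0 := hh.1
  have hJ : ∀ x : Eucl n, 0 ≤ japanese x ^ (-δ) := fun x => Real.rpow_nonneg (Real.sqrt_nonneg _) _
  have hJ1 : ∀ x : Eucl n, japanese x ^ (-δ) ≤ 1 := fun x =>
    Real.rpow_le_one_of_one_le_of_nonpos (one_le_japanese x) (by linarith)
  have hcf : ∀ᵐ x : Eucl n,
      (∀ i j, |c.a h i j x - Coefficients.aFlat i j| ≤ D * h ^ c.nu δ * japanese x ^ (-δ)) ∧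
      (∀ j, |c.b h j x| ≤ D * h ^ c.nu δ * japanese x ^ (-δ)) ∧
      |c.V h x| ≤ D * h ^ c.nu δ * japanese x ^ (-δ) := by
    filter_upwards [hcoef h hh] with x hx
    have : E * h ^ c.nu δ * japanese x ^ (-δ) ≤ D * h ^ c.nu δ * japanese x ^ (-δ) := by
      have := hJ x
      gcongr
    exact ⟨fun i j => (hx.1 i j).trans this, fun j => (hx.2.1 j).trans this, hx.2.2.trans this⟩
  have hle : ∀ x : Eucl n, D * h ^ c.nu δ * japanese x ^ (-δ) ≤ D := fun x => by
    have h1 : h ^ c.nu δ ≤ 1 := pow_le_one₀ h0.le hh.2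
    calc D * h ^ c.nu δ * japanese x ^ (-δ) ≤ D * 1 * 1 := by
          have := hJ x
          gcongr
          exact hJ1 x
      _ = D := by ring
  have hdv : ∀ᵐ x : Eucl n, (∀ k i j, |partialDeriv k (c.a h i j) x| ≤ D * japanese x ^ (-δ)) ∧
      ∀ k j, |partialDeriv k (c.b h j) x| ≤ D * japanese x ^ (-δ) := by
    filter_upwards [hC h hh] with x hx
    have : C * japanese x ^ (-δ) ≤ D * japanese x ^ (-δ) :=
      mul_le_mul_of_nonneg_right ((le_abs_self C).trans hCD) (hJ x)
    have h1 := fun k => le_of_sum₄ (fun _ _ => abs_nonneg _) (fun _ => abs_nonneg _)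
      (abs_nonneg _) (abs_nonneg _) (hx.2 k)
    refine ⟨fun k i j => ?_, fun k j => ((h1 k).2.1 j).trans this⟩
    have := ((h1 k).1 i j).trans this
    rwa [partialDeriv_sub_const] at this
  have hle' : ∀ x : Eucl n, D * japanese x ^ (-δ) ≤ D := fun x =>
    mul_le_of_le_one_right hD0 (hJ1 x)
  refine ⟨{ h := h, a := fun i j => c.a h j i, b := c.b h, V := c.V h, B := D + 1, h_pos := h0,
            h_le := hh.2, B_nonneg := by linarith, a_C1 := fun i j => hr.a_C1 h hh j i,
            b_C1 := hr.b_C1 h hh, V_meas := ?_, a_le := ?_, da_le := ?_, b_le := ?_, db_le := ?_,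
            V_le := ?_ }, rfl, rfl, rfl, rfl, rfl, ?_, ?_, ?_⟩
  · exact hr.V0_C1.continuous.aestronglyMeasurable.add ((hr.V1_meas h hh).const_mul h)
  · filter_upwards [hcf] with x hx i j
    have h1 := (hx.1 j i).trans (hle x)
    have h2 := abs_aFlat_le j i
    have h3 := abs_add_le (c.a h j i x - Coefficients.aFlat j i) (Coefficients.aFlat j i)
    rw [sub_add_cancel] at h3
    linarith
  · filter_upwards [hdv] with x hx k i j
    linarith [(hx.1 k j i).trans (hle' x)]
  · filter_upwards [hcf] with x hx j
    linarith [(hx.2.1 j).trans (hle x)]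
  · filter_upwards [hdv] with x hx k j
    linarith [(hx.2 k j).trans (hle' x)]
  · filter_upwards [hcf] with x hx
    linarith [hx.2.2.trans (hle x)]
  · filter_upwards [hcf] with x hx o o'
    rcases o with _ | i <;> rcases o' with _ | j
    · exact hx.2.2
    · exact hx.2.1 j
    · exact hx.2.1 i
    · have : Coefficients.aFlat i j = Coefficients.aFlat j i := by
        simp only [Coefficients.aFlat, eq_comm]
      change |c.a h j i x - Coefficients.aFlat i j| ≤ _
      rw [this]
      exact hx.1 j i
  · filter_upwards [hdv] with x hx i j
    exact hx.1 i j i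
  · filter_upwards [hdv] with x hx j
    exact hx.2 j j

/-- The operators `P(h)` are realizations of differential operators with uniform constants. -/
theorem exists_realizes {c : Coefficients n} {δ : ℝ} {P : ℝ → L2 n →ₗ.[ℂ] L2 n} (hδ : 0 ≤ δ)
    (hr : c.Regular) (hP : ∀ h ∈ hRange, IsSelfAdjointRealization c h (P h)) (hell : Elliptic P)
    (hs : c.ShortRange δ) : ∃ D C : ℝ, 0 ≤ D ∧ 2 ≤ C ∧ ∀ h ∈ hRange, ∃ L : DiffOp n, L.h = h ∧
      (L.a = fun i j => c.a h j i) ∧ L.B ≤ D + 1 ∧ L.Decay δ D (D * h ^ c.nu δ) ∧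
      Realizes L (P h) (resolventOp (P h) (-Complex.I)) C := by
  obtain ⟨D, hD, hL⟩ := exists_diffOp hδ hr hs
  obtain ⟨C, hC⟩ := hell
  refine ⟨D, max C 2, hD, le_max_right _ _, fun h hh => ?_⟩
  obtain ⟨L, rfl, ha, hb, hV, hB, hdec⟩ := hL h hh
  refine ⟨L, rfl, ha, hB.le, hdec, ?_⟩
  have hpair := isResolventPair_of_isSelfAdjoint (hP L.h hh).1
  have hcore : ∀ z : ℂ, (z = Complex.I ∨ z = -Complex.I) →
      IsCore L z (resolventOp (P L.h) z) (max C 2) := by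
    intro z hz
    have hz0 : z.re = 0 := by rcases hz with rfl | rfl <;> simp
    have hz1 : ‖z‖ = 1 := by rcases hz with rfl | rfl <;> simp
    refine isCore_perturbed (hP L.h hh) ha hb hV hz0 hz1 (zero_le_two.trans (le_max_right _ _))
      fun k hk m f => ?_
    obtain ⟨g, h1, h2⟩ := hC L.h hh z hz k hk m f
    exact ⟨g, h1, h2.trans (by gcongr; exact le_max_left _ _)⟩
  refine ⟨hpair, hcore _ (Or.inr rfl), ?_⟩
  rw [← resolventOp_eq hpair.pos]
  exact hcore _ (Or.inl rfl)

/-! ### Pointwise bounds for functions of the free operator -/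

section FreeKernel

open Convolution

theorem exists_subseq_ae {u : ℕ → L2 n} {v : L2 n} (h : Tendsto u atTop (𝓝 v)) :
    ∃ ns : ℕ → ℕ, StrictMono ns ∧ ∀ᵐ x, Tendsto (fun k => u (ns k) x) atTop (𝓝 (v x)) :=
  (tendstoInMeasure_of_tendsto_Lp h).exists_seq_tendsto_ae

theorem denseRange_testLp : DenseRange (testLp : Test n → L2 n) := by
  refine DenseRange.of_exists_norm_lt fun f ε hε => ?_
  obtain ⟨ψ, hψ⟩ := dense_free one_pos isFar_neg_one f hε
  refine ⟨testLap 1 ψ - (-1 : ℂ) • ψ, ?_⟩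
  rwa [map_sub, map_smul]

/-- A bound `L² → L^∞` may be checked on a dense family. -/
theorem ae_bound_of_denseRange {ι : Type*} {v : ι → L2 n} (hv : DenseRange v) {T : L2 n →L[ℂ] L2 n}
    {K : ℝ} (h : ∀ i, ∀ᵐ x, ‖T (v i) x‖ ≤ K * ‖v i‖) (f : L2 n) :
    ∀ᵐ x, ‖T f x‖ ≤ K * ‖f‖ := by
  obtain ⟨ψ, hψ⟩ : ∃ ψ : ℕ → ι, Tendsto (fun k => v (ψ k)) atTop (𝓝 f) := by
    obtain ⟨u, hu, hlim⟩ := mem_closure_iff_seq_limit.1 (hv f)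
    choose ψ hψ using hu
    exact ⟨ψ, by simpa only [hψ] using hlim⟩
  obtain ⟨ns, hns, hae⟩ := exists_subseq_ae ((T.continuous.tendsto f).comp hψ)
  have hall : ∀ᵐ x, ∀ k, ‖T (v (ψ k)) x‖ ≤ K * ‖v (ψ k)‖ := by
    rw [ae_all_iff]; exact fun k => h _
  filter_upwards [hae, hall] with x h1 h2
  refine le_of_tendsto_of_tendsto' h1.norm ((hψ.comp hns.tendsto_atTop).norm.const_mul K)
    fun k => h2 _

/-- Peetre's inequality for the regularized weights. -/
theorem wt_le_mul_wt {ε : ℝ} (h0 : 0 < ε) {s : ℝ} (hs : 0 ≤ s) {m : ℕ} (hm : s ≤ m) (x y : Eucl n) :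
    wt ε s y ≤ (2 * (1 + ‖x - y‖ ^ 2)) ^ m * wt ε s x := by
  have h1 : wtSq ε y ≤ 2 * (1 + ‖x - y‖ ^ 2) * wtSq ε x := by
    have hy : ‖y‖ ≤ ‖x‖ + ‖x - y‖ := by
      have := norm_sub_norm_le y x
      rw [norm_sub_rev] at this
      linarith
    have hq : 1 + ‖y‖ ^ 2 ≤ 2 * (1 + ‖x - y‖ ^ 2) * (1 + ‖x‖ ^ 2) := by
      have : ‖y‖ ^ 2 ≤ (‖x‖ + ‖x - y‖) ^ 2 := pow_le_pow_left₀ (norm_nonneg _) hy 2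
      nlinarith [sq_nonneg (‖x‖ - ‖x - y‖), sq_nonneg (‖x‖ * ‖x - y‖), sq_nonneg ‖x‖,
        sq_nonneg ‖x - y‖]
    rw [wtSq, wtSq, ← mul_div_assoc, div_le_div_iff₀ (by positivity) (by positivity)]
    have hpq : 0 ≤ ε * ((1 + ‖x‖ ^ 2) * (1 + ‖y‖ ^ 2)) := by positivity
    have hc : 0 ≤ (2 * (1 + ‖x - y‖ ^ 2) - 1) := by nlinarith [sq_nonneg ‖x - y‖]
    nlinarith [mul_nonneg hpq hc]
  have h2 : 1 ≤ 2 * (1 + ‖x - y‖ ^ 2) := by nlinarith [sq_nonneg ‖x - y‖]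
  calc wt ε s y ≤ (2 * (1 + ‖x - y‖ ^ 2) * wtSq ε x) ^ (s / 2) :=
        Real.rpow_le_rpow (wtSq_pos h0 y).le h1 (by linarith)
    _ = (2 * (1 + ‖x - y‖ ^ 2)) ^ (s / 2) * wt ε s x := by
        rw [Real.mul_rpow (by positivity) (wtSq_pos h0 x).le, wt]
    _ ≤ (2 * (1 + ‖x - y‖ ^ 2)) ^ (m : ℝ) * wt ε s x := by
        have := wt_pos h0 s x
        refine mul_le_mul_of_nonneg_right (Real.rpow_le_rpow_of_exponent_le h2 ?_) this.le
        linarith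
    _ = _ := by rw [Real.rpow_natCast]

/-- The dilation `ξ ↦ W(hξ)` of a test function. -/
def dilate (W : Test n) {h : ℝ} (h0 : 0 < h) : Test n := ⟨_, W.comp_smul h0.ne'⟩

theorem dilate_apply (W : Test n) {h : ℝ} (h0 : 0 < h) (ξ : Eucl n) :
    (dilate W h0 : Eucl n → ℂ) ξ = (W : Eucl n → ℂ) (h • ξ) := rfl

theorem Test.bddMeas (ψ : Test n) : BddMeas (ψ : Eucl n → ℂ) := by
  obtain ⟨C, -, hC⟩ := ψ.bounded
  exact BddMeas.of_continuous ψ.continuous hC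

theorem fourierInv_dilate (W : Test n) {h : ℝ} (h0 : 0 < h) (z : Eucl n) :
    𝓕⁻ (testToSchwartz (dilate W h0)) z = ((h ^ n)⁻¹ : ℝ) * 𝓕⁻ (testToSchwartz W) (h⁻¹ • z) := by
  rw [SchwartzMap.fourierInv_coe, SchwartzMap.fourierInv_coe, Real.fourierInv_eq, Real.fourierInv_eq]
  set G : Eucl n → ℂ := fun v => Real.fourierChar (inner ℝ v (h⁻¹ • z)) • testToSchwartz W v with hG
  have e1 : ∀ v : Eucl n, Real.fourierChar (inner ℝ v z) • testToSchwartz (dilate W h0) v =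
      G (h • v) := by
    intro v
    simp only [hG, testToSchwartz_apply, dilate_apply]
    rw [real_inner_smul_left, real_inner_smul_right, mul_inv_cancel_left₀ h0.ne']
  rw [integral_congr_ae (Eventually.of_forall e1), Measure.integral_comp_smul volume G h,
    finrank_euclideanSpace_fin, abs_of_pos (by positivity), Complex.real_smul]

/-- A Fourier multiplier acts on test functions by convolution. -/
theorem fmul_test_eq (W ψ : Test n) : ∀ᵐ x, fmul (W : Eucl n → ℂ) (testLp ψ) x =
    ∫ t, 𝓕⁻ (testToSchwartz W) t * (ψ : Eucl n → ℂ) (x - t) := by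
  set S := SchwartzMap.convolution (ContinuousLinearMap.mul ℂ ℂ) (𝓕⁻ (testToSchwartz W))
    (testToSchwartz ψ) with hS
  have e : fmul (W : Eucl n → ℂ) (testLp ψ) = schLp S := by
    rw [fmul_eq_iff W.bddMeas, ← toLp_testToSchwartz]
    filter_upwards [fourier_schLp S, fourier_schLp (testToSchwartz ψ)] with ξ h1 h2
    rw [h1]
    change _ = _ * 𝓕 (schLp (testToSchwartz ψ)) ξ
    rw [h2, hS, SchwartzMap.fourier_convolution, fourier_fourierInv_eq]
    simp
  rw [e]
  filter_upwards [S.coeFn_toLp 2 volume] with x hx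
  rw [schLp, hx, hS, SchwartzMap.convolution_apply, convolution_def]
  simp

/-- The functions `W(hD)` map `L²` to `L^∞` in weighted spaces, with norm `O(h^{-n/2})`: the
convolution kernel is a dilated Schwartz function, which absorbs the quotient of the weights by
Peetre's inequality. -/
theorem exists_kernel_bound (W : Test n) {s : ℝ} (hs : 0 ≤ s) : ∃ K : ℝ, 0 ≤ K ∧
    ∀ h ∈ hRange, ∀ ε : ℝ, 0 < ε → ε ≤ 1 → ∀ f : L2 n, ∀ᵐ x,
      ‖wop n ε (-s) (fmul (fun ξ => (W : Eucl n → ℂ) (h • ξ)) (wop n ε s f)) x‖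
        ≤ K * h ^ (-(n : ℝ) / 2) * ‖f‖ := by
  set m := ⌈s⌉₊
  set q : Eucl n → ℂ := fun t => (2 * (1 + ((‖t‖ ^ 2 : ℝ) : ℂ))) ^ m with hq
  have hqt : q.HasTemperateGrowth := by rw [hq]; fun_prop
  set κ : 𝓢(Eucl n, ℂ) := 𝓕⁻ (testToSchwartz W) with hκ
  set S : 𝓢(Eucl n, ℂ) := SchwartzMap.smulLeftCLM ℂ q κ with hS
  have hSn : ∀ t, ‖S t‖ = (2 * (1 + ‖t‖ ^ 2)) ^ m * ‖κ t‖ := fun t => by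
    rw [hS, SchwartzMap.smulLeftCLM_apply_apply hqt, smul_eq_mul, norm_mul, hq, norm_pow]
    congr 2
    rw [show (2 * (1 + ((‖t‖ ^ 2 : ℝ) : ℂ))) = ((2 * (1 + ‖t‖ ^ 2) : ℝ) : ℂ) by push_cast; ring,
      Complex.norm_real, Real.norm_of_nonneg (by positivity)]
  refine ⟨‖schLp S‖, norm_nonneg _, fun h hh ε h0 h1 f => ?_⟩
  have hpos := hh.1
  have hw : (fun ξ => (W : Eucl n → ℂ) (h • ξ)) = (dilate W hpos : Eucl n → ℂ) := rfl
  rw [hw]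
  have main : ∀ ψ : Test n, ∀ᵐ x, ‖(wop n ε (-s) * fmul (dilate W hpos : Eucl n → ℂ) * wop n ε s)
      (testLp ψ) x‖ ≤ ‖schLp S‖ * h ^ (-(n : ℝ) / 2) * ‖testLp ψ‖ := by
    intro ψ
    simp only [mul_apply_eq_comp]
    rw [← testLp_wtTest h0 h1]
    filter_upwards [coeFn_mulOp (bddMeas_wt h0 h1 (-s))
      (fmul (dilate W hpos : Eucl n → ℂ) (testLp (wtTest n h0 s ψ))),
      fmul_test_eq (dilate W hpos) (wtTest n h0 s ψ)] with x e1 e2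
    rw [wop, e1, e2, norm_mul, Complex.norm_real, Real.norm_of_nonneg (wt_pos h0 _ x).le]
    have hwx := wt_pos h0 s x
    -- the integrand is bounded by the product of a dilate of `S` and a translate of `ψ`
    have b1 : ∀ t, ‖𝓕⁻ (testToSchwartz (dilate W hpos)) t * (wtTest n h0 s ψ : Eucl n → ℂ) (x - t)‖
        ≤ wt ε s x * (h ^ n)⁻¹ * (‖S (h⁻¹ • t)‖ * ‖(ψ : Eucl n → ℂ) (x - t)‖) := by
      intro t
      rw [fourierInv_dilate, norm_mul, norm_mul, Complex.norm_real,
        Real.norm_of_nonneg (by positivity), wtTest_apply, norm_mul, Complex.norm_real,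
        Real.norm_of_nonneg (wt_pos h0 _ _).le, hSn]
      have p1 := wt_le_mul_wt h0 hs (Nat.le_ceil s) x (x - t)
      rw [sub_sub_cancel] at p1
      -- Since `h ≤ 1`, the polynomial in `t` is bounded by the one in `t/h` that is part of
      -- `S(t/h)`.
      have p2 : ‖t‖ ≤ ‖h⁻¹ • t‖ := by
        rw [norm_smul, norm_inv, Real.norm_of_nonneg hpos.le]
        exact le_mul_of_one_le_left (norm_nonneg _) (one_le_inv₀ hpos |>.2 hh.2)
      have p3 : (2 * (1 + ‖t‖ ^ 2)) ^ m ≤ (2 * (1 + ‖h⁻¹ • t‖ ^ 2)) ^ m := by gcongr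
      have p4 : wt ε s (x - t) ≤ (2 * (1 + ‖h⁻¹ • t‖ ^ 2)) ^ m * wt ε s x :=
        p1.trans (mul_le_mul_of_nonneg_right p3 hwx.le)
      calc (h ^ n)⁻¹ * ‖κ (h⁻¹ • t)‖ * (wt ε s (x - t) * ‖(ψ : Eucl n → ℂ) (x - t)‖)
          ≤ (h ^ n)⁻¹ * ‖κ (h⁻¹ • t)‖ * ((2 * (1 + ‖h⁻¹ • t‖ ^ 2)) ^ m * wt ε s x
            * ‖(ψ : Eucl n → ℂ) (x - t)‖) := by gcongr
        _ = _ := by ring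
    have two : ENNReal.ofReal 2 = 2 := by simp
    have cS : Continuous fun t : Eucl n => S (h⁻¹ • t) := S.continuous.comp (continuous_const_smul _)
    have cψ : Continuous fun t : Eucl n => (ψ : Eucl n → ℂ) (x - t) :=
      ψ.continuous.comp (continuous_const.sub continuous_id)
    have sψ : HasCompactSupport fun t : Eucl n => (ψ : Eucl n → ℂ) (x - t) :=
      ψ.hasCompactSupport.comp_homeomorph (Homeomorph.subLeft x)
    have iS : Integrable fun t : Eucl n => ‖S t‖ ^ 2 :=
      (memLp_two_iff_integrable_sq_norm S.continuous.aestronglyMeasurable).1 (S.memLp 2 volume)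
    have mS : MemLp (fun t => S (h⁻¹ • t)) (ENNReal.ofReal 2) volume := by
      rw [two, memLp_two_iff_integrable_sq_norm cS.aestronglyMeasurable]
      exact iS.comp_smul (inv_ne_zero hpos.ne')
    have mψ : MemLp (fun t => (ψ : Eucl n → ℂ) (x - t)) (ENNReal.ofReal 2) volume :=
      cψ.memLp_of_hasCompactSupport sψ
    have b2 := integral_mul_norm_le_Lp_mul_Lq Real.HolderConjugate.two_two mS mψ
    have i1 : Integrable fun t => ‖S (h⁻¹ • t)‖ * ‖(ψ : Eucl n → ℂ) (x - t)‖ :=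
      (cS.norm.mul cψ.norm).integrable_of_hasCompactSupport sψ.norm.mul_left
    have sq2 : ∀ {y : ℝ}, 0 ≤ y → (y ^ 2) ^ (1 / (2 : ℝ)) = y := fun hy => by
      rw [← Real.sqrt_eq_rpow, Real.sqrt_sq hy]
    have n1 : (∫ t, ‖S (h⁻¹ • t)‖ ^ (2 : ℝ)) ^ (1 / (2 : ℝ)) = h ^ ((n : ℝ) / 2) * ‖schLp S‖ := by
      simp only [Real.rpow_two]
      have e3 := Measure.integral_comp_inv_smul_of_nonneg volume (fun t : Eucl n => ‖S t‖ ^ 2) hpos.le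
      have e4 : ∫ t, ‖S t‖ ^ 2 = ‖schLp S‖ ^ 2 := by
        rw [norm_sq_L2]
        refine integral_congr_ae ?_
        filter_upwards [S.coeFn_toLp 2 volume] with t ht
        rw [schLp, ht]
      rw [e3, e4, finrank_euclideanSpace_fin, smul_eq_mul, Real.mul_rpow (by positivity)
        (by positivity), sq2 (norm_nonneg _), ← Real.rpow_natCast, ← Real.rpow_mul hpos.le]
      congr 2; ring
    have n2 : (∫ t, ‖(ψ : Eucl n → ℂ) (x - t)‖ ^ (2 : ℝ)) ^ (1 / (2 : ℝ)) = ‖testLp ψ‖ := by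
      simp only [Real.rpow_two]
      rw [integral_sub_left_eq_self (fun t => ‖(ψ : Eucl n → ℂ) t‖ ^ 2) volume x]
      have e4 : ∫ t, ‖(ψ : Eucl n → ℂ) t‖ ^ 2 = ‖testLp ψ‖ ^ 2 := by
        rw [norm_sq_L2]
        refine integral_congr_ae ?_
        filter_upwards [coeFn_testLp ψ] with t ht
        rw [ht]
      rw [e4, sq2 (norm_nonneg _)]
    rw [n1, n2] at b2
    have b3 : ‖∫ t, 𝓕⁻ (testToSchwartz (dilate W hpos)) t * (wtTest n h0 s ψ : Eucl n → ℂ) (x - t)‖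
        ≤ wt ε s x * (h ^ n)⁻¹ * (h ^ ((n : ℝ) / 2) * ‖schLp S‖ * ‖testLp ψ‖) := by
      refine (norm_integral_le_of_norm_le (i1.const_mul _) (Eventually.of_forall b1)).trans ?_
      rw [integral_const_mul]
      gcongr
    have hw1 : wt ε (-s) x * wt ε s x = 1 := by
      rw [← wt_add h0, neg_add_cancel, wt, zero_div, Real.rpow_zero]
    have hh1 : (h ^ n)⁻¹ * h ^ ((n : ℝ) / 2) = h ^ (-(n : ℝ) / 2) := by
      rw [← Real.rpow_natCast, ← Real.rpow_neg hpos.le, ← Real.rpow_add hpos]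
      congr 1; ring
    calc _ ≤ wt ε (-s) x * (wt ε s x * (h ^ n)⁻¹ * (h ^ ((n : ℝ) / 2) * ‖schLp S‖ * ‖testLp ψ‖)) :=
          mul_le_mul_of_nonneg_left b3 (wt_pos h0 _ x).le
      _ = (wt ε (-s) x * wt ε s x) * ((h ^ n)⁻¹ * h ^ ((n : ℝ) / 2)) * ‖schLp S‖ * ‖testLp ψ‖ := by
          ring
      _ = _ := by rw [hw1, hh1]; ring
  exact ae_bound_of_denseRange denseRange_testLp main f

end FreeKernel

/-! ### The functional calculus of the free operator -/

theorem fourier_pow_apply {T : L2 n →L[ℂ] L2 n} {u : Eucl n → ℂ}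
    (hT : ∀ f, ∀ᵐ ξ, 𝓕 (T f) ξ = u ξ * 𝓕 f ξ) (k : ℕ) (f : L2 n) :
    ∀ᵐ ξ, 𝓕 ((T ^ k) f) ξ = u ξ ^ k * 𝓕 f ξ := by
  induction k with
  | zero => exact Eventually.of_forall fun ξ => by simp
  | succ k ih =>
    rw [pow_succ', mul_apply_eq_comp]
    filter_upwards [hT ((T ^ k) f), ih] with ξ h1 h2
    rw [h1, h2, pow_succ']; ring

theorem fourier_fmul_ae {w : Eucl n → ℂ} (hw : BddMeas w) (f : L2 n) :
    ∀ᵐ ξ, 𝓕 (fmul w f) ξ = w ξ * 𝓕 f ξ := by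
  rw [fourier_fmul]; exact coeFn_mulOp hw _

theorem fourier_one_sub_fmul {w : Eucl n → ℂ} (hw : BddMeas w) (c : ℂ) (f : L2 n) :
    ∀ᵐ ξ, 𝓕 ((1 - c • fmul w : L2 n →L[ℂ] L2 n) f) ξ = (1 - c * w ξ) * 𝓕 f ξ := by
  rw [_root_.sub_apply, _root_.smul_apply, fourier_L2_sub, fourier_L2_smul]
  filter_upwards [fourier_fmul_ae hw f, Lp.coeFn_sub (𝓕 ((1 : L2 n →L[ℂ] L2 n) f)) (c • 𝓕 (fmul w f)),
    Lp.coeFn_smul c (𝓕 (fmul w f))] with ξ h1 h2 h3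
  rw [h2, Pi.sub_apply, h3, Pi.smul_apply, h1, smul_eq_mul]
  change 𝓕 f ξ - _ = _
  ring

/-- The symbol of the Cayley transform of `-h²Δ`. -/
def caySym (h : ℝ) (ξ : Eucl n) : ℂ := 1 - 2 * Complex.I * resSym h (-Complex.I) ξ

theorem conj_caySym (h : ℝ) (ξ : Eucl n) :
    conj (caySym h ξ) = 1 - -(2 * Complex.I) * resSym h Complex.I ξ := by
  have h2 : conj (2 : ℂ) = 2 := map_ofNat _ 2
  simp [caySym, resSym, sub_eq_add_neg, h2]

theorem norm_caySym (h : ℝ) (ξ : Eucl n) : ‖caySym h ξ‖ = 1 := by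
  have h1 : (symLap h ξ : ℂ) + Complex.I ≠ 0 := by
    have := symLap_sub_ne_zero isFar_neg_I h ξ
    rwa [sub_neg_eq_add] at this
  have h2 : caySym h ξ = conj ((symLap h ξ : ℂ) + Complex.I) / ((symLap h ξ : ℂ) + Complex.I) := by
    rw [caySym, resSym, sub_neg_eq_add, map_add, Complex.conj_ofReal, Complex.conj_I]
    field_simp
    ring
  rw [h2, norm_div, RCLike.norm_conj, div_self (norm_ne_zero_iff.2 h1)]

theorem fourier_cayPow (h : ℝ) (k : ℤ) (f : L2 n) :
    ∀ᵐ ξ, 𝓕 (cayPow (cayley (fmul (resSym h (-Complex.I)))) k f) ξ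
      = cayPow (caySym h ξ) k * 𝓕 f ξ := by
  rcases k with k | k
  · exact fourier_pow_apply (u := caySym h)
      (fun f => fourier_one_sub_fmul (bddMeas_resSym h isFar_neg_I) _ f) k f
  · have h1 : star (cayley (fmul (resSym (n := n) h (-Complex.I))))
        = 1 - (-(2 * Complex.I)) • fmul (resSym h Complex.I) := by
      rw [star_cayley, star_fmul_resSym, neg_smul, sub_neg_eq_add]
    refine fourier_pow_apply (T := star (cayley (fmul (resSym h (-Complex.I)))))
      (u := fun ξ => star (caySym h ξ)) (fun f => ?_) (k + 1) f
    rw [h1]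
    filter_upwards [fourier_one_sub_fmul (bddMeas_resSym h isFar_I) (-(2 * Complex.I)) f] with ξ h2
    rw [h2, ← conj_caySym]; rfl

theorem resolventFun_resSym (φ : ℝ → ℂ) (h : ℝ) (ξ : Eucl n) :
    resolventFun φ (resSym h (-Complex.I) ξ) = φ (symLap h ξ) := by
  have h1 : resSym h (-Complex.I) ξ ≠ 0 := inv_ne_zero (symLap_sub_ne_zero isFar_neg_I h ξ)
  rw [resolventFun, if_neg h1, resSym, inv_inv]
  simp

/-- `φ(-h²Δ)` is the Fourier multiplier with symbol `φ(4π²h²|ξ|²)`. -/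
theorem funCalc_free {φ : ℝ → ℂ} (hφ : ContDiff ℝ ∞ φ) (hc : HasCompactSupport φ) (h : ℝ) (f : L2 n) :
    ∀ᵐ ξ, 𝓕 (funCalc (freeOp n h) φ f) ξ = φ (symLap h ξ) * 𝓕 f ξ := by
  have hs := (funCalc_hasSum (isResolventPair_free (n := n) h) hφ hc).mapL
    (ContinuousLinearMap.apply ℂ (L2 n) f)
  have hs2 := hs.mapL ((Lp.fourierTransformₗᵢ (Eucl n) ℂ).toContinuousLinearEquiv : L2 n →L[ℂ] L2 n)
  have hs3 := ((Equiv.intEquivNat.symm.hasSum_iff).2 hs2).tendsto_sum_nat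
  obtain ⟨ns, hns, hae⟩ := exists_subseq_ae hs3
  set u : ℕ → L2 n := fun i => 𝓕 (cayCoeff φ (Equiv.intEquivNat.symm i) •
    cayPow (cayley (fmul (resSym h (-Complex.I)))) (Equiv.intEquivNat.symm i) f) with hu
  have hall : ∀ᵐ ξ, ∀ i, u i ξ = cayCoeff φ (Equiv.intEquivNat.symm i) *
      cayPow (caySym h ξ) (Equiv.intEquivNat.symm i) * 𝓕 f ξ := by
    rw [ae_all_iff]
    intro i
    rw [hu]
    simp only [fourier_L2_smul]
    filter_upwards [fourier_cayPow h (Equiv.intEquivNat.symm i) f, Lp.coeFn_smul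
      (cayCoeff φ (Equiv.intEquivNat.symm i)) (𝓕 (cayPow (cayley (fmul (resSym h (-Complex.I))))
        (Equiv.intEquivNat.symm i) f))] with ξ h1 h2
    rw [h2, Pi.smul_apply, h1, smul_eq_mul, mul_assoc]
  have hsum : ∀ᵐ ξ, ∀ N, (∑ i ∈ Finset.range N, u i : L2 n) ξ = ∑ i ∈ Finset.range N, u i ξ := by
    rw [ae_all_iff]
    intro N
    filter_upwards [Lp.coeFn_finsetSum (Finset.range N) u] with ξ h1
    rw [h1, Finset.sum_apply]
  filter_upwards [hae, hall, hsum] with ξ h1 h2 h3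
  have h4 : Tendsto (fun k => (∑ i ∈ Finset.range (ns k), u i : L2 n) ξ) atTop
      (𝓝 (𝓕 (funCalc (freeOp n h) φ f) ξ)) := h1
  have h5 : Tendsto (fun k => (∑ i ∈ Finset.range (ns k), u i : L2 n) ξ) atTop
      (𝓝 (φ (symLap h ξ) * 𝓕 f ξ)) := by
    simp only [h3, h2]
    have h6 := resolventFun_hasSum hφ hc (w := resSym h (-Complex.I) ξ) (norm_caySym h ξ)
    rw [resolventFun_resSym] at h6
    exact ((((Equiv.intEquivNat.symm.hasSum_iff).2 h6).mul_right (𝓕 f ξ)).tendsto_sum_nat).comp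
      hns.tendsto_atTop
  exact tendsto_nhds_unique h4 h5

/-- The symbols of the derivatives of order at most one. -/
def lowSym (h : ℝ) : Option (Fin n) → Eucl n → ℂ
  | none, _ => 1
  | some j, ξ => symD h j ξ

theorem fourier_lowMono (h : ℝ) (o : Option (Fin n)) (ψ : Test n) :
    ∀ᵐ ξ, 𝓕 (testLp ((lowMono o).act h ψ)) ξ = lowSym h o ξ * 𝓕 (testLp ψ) ξ := by
  rcases o with _ | j
  · exact Eventually.of_forall fun ξ => by simp [lowMono, Mono.act, lowSym]
  · exact fourier_testD h j ψ

theorem lowSym_continuous (h : ℝ) (o : Option (Fin n)) : Continuous (lowSym h o : Eucl n → ℂ) := by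
  rcases o with _ | j
  · exact continuous_const
  · unfold lowSym symD; fun_prop

/-- Derivatives of order at most one of the free resolvent are Fourier multipliers. -/
theorem derivRes_free {h : ℝ} (hh : h ∈ hRange) (o : Option (Fin n)) (f : L2 n) :
    ∀ᵐ ξ, 𝓕 (derivRes (freeDiffOp n h hh) (-Complex.I) (lowMono o) f) ξ
      = lowSym h o ξ * resSym h (-Complex.I) ξ * 𝓕 f ξ := by
  have hF := realizes_free (n := n) hh
  have hb : BddMeas fun ξ : Eucl n => lowSym h o ξ * resSym h (-Complex.I) ξ := by
    have hc := (hasTemperateGrowth_symLap (n := n) h).1.continuous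
    refine BddMeas.of_continuous (C := 2) ((lowSym_continuous h o).mul
      ((hc.sub continuous_const).inv₀ (symLap_sub_ne_zero isFar_neg_I h))) fun ξ => ?_
    have h1 := norm_pos_iff.2 (symLap_sub_ne_zero isFar_neg_I h ξ)
    rw [resSym, norm_mul, norm_inv, ← div_eq_mul_inv, div_le_iff₀ h1]
    refine le_trans ?_ (isFar_neg_I _ (symLap_nonneg h ξ))
    rcases o with _ | j
    · simpa [lowSym] using symLap_nonneg h ξ
    · have h2 := sq_symD_le h j ξ
      rw [lowSym, Complex.norm_real, Real.norm_eq_abs]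
      nlinarith [sq_abs (symD h j ξ), sq_nonneg (|symD h j ξ| - 1)]
  have e : derivRes (freeDiffOp n h hh) (-Complex.I) (lowMono o) =
      fmul fun ξ => lowSym h o ξ * resSym h (-Complex.I) ξ := by
    refine hF.neg.ext fun ψ => ?_
    rw [derivRes_apply hF.neg, eq_comm, fmul_eq_iff hb]
    have h1 := hF.neg.left_inv ψ
    rw [fmul_eq_iff (bddMeas_resSym h isFar_neg_I)] at h1
    filter_upwards [h1, fourier_lowMono h o ψ] with ξ h2 h3
    change 𝓕 (testLp ((lowMono o).act h ψ)) ξ = _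
    rw [h3, h2, mul_assoc]
  rw [e]
  exact fourier_fmul_ae hb f

/-- The symbol of `𝒟^α φ(-h²Δ)` for `h = 1` and `|α| ≤ 1`. -/
def symTest {φ : ℝ → ℂ} (hφ : ContDiff ℝ ∞ φ) (hc : HasCompactSupport φ) (o : Option (Fin n)) :
    Test n :=
  ⟨fun ξ => lowSym 1 o ξ * φ (symLap 1 ξ), by
    have h1 : ContDiff ℝ ∞ (lowSym 1 o : Eucl n → ℂ) := by
      rcases o with _ | j
      · exact contDiff_const
      · have : ContDiff ℝ ∞ fun ξ : Eucl n => ξ j := by fun_prop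
        exact Complex.ofRealCLM.contDiff.comp (contDiff_const.mul this)
    have h2 : ContDiff ℝ ∞ (symLap 1 : Eucl n → ℝ) := contDiff_const.mul (contDiff_norm_sq ℝ)
    refine ⟨h1.mul (hφ.comp h2), ?_⟩
    obtain ⟨B, hB⟩ := hc.isCompact.isBounded.subset_closedBall 0
    have h3 : HasCompactSupport fun ξ : Eucl n => φ (symLap 1 ξ) := by
      refine HasCompactSupport.of_support_subset_isCompact
        (isCompact_closedBall (0 : Eucl n) (B + 1)) fun ξ hξ => ?_
      have h4 := hB (subset_tsupport _ hξ)
      rw [mem_closedBall_zero_iff, Real.norm_of_nonneg (symLap_nonneg 1 ξ), symLap] at h4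
      rw [mem_closedBall_zero_iff]
      have h5 := Real.pi_gt_three
      have h6 : 1 ≤ (2 * Real.pi * 1) ^ 2 := by nlinarith
      nlinarith [mul_nonneg (sub_nonneg.2 h6) (sq_nonneg ‖ξ‖), sq_nonneg (‖ξ‖ - 1)]
    exact h3.mul_left⟩

/-- The function `φ(P₀)⟨x⟩^s f` and its first derivatives are bounded pointwise by `⟨x⟩^s`. It is
written as a resolvent applied to `((t + i)φ)(P₀)⟨x⟩^s f`, the form in which it appears in the
equations. -/
theorem exists_free_pointwise {φ : ℝ → ℂ} (hφ : ContDiff ℝ ∞ φ) (hc : HasCompactSupport φ) {s : ℝ}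
    (hs : 0 ≤ s) : ∃ K : ℝ, 0 ≤ K ∧ ∀ (h : ℝ) (hh : h ∈ hRange) (ε : ℝ), 0 < ε → ε ≤ 1 →
      ∀ (f : L2 n) (o : Option (Fin n)), ∀ᵐ x,
        ‖wop n ε (-s) (derivRes (freeDiffOp n h hh) (-Complex.I) (lowMono o)
          (funCalc (freeOp n h) (addI φ) (wop n ε s f))) x‖ ≤ K * h ^ (-(n : ℝ) / 2) * ‖f‖ := by
  choose K hK hb using fun o : Option (Fin n) => exists_kernel_bound (symTest hφ hc o) hs
  refine ⟨∑ o, K o, Finset.sum_nonneg fun o _ => hK o, fun h hh ε h0 h1 f o => ?_⟩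
  have e : derivRes (freeDiffOp n h hh) (-Complex.I) (lowMono o)
      (funCalc (freeOp n h) (addI φ) (wop n ε s f))
      = fmul (fun ξ => (symTest hφ hc o : Eucl n → ℂ) (h • ξ)) (wop n ε s f) := by
    have hb' : BddMeas fun ξ => (symTest hφ hc o : Eucl n → ℂ) (h • ξ) :=
      (dilate (symTest hφ hc o) hh.1).bddMeas
    rw [eq_comm, fmul_eq_iff hb']
    filter_upwards [derivRes_free hh o (funCalc (freeOp n h) (addI φ) (wop n ε s f)),
      funCalc_free (addI_contDiff hφ) (addI_hasCompactSupport hc) h (wop n ε s f)] with ξ e1 e2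
    have hz := symLap_sub_ne_zero isFar_neg_I h ξ
    have hl : symLap 1 (h • ξ) = symLap h ξ := by
      rw [symLap, symLap, norm_smul, Real.norm_of_nonneg hh.1.le]; ring
    have ho : lowSym 1 o (h • ξ) = lowSym h o ξ := by
      rcases o with _ | j
      · rfl
      · simp only [lowSym, symD, PiLp.smul_apply, smul_eq_mul]; push_cast; ring
    change _ = (lowSym 1 o (h • ξ) * φ (symLap 1 (h • ξ))) * _
    rw [e1, e2, hl, ho, resSym, addI]
    rw [sub_neg_eq_add] at hz ⊢
    field_simp
  rw [e]
  filter_upwards [hb o h hh ε h0 h1 f] with x hx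
  refine hx.trans ?_
  have h2 : K o ≤ ∑ o, K o := Finset.single_le_sum (fun o _ => hK o) (Finset.mem_univ o)
  have := hh.1
  gcongr

/-! ### Pointwise bounds in dimension at most three -/

/-- The symbol decays like `|ξ|^{-2}`, which is square integrable at infinity for `n < 4`. -/
theorem memLp_resSym (hn : n ≤ 3) {h : ℝ} (h0 : 0 < h) :
    MemLp (resSym h (-Complex.I) : Eucl n → ℂ) (ENNReal.ofReal 2) volume := by
  have two : ENNReal.ofReal 2 = 2 := by simp
  have hm := (bddMeas_resSym (n := n) h isFar_neg_I).1
  rw [two, memLp_two_iff_integrable_sq_norm hm]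
  have hr : (Module.finrank ℝ (Eucl n) : ℝ) < 4 := by
    rw [finrank_euclideanSpace_fin]
    have : (n : ℝ) ≤ 3 := by exact_mod_cast hn
    linarith
  have hi := ((integrable_rpow_neg_one_add_norm_sq (μ := volume) hr).comp_smul
    (mul_pos Real.two_pi_pos h0).ne').const_mul 4
  refine hi.mono' (hm.norm.pow 2) (Eventually.of_forall fun ξ => ?_)
  have h1 : 0 < 1 + ‖(2 * Real.pi * h) • ξ‖ ^ 2 := by positivity
  have h2 : 1 + ‖(2 * Real.pi * h) • ξ‖ ^ 2 ≤ 2 * ‖(symLap h ξ : ℂ) - -Complex.I‖ := by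
    refine le_trans (le_of_eq ?_) (isFar_neg_I _ (symLap_nonneg h ξ))
    rw [symLap, norm_smul, Real.norm_of_nonneg (mul_pos Real.two_pi_pos h0).le, mul_pow]
  have h3 : -(4 : ℝ) / 2 = -(2 : ℕ) := by norm_num
  have h4 : 0 < ‖(symLap h ξ : ℂ) - -Complex.I‖ := by linarith
  rw [h3, Real.rpow_neg h1.le, Real.rpow_natCast, Real.norm_of_nonneg (by positivity), resSym,
    norm_inv, inv_pow, ← div_eq_mul_inv, inv_eq_one_div, div_le_div_iff₀ (pow_pos h4 2)
      (by positivity)]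
  nlinarith [pow_le_pow_left₀ h1.le h2 2]

theorem integral_sq_norm_resSym {h : ℝ} (h0 : 0 < h) :
    ∫ ξ : Eucl n, ‖resSym h (-Complex.I) ξ‖ ^ 2
      = (h ^ n)⁻¹ * ∫ ξ : Eucl n, ‖resSym 1 (-Complex.I) ξ‖ ^ 2 := by
  have e : ∀ ξ : Eucl n, resSym h (-Complex.I) ξ = resSym 1 (-Complex.I) (h • ξ) := fun ξ => by
    rw [resSym, resSym, symLap, symLap, norm_smul, Real.norm_of_nonneg h0.le, mul_one]
    congr 3; ring
  simp only [e]
  rw [Measure.integral_comp_smul volume (fun ξ : Eucl n => ‖resSym 1 (-Complex.I) ξ‖ ^ 2) h,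
    finrank_euclideanSpace_fin, abs_of_pos (by positivity), smul_eq_mul]

/-- In dimension at most three the free resolvent maps `L²` to `L^∞`, because its symbol is square
integrable. -/
theorem exists_free_resolvent_sup (hn : n ≤ 3) : ∃ K : ℝ, 0 ≤ K ∧ ∀ h ∈ hRange, ∀ f : L2 n,
    ∀ᵐ x, ‖fmul (resSym h (-Complex.I)) f x‖ ≤ K * h ^ (-(n : ℝ) / 2) * ‖f‖ := by
  refine ⟨(∫ ξ : Eucl n, ‖resSym 1 (-Complex.I) ξ‖ ^ 2) ^ (1 / (2 : ℝ)), by positivity,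
    fun h hh f => ?_⟩
  refine ae_bound_of_denseRange (realizes_free (n := n) hh).neg.dense (fun ψ => ?_) f
  rw [(realizes_free (n := n) hh).neg.left_inv]
  set g : L2 n := 𝓕 ((freeDiffOp n h hh).shift (-Complex.I) ψ) with hg
  have hgn : ‖g‖ = ‖(freeDiffOp n h hh).shift (-Complex.I) ψ‖ :=
    (Lp.fourierTransformₗᵢ (Eucl n) ℂ).norm_map _
  set S := testToSchwartz ψ
  have hS : ∀ᵐ ξ, ‖𝓕 S ξ‖ = ‖resSym h (-Complex.I) ξ‖ * ‖g ξ‖ := by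
    have h1 := fourier_testLap_sub h (-Complex.I) ψ
    rw [← freeDiffOp_shift hh] at h1
    filter_upwards [h1, fourier_schLp S] with ξ h1 h2
    have h3 : 𝓕 (testLp ψ) ξ = 𝓕 S ξ := by rw [← h2, ← toLp_testToSchwartz]; rfl
    rw [hg, h1, h3, ← norm_mul, resSym, inv_mul_cancel_left₀ (symLap_sub_ne_zero isFar_neg_I h ξ)]
  have mg : MemLp g (ENNReal.ofReal 2) volume := by
    have two : ENNReal.ofReal 2 = 2 := by simp
    rw [two]; exact Lp.memLp g
  have cs := integral_mul_norm_le_Lp_mul_Lq Real.HolderConjugate.two_two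
    (memLp_resSym (n := n) hn hh.1) mg
  simp only [Real.rpow_two] at cs
  rw [integral_sq_norm_resSym hh.1, ← norm_sq_L2, ← integral_congr_ae hS, hgn] at cs
  have sq2 : (‖(freeDiffOp n h hh).shift (-Complex.I) ψ‖ ^ 2) ^ (1 / (2 : ℝ))
      = ‖(freeDiffOp n h hh).shift (-Complex.I) ψ‖ := by
    rw [← Real.sqrt_eq_rpow, Real.sqrt_sq (norm_nonneg _)]
  have hpow : ((h ^ n)⁻¹) ^ (1 / (2 : ℝ)) = h ^ (-(n : ℝ) / 2) := by
    rw [← Real.rpow_natCast, ← Real.rpow_neg hh.1.le, ← Real.rpow_mul hh.1.le]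
    congr 1; ring
  rw [Real.mul_rpow (by have := hh.1; positivity) (by positivity), sq2, hpow] at cs
  filter_upwards [coeFn_testLp ψ] with x hx
  rw [hx, ← testToSchwartz_apply]
  change ‖S x‖ ≤ _
  rw [← fourierInv_fourier_eq (F := 𝓢(Eucl n, ℂ)) S,
    SchwartzMap.fourierInv_coe, Real.fourierInv_eq]
  refine (norm_integral_le_integral_norm _).trans ?_
  simp only [Circle.norm_smul]
  refine cs.trans (le_of_eq ?_)
  ring

/-- The bounded operator `(L + h²Δ)(L + i)⁻¹`. -/
def pertRes (L : DiffOp n) (R : L2 n →L[ℂ] L2 n) : L2 n →L[ℂ] L2 n :=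
  (∑ i, ∑ j, (mulOp (fun x => (L.pertCoef (some i) (some j) x : ℂ))
        * derivRes L (-Complex.I) (.DD i j)
      + mulOp (semiD L.h i fun x => (L.a i j x : ℂ)) * derivRes L (-Complex.I) (.D j)))
    + (∑ j, ((2 : ℂ) • (mulOp (fun x => (L.b j x : ℂ)) * derivRes L (-Complex.I) (.D j))
      + mulOp (semiD L.h j fun x => (L.b j x : ℂ)) * R))
    + mulOp (fun x => (L.V x : ℂ)) * R

theorem mulOp_pertCoef (L : DiffOp n) (i j : Fin n) (f : L2 n) :
    mulOp (fun x => (L.pertCoef (some i) (some j) x : ℂ)) f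
      = mulOp (fun x => (L.a i j x : ℂ)) f - (Coefficients.aFlat i j : ℂ) • f := by
  refine Lp.ext ?_
  filter_upwards [coeFn_mulOp (L.bddMeas_pertCoef (some i) (some j)) f,
    coeFn_mulOp (L.bddMeas_a i j) f, Lp.coeFn_sub (mulOp (fun x => (L.a i j x : ℂ)) f)
    ((Coefficients.aFlat i j : ℂ) • f), Lp.coeFn_smul (Coefficients.aFlat i j : ℂ) f]
    with x e1 e2 e3 e4
  rw [e1, e3, Pi.sub_apply, e2, e4, Pi.smul_apply, smul_eq_mul, ← sub_mul]
  simp [DiffOp.pertCoef]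

/-- The second resolvent identity `R = R₀(1 - (L + h²Δ)R)`. -/
theorem pertRes_eq {L : DiffOp n} {R : L2 n →L[ℂ] L2 n} {C : ℝ} (hc : IsCore L (-Complex.I) R C) :
    R = fmul (resSym L.h (-Complex.I)) * (1 - pertRes L R) := by
  have e : (1 : L2 n →L[ℂ] L2 n) - pertRes L R
      = (∑ j, derivRes L (-Complex.I) (.DD j j)) + Complex.I • R := by
    refine hc.ext fun ψ => ?_
    rw [_root_.sub_apply, pertRes]
    simp only [mul_apply_eq_comp, _root_.add_apply, _root_.sum_apply, _root_.smul_apply,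
      derivRes_apply hc, hc.left_inv, mulOp_pertCoef]
    have h2 : (∑ i, ∑ j, (Coefficients.aFlat i j : ℂ) • testLp ((Mono.DD i j).act L.h ψ))
        = ∑ j, testLp ((Mono.DD j j).act L.h ψ) := by
      refine Finset.sum_congr rfl fun i _ => ?_
      rw [Finset.sum_eq_single i (fun j _ hj => by simp [Coefficients.aFlat, hj.symm])
        (fun hi => absurd (Finset.mem_univ i) hi)]
      simp [Coefficients.aFlat]
    rw [← h2]
    change L.shift (-Complex.I) ψ - _ = _
    rw [L.shift_apply, L.op_apply]
    simp only [Finset.sum_add_distrib, Finset.sum_sub_distrib, neg_smul, Mono.act,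
      LinearMap.comp_apply]
    abel
  rw [e]
  exact hc.eq_free_mul

/-- The operator `(L + h²Δ)(L + i)⁻¹` gains the decay of the coefficients and of their first
derivatives. -/
theorem exists_pertRes_bound {B C : ℝ} (hB : 0 ≤ B) (hC : 0 ≤ C) {s δ : ℝ} (hs : 0 ≤ s)
    (hδ : s ≤ δ) {φ : ℝ → ℂ} (hφ : ContDiff ℝ ∞ φ) (hc : HasCompactSupport φ) :
    ∃ K : ℝ, 0 ≤ K ∧ ∀ (L : DiffOp n) (A : L2 n →ₗ.[ℂ] L2 n) (R : L2 n →L[ℂ] L2 n) (D e : ℝ),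
      0 ≤ D → 0 ≤ e → L.B ≤ B → Realizes L A R C → L.Decay δ D e → ∀ ε : ℝ, 0 < ε → ε ≤ 1 →
        ‖pertRes L R * (funCalc A φ * wop n ε s)‖ ≤ K * (D + e) := by
  obtain ⟨K₁, hK₁, hb₁⟩ := exists_weighted_derivRes (n := n) hB hC ⌈s⌉₊ s hs (Nat.le_ceil _)
  obtain ⟨K₂, hK₂, hb₂⟩ := exists_weighted_funCalc (n := n) hB hC hs hφ hc
  refine ⟨((n : ℝ) * (n * 2) + n * 3 + 1) * (K₁ * K₂), by positivity,
    fun L A R D e hD he hL hR hdec ε h0 h1 => ?_⟩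
  set Y := funCalc A φ * wop n ε s with hY
  have piece : ∀ {w : Eucl n → ℂ} (_ : BddMeas w) (_ : ∀ᵐ x, ‖w x‖ ≤ (D + e) * japanese x ^ (-δ))
      (Q : Mono n), ‖mulOp w * derivRes L (-Complex.I) Q * Y‖ ≤ (D + e) * (K₁ * K₂) := by
    intro w hw hd Q
    have e1 : mulOp w * derivRes L (-Complex.I) Q * Y = (wop n ε 0 * mulOp w * wop n ε s)
        * (wop n ε (-s) * derivRes L (-Complex.I) Q * wop n ε s)
        * (wop n ε (-s) * funCalc A φ * wop n ε s) := by
      have e2 : ∀ X : L2 n →L[ℂ] L2 n, wop n ε s * (wop n ε (-s) * X) = X := fun X => by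
        rw [← mul_assoc, wop_mul_neg h0 h1, one_mul]
      rw [wop_zero, one_mul, hY]
      simp only [mul_assoc, e2]
    rw [e1]
    refine (norm_mul_le _ _).trans ?_
    rw [← mul_assoc (D + e)]
    refine mul_le_mul ?_ (hb₂ L A R hL hR ε h0 h1).1 (norm_nonneg _) (by positivity)
    refine (norm_mul_le _ _).trans ?_
    exact mul_le_mul
      (norm_wop_mulOp_wop_le h0 h1 le_rfl hs (by rwa [zero_add]) (by positivity) hw hd)
      (hb₁ L _ R hL hR.neg ε h0 h1 Q) (norm_nonneg _) (by positivity)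
  have hcoef : ∀ o o', ∀ᵐ x, ‖(L.pertCoef o o' x : ℂ)‖ ≤ (D + e) * japanese x ^ (-δ) := by
    intro o o'
    filter_upwards [hdec.coef] with x hx
    rw [Complex.norm_real, Real.norm_eq_abs]
    refine (hx o o').trans (mul_le_mul_of_nonneg_right (by linarith) ?_)
    exact Real.rpow_nonneg (zero_le_one.trans (one_le_japanese x)) _
  have hder : ∀ {f : Eucl n → ℝ} {i : Fin n}, ContDiff ℝ 1 f →
      (∀ᵐ x, |partialDeriv i f x| ≤ D * japanese x ^ (-δ)) →
      ∀ᵐ x, ‖semiD L.h i (fun y => (f y : ℂ)) x‖ ≤ (D + e) * japanese x ^ (-δ) := by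
    intro f i hf hd
    filter_upwards [hd] with x hx
    refine DiffOp.norm_semiD_le L.h_pos L.h_le hf (hx.trans (mul_le_mul_of_nonneg_right
      (by linarith) ?_))
    exact Real.rpow_nonneg (zero_le_one.trans (one_le_japanese x)) _
  have e1 := derivRes_one hR.neg
  have p1 : ∀ i j, ‖mulOp (fun x => (L.pertCoef (some i) (some j) x : ℂ))
      * derivRes L (-Complex.I) (.DD i j) * Y‖ ≤ (D + e) * (K₁ * K₂) := fun i j =>
    piece (L.bddMeas_pertCoef _ _) (hcoef _ _) _
  have p2 : ∀ i j, ‖mulOp (semiD L.h i fun x => (L.a i j x : ℂ))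
      * derivRes L (-Complex.I) (.D j) * Y‖ ≤ (D + e) * (K₁ * K₂) := fun i j =>
    piece (L.bddMeas_da i j) (hder (L.a_C1 i j) (hdec.da.mono fun x hx => hx i j)) _
  have p3 : ∀ j, ‖mulOp (fun x => (L.b j x : ℂ)) * derivRes L (-Complex.I) (.D j) * Y‖
      ≤ (D + e) * (K₁ * K₂) := fun j => piece (L.bddMeas_b j) (hcoef (some j) none) _
  have p4 : ∀ j, ‖mulOp (semiD L.h j fun x => (L.b j x : ℂ)) * R * Y‖ ≤ (D + e) * (K₁ * K₂) :=
    fun j => by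
      have := piece (L.bddMeas_db j) (hder (L.b_C1 j) (hdec.db.mono fun x hx => hx j)) .one
      rwa [e1] at this
  have p5 : ‖mulOp (fun x => (L.V x : ℂ)) * R * Y‖ ≤ (D + e) * (K₁ * K₂) := by
    have := piece L.bddMeas_V (hcoef none none) .one
    rwa [e1] at this
  have hsum : ∀ {f : Fin n → L2 n →L[ℂ] L2 n} {c : ℝ}, (∀ i, ‖f i‖ ≤ c) → ‖∑ i, f i‖ ≤ n * c := by
    intro f c hf
    refine (norm_sum_le_of_le _ fun i _ => hf i).trans (le_of_eq ?_)
    simp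
  rw [pertRes]
  simp only [add_mul, Finset.sum_mul, smul_mul_assoc]
  set k := (D + e) * (K₁ * K₂) with hk
  have q1 := hsum fun i => hsum fun j => norm_add_le_of_le (p1 i j) (p2 i j)
  have q2 := hsum fun j => norm_add_le_of_le (show ‖(2 : ℂ) • (mulOp (fun x => (L.b j x : ℂ))
    * derivRes L (-Complex.I) (.D j) * Y)‖ ≤ 2 * k by
      rw [norm_smul]; simpa using p3 j) (p4 j)
  refine (norm_add_le_of_le (norm_add_le_of_le q1 q2) p5).trans (le_of_eq ?_)
  rw [hk]; ring

/-- In dimension at most three `φ(A) - φ(P₀)` maps weighted `L²` to `L^∞`: by the second resolvent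
identity it factors through the free resolvent. The bound contains the size `D` of the derivatives
of the coefficients, so that it yields no power of `h`. -/
theorem exists_sup_bound_of_le_three (hn : n ≤ 3) {B C : ℝ} (hB : 1 ≤ B) (hC : 2 ≤ C) {s δ : ℝ}
    (hs : 0 ≤ s) (hδ : s ≤ δ) {φ : ℝ → ℂ} (hφ : ContDiff ℝ ∞ φ) (hc : HasCompactSupport φ) :
    ∃ K : ℝ, 0 ≤ K ∧ ∀ (L : DiffOp n) (A : L2 n →ₗ.[ℂ] L2 n) (R : L2 n →L[ℂ] L2 n) (D e : ℝ),
      0 ≤ D → 0 ≤ e → L.B ≤ B → Realizes L A R C → L.Decay δ D e → ∀ ε : ℝ, 0 < ε → ε ≤ 1 →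
        ∀ f : L2 n, ∀ᵐ x, ‖(funCalc A φ - funCalc (freeOp n L.h) φ) (wop n ε s f) x‖
          ≤ K * (D + e) * L.h ^ (-(n : ℝ) / 2) * ‖f‖ := by
  obtain ⟨K₀, hK₀, hb₀⟩ := exists_free_resolvent_sup hn
  obtain ⟨K₁, hK₁, hb₁⟩ := exists_pertRes_bound (n := n) (zero_le_one.trans hB)
    (zero_le_two.trans hC) hs hδ (addI_contDiff hφ) (addI_hasCompactSupport hc)
  obtain ⟨K₂, hK₂, hb₂⟩ := exists_weighted_funCalc_sub (n := n) (s₁ := 0) (δ := δ) hB hC le_rfl hs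
    (by rwa [zero_add]) (addI_contDiff hφ) (addI_hasCompactSupport hc)
  refine ⟨K₀ * (K₁ + K₂), by positivity, fun L A R D e hD he hL hR hdec ε h0 h1 f => ?_⟩
  have hF := realizes_free (n := n) L.mem_hRange
  set ψ := addI φ
  set Y : L2 n →L[ℂ] L2 n := (funCalc A ψ - funCalc (freeOp n L.h) ψ) * wop n ε s
    - pertRes L R * (funCalc A ψ * wop n ε s) with hY
  have e1 : (funCalc A φ - funCalc (freeOp n L.h) φ) (wop n ε s f)
      = fmul (resSym L.h (-Complex.I)) (Y f) := by
    have e2 : (funCalc A φ - funCalc (freeOp n L.h) φ) * wop n ε s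
        = fmul (resSym L.h (-Complex.I)) * Y := by
      rw [funCalc_eq_mul hR.pair hφ hc, funCalc_eq_mul hF.pair hφ hc]
      nth_rw 1 [pertRes_eq hR.neg]
      rw [hY]
      noncomm_ring
    have := congrArg (fun T : L2 n →L[ℂ] L2 n => T f) e2
    simpa only [mul_apply_eq_comp] using this
  have e3 : ‖Y‖ ≤ (K₁ + K₂) * (D + e) := by
    have h2 := hb₂ L A R D e he hL hR hdec ε h0 h1
    rw [wop_zero, one_mul] at h2
    refine (norm_sub_le_of_le h2 (hb₁ L A R D e hD he hL hR hdec ε h0 h1)).trans ?_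
    nlinarith [mul_nonneg hK₂ hD]
  filter_upwards [hb₀ L.h L.mem_hRange (Y f)] with x hx
  rw [e1]
  refine hx.trans ?_
  have h2 : ‖Y f‖ ≤ (K₁ + K₂) * (D + e) * ‖f‖ := Y.le_of_opNorm_le e3 f
  have h3 : 0 ≤ L.h ^ (-(n : ℝ) / 2) := Real.rpow_nonneg L.h_pos.le _
  calc _ ≤ K₀ * L.h ^ (-(n : ℝ) / 2) * ((K₁ + K₂) * (D + e) * ‖f‖) := by gcongr
    _ = _ := by ring

/-! ### Decay of the level sets -/

/-- The relation between the levels of a sequence of functions `U_m`, in terms of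
`T_m(k) = ∫_{U_m > k} U_m²`, which follows from the energy and the Sobolev inequality. -/
structure LevelDecay (q : ℝ) (K : ℕ → ℝ) (T : ℕ → ℝ → ℝ) : Prop where
  nonneg : ∀ m k, 0 ≤ T m k
  anti : ∀ m k l, 0 < k → k ≤ l → T m l ≤ T m k
  le_one : ∀ m k, 0 < k → T m k ≤ 1
  step : ∀ m k l j, 0 < k → k < l → 0 < j → T m l ≤ l ^ (2 - 2 * q) *
    ((1 - (k / l) ^ 2)⁻¹ ^ 3 * (K m * (T m k * (1 + (1 + j ^ 2) / k ^ 2) + T (m + 1) j))) ^ q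

/-- If `T_m` decays like `k^{2-p}` for all `m`, it decays like `k^{2-pq}`. -/
theorem levelDecay_power {q : ℝ} (hq : 1 < q) {K : ℕ → ℝ} (hK : ∀ m, 0 ≤ K m) (i : ℕ) :
    ∃ C : ℕ → ℝ, (∀ m, 1 ≤ C m) ∧ ∀ T, LevelDecay q K T → ∀ m k, 0 < k →
      T m k ≤ C m * k ^ (2 - 2 * q ^ i) := by
  have hq0 : 0 < q := by linarith
  induction i with
  | zero =>
    refine ⟨fun _ => 1, fun _ => le_rfl, fun T hT m k hk => ?_⟩
    simpa using hT.le_one m k hk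
  | succ i ih =>
    obtain ⟨C, hC, hb⟩ := ih
    have hp : 1 ≤ q ^ i := one_le_pow₀ hq.le
    have hp' : 1 ≤ q ^ (i + 1) := one_le_pow₀ hq.le
    set p := 2 * q ^ i with hpdef
    have hpq : 2 * q ^ (i + 1) = p * q := by rw [hpdef, pow_succ]; ring
    set D : ℕ → ℝ := fun m => (64 / 27 * (K m * (3 * C m + C (m + 1)))
      * (2 : ℝ) ^ (p - 2)) ^ q with hD
    have hbase : ∀ m, 0 ≤ K m * (3 * C m + C (m + 1)) := fun m =>
      mul_nonneg (hK m) (by linarith [hC m, hC (m + 1)])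
    refine ⟨fun m => D m + 2 ^ (p * q - 2), fun m => ?_, fun T hT m l hl => ?_⟩
    · have h1 : (1 : ℝ) ≤ 2 ^ (p * q - 2) :=
        Real.one_le_rpow one_le_two (by rw [← hpq]; linarith)
      have h2 : 0 ≤ D m := Real.rpow_nonneg (by have := hbase m; positivity) _
      linarith
    · have hD0 : 0 ≤ D m := Real.rpow_nonneg (by have := hbase m; positivity) _
      have hl0 : 0 ≤ l ^ (2 - p * q) := Real.rpow_nonneg hl.le _
      rw [hpq]
      -- For `l < 2` the bound is trivial; for `l ≥ 2` the recursion is applied with `k = j = l/2`.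
      rcases lt_or_ge l 2 with h2 | h2
      · have h3 : 1 ≤ 2 ^ (p * q - 2) * l ^ (2 - p * q) := by
          have e : l ^ (2 - p * q) = (l ^ (p * q - 2))⁻¹ := by
            rw [← Real.rpow_neg hl.le]; congr 1; ring
          rw [e, ← div_eq_mul_inv, one_le_div (Real.rpow_pos_of_pos hl _)]
          exact Real.rpow_le_rpow hl.le h2.le (by rw [← hpq]; linarith)
        have := hT.le_one m l hl
        nlinarith [mul_nonneg hD0 hl0]
      · have hk : 0 < l / 2 := by linarith
        have s := hT.step m (l / 2) l (l / 2) hk (by linarith) hk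
        have e1 : (1 - (l / 2 / l) ^ 2)⁻¹ ^ 3 = 64 / 27 := by
          have : l / 2 / l = 1 / 2 := by field_simp
          rw [this]; norm_num
        have e2 : 1 + (1 + (l / 2) ^ 2) / (l / 2) ^ 2 ≤ 3 := by
          have : (1 + (l / 2) ^ 2) / (l / 2) ^ 2 ≤ 2 := by
            rw [div_le_iff₀ (by positivity)]; nlinarith
          linarith
        have e3 : (l / 2) ^ (2 - p) = 2 ^ (p - 2) * l ^ (2 - p) := by
          rw [Real.div_rpow hl.le zero_le_two, div_eq_mul_inv, ← Real.rpow_neg zero_le_two, mul_comm]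
          congr 2; ring
        have hT0 := hT.nonneg m (l / 2)
        have hT1 := hT.nonneg (m + 1) (l / 2)
        have hx : (0 : ℝ) < (l / 2) ^ (2 - p) := Real.rpow_pos_of_pos hk _
        have e4 : T m (l / 2) * (1 + (1 + (l / 2) ^ 2) / (l / 2) ^ 2) + T (m + 1) (l / 2)
            ≤ (3 * C m + C (m + 1)) * (l / 2) ^ (2 - p) := by
          have b1 := hb T hT m (l / 2) hk
          have b2 := hb T hT (m + 1) (l / 2) hk
          nlinarith
        rw [e1] at s
        have e5 : 64 / 27 * (K m * (T m (l / 2) * (1 + (1 + (l / 2) ^ 2) / (l / 2) ^ 2)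
            + T (m + 1) (l / 2)))
            ≤ (64 / 27 * (K m * (3 * C m + C (m + 1))) * (2 : ℝ) ^ (p - 2)) * l ^ (2 - p) := by
          have := mul_le_mul_of_nonneg_left e4 (hK m)
          rw [e3] at this
          nlinarith
        have hlhs : 0 ≤ 64 / 27 * (K m * (T m (l / 2) * (1 + (1 + (l / 2) ^ 2) / (l / 2) ^ 2)
            + T (m + 1) (l / 2))) := by have := hK m; positivity
        have e6 := Real.rpow_le_rpow hlhs e5 hq0.le
        rw [Real.mul_rpow (by have := hbase m; positivity) (Real.rpow_nonneg hl.le _),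
          ← Real.rpow_mul hl.le] at e6
        have e7 : l ^ (2 - 2 * q) * l ^ ((2 - p) * q) = l ^ (2 - p * q) := by
          rw [← Real.rpow_add hl]; congr 1; ring
        calc T m l ≤ l ^ (2 - 2 * q) * (D m * l ^ ((2 - p) * q)) :=
              s.trans (mul_le_mul_of_nonneg_left e6 (Real.rpow_nonneg hl.le _))
          _ = D m * l ^ (2 - p * q) := by rw [← e7]; ring
          _ ≤ _ := by
            have : (0 : ℝ) ≤ 2 ^ (p * q - 2) := by positivity
            nlinarith

/-- A sequence with `y_{m+1} ≤ A b^m y_m^{1+σ}` tends to zero if `y_0` is small. -/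
theorem exists_fast_decay {A b σ : ℝ} (hA : 0 < A) (hb : 1 < b) (hσ : 0 < σ) :
    ∃ η : ℝ, 0 < η ∧ ∀ y : ℕ → ℝ, (∀ m, 0 ≤ y m) → y 0 ≤ η →
      (∀ m, y (m + 1) ≤ A * b ^ m * y m ^ (1 + σ)) → Tendsto y atTop (𝓝 0) := by
  have hb0 : 0 < b := by linarith
  set r := b ^ (-σ⁻¹) with hr
  have hr0 : 0 < r := Real.rpow_pos_of_pos hb0 _
  have hr1 : r < 1 := Real.rpow_lt_one_of_one_lt_of_neg hb (by simpa using hσ)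
  have hrσ : r ^ σ = b⁻¹ := by
    rw [hr, ← Real.rpow_mul hb0.le, neg_mul, inv_mul_cancel₀ hσ.ne', Real.rpow_neg_one]
  set η := (r / A) ^ σ⁻¹ with hη
  have hη0 : 0 < η := Real.rpow_pos_of_pos (by positivity) _
  have hησ : η ^ σ = r / A := by
    rw [hη, ← Real.rpow_mul (by positivity), inv_mul_cancel₀ hσ.ne', Real.rpow_one]
  refine ⟨η, hη0, fun y hy h0 hs => ?_⟩
  have main : ∀ m, y m ≤ η * r ^ m := by
    intro m
    induction m with
    | zero => simpa using h0
    | succ m ih =>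
      have h1 : y m ^ (1 + σ) ≤ (η * r ^ m) ^ (1 + σ) := Real.rpow_le_rpow (hy m) ih (by linarith)
      have h2 : (η * r ^ m) ^ (1 + σ) = η * r ^ m * (r / A * (b⁻¹) ^ m) := by
        rw [Real.rpow_add (by positivity), Real.rpow_one, Real.mul_rpow hη0.le (by positivity), hησ,
          ← Real.rpow_natCast, ← Real.rpow_natCast, ← Real.rpow_mul hr0.le, mul_comm (m : ℝ) σ,
          Real.rpow_mul hr0.le, hrσ]
      calc y (m + 1) ≤ A * b ^ m * (η * r ^ m * (r / A * (b⁻¹) ^ m)) := by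
            rw [← h2]
            exact (hs m).trans (mul_le_mul_of_nonneg_left h1 (by positivity))
        _ = η * r ^ (m + 1) * (b ^ m * (b⁻¹) ^ m) := by rw [pow_succ]; field_simp
        _ = η * r ^ (m + 1) := by
            rw [← mul_pow, mul_inv_cancel₀ hb0.ne', one_pow, mul_one]
  refine squeeze_zero hy main ?_
  simpa using (tendsto_pow_atTop_nhds_zero_of_lt_one hr0.le hr1).const_mul η

/-- One step of the iteration along levels `k < l` with `1 - k/l ≥ 2^{-m-2}`; the level `j` of the
next function is chosen so as to balance the two terms. -/
theorem level_step_le {q p C κ k l y t : ℝ} {m : ℕ} (hq : 1 < q) (hp : 2 < p) (hC : 0 ≤ C)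
    (hκ : 0 ≤ κ) (hk : 1 ≤ k) (hkl : k < l) (hgap : (4 * 2 ^ m)⁻¹ ≤ 1 - k / l) (hy : 0 < y)
    (hy1 : y ≤ 1) (ht0 : 0 ≤ t) (ht : t ≤ C * (y ^ (-(1 / p))) ^ (2 - p)) :
    l ^ (2 - 2 * q) * ((1 - (k / l) ^ 2)⁻¹ ^ 3 *
      (κ * (y * (1 + (1 + (y ^ (-(1 / p))) ^ 2) / k ^ 2) + t))) ^ q
      ≤ (64 * (κ * (3 + C) + 1)) ^ q * ((8 : ℝ) ^ q) ^ m * y ^ (q * (1 - 2 / p)) := by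
  have hq0 : 0 < q := by linarith
  have hp0 : 0 < p := by linarith
  have hl0 : 0 < l := by linarith
  -- With `j = y^{-1/p}` both `y j²` and `j^{2-p}` are equal to `y^{1-2/p}`.
  set j := y ^ (-(1 / p)) with hj
  have hj1 : 1 ≤ j := Real.one_le_rpow_of_pos_of_le_one_of_nonpos hy hy1
    (by rw [neg_nonpos]; positivity)
  have hjp : y * j ^ 2 = y ^ (1 - 2 / p) := by
    rw [hj, ← Real.rpow_natCast, ← Real.rpow_mul hy.le]
    nth_rw 1 [← Real.rpow_one y]
    rw [← Real.rpow_add hy]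
    congr 1; push_cast; ring
  have hjp2 : j ^ (2 - p) = y ^ (1 - 2 / p) := by
    rw [hj, ← Real.rpow_mul hy.le]
    congr 1
    field_simp; ring
  rw [hjp2] at ht
  have h1 : k / l < 1 := (div_lt_one hl0).2 hkl
  have h2 : 0 ≤ k / l := by positivity
  have hgap0 : 0 < 1 - (k / l) ^ 2 := by nlinarith
  have b1 : l ^ (2 - 2 * q) ≤ 1 :=
    Real.rpow_le_one_of_one_le_of_nonpos (by linarith) (by linarith)
  have b2 : (1 - (k / l) ^ 2)⁻¹ ≤ 4 * 2 ^ m := by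
    rw [inv_le_comm₀ hgap0 (by positivity)]
    nlinarith
  have b20 : 0 ≤ (1 - (k / l) ^ 2)⁻¹ := (inv_pos.2 hgap0).le
  have hY : 0 ≤ y ^ (1 - 2 / p) := Real.rpow_nonneg hy.le _
  have b3 : y * (1 + (1 + j ^ 2) / k ^ 2) + t ≤ (3 + C) * y ^ (1 - 2 / p) := by
    have h2 : (1 + j ^ 2) / k ^ 2 ≤ 1 + j ^ 2 := div_le_self (by positivity) (by nlinarith)
    have h3 : 1 ≤ j ^ 2 := by nlinarith
    have h5 : 1 + (1 + j ^ 2) / k ^ 2 ≤ 3 * j ^ 2 := by linarith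
    have h4 := mul_le_mul_of_nonneg_left h5 hy.le
    have h6 : y * (3 * j ^ 2) = 3 * (y * j ^ 2) := by ring
    rw [h6, hjp] at h4
    linarith
  have hT1 : 0 ≤ y * (1 + (1 + j ^ 2) / k ^ 2) + t := by positivity
  have h3 := pow_le_pow_left₀ b20 b2 3
  have h4 : (4 * (2 : ℝ) ^ m) ^ 3 = 64 * 8 ^ m := by
    rw [mul_pow, ← pow_mul, mul_comm m 3, pow_mul]; norm_num
  rw [h4] at h3
  have h5 := mul_le_mul_of_nonneg_left b3 hκ
  have b4 : (1 - (k / l) ^ 2)⁻¹ ^ 3 * (κ * (y * (1 + (1 + j ^ 2) / k ^ 2) + t))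
      ≤ 64 * (κ * (3 + C) + 1) * 8 ^ m * y ^ (1 - 2 / p) := by
    calc _ ≤ 64 * 8 ^ m * (κ * ((3 + C) * y ^ (1 - 2 / p))) :=
          mul_le_mul h3 h5 (mul_nonneg hκ hT1) (by positivity)
      _ = 64 * (κ * (3 + C)) * 8 ^ m * y ^ (1 - 2 / p) := by ring
      _ ≤ _ := by gcongr; linarith
  have h0 := mul_nonneg (pow_nonneg b20 3) (mul_nonneg hκ hT1)
  have b5 := Real.rpow_le_rpow h0 b4 hq0.le
  have e1 : (64 * (κ * (3 + C) + 1) * 8 ^ m * y ^ (1 - 2 / p)) ^ q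
      = (64 * (κ * (3 + C) + 1)) ^ q * ((8 : ℝ) ^ q) ^ m * y ^ (q * (1 - 2 / p)) := by
    have h6 : 0 ≤ 64 * (κ * (3 + C) + 1) := by positivity
    rw [Real.mul_rpow (mul_nonneg h6 (by positivity)) hY, Real.mul_rpow h6 (by positivity),
      ← Real.rpow_mul hy.le, mul_comm (1 - 2 / p) q, ← Real.rpow_natCast, ← Real.rpow_natCast,
      ← Real.rpow_mul (by norm_num), ← Real.rpow_mul (by norm_num), mul_comm q (m : ℝ)]
  rw [e1] at b5
  exact (mul_le_mul b1 b5 (Real.rpow_nonneg h0 _) zero_le_one).trans (le_of_eq (one_mul _))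

/-- The levels of `U_0` are empty beyond a height that depends only on the constants. -/
theorem exists_level_eq_zero {q : ℝ} (hq : 1 < q) {K : ℕ → ℝ} (hK : ∀ m, 0 ≤ K m) :
    ∃ M : ℝ, 0 < M ∧ ∀ T, LevelDecay q K T → T 0 M = 0 := by
  have hq0 : 0 < q := by linarith
  -- the decay exponent `p` is chosen so large that `q(1 - 2/p) > 1`
  obtain ⟨i, hi⟩ := pow_unbounded_of_one_lt (q / (q - 1)) hq
  obtain ⟨C, hC, hb⟩ := levelDecay_power hq hK i
  set p := 2 * q ^ i with hp
  have hq1 : 0 < q - 1 := by linarith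
  have hp2 : 2 * q / (q - 1) < p := by rw [hp, mul_div_assoc]; linarith
  have hpp : 2 < p := by
    refine lt_trans ?_ hp2
    rw [lt_div_iff₀ hq1]; linarith
  set σ := q * (1 - 2 / p) - 1 with hσ
  have hσ0 : 0 < σ := by
    have h1 : 2 * q < p * (q - 1) := by rwa [div_lt_iff₀ hq1] at hp2
    have h2 : σ = (p * (q - 1) - 2 * q) / p := by rw [hσ]; field_simp; ring
    rw [h2]
    exact div_pos (by linarith) (by linarith)
  set κ := K 0 * (3 + C 1) with hκ
  have hκ0 : 0 ≤ κ := mul_nonneg (hK 0) (by linarith [hC 1])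
  obtain ⟨η, hη, hfast⟩ := exists_fast_decay (A := (64 * (κ + 1)) ^ q) (b := (8 : ℝ) ^ q)
    (by positivity) (Real.one_lt_rpow (by norm_num) hq0) hσ0
  obtain ⟨M, hM1, hM⟩ : ∃ M : ℝ, 1 ≤ M ∧ C 0 * M ^ (2 - p) ≤ η := by
    have h1 : Tendsto (fun M : ℝ => C 0 * M ^ (2 - p)) atTop (𝓝 (C 0 * 0)) := by
      have := tendsto_rpow_neg_atTop (show 0 < p - 2 by linarith)
      rw [neg_sub] at this
      exact this.const_mul _
    rw [mul_zero] at h1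
    exact ((eventually_ge_atTop 1).and (h1.eventually (eventually_le_nhds hη))).exists
  refine ⟨2 * M, by linarith, fun T hT => ?_⟩
  -- The levels increase from `M` to `2M`, with geometrically decreasing gaps.
  set k : ℕ → ℝ := fun m => M * (2 - (1 / 2) ^ m) with hk
  have hk1 : ∀ m, M ≤ k m := fun m => by
    have : (1 / 2 : ℝ) ^ m ≤ 1 := pow_le_one₀ (by norm_num) (by norm_num)
    simp only [hk]; nlinarith
  have hk2 : ∀ m, k m ≤ 2 * M := fun m => by
    have : (0 : ℝ) ≤ (1 / 2 : ℝ) ^ m := by positivity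
    simp only [hk]; nlinarith
  have hkd : ∀ m, k (m + 1) - k m = M * (1 / 2) ^ (m + 1) := fun m => by
    simp only [hk]; ring
  have lim := hfast (fun m => T 0 (k m)) (fun m => hT.nonneg _ _) ?_ fun m => ?_
  · refine le_antisymm (ge_of_tendsto' lim fun m => ?_) (hT.nonneg _ _)
    exact hT.anti 0 (k m) (2 * M) (by linarith [hk1 m]) (hk2 m)
  · refine le_trans (hb T hT 0 (k 0) (by linarith [hk1 0])) ?_
    have : k 0 = M := by simp [hk]; ring
    rwa [this]
  · have hkm : 1 ≤ k m := hM1.trans (hk1 m)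
    have hlt : k m < k (m + 1) := by
      have := hkd m
      have h2 : 0 < M * (1 / 2) ^ (m + 1) := by positivity
      linarith
    rcases (hT.nonneg 0 (k m)).eq_or_lt with hz | hz
    · have h1 := (hT.anti 0 (k m) _ (by linarith) hlt.le).trans (le_of_eq hz.symm)
      refine h1.trans (mul_nonneg (by positivity) (Real.rpow_nonneg (hT.nonneg 0 (k m)) _))
    have hj := Real.rpow_pos_of_pos hz (-(1 / p))
    refine (hT.step 0 (k m) (k (m + 1)) _ (by linarith) hlt hj).trans ?_
    have hgap : (4 * 2 ^ m)⁻¹ ≤ 1 - k m / k (m + 1) := by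
      have h3 : 0 < k (m + 1) := by linarith
      rw [one_sub_div h3.ne', hkd, le_div_iff₀ h3]
      have h4 := hk2 (m + 1)
      have h5 : (1 / 2 : ℝ) ^ (m + 1) = 2 * (4 * 2 ^ m)⁻¹ := by
        rw [one_div, inv_pow, pow_succ, mul_inv, mul_inv]; ring
      rw [h5]
      have h6 : (0 : ℝ) < (4 * 2 ^ m)⁻¹ := by positivity
      nlinarith
    have e1 : 1 + σ = q * (1 - 2 / p) := by rw [hσ]; ring
    rw [e1]
    exact level_step_le hq hpp (zero_le_one.trans (hC 1)) (hK 0) hkm hlt hgap hz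
      (hT.le_one 0 _ (by linarith)) (hT.nonneg _ _) (hb T hT 1 _ hj)

/-! ### Truncations -/

/-- The chain rule for a `C¹` function of the positive part of `t - κ` whose derivative vanishes
at `0`. -/
theorem hasDerivAt_comp_posPart {g g' : ℝ → ℝ} (hg : ∀ t, 0 ≤ t → HasDerivAt g (g' t) t)
    (h0 : g' 0 = 0) (κ t : ℝ) :
    HasDerivAt (fun t => g (max (t - κ) 0)) (g' (max (t - κ) 0)) t := by
  rcases lt_trichotomy t κ with h | h | h
  · have h1 : max (t - κ) 0 = 0 := max_eq_right (by linarith)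
    rw [h1, h0]
    refine (hasDerivAt_const t (g 0)).congr_of_eventuallyEq ?_
    filter_upwards [Iio_mem_nhds h] with s hs
    have : s < κ := hs
    rw [max_eq_right (by linarith)]
  · subst h
    rw [sub_self, max_self, h0]
    have left : HasDerivWithinAt (fun s => g (max (s - t) 0)) 0 (Set.Iic t) t := by
      refine (hasDerivWithinAt_const t _ (g 0)).congr (fun s hs => ?_) (by simp)
      have : s ≤ t := hs
      rw [max_eq_right (by linarith)]
    have right : HasDerivWithinAt (fun s => g (max (s - t) 0)) 0 (Set.Ici t) t := by
      have h2 : HasDerivAt (fun s => g (s - t)) (g' 0) t := by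
        have := HasDerivAt.comp_sub_const t t (f := g) (f' := g' 0) (by
          rw [sub_self]; exact hg 0 le_rfl)
        exact this
      rw [h0] at h2
      refine h2.hasDerivWithinAt.congr (fun s hs => ?_) (by simp)
      have : t ≤ s := hs
      rw [max_eq_left (by linarith)]
    have := left.union right
    rwa [Set.Iic_union_Ici, hasDerivWithinAt_univ] at this
  · have h1 : max (t - κ) 0 = t - κ := max_eq_left (by linarith)
    rw [h1]
    have h2 := HasDerivAt.comp_sub_const t κ (hg (t - κ) (by linarith))
    refine h2.congr_of_eventuallyEq ?_
    filter_upwards [Ioi_mem_nhds h] with s hs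
    have : κ < s := hs
    rw [max_eq_left (by linarith)]

/-- The truncation `τ = (ρ - κ)_+ / (κ + (ρ - κ)_+)` of `ρ = |u|²` at the level `κ`. -/
def trunc (κ ρ : ℝ) : ℝ := max (ρ - κ) 0 / (κ + max (ρ - κ) 0)

/-- The derivative of `τ²`. -/
def truncSqDeriv (κ ρ : ℝ) : ℝ := 2 * max (ρ - κ) 0 * κ / (κ + max (ρ - κ) 0) ^ 3

/-- The function `ρτ³` for `ρ > κ`, whose derivative is controlled by `τ²`. -/
def truncCube (κ ρ : ℝ) : ℝ := max (ρ - κ) 0 ^ 3 / (κ + max (ρ - κ) 0) ^ 2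

/-- The derivative of `ρτ³`. -/
def truncCubeDeriv (κ ρ : ℝ) : ℝ :=
  max (ρ - κ) 0 ^ 2 * (3 * κ + max (ρ - κ) 0) / (κ + max (ρ - κ) 0) ^ 3

section Trunc

variable {κ : ℝ} (hκ : 0 < κ)
include hκ

theorem trunc_nonneg (ρ : ℝ) : 0 ≤ trunc κ ρ := by
  have : 0 ≤ max (ρ - κ) 0 := le_max_right _ _
  unfold trunc; positivity

theorem trunc_le_one (ρ : ℝ) : trunc κ ρ ≤ 1 := by
  have : 0 ≤ max (ρ - κ) 0 := le_max_right _ _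
  rw [trunc, div_le_one (by positivity)]; linarith

omit hκ in
theorem trunc_eq_zero {ρ : ℝ} (h : ρ ≤ κ) : trunc κ ρ = 0 := by
  rw [trunc, max_eq_right (by linarith), zero_div]

theorem continuous_trunc : Continuous (trunc κ) := by
  have h : Continuous fun ρ : ℝ => max (ρ - κ) 0 := (continuous_id.sub continuous_const).max continuous_const
  refine h.div (continuous_const.add h) fun ρ => ?_
  have : 0 ≤ max (ρ - κ) 0 := le_max_right _ _
  positivity

theorem truncSqDeriv_nonneg (ρ : ℝ) : 0 ≤ truncSqDeriv κ ρ := by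
  have : 0 ≤ max (ρ - κ) 0 := le_max_right _ _
  unfold truncSqDeriv; positivity

theorem truncSqDeriv_mul_le (ρ : ℝ) : truncSqDeriv κ ρ * ρ ≤ 2 * trunc κ ρ := by
  rcases le_or_gt ρ κ with h | h
  · rw [truncSqDeriv, max_eq_right (by linarith), trunc_eq_zero h]; simp
  · have h1 : κ + (ρ - κ) = ρ := by ring
    have h3 : 0 < ρ := hκ.trans h
    rw [truncSqDeriv, trunc, max_eq_left (by linarith), h1, ← mul_div_assoc, div_mul_eq_mul_div,
      div_le_div_iff₀ (by positivity) h3]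
    have h2 : 0 ≤ (ρ - κ) * ρ ^ 2 := by
      have : 0 ≤ ρ - κ := by linarith
      positivity
    nlinarith

theorem hasDerivAt_trunc_sq (ρ : ℝ) :
    HasDerivAt (fun t => trunc κ t ^ 2) (truncSqDeriv κ ρ) ρ := by
  refine hasDerivAt_comp_posPart (g := fun p => (p / (κ + p)) ^ 2)
    (g' := fun p => 2 * p * κ / (κ + p) ^ 3) (fun p hp => ?_) (by simp) κ ρ
  have h1 : κ + p ≠ 0 := by positivity
  have h2 := (((hasDerivAt_id p).div ((hasDerivAt_id p).const_add κ) h1).pow 2)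
  refine h2.congr_deriv ?_
  simp only [id, Pi.div_apply]
  have h3 : p / (κ + p) * (κ + p) = p := div_mul_cancel₀ p h1
  field_simp
  push_cast
  linear_combination 2 * κ * h3

theorem hasDerivAt_truncCube (ρ : ℝ) :
    HasDerivAt (truncCube κ) (truncCubeDeriv κ ρ) ρ := by
  refine hasDerivAt_comp_posPart (g := fun p => p ^ 3 / (κ + p) ^ 2)
    (g' := fun p => p ^ 2 * (3 * κ + p) / (κ + p) ^ 3) (fun p hp => ?_) (by simp) κ ρ
  have h1 : κ + p ≠ 0 := by positivity
  have h2 := ((hasDerivAt_id p).pow 3).div (((hasDerivAt_id p).const_add κ).pow 2) (pow_ne_zero 2 h1)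
  refine h2.congr_deriv ?_
  simp only [id]
  field_simp
  simp
  ring

theorem contDiff_trunc_sq : ContDiff ℝ 1 fun t => trunc κ t ^ 2 := by
  rw [contDiff_one_iff_deriv]
  refine ⟨fun t => (hasDerivAt_trunc_sq hκ t).differentiableAt, ?_⟩
  have e : deriv (fun t => trunc κ t ^ 2) = truncSqDeriv κ :=
    funext fun t => (hasDerivAt_trunc_sq hκ t).deriv
  rw [e]
  have h : Continuous fun ρ : ℝ => max (ρ - κ) 0 := (continuous_id.sub continuous_const).max continuous_const
  refine ((continuous_const.mul h).mul continuous_const).div ((continuous_const.add h).pow 3) fun ρ => ?_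
  have : 0 ≤ max (ρ - κ) 0 := le_max_right _ _
  positivity

theorem contDiff_truncCube : ContDiff ℝ 1 (truncCube κ) := by
  rw [contDiff_one_iff_deriv]
  refine ⟨fun t => (hasDerivAt_truncCube hκ t).differentiableAt, ?_⟩
  have e : deriv (truncCube κ) = truncCubeDeriv κ :=
    funext fun t => (hasDerivAt_truncCube hκ t).deriv
  rw [e]
  have h : Continuous fun ρ : ℝ => max (ρ - κ) 0 := (continuous_id.sub continuous_const).max continuous_const
  refine ((h.pow 2).mul (continuous_const.add h)).div ((continuous_const.add h).pow 3) fun ρ => ?_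
  have : 0 ≤ max (ρ - κ) 0 := le_max_right _ _
  positivity

theorem truncCubeDeriv_nonneg (ρ : ℝ) : 0 ≤ truncCubeDeriv κ ρ := by
  have : 0 ≤ max (ρ - κ) 0 := le_max_right _ _
  unfold truncCubeDeriv; positivity

theorem truncCubeDeriv_le (ρ : ℝ) : truncCubeDeriv κ ρ ≤ 3 * trunc κ ρ ^ 2 := by
  have h : 0 ≤ max (ρ - κ) 0 := le_max_right _ _
  rw [truncCubeDeriv, trunc]
  set p := max (ρ - κ) 0
  rw [div_pow, ← mul_div_assoc, div_le_div_iff₀ (by positivity) (by positivity)]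
  have h1 : 0 ≤ p ^ 2 * (κ + p) ^ 2 * (2 * p) := by positivity
  nlinarith

theorem truncCube_nonneg (ρ : ℝ) : 0 ≤ truncCube κ ρ := by
  have : 0 ≤ max (ρ - κ) 0 := le_max_right _ _
  unfold truncCube; positivity

omit hκ in
theorem truncCube_eq_zero {ρ : ℝ} (h : ρ ≤ κ) : truncCube κ ρ = 0 := by
  rw [truncCube, max_eq_right (by linarith)]; simp

theorem truncCube_eq {ρ : ℝ} (h : κ ≤ ρ) : truncCube κ ρ = ρ * (1 - κ / ρ) ^ 3 := by
  have : ρ ≠ 0 := by linarith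
  rw [truncCube, max_eq_left (by linarith)]
  have h1 : κ + (ρ - κ) = ρ := by ring
  rw [h1]
  field_simp

end Trunc

/-! ### The energy inequality -/

/-- Young's inequality: the terms of the form density other than the quadratic principal ones are
absorbed by a part of those and by the source. -/
theorem absorb_le (w r : Fin n → ℝ) {Θ Θ' τ U Q β : ℝ} (hΘ : 0 ≤ Θ) (hΘ' : 0 ≤ Θ')
    (hτ : Θ ≤ τ) (hτ' : Θ' * U ^ 2 ≤ 2 * τ) (hβ : 0 ≤ β) :
    Q * ∑ i, (Θ * w i + Θ' * |r i| * U) + Q * (U * Θ) + 2 * β * (Θ * U * ∑ i, w i) + β * (U ^ 2 * Θ)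
      ≤ Θ * (∑ i, w i ^ 2) / 4 + Θ' * (∑ i, r i ^ 2) / 4
        + (8 * n * β ^ 2 + β + 4 * n + 1) * (τ * (U ^ 2 + Q ^ 2)) := by
  have hτ0 : 0 ≤ τ := hΘ.trans hτ
  have hn : (0 : ℝ) ≤ n := Nat.cast_nonneg n
  have a2 : Q * ∑ i, (Θ * w i + Θ' * |r i| * U) ≤ Θ / 8 * ∑ i, w i ^ 2 + Θ' / 4 * ∑ i, r i ^ 2
      + n * (2 * (Θ * Q ^ 2) + (Θ' * U ^ 2) * Q ^ 2) := by
    have h1 : ∀ i, Q * (Θ * w i + Θ' * |r i| * U) ≤ Θ / 8 * w i ^ 2 + Θ' / 4 * r i ^ 2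
        + (2 * (Θ * Q ^ 2) + (Θ' * U ^ 2) * Q ^ 2) := by
      intro i
      have h2 := mul_nonneg hΘ (sq_nonneg (w i - 4 * Q))
      have h3 := mul_nonneg hΘ' (sq_nonneg (|r i| - 2 * (Q * U)))
      rw [← sq_abs (r i)]
      linarith
    have h2 := Finset.sum_le_sum fun i (_ : i ∈ Finset.univ) => h1 i
    refine (le_of_eq (Finset.mul_sum _ _ _)).trans (h2.trans (le_of_eq ?_))
    rw [Finset.sum_add_distrib, Finset.sum_add_distrib, ← Finset.mul_sum,
      ← Finset.mul_sum, Finset.sum_const, Finset.card_univ, Fintype.card_fin, nsmul_eq_mul]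
  have a3 : 2 * β * (Θ * U * ∑ i, w i) ≤ Θ / 8 * (∑ i, w i ^ 2) + n * (8 * β ^ 2 * (Θ * U ^ 2)) := by
    have h1 : ∀ i, 2 * β * (Θ * U) * w i ≤ Θ / 8 * w i ^ 2 + 8 * β ^ 2 * (Θ * U ^ 2) := by
      intro i
      have h2 := mul_nonneg hΘ (sq_nonneg (w i - 8 * (β * U)))
      linarith
    have h2 := Finset.sum_le_sum fun i (_ : i ∈ Finset.univ) => h1 i
    rw [← Finset.mul_sum, Finset.sum_add_distrib, ← Finset.mul_sum, Finset.sum_const,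
      Finset.card_univ, Fintype.card_fin, nsmul_eq_mul] at h2
    linarith
  have a4 : Q * (U * Θ) ≤ Θ * (Q ^ 2 + U ^ 2) := by
    have h2 := mul_nonneg hΘ (sq_nonneg (Q - U))
    have h3 : 0 ≤ Θ * (Q ^ 2 + U ^ 2) := by positivity
    linarith
  have a5 : n * (2 * (Θ * Q ^ 2) + (Θ' * U ^ 2) * Q ^ 2) ≤ n * (4 * (τ * Q ^ 2)) := by
    have h1 := mul_le_mul_of_nonneg_right hτ' (sq_nonneg Q)
    have h2 := mul_le_mul_of_nonneg_right hτ (sq_nonneg Q)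
    refine mul_le_mul_of_nonneg_left ?_ hn
    linarith
  have hU2 := mul_le_mul_of_nonneg_right hτ (sq_nonneg U)
  have a6 : n * (8 * β ^ 2 * (Θ * U ^ 2)) ≤ n * (8 * β ^ 2 * (τ * U ^ 2)) := by gcongr
  have a7 : β * (U ^ 2 * Θ) ≤ β * (τ * U ^ 2) := by
    refine mul_le_mul_of_nonneg_left ?_ hβ
    linarith
  have a8 : Θ * (Q ^ 2 + U ^ 2) ≤ τ * (Q ^ 2 + U ^ 2) :=
    mul_le_mul_of_nonneg_right hτ (by positivity)
  have r1 : 0 ≤ (8 * n * β ^ 2 + β) * (τ * Q ^ 2) := by positivity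
  have r2 : 0 ≤ 4 * n * (τ * U ^ 2) := by positivity
  linarith

/-- The real part of the form density of `L` with the truncated solution as test function. Here
`u` is the difference of the solutions, `w` its derivatives, `c` the unperturbed solution, `d` its
derivatives, and `m`, `b`, `V` are the perturbations of the coefficients. The terms with `Θ'` that
come from the principal part are nonnegative because the coefficients are real. -/
theorem energy_pointwise (m : Fin n → Fin n → ℝ) (b : Fin n → ℝ) (V : ℝ) (w d : Fin n → ℂ)
    (u c : ℂ) {Θ Θ' τ N β : ℝ} (hm : ∑ i, ∑ j, |m i j| ≤ 1 / 2) (hmN : ∀ i j, |m i j| ≤ N)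
    (hbN : ∀ j, |b j| ≤ N) (hVN : |V| ≤ N) (hbβ : ∀ j, |b j| ≤ β) (hVβ : |V| ≤ β) (hΘ : 0 ≤ Θ)
    (hΘ' : 0 ≤ Θ') (hτ : Θ ≤ τ) (hτ' : Θ' * ‖u‖ ^ 2 ≤ 2 * τ) {DF : Fin n → ℂ} {r : Fin n → ℝ}
    (hr : ∀ i, r i = -2 * (conj u * w i).im)
    (hDF : ∀ i, DF i = Θ * w i - Complex.I * Θ' * r i * u) :
    1 / 4 * (Θ * ∑ i, ‖w i‖ ^ 2) ≤
      ((∑ i, ∑ j, conj (((Coefficients.aFlat i j + m i j : ℝ) : ℂ) * (w j + d j)) * DF i)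
        + (∑ j, (conj ((b j : ℂ) * (w j + d j)) * (u * Θ) + conj ((b j : ℂ) * (u + c)) * DF j))
        + conj ((V : ℂ) * (u + c)) * (u * Θ)
        - ∑ i, ∑ j, conj ((Coefficients.aFlat i j : ℂ) * d j) * DF i).re
      + (8 * n * β ^ 2 + β + 4 * n + 1) * (τ * (‖u‖ ^ 2 + (N * (‖c‖ + ∑ j, ‖d j‖)) ^ 2)) := by
  set U := ‖u‖
  set W := ∑ i, ‖w i‖ ^ 2 with hW
  set S := ∑ i, r i ^ 2 with hS
  set X := ∑ j, ‖d j‖ with hX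
  have hU : 0 ≤ U := norm_nonneg _
  have hN : 0 ≤ N := (abs_nonneg _).trans hVN
  have hβ : 0 ≤ β := (abs_nonneg _).trans hVβ
  have hX0 : 0 ≤ X := Finset.sum_nonneg fun _ _ => norm_nonneg _
  have hW0 : 0 ≤ W := Finset.sum_nonneg fun _ _ => sq_nonneg _
  have hS0 : 0 ≤ S := Finset.sum_nonneg fun _ _ => sq_nonneg _
  set Y : Fin n → ℝ := fun i => Θ * ‖w i‖ + Θ' * |r i| * U with hY
  have hY0 : ∀ i, 0 ≤ Y i := fun i => by simp only [hY]; positivity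
  have cross : ∀ i (z : ℂ), -(‖z‖ * Y i) ≤ (conj z * DF i).re := by
    intro i z
    have h1 : ‖DF i‖ ≤ Y i := by
      rw [hDF]
      refine (norm_sub_le _ _).trans (le_of_eq ?_)
      rw [norm_mul, norm_mul, norm_mul, norm_mul, Complex.norm_I, Complex.norm_real,
        Complex.norm_real, Complex.norm_real, Real.norm_of_nonneg hΘ, Real.norm_of_nonneg hΘ', one_mul,
        Real.norm_eq_abs]
    have h2 := Complex.abs_re_le_norm (conj z * DF i)
    rw [norm_mul, RCLike.norm_conj] at h2
    have h3 := mul_le_mul_of_nonneg_left h1 (norm_nonneg z)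
    have := neg_abs_le (conj z * DF i).re
    linarith
  -- The derivative of the truncation contributes `Θ' r_i r_j / 2`. With real coefficients close to
  -- the identity matrix it is summed to a nonnegative quadratic form in `r`.
  have main : ∀ i j, (conj (w j) * DF i).re = Θ * (conj (w j) * w i).re + Θ' * (r i * r j) / 2 := by
    intro i j
    rw [hDF]
    have h2 : (conj (w j) * (Θ * w i - Complex.I * Θ' * r i * u)).re
        = Θ * (conj (w j) * w i).re + Θ' * r i * (-(conj u * w j).im) := by
      simp [Complex.mul_re, Complex.mul_im]; ring
    rw [h2, hr j]; ring
  have wle : ∀ i j, |(conj (w j) * w i).re| ≤ W := by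
    intro i j
    have h1 := Complex.abs_re_le_norm (conj (w j) * w i)
    rw [norm_mul, RCLike.norm_conj] at h1
    have h2 : ∀ i, ‖w i‖ ^ 2 ≤ W := fun i =>
      Finset.single_le_sum (f := fun i => ‖w i‖ ^ 2) (fun _ _ => sq_nonneg _) (Finset.mem_univ i)
    nlinarith [h2 i, h2 j, sq_nonneg (‖w i‖ - ‖w j‖)]
  have rle : ∀ i j, |r i * r j| ≤ S := by
    intro i j
    have h2 : ∀ i, r i ^ 2 ≤ S := fun i =>
      Finset.single_le_sum (f := fun i => r i ^ 2) (fun _ _ => sq_nonneg _) (Finset.mem_univ i)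
    rw [abs_mul]
    nlinarith [h2 i, h2 j, sq_nonneg (|r i| - |r j|), sq_abs (r i), sq_abs (r j)]
  have t1 : ∀ i j, Coefficients.aFlat i j * (Θ * (conj (w j) * w i).re + Θ' * (r i * r j) / 2)
      - |m i j| * (Θ * W + Θ' * S / 2) - N * (‖d j‖ * Y i) ≤
      (conj (((Coefficients.aFlat i j + m i j : ℝ) : ℂ) * (w j + d j)) * DF i).re
        - (conj ((Coefficients.aFlat i j : ℂ) * d j) * DF i).re := by
    intro i j
    have e : (conj (((Coefficients.aFlat i j + m i j : ℝ) : ℂ) * (w j + d j)) * DF i).re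
        - (conj ((Coefficients.aFlat i j : ℂ) * d j) * DF i).re
        = Coefficients.aFlat i j * (conj (w j) * DF i).re + m i j * (conj (w j) * DF i).re
          + (conj ((m i j : ℂ) * d j) * DF i).re := by
      simp only [map_mul, map_add, Complex.conj_ofReal, Complex.mul_re, Complex.mul_im,
        Complex.add_re, Complex.add_im, Complex.ofReal_re, Complex.ofReal_im]
      ring
    rw [e, main]
    have h1 := cross i ((m i j : ℂ) * d j)
    rw [norm_mul, Complex.norm_real, Real.norm_eq_abs, mul_assoc] at h1
    have h2 := mul_le_mul_of_nonneg_right (hmN i j) (mul_nonneg (norm_nonneg (d j)) (hY0 i))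
    have h3 : |Θ * (conj (w j) * w i).re + Θ' * (r i * r j) / 2| ≤ Θ * W + Θ' * S / 2 := by
      refine (abs_add_le _ _).trans ?_
      rw [abs_mul, abs_of_nonneg hΘ, abs_div, abs_mul, abs_of_nonneg hΘ', abs_two]
      have := wle i j
      have := rle i j
      gcongr
    have h4 := neg_abs_le (m i j * (Θ * (conj (w j) * w i).re + Θ' * (r i * r j) / 2))
    rw [abs_mul] at h4
    have h5 := mul_le_mul_of_nonneg_left h3 (abs_nonneg (m i j))
    linarith
  have t2 : ∀ j, -(2 * β * (Θ * U * ‖w j‖)) - N * (‖d j‖ * (U * Θ)) - N * (‖c‖ * Y j) ≤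
      (conj ((b j : ℂ) * (w j + d j)) * (u * Θ) + conj ((b j : ℂ) * (u + c)) * DF j).re := by
    intro j
    have e : (conj ((b j : ℂ) * (w j + d j)) * (u * Θ) + conj ((b j : ℂ) * (u + c)) * DF j).re
        = 2 * b j * (Θ * (conj u * w j).re) + (conj ((b j : ℂ) * d j) * (u * Θ)).re
          + (conj ((b j : ℂ) * c) * DF j).re := by
      rw [hDF]
      simp only [map_mul, map_add, Complex.conj_ofReal, Complex.mul_re, Complex.mul_im,
        Complex.add_re, Complex.add_im, Complex.sub_re, Complex.sub_im, Complex.ofReal_re,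
        Complex.ofReal_im, Complex.conj_re, Complex.conj_im, Complex.I_re, Complex.I_im]
      ring
    rw [e]
    have h1 := cross j ((b j : ℂ) * c)
    rw [norm_mul, Complex.norm_real, Real.norm_eq_abs, mul_assoc] at h1
    have h2 := mul_le_mul_of_nonneg_right (hbN j) (mul_nonneg (norm_nonneg c) (hY0 j))
    have h3 := Complex.abs_re_le_norm (conj ((b j : ℂ) * d j) * (u * Θ))
    rw [norm_mul, norm_mul, RCLike.norm_conj, norm_mul, Complex.norm_real, Complex.norm_real,
      Real.norm_eq_abs, Real.norm_of_nonneg hΘ, mul_assoc] at h3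
    have h4 := mul_le_mul_of_nonneg_right (hbN j) (mul_nonneg (norm_nonneg (d j))
      (mul_nonneg hU hΘ))
    have h5 := neg_abs_le (conj ((b j : ℂ) * d j) * (u * Θ)).re
    have h6 := Complex.abs_re_le_norm (conj u * w j)
    rw [norm_mul, RCLike.norm_conj] at h6
    have h7 : |b j * (Θ * (conj u * w j).re)| ≤ β * (Θ * (U * ‖w j‖)) := by
      rw [abs_mul, abs_mul, abs_of_nonneg hΘ]
      have := hbβ j
      gcongr
    have h8 := neg_abs_le (b j * (Θ * (conj u * w j).re))
    linarith
  have t3 : -(β * (U ^ 2 * Θ)) - N * (‖c‖ * (U * Θ)) ≤ (conj ((V : ℂ) * (u + c)) * (u * Θ)).re := by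
    have e : (conj ((V : ℂ) * (u + c)) * (u * Θ)).re
        = V * (U ^ 2 * Θ) + (conj ((V : ℂ) * c) * (u * Θ)).re := by
      have : U ^ 2 = u.re * u.re + u.im * u.im := by
        rw [← Complex.normSq_apply, Complex.normSq_eq_norm_sq]
      rw [this]
      simp only [map_mul, map_add, Complex.conj_ofReal, Complex.mul_re, Complex.mul_im,
        Complex.add_re, Complex.add_im, Complex.ofReal_re,
        Complex.ofReal_im, Complex.conj_re, Complex.conj_im]
      ring
    rw [e]
    have h3 := Complex.abs_re_le_norm (conj ((V : ℂ) * c) * (u * Θ))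
    rw [norm_mul, norm_mul, RCLike.norm_conj, norm_mul, Complex.norm_real, Complex.norm_real,
      Real.norm_eq_abs, Real.norm_of_nonneg hΘ, mul_assoc] at h3
    have h4 := mul_le_mul_of_nonneg_right hVN (mul_nonneg (norm_nonneg c) (mul_nonneg hU hΘ))
    have h5 := neg_abs_le (conj ((V : ℂ) * c) * (u * Θ)).re
    have h6 := mul_le_mul_of_nonneg_right ((neg_le_neg hVβ).trans (neg_abs_le V))
      (mul_nonneg (sq_nonneg U) hΘ)
    linarith
  have s1 := Finset.sum_le_sum fun i (_ : i ∈ Finset.univ) =>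
    Finset.sum_le_sum fun j (_ : j ∈ Finset.univ) => t1 i j
  have s2 := Finset.sum_le_sum fun j (_ : j ∈ Finset.univ) => t2 j
  have f1 : ∑ i, ∑ j, Coefficients.aFlat i j
      * (Θ * (conj (w j) * w i).re + Θ' * (r i * r j) / 2) = Θ * W + Θ' * S / 2 := by
    have : ∀ i, ∑ j, Coefficients.aFlat i j * (Θ * (conj (w j) * w i).re + Θ' * (r i * r j) / 2)
        = Θ * ‖w i‖ ^ 2 + Θ' / 2 * r i ^ 2 := by
      intro i
      rw [Finset.sum_eq_single i (fun j _ hj => by simp [Coefficients.aFlat, hj.symm])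
        (fun hi => absurd (Finset.mem_univ i) hi)]
      have : (conj (w i) * w i).re = ‖w i‖ ^ 2 := by
        rw [mul_comm, Complex.mul_conj, Complex.ofReal_re, Complex.normSq_eq_norm_sq]
      rw [this]
      simp [Coefficients.aFlat]; ring
    rw [Finset.sum_congr rfl fun i _ => this i, Finset.sum_add_distrib, ← Finset.mul_sum,
      ← Finset.mul_sum]
    ring
  simp only [Finset.sum_sub_distrib, f1, ← Finset.sum_mul, Finset.sum_neg_distrib,
    ← Finset.mul_sum] at s1 s2
  rw [← hX] at s1 s2
  simp only [Complex.add_re, Complex.sub_re, Complex.re_sum] at s1 s2 ⊢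
  have a1 := mul_le_mul_of_nonneg_right hm (show 0 ≤ Θ * W + Θ' * S / 2 by positivity)
  set Q := N * (‖c‖ + X) with hQ
  have hQ0 : 0 ≤ Q := by positivity
  have a2 := absorb_le (Q := Q) (fun i => ‖w i‖) r hΘ hΘ' hτ hτ' hβ
  have g1 : N * (X * ∑ i, Y i) + N * (‖c‖ * ∑ i, Y i) = Q * ∑ i, Y i := by rw [hQ]; ring
  have g2 : N * (X * (U * Θ)) + N * (‖c‖ * (U * Θ)) = Q * (U * Θ) := by rw [hQ]; ring
  linarith

/-! ### The energy and Sobolev inequalities for test functions -/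

theorem partialDeriv_comp_sq_norm {g : ℝ → ℝ} {g' : ℝ} {u : Eucl n → ℂ} {x : Eucl n}
    (hu : DifferentiableAt ℝ u x) (hg : HasDerivAt g g' (‖u x‖ ^ 2)) (j : Fin n) :
    partialDeriv j (fun y => g (‖u y‖ ^ 2)) x
      = g' * (2 * (conj (u x) * fderiv ℝ u x (stdVec j)).re) := by
  have h1 := hg.comp_hasFDerivAt x hu.hasFDerivAt.norm_sq
  have h2 : fderiv ℝ (fun y => g (‖u y‖ ^ 2)) x = _ := h1.fderiv
  rw [partialDeriv, h2]
  simp only [_root_.smul_apply, ContinuousLinearMap.comp_apply, innerSL_apply_apply, Complex.inner,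
    smul_eq_mul, nsmul_eq_mul, Nat.cast_ofNat, mul_comm ((fderiv ℝ u x) (stdVec j))]

theorem two_mul_re_fderiv (h : ℝ) (u : Eucl n → ℂ) (x : Eucl n) (j : Fin n) :
    h * (2 * (conj (u x) * fderiv ℝ u x (stdVec j)).re) = -2 * (conj (u x) * semiD h j u x).im := by
  rw [semiD]
  simp only [Complex.mul_re, Complex.mul_im, Complex.neg_re, Complex.neg_im, Complex.I_re,
    Complex.I_im, Complex.ofReal_re, Complex.ofReal_im, Complex.conj_re, Complex.conj_im]
  ring

theorem contDiff_comp_sq_norm {g : ℝ → ℝ} (hg : ContDiff ℝ 1 g) (u : Test n) :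
    ContDiff ℝ 1 fun x => g (‖(u : Eucl n → ℂ) x‖ ^ 2) :=
  hg.comp ((u.contDiff.of_le (by simp)).norm_sq ℝ)

/-- The truncated function `u τ(|u|²)²`. -/
def truncFun (κ : ℝ) (u : Eucl n → ℂ) (x : Eucl n) : ℂ := u x * ((trunc κ (‖u x‖ ^ 2) ^ 2 : ℝ) : ℂ)

theorem contDiff_truncFun {κ : ℝ} (hκ : 0 < κ) (u : Test n) : ContDiff ℝ 1 (truncFun κ (u : Eucl n → ℂ)) :=
  (u.contDiff.of_le (by simp)).mul
    (Complex.ofRealCLM.contDiff.comp (contDiff_comp_sq_norm (contDiff_trunc_sq hκ) u))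

theorem hasCompactSupport_truncFun (κ : ℝ) (u : Test n) : HasCompactSupport (truncFun κ (u : Eucl n → ℂ)) :=
  u.hasCompactSupport.mul_right

/-- The derivative of the truncation. The factor `-2 Im(ū 𝒟_j u)` is `h ∂_j |u|²`. -/
theorem semiD_truncFun {κ : ℝ} (hκ : 0 < κ) (u : Test n) (h : ℝ) (j : Fin n) (x : Eucl n) :
    semiD h j (truncFun κ (u : Eucl n → ℂ)) x =
      ((trunc κ (‖(u : Eucl n → ℂ) x‖ ^ 2) ^ 2 : ℝ) : ℂ) * semiD h j u x
      - Complex.I * (truncSqDeriv κ (‖(u : Eucl n → ℂ) x‖ ^ 2) : ℝ)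
        * ((-2 * (conj ((u : Eucl n → ℂ) x) * semiD h j u x).im : ℝ) : ℂ) * (u : Eucl n → ℂ) x := by
  have h1 : DifferentiableAt ℝ (fun x => trunc κ (‖(u : Eucl n → ℂ) x‖ ^ 2) ^ 2) x :=
    (contDiff_comp_sq_norm (contDiff_trunc_sq hκ) u).differentiable (by simp) x
  have h2 : DifferentiableAt ℝ (fun y => ((trunc κ (‖(u : Eucl n → ℂ) y‖ ^ 2) ^ 2 : ℝ) : ℂ)) x :=
    Complex.ofRealCLM.differentiableAt.comp x h1
  have h3 := semiD_mul (h := h) (j := j) (u.differentiable x) h2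
  rw [semiD_ofReal h1, partialDeriv_comp_sq_norm (u.differentiable x)
    (hasDerivAt_trunc_sq hκ _)] at h3
  refine h3.trans ?_
  rw [← two_mul_re_fderiv]
  push_cast
  ring

/-- The density of the sesquilinear form of `L`. -/
def DiffOp.formDens (L : DiffOp n) (χ : Test n) (G : Eucl n → ℂ) (x : Eucl n) : ℂ :=
  (∑ i, ∑ j, conj ((L.a i j x : ℂ) * semiD L.h j χ x) * semiD L.h i G x)
    + (∑ j, (conj ((L.b j x : ℂ) * semiD L.h j χ x) * G x
      + conj ((L.b j x : ℂ) * (χ : Eucl n → ℂ) x) * semiD L.h j G x))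
    + conj ((L.V x : ℂ) * (χ : Eucl n → ℂ) x) * G x

theorem DiffOp.integral_formDens (L : DiffOp n) (χ : Test n) {G : Eucl n → ℂ}
    (hG : ContDiff ℝ 1 G) (hc : HasCompactSupport G) : Integrable (L.formDens χ G) ∧
      Integrable (fun x => conj (diffExpr L.h L.a L.b L.V χ x) * G x) ∧
      ∫ x, L.formDens χ G x = ∫ x, conj (diffExpr L.h L.a L.b L.V χ x) * G x := by
  have hDχ : ∀ j : Fin n, Continuous (semiD L.h j χ) := fun j => (testD L.h j χ).continuous
  have cG : ∀ j, Continuous (semiD L.h j G) := fun j => continuous_semiD hG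
  have sG : ∀ j, HasCompactSupport (semiD L.h j G) := fun j => hc.semiD
  have int : ∀ {F H : Eucl n → ℂ}, Continuous F → Continuous H → HasCompactSupport H →
      Integrable fun x => conj (F x) * H x := fun hF hH hc =>
    ((Complex.continuous_conj.comp hF).mul hH).integrable_of_hasCompactSupport hc.mul_left
  have ca : ∀ i j, Continuous fun x => (L.a i j x : ℂ) := fun i j =>
    Complex.continuous_ofReal.comp (L.a_C1 i j).continuous
  have cb : ∀ j, Continuous fun x => (L.b j x : ℂ) := fun j =>
    Complex.continuous_ofReal.comp (L.b_C1 j).continuous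
  have i1 : ∀ i j : Fin n, Integrable fun x =>
      conj ((L.a i j x : ℂ) * semiD L.h j χ x) * semiD L.h i G x := fun i j =>
    int ((ca i j).mul (hDχ j)) (cG i) (sG i)
  have i2 : ∀ j : Fin n, Integrable fun x => conj ((L.b j x : ℂ) * semiD L.h j χ x) * G x := fun j =>
    int ((cb j).mul (hDχ j)) hG.continuous hc
  have i3 : ∀ j : Fin n, Integrable fun x =>
      conj ((L.b j x : ℂ) * (χ : Eucl n → ℂ) x) * semiD L.h j G x := fun j =>
    int ((cb j).mul χ.continuous) (cG j) (sG j)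
  have i4 : Integrable fun x => conj ((L.V x : ℂ) * (χ : Eucl n → ℂ) x) * G x := by
    obtain ⟨K, hK⟩ := L.bddMeas_V.2
    have := (int χ.continuous hG.continuous hc).bdd_mul (c := K) L.bddMeas_V.1 hK
    refine this.congr (Eventually.of_forall fun x => ?_)
    simp only [map_mul, Complex.conj_ofReal]
    ring
  refine ⟨((integrable_finsetSum _ fun i _ => integrable_finsetSum _ fun j _ => i1 i j).add
    (integrable_finsetSum _ fun j _ => (i2 j).add (i3 j))).add i4, ?_, ?_⟩
  · have h2 : MemLp G 2 volume := hG.continuous.memLp_of_hasCompactSupport hc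
    refine ((Lp.memLp (L.op χ)).star.integrable_mul h2).congr ?_
    filter_upwards [L.coeFn_op χ] with x hx
    change star (L.op χ x) * G x = _
    rw [hx]; rfl
  rw [integral_conj_diffExpr_mul L χ hG hc]
  exact integral_sum₃ i1 i2 i3 i4

theorem lowSum_eq (h : ℝ) (ψ : Test n) (x : Eucl n) :
    lowSum h ψ x = ‖(ψ : Eucl n → ℂ) x‖ + ∑ j : Fin n, ‖semiD h j ψ x‖ := by
  rw [lowSum, Fintype.sum_option]; rfl

theorem continuous_lowSum (h : ℝ) (ψ : Test n) : Continuous (lowSum h ψ) :=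
  continuous_finsetSum _ fun _ _ => (Test.continuous _).norm

theorem integrable_trunc_mul {κ : ℝ} (hκ : 0 < κ) {u : Eucl n → ℂ}
    (hu : AEStronglyMeasurable u volume) {f : Eucl n → ℝ} (hf : Integrable f) :
    Integrable fun x => trunc κ (‖u x‖ ^ 2) * f x := by
  refine hf.bdd_mul (c := 1) ((continuous_trunc hκ).comp_aestronglyMeasurable (hu.norm.pow 2))
    (Eventually.of_forall fun x => ?_)
  rw [Real.norm_of_nonneg (trunc_nonneg hκ _)]
  exact trunc_le_one hκ _

theorem hasCompactSupport_lowSum (h : ℝ) (ψ : Test n) : HasCompactSupport (lowSum h ψ) := by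
  refine HasCompactSupport.intro ψ.hasCompactSupport.isCompact fun x hx => ?_
  rw [lowSum_eq, image_eq_zero_of_notMem_tsupport hx]
  simp only [semiD_eq_zero_of_notMem hx, norm_zero, Finset.sum_const_zero, add_zero]

/-- The density that controls the truncated energy: `u` is the difference of two solutions, `Z` that
of the right-hand sides, `c` the unperturbed solution and `N` the size of the perturbation. -/
def energySource (h : ℝ) (N : Eucl n → ℝ) (u c : Test n) (Z : L2 n) (x : Eucl n) : ℝ :=
  ‖(u : Eucl n → ℂ) x‖ ^ 2 + ‖Z x‖ ^ 2 + (N x * lowSum h c x) ^ 2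

theorem integrable_energySource (h : ℝ) {N : Eucl n → ℝ} (hN : Continuous N) (u c : Test n)
    (Z : L2 n) : Integrable (energySource h N u c Z) := by
  have s1 : HasCompactSupport fun x => ‖(u : Eucl n → ℂ) x‖ ^ 2 :=
    HasCompactSupport.intro u.hasCompactSupport.isCompact fun x hx => by
      rw [image_eq_zero_of_notMem_tsupport hx]; simp
  have c1 : Continuous fun x => ‖(u : Eucl n → ℂ) x‖ ^ 2 := u.continuous.norm.pow 2
  have k1 : Integrable fun x => ‖(u : Eucl n → ℂ) x‖ ^ 2 := c1.integrable_of_hasCompactSupport s1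
  have k2 : Integrable fun x => ‖Z x‖ ^ 2 := (Lp.memLp Z).norm.integrable_sq
  have s3 : HasCompactSupport fun x => (N x * lowSum h c x) ^ 2 :=
    HasCompactSupport.intro (hasCompactSupport_lowSum h c).isCompact fun x hx => by
      rw [image_eq_zero_of_notMem_tsupport hx]; simp
  have k3 : Integrable fun x => (N x * lowSum h c x) ^ 2 :=
    ((hN.mul (continuous_lowSum h c)).pow 2).integrable_of_hasCompactSupport s3
  exact (k1.add k2).add k3

/-- The form of the difference of the two equations bounds the truncated energy from below,
pointwise, up to the source. -/
theorem form_ge (L : DiffOp n) {N : Eucl n → ℝ} (hN : ∀ᵐ x, ∀ o o', |L.pertCoef o o' x| ≤ N x)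
    (hm : ∀ᵐ x, ∑ i, ∑ j, |L.pertCoef (some i) (some j) x| ≤ 1 / 2) {α c u : Test n} {κ : ℝ}
    (hκ : 0 < κ) (hu : α = u + c) (Z : L2 n) : ∀ᵐ x,
      1 / 4 * (trunc κ (‖(u : Eucl n → ℂ) x‖ ^ 2) ^ 2 * ∑ i : Fin n, ‖semiD L.h i u x‖ ^ 2)
      ≤ (L.formDens α (truncFun κ (u : Eucl n → ℂ)) x
          - (freeDiffOp n L.h L.mem_hRange).formDens c (truncFun κ (u : Eucl n → ℂ)) x).re
        + (8 * n * L.B ^ 2 + L.B + 4 * n + 1)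
          * (trunc κ (‖(u : Eucl n → ℂ) x‖ ^ 2) * energySource L.h N u c Z x) := by
  filter_upwards [hN, hm, L.b_le, L.V_le] with x k1 k2 k3 k4
  set ρ := ‖(u : Eucl n → ℂ) x‖ ^ 2 with hρ
  have hB := L.B_nonneg
  have hτ0 := trunc_nonneg hκ ρ
  have hτ1 := trunc_le_one hκ ρ
  have key := energy_pointwise (fun i j => L.pertCoef (some i) (some j) x) (fun j => L.b j x)
    (L.V x) (fun j => semiD L.h j u x) (fun j => semiD L.h j c x) ((u : Eucl n → ℂ) x)
    ((c : Eucl n → ℂ) x) (Θ := trunc κ ρ ^ 2) (Θ' := truncSqDeriv κ ρ)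
    (τ := trunc κ ρ) k2 (fun i j => k1 _ _) (fun j => k1 (some j) none) (k1 none none) k3 k4
    (sq_nonneg _) (truncSqDeriv_nonneg hκ _) (by nlinarith) (truncSqDeriv_mul_le hκ _)
    (fun _ => rfl) (fun i => semiD_truncFun hκ u L.h i x)
  have hα : (α : Eucl n → ℂ) x = (u : Eucl n → ℂ) x + (c : Eucl n → ℂ) x := by rw [hu]; rfl
  have hDα : ∀ j : Fin n, semiD L.h j α x = semiD L.h j u x + semiD L.h j c x := fun j => by
    have := congrArg (fun ψ : Test n => (ψ : Eucl n → ℂ) x) (map_add (testD L.h j) u c)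
    rw [← hu] at this
    rw [coe_testD] at this
    rw [this]
    change (testD L.h j u : Eucl n → ℂ) x + (testD L.h j c : Eucl n → ℂ) x = _
    rw [coe_testD, coe_testD]
  have e4 : ∀ i j, Coefficients.aFlat i j + L.pertCoef (some i) (some j) x = L.a i j x :=
    fun i j => by simp [DiffOp.pertCoef]
  have e5 : (freeDiffOp n L.h L.mem_hRange).formDens c (truncFun κ (u : Eucl n → ℂ)) x
      = ∑ i, ∑ j, conj ((Coefficients.aFlat i j : ℂ) * semiD L.h j c x)
        * semiD L.h i (truncFun κ (u : Eucl n → ℂ)) x := by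
    simp only [DiffOp.formDens, freeDiffOp, Complex.ofReal_zero, zero_mul, map_zero, add_zero,
      Finset.sum_const_zero]
  rw [e5, DiffOp.formDens, hα]
  simp only [hDα]
  simp only [e4] at key
  refine key.trans (add_le_add le_rfl (mul_le_mul_of_nonneg_left (mul_le_mul_of_nonneg_left ?_ hτ0)
    (by positivity)))
  rw [energySource, lowSum_eq]
  linarith [sq_nonneg ‖Z x‖]

/-- The same form is bounded from above by the source, by the equation for the difference. -/
theorem form_le (L : DiffOp n) {N : Eucl n → ℝ} (hNc : Continuous N) {α c u : Test n} {κ : ℝ}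
    (hκ : 0 < κ) (hu : α = u + c) {Z : L2 n} (hZ : Z = L.shift (-Complex.I) α
      - (freeDiffOp n L.h L.mem_hRange).shift (-Complex.I) c) :
    (∫ x, (L.formDens α (truncFun κ (u : Eucl n → ℂ)) x
          - (freeDiffOp n L.h L.mem_hRange).formDens c (truncFun κ (u : Eucl n → ℂ)) x)).re
      ≤ ∫ x, 2 * (trunc κ (‖(u : Eucl n → ℂ) x‖ ^ 2) * energySource L.h N u c Z x) := by
  set L₀ := freeDiffOp n L.h L.mem_hRange
  set F := truncFun κ (u : Eucl n → ℂ) with hF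
  have hF1 : ContDiff ℝ 1 F := contDiff_truncFun hκ u
  have hFc : HasCompactSupport F := hasCompactSupport_truncFun κ u
  obtain ⟨j1, d1, e1⟩ := L.integral_formDens α hF1 hFc
  obtain ⟨j2, d2, e2⟩ := L₀.integral_formDens c hF1 hFc
  have iR := integrable_trunc_mul hκ u.continuous.aestronglyMeasurable
    (integrable_energySource L.h hNc u c Z)
  have e3 : ∫ x, (L.formDens α F x - L₀.formDens c F x)
      = ∫ x, conj (Z x - Complex.I * (u : Eucl n → ℂ) x) * F x := by
    rw [integral_sub j1 j2, e1, e2, ← integral_sub d1 d2]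
    refine integral_congr_ae ?_
    filter_upwards [L.coeFn_op α, L₀.coeFn_op c, coeFn_testLp α, coeFn_testLp c,
      Lp.coeFn_sub (L.shift (-Complex.I) α) (L₀.shift (-Complex.I) c),
      Lp.coeFn_sub (L.op α) ((-Complex.I) • testLp α), Lp.coeFn_smul (-Complex.I) (testLp α),
      Lp.coeFn_sub (L₀.op c) ((-Complex.I) • testLp c), Lp.coeFn_smul (-Complex.I) (testLp c)]
      with x k1 k2 k3 k4 k5 k6 k7 k8 k9
    have hα : (α : Eucl n → ℂ) x = (u : Eucl n → ℂ) x + (c : Eucl n → ℂ) x := by rw [hu]; rfl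
    have e5 : Z x - Complex.I * (u : Eucl n → ℂ) x = diffExpr L.h L.a L.b L.V α x
        - diffExpr L₀.h L₀.a L₀.b L₀.V c x := by
      rw [hZ, k5, Pi.sub_apply, L.shift_apply, L₀.shift_apply, k6, k8, Pi.sub_apply,
        Pi.sub_apply, k7, k9, Pi.smul_apply, Pi.smul_apply, k1, k2, k3, k4, hα, smul_eq_mul,
        smul_eq_mul]
      ring
    rw [e5, map_sub, sub_mul]
  rw [e3]
  refine (Complex.re_le_norm _).trans (norm_integral_le_of_norm_le (iR.const_mul 2)
    (Eventually.of_forall fun x => ?_))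
  have hτ0 := trunc_nonneg hκ (‖(u : Eucl n → ℂ) x‖ ^ 2)
  have hτ1 := trunc_le_one hκ (‖(u : Eucl n → ℂ) x‖ ^ 2)
  rw [norm_mul, RCLike.norm_conj, hF, truncFun, norm_mul, Complex.norm_real,
    Real.norm_of_nonneg (sq_nonneg _), energySource]
  have hZ' : ‖Z x - Complex.I * (u : Eucl n → ℂ) x‖ ≤ ‖Z x‖ + ‖(u : Eucl n → ℂ) x‖ := by
    refine (norm_sub_le _ _).trans (le_of_eq ?_)
    rw [norm_mul, Complex.norm_I, one_mul]
  set U := ‖(u : Eucl n → ℂ) x‖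
  set τ := trunc κ (U ^ 2)
  have hU0 : 0 ≤ U := norm_nonneg _
  have h1 : U * τ ^ 2 ≤ U * τ := mul_le_mul_of_nonneg_left (by nlinarith) hU0
  have h2 : (‖Z x‖ + U) * U ≤ 2 * (U ^ 2 + ‖Z x‖ ^ 2 + (N x * lowSum L.h c x) ^ 2) := by
    nlinarith [sq_nonneg (‖Z x‖ - U), sq_nonneg (N x * lowSum L.h c x), sq_nonneg ‖Z x‖]
  calc _ ≤ (‖Z x‖ + U) * (U * τ) := mul_le_mul hZ' h1 (by positivity) (by positivity)
    _ = τ * ((‖Z x‖ + U) * U) := by ring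
    _ ≤ τ * (2 * (U ^ 2 + ‖Z x‖ ^ 2 + (N x * lowSum L.h c x) ^ 2)) :=
      mul_le_mul_of_nonneg_left h2 hτ0
    _ = _ := by ring

theorem integrable_trunc_energy {κ : ℝ} (hκ : 0 < κ) (u : Test n) (h : ℝ) : Integrable fun x =>
    trunc κ (‖(u : Eucl n → ℂ) x‖ ^ 2) ^ 2 * ∑ i : Fin n, ‖semiD h i u x‖ ^ 2 := by
  refine Continuous.integrable_of_hasCompactSupport ?_ ?_
  · exact (((continuous_trunc hκ).comp (u.continuous.norm.pow 2)).pow 2).mul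
      (continuous_finsetSum _ fun j _ => (testD h j u).continuous.norm.pow 2)
  · refine HasCompactSupport.intro u.hasCompactSupport.isCompact fun x hx => ?_
    simp only [semiD_eq_zero_of_notMem hx, norm_zero]
    simp

/-- The energy inequality: if the principal part is close to the Euclidean one, the truncated
energy of the difference `u` of two solutions is controlled by the levels of `u`, of the difference
of the right-hand sides, and by the perturbation. -/
theorem energy_test (L : DiffOp n) {N : Eucl n → ℝ} (hNc : Continuous N)
    (hN : ∀ᵐ x, ∀ o o', |L.pertCoef o o' x| ≤ N x)
    (hm : ∀ᵐ x, ∑ i, ∑ j, |L.pertCoef (some i) (some j) x| ≤ 1 / 2) {α c u : Test n} {κ : ℝ}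
    (hκ : 0 < κ) (hu : α = u + c) {Z : L2 n} (hZ : Z = L.shift (-Complex.I) α
      - (freeDiffOp n L.h L.mem_hRange).shift (-Complex.I) c) :
    ∫ x, trunc κ (‖(u : Eucl n → ℂ) x‖ ^ 2) ^ 2 * ∑ i : Fin n, ‖semiD L.h i u x‖ ^ 2
      ≤ 4 * (8 * n * L.B ^ 2 + L.B + 4 * n + 3) *
        ∫ x, trunc κ (‖(u : Eucl n → ℂ) x‖ ^ 2) * energySource L.h N u c Z x := by
  obtain ⟨j1, -, -⟩ := L.integral_formDens α (contDiff_truncFun hκ u) (hasCompactSupport_truncFun κ u)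
  obtain ⟨j2, -, -⟩ := (freeDiffOp n L.h L.mem_hRange).integral_formDens c (contDiff_truncFun hκ u)
    (hasCompactSupport_truncFun κ u)
  have iR := integrable_trunc_mul hκ u.continuous.aestronglyMeasurable
    (integrable_energySource L.h hNc u c Z)
  have p2 := form_le L hNc hκ hu hZ
  have j3 := (j1.sub j2).re
  have p3 := integral_mono_ae ((integrable_trunc_energy hκ u L.h).const_mul (1 / 4))
    (j3.add (iR.const_mul _)) (form_ge L hN hm hκ hu Z)
  have p5 := p3.trans (le_of_eq (integral_add j3 (iR.const_mul _)))
  have e4 : (∫ x, RCLike.re ((L.formDens α (truncFun κ (u : Eucl n → ℂ))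
        - (freeDiffOp n L.h L.mem_hRange).formDens c (truncFun κ (u : Eucl n → ℂ))) x))
      = (∫ x, (L.formDens α (truncFun κ (u : Eucl n → ℂ)) x
        - (freeDiffOp n L.h L.mem_hRange).formDens c (truncFun κ (u : Eucl n → ℂ)) x)).re :=
    integral_re (j1.sub j2)
  rw [integral_const_mul] at p2
  rw [integral_const_mul, integral_const_mul, e4] at p5
  linarith

/-- The Sobolev inequality `W^{1,1} ⊂ L^{n/(n-1)}`. -/
theorem exists_sobolev (hn : 2 ≤ n) : ∃ C : ℝ, 0 ≤ C ∧ ∀ G : Eucl n → ℝ, ContDiff ℝ 1 G →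
    HasCompactSupport G → ∀ I : ℝ, ∫ x, ∑ j, |partialDeriv j G x| ≤ I →
      ∫⁻ x, ENNReal.ofReal |G x| ^ ((n : ℝ) / (n - 1))
        ≤ ENNReal.ofReal (C * I ^ ((n : ℝ) / (n - 1))) := by
  have hn1 : (1 : ℝ) < n := by exact_mod_cast hn
  have hq : Real.HolderConjugate (Module.finrank ℝ (Eucl n) : ℝ) ((n : ℝ) / (n - 1)) := by
    rw [finrank_euclideanSpace_fin]
    exact Real.HolderConjugate.conjExponent hn1
  have hq0 : 0 < (n : ℝ) / (n - 1) := hq.symm.pos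
  set C := lintegralPowLePowLIntegralFDerivConst (volume : Measure (Eucl n)) ((n : ℝ) / (n - 1))
  refine ⟨C, C.2, fun G hG hc I hI => ?_⟩
  have cd : ∀ j, Continuous fun x => |partialDeriv j G x| := fun j =>
    ((hG.continuous_fderiv (by simp)).clm_apply continuous_const).abs
  have ci : Integrable fun x => ∑ j, |partialDeriv j G x| := by
    refine (continuous_finsetSum _ fun j _ => cd j).integrable_of_hasCompactSupport ?_
    refine HasCompactSupport.intro hc.isCompact fun x hx => ?_
    simp [partialDeriv, fderiv_of_notMem_tsupport ℝ hx]
  have hI0 : 0 ≤ I := (integral_nonneg fun x => Finset.sum_nonneg fun j _ => abs_nonneg _).trans hI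
  have h1 := lintegral_pow_le_pow_lintegral_fderiv (volume : Measure (Eucl n)) hG hc hq
  have h2 : ∫⁻ x, ‖fderiv ℝ G x‖ₑ ≤ ENNReal.ofReal I := by
    refine le_trans ?_ (ENNReal.ofReal_le_ofReal hI)
    rw [ofReal_integral_eq_lintegral_ofReal ci (Eventually.of_forall fun x =>
      Finset.sum_nonneg fun j _ => abs_nonneg _)]
    refine lintegral_mono fun x => ?_
    rw [← ofReal_norm]
    refine ENNReal.ofReal_le_ofReal (ContinuousLinearMap.opNorm_le_bound _
      (Finset.sum_nonneg fun j _ => abs_nonneg _) fun v => ?_)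
    have hv : v = ∑ j, v j • stdVec j := by
      ext i
      simp [stdVec, Finset.sum_apply, Pi.single_apply]
    have e : fderiv ℝ G x v = ∑ j, v j * partialDeriv j G x := by
      nth_rw 1 [hv]
      simp [partialDeriv]
    rw [e, Finset.sum_mul]
    refine norm_sum_le_of_le _ fun j _ => ?_
    rw [norm_mul, mul_comm, Real.norm_eq_abs]
    exact mul_le_mul_of_nonneg_left (PiLp.norm_apply_le v j) (abs_nonneg _)
  have h3 : ∀ x, ENNReal.ofReal |G x| = ‖G x‖ₑ := fun x => (Real.enorm_eq_ofReal_abs _).symm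
  simp only [h3]
  refine h1.trans ?_
  rw [ENNReal.ofReal_mul (NNReal.coe_nonneg C), ← ENNReal.ofReal_rpow_of_nonneg hI0 hq0.le,
    ENNReal.ofReal_coe_nnreal]
  gcongr

/-! ### The decay of the levels of the difference of two solutions -/

/-- The constant in the energy inequality. -/
def energyConst (n : ℕ) (B : ℝ) : ℝ := 4 * (8 * n * B ^ 2 + B + 4 * n + 3)

theorem energyConst_mono {B B' : ℝ} (hB : 0 ≤ B) (h : B ≤ B') :
    energyConst n B ≤ energyConst n B' := by
  unfold energyConst; gcongr

theorem energyConst_nonneg {B : ℝ} (hB : 0 ≤ B) : 0 ≤ energyConst n B := by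
  unfold energyConst; positivity

theorem trunc_mul_source_nonneg {κ : ℝ} (hκ : 0 < κ) (h : ℝ) (N : Eucl n → ℝ) (u c : Test n)
    (Z : L2 n) (x : Eucl n) :
    0 ≤ trunc κ (‖(u : Eucl n → ℂ) x‖ ^ 2) * energySource h N u c Z x := by
  have := trunc_nonneg hκ (‖(u : Eucl n → ℂ) x‖ ^ 2)
  unfold energySource; positivity

/-- The gradient of `ρτ³` is integrable by the energy inequality. It is at most `3τ²|∂_j |u|²|`, and
`|∂_j |u|²| ≤ (|u|² + |𝒟_j u|²)/h`. -/
theorem integral_deriv_truncCube_le (L : DiffOp n) {B : ℝ} (hB : L.B ≤ B) {N : Eucl n → ℝ}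
    (hNc : Continuous N) (hN : ∀ᵐ x, ∀ o o', |L.pertCoef o o' x| ≤ N x)
    (hm : ∀ᵐ x, ∑ i, ∑ j, |L.pertCoef (some i) (some j) x| ≤ 1 / 2) {α c u : Test n} {κ : ℝ}
    (hκ : 0 < κ) (hu : α = u + c) {Z : L2 n} (hZ : Z = L.shift (-Complex.I) α
      - (freeDiffOp n L.h L.mem_hRange).shift (-Complex.I) c) :
    ∫ x, ∑ j, |partialDeriv j (fun x => truncCube κ (‖(u : Eucl n → ℂ) x‖ ^ 2)) x|
      ≤ 3 / L.h * (n + energyConst n B) *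
        ∫ x, trunc κ (‖(u : Eucl n → ℂ) x‖ ^ 2) * energySource L.h N u c Z x := by
  have hh := L.h_pos
  have iR := integrable_trunc_mul hκ u.continuous.aestronglyMeasurable
    (integrable_energySource L.h hNc u c Z)
  have iE := integrable_trunc_energy hκ u L.h
  have p1 : ∀ x, ∑ j, |partialDeriv j (fun x => truncCube κ (‖(u : Eucl n → ℂ) x‖ ^ 2)) x|
      ≤ 3 / L.h * (n * (trunc κ (‖(u : Eucl n → ℂ) x‖ ^ 2) * energySource L.h N u c Z x)
        + trunc κ (‖(u : Eucl n → ℂ) x‖ ^ 2) ^ 2 * ∑ i : Fin n, ‖semiD L.h i u x‖ ^ 2) := by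
    intro x
    set U := ‖(u : Eucl n → ℂ) x‖ with hU
    have hτ0 := trunc_nonneg hκ (U ^ 2)
    have hτ1 := trunc_le_one hκ (U ^ 2)
    have p2 : ∀ j, |partialDeriv j (fun x => truncCube κ (‖(u : Eucl n → ℂ) x‖ ^ 2)) x|
        ≤ 3 / L.h * (trunc κ (U ^ 2) ^ 2 * U ^ 2 + trunc κ (U ^ 2) ^ 2 * ‖semiD L.h j u x‖ ^ 2) := by
      intro j
      rw [partialDeriv_comp_sq_norm (u.differentiable x) (hasDerivAt_truncCube hκ _), abs_mul,
        abs_of_nonneg (truncCubeDeriv_nonneg hκ _)]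
      have e1 := two_mul_re_fderiv L.h (u : Eucl n → ℂ) x j
      have e2 : |2 * (conj ((u : Eucl n → ℂ) x) * fderiv ℝ (u : Eucl n → ℂ) x (stdVec j)).re|
          ≤ (U ^ 2 + ‖semiD L.h j u x‖ ^ 2) / L.h := by
        rw [le_div_iff₀ hh, mul_comm, ← abs_of_pos hh, ← abs_mul, abs_of_pos hh, e1, abs_mul]
        have h1 := Complex.abs_im_le_norm (conj ((u : Eucl n → ℂ) x) * semiD L.h j u x)
        rw [norm_mul, RCLike.norm_conj] at h1
        have h2 : |(-2 : ℝ)| = 2 := by norm_num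
        rw [h2]
        nlinarith [sq_nonneg (U - ‖semiD L.h j u x‖)]
      calc _ ≤ 3 * trunc κ (U ^ 2) ^ 2 * ((U ^ 2 + ‖semiD L.h j u x‖ ^ 2) / L.h) :=
            mul_le_mul (truncCubeDeriv_le hκ _) e2 (abs_nonneg _) (by positivity)
        _ = _ := by ring
    refine (Finset.sum_le_sum fun j _ => p2 j).trans ?_
    rw [← Finset.mul_sum, Finset.sum_add_distrib, ← Finset.mul_sum, Finset.sum_const,
      Finset.card_univ, Fintype.card_fin, nsmul_eq_mul]
    have h1 : trunc κ (U ^ 2) ^ 2 * U ^ 2 ≤ trunc κ (U ^ 2) * energySource L.h N u c Z x := by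
      have h2 : U ^ 2 ≤ energySource L.h N u c Z x := by
        rw [energySource]
        nlinarith [sq_nonneg ‖Z x‖, sq_nonneg (N x * lowSum L.h c x)]
      have h3 : trunc κ (U ^ 2) ^ 2 ≤ trunc κ (U ^ 2) := by nlinarith
      exact mul_le_mul h3 h2 (sq_nonneg _) hτ0
    rw [← Finset.mul_sum, mul_left_comm (trunc κ (U ^ 2) ^ 2)]
    exact mul_le_mul_of_nonneg_left (add_le_add (mul_le_mul_of_nonneg_left h1 (Nat.cast_nonneg n))
      le_rfl) (by positivity)
  have p3 := integral_mono_of_nonneg (Eventually.of_forall fun x =>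
    Finset.sum_nonneg fun j _ => abs_nonneg _) (((iR.const_mul (n : ℝ)).add iE).const_mul (3 / L.h))
    (Eventually.of_forall p1)
  refine p3.trans ?_
  rw [integral_const_mul, mul_assoc]
  refine mul_le_mul_of_nonneg_left ?_ (by positivity)
  have p4 := (energy_test L hNc hN hm hκ hu hZ)
  have p5 := integral_add (iR.const_mul (n : ℝ)) iE
  refine (le_of_eq p5).trans ?_
  rw [integral_const_mul, add_mul]
  have p6 : energyConst n L.B * (∫ x, trunc κ (‖(u : Eucl n → ℂ) x‖ ^ 2)
      * energySource L.h N u c Z x) ≤ energyConst n B * ∫ x, trunc κ (‖(u : Eucl n → ℂ) x‖ ^ 2)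
      * energySource L.h N u c Z x := mul_le_mul_of_nonneg_right (energyConst_mono L.B_nonneg hB)
    (integral_nonneg fun x => trunc_mul_source_nonneg hκ L.h N u c Z x)
  exact add_le_add le_rfl (p4.trans p6)

/-- The source density for elements of `L²`. -/
def sourceL2 (N : Eucl n → ℝ) (u Z : L2 n) (c : Option (Fin n) → L2 n) (x : Eucl n) : ℝ :=
  ‖u x‖ ^ 2 + ‖Z x‖ ^ 2 + (N x * ∑ o, ‖c o x‖) ^ 2

theorem integrable_sq_norm (u : L2 n) : Integrable fun x => ‖u x‖ ^ 2 :=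
  (Lp.memLp u).norm.integrable_sq

theorem sq_mul_sum_norm_le {N₀ t : ℝ} (ht : |t| ≤ N₀) (c : Option (Fin n) → ℂ) :
    (t * ∑ o, ‖c o‖) ^ 2 ≤ N₀ ^ 2 * (n + 1) * ∑ o, ‖c o‖ ^ 2 := by
  have h1 : (∑ o, ‖c o‖) ^ 2 ≤ (n + 1) * ∑ o, ‖c o‖ ^ 2 := by
    have := sq_sum_le_card_mul_sum_sq (s := Finset.univ) (f := fun o : Option (Fin n) => ‖c o‖)
    simpa using this
  rw [mul_pow, mul_assoc]
  refine mul_le_mul ?_ h1 (sq_nonneg _) (sq_nonneg _)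
  rw [← sq_abs]
  exact pow_le_pow_left₀ (abs_nonneg _) ht 2

theorem integrable_sourceL2 {N : Eucl n → ℝ} (hNc : Continuous N) {N₀ : ℝ} (hN₀ : ∀ x, |N x| ≤ N₀)
    (u Z : L2 n) (c : Option (Fin n) → L2 n) : Integrable (sourceL2 N u Z c) := by
  have h1 : Integrable fun x => N₀ ^ 2 * (n + 1) * ∑ o, ‖c o x‖ ^ 2 :=
    (integrable_finsetSum _ fun o _ => integrable_sq_norm (c o)).const_mul _
  have h2 : AEStronglyMeasurable (fun x => (N x * ∑ o, ‖c o x‖) ^ 2) volume :=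
    (hNc.aestronglyMeasurable.mul (Finset.aestronglyMeasurable_fun_sum _ fun o _ =>
      (Lp.aestronglyMeasurable (c o)).norm)).pow 2
  refine ((integrable_sq_norm u).add (integrable_sq_norm Z)).add (h1.mono' h2
    (Eventually.of_forall fun x => ?_))
  rw [Real.norm_of_nonneg (sq_nonneg _)]
  exact sq_mul_sum_norm_le (hN₀ x) fun o => c o x

theorem sq_le_two_mul_add (a b : ℝ) : a ^ 2 ≤ 2 * b ^ 2 + 2 * (a - b) ^ 2 := by
  nlinarith [sq_nonneg (2 * b - a)]

theorem sq_norm_le_two_mul_add (a b : ℂ) : ‖a‖ ^ 2 ≤ 2 * ‖b‖ ^ 2 + 2 * ‖a - b‖ ^ 2 := by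
  have h1 : ‖a‖ ≤ ‖b‖ + ‖a - b‖ := by
    have := norm_sub_norm_le a b
    linarith
  have h2 := pow_le_pow_left₀ (norm_nonneg a) h1 2
  nlinarith [sq_nonneg (‖b‖ - ‖a - b‖)]

/-- The source of perturbed functions, up to a factor two and the squares of the errors. -/
theorem sourceL2_le {N : Eucl n → ℝ} {N₀ : ℝ} (hN₀ : ∀ x, |N x| ≤ N₀) (u Z u' Z' : L2 n)
    (c c' : Option (Fin n) → L2 n) (x : Eucl n) :
    sourceL2 N u' Z' c' x ≤ 2 * sourceL2 N u Z c x + 2 * (‖u' x - u x‖ ^ 2 + ‖Z' x - Z x‖ ^ 2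
      + N₀ ^ 2 * (n + 1) * ∑ o, ‖c' o x - c o x‖ ^ 2) := by
  have h1 := sq_norm_le_two_mul_add (u' x) (u x)
  have h2 := sq_norm_le_two_mul_add (Z' x) (Z x)
  have h3 := sq_le_two_mul_add (N x * ∑ o, ‖c' o x‖) (N x * ∑ o, ‖c o x‖)
  have h4 := sq_mul_sum_norm_le (hN₀ x) fun o => c' o x - c o x
  have h5 : (N x * ∑ o, ‖c' o x‖ - N x * ∑ o, ‖c o x‖) ^ 2 ≤ (N x * ∑ o, ‖c' o x - c o x‖) ^ 2 := by
    rw [← mul_sub, mul_pow, mul_pow]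
    refine mul_le_mul_of_nonneg_left ?_ (sq_nonneg _)
    rw [← Finset.sum_sub_distrib]
    refine sq_le_sq' ?_ ?_
    · rw [← Finset.sum_neg_distrib]
      refine Finset.sum_le_sum fun o _ => ?_
      have := norm_sub_norm_le (c o x) (c' o x)
      rw [norm_sub_rev] at this
      linarith
    · exact Finset.sum_le_sum fun o _ => norm_sub_norm_le _ _
  unfold sourceL2
  linarith

/-- The truncated source of approximations is bounded, up to a factor two, by that of the limit. The
factor allows dominated convergence for the fixed source, the truncations being at most one. -/
theorem exists_source_limit {N : Eucl n → ℝ} (hNc : Continuous N) {N₀ : ℝ}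
    (hN₀ : ∀ x, |N x| ≤ N₀) {κ : ℝ} (hκ : 0 < κ) {u Z : L2 n} {c : Option (Fin n) → L2 n}
    {u' Z' : ℕ → L2 n} {c' : ℕ → Option (Fin n) → L2 n} (hu : Tendsto u' atTop (𝓝 u))
    (hZ : Tendsto Z' atTop (𝓝 Z)) (hc : ∀ o, Tendsto (fun k => c' k o) atTop (𝓝 (c o)))
    (hae : ∀ᵐ x, Tendsto (fun k => u' k x) atTop (𝓝 (u x))) :
    ∃ b : ℕ → ℝ, Tendsto b atTop (𝓝 (2 * ∫ x, trunc κ (‖u x‖ ^ 2) * sourceL2 N u Z c x)) ∧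
      ∀ k, ∫ x, trunc κ (‖u' k x‖ ^ 2) * sourceL2 N (u' k) (Z' k) (c' k) x ≤ b k := by
  have iS := integrable_sourceL2 hNc hN₀ u Z c
  have hS0 : ∀ u Z c x, 0 ≤ sourceL2 (n := n) N u Z c x := fun u Z c x => by
    unfold sourceL2; positivity
  refine ⟨fun k => 2 * (∫ x, trunc κ (‖u' k x‖ ^ 2) * sourceL2 N u Z c x)
    + 2 * (‖u' k - u‖ ^ 2 + ‖Z' k - Z‖ ^ 2 + N₀ ^ 2 * (n + 1) * ∑ o, ‖c' k o - c o‖ ^ 2), ?_, fun k => ?_⟩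
  · have t1 : Tendsto (fun k => ∫ x, trunc κ (‖u' k x‖ ^ 2) * sourceL2 N u Z c x) atTop
        (𝓝 (∫ x, trunc κ (‖u x‖ ^ 2) * sourceL2 N u Z c x)) := by
      refine tendsto_integral_of_dominated_convergence (sourceL2 N u Z c) (fun k =>
        (integrable_trunc_mul hκ (Lp.aestronglyMeasurable (u' k)) iS).1) iS (fun k =>
        Eventually.of_forall fun x => ?_) ?_
      · rw [norm_mul, Real.norm_of_nonneg (trunc_nonneg hκ _), Real.norm_of_nonneg (hS0 _ _ _ _)]
        exact mul_le_of_le_one_left (hS0 _ _ _ _) (trunc_le_one hκ _)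
      · filter_upwards [hae] with x hx
        exact (((continuous_trunc hκ).tendsto _).comp (hx.norm.pow 2)).mul_const _
    have z : ∀ {f : ℕ → L2 n} {g : L2 n}, Tendsto f atTop (𝓝 g) →
        Tendsto (fun k => ‖f k - g‖ ^ 2) atTop (𝓝 0) := fun hf => by
      have := (tendsto_iff_norm_sub_tendsto_zero.1 hf).pow 2
      simpa using this
    have t2 : Tendsto (fun k => ∑ o, ‖c' k o - c o‖ ^ 2) atTop (𝓝 0) := by
      have := tendsto_finsetSum (Finset.univ : Finset (Option (Fin n))) fun o _ => z (hc o)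
      simpa using this
    have t3 := (t1.const_mul 2).add ((((z hu).add (z hZ)).add
      (t2.const_mul (N₀ ^ 2 * (n + 1)))).const_mul 2)
    simpa using t3
  · have d : ∀ f g : L2 n, ∫ x, ‖f x - g x‖ ^ 2 = ‖f - g‖ ^ 2 := fun f g => by
      rw [norm_sq_L2]
      refine integral_congr_ae ?_
      filter_upwards [Lp.coeFn_sub f g] with x hx
      rw [hx, Pi.sub_apply]
    have id : ∀ f g : L2 n, Integrable fun x => ‖f x - g x‖ ^ 2 := fun f g => by
      refine (integrable_sq_norm (f - g)).congr ?_
      filter_upwards [Lp.coeFn_sub f g] with x hx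
      rw [hx, Pi.sub_apply]
    have i1 := (integrable_trunc_mul hκ (Lp.aestronglyMeasurable (u' k)) iS).const_mul 2
    have i2 : Integrable fun x => ‖u' k x - u x‖ ^ 2 + ‖Z' k x - Z x‖ ^ 2 := (id _ _).add (id _ _)
    have i3 : Integrable fun x => N₀ ^ 2 * (n + 1) * ∑ o, ‖c' k o x - c o x‖ ^ 2 :=
      (integrable_finsetSum _ fun o _ => id (c' k o) (c o)).const_mul _
    have i4 : Integrable fun x => 2 * ((‖u' k x - u x‖ ^ 2 + ‖Z' k x - Z x‖ ^ 2)
        + N₀ ^ 2 * (n + 1) * ∑ o, ‖c' k o x - c o x‖ ^ 2) := (i2.add i3).const_mul 2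
    have m := integral_mono_of_nonneg (μ := volume) (f := fun x => trunc κ (‖u' k x‖ ^ 2)
        * sourceL2 N (u' k) (Z' k) (c' k) x) (Eventually.of_forall fun x =>
        mul_nonneg (trunc_nonneg hκ _) (hS0 _ _ _ _)) (i1.add i4) (Eventually.of_forall fun x => by
          have h1 := sourceL2_le hN₀ u Z (u' k) (Z' k) c (c' k) x
          have h2 := mul_le_mul_of_nonneg_left h1 (trunc_nonneg hκ (‖u' k x‖ ^ 2))
          have h3 : 0 ≤ 2 * (‖u' k x - u x‖ ^ 2 + ‖Z' k x - Z x‖ ^ 2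
            + N₀ ^ 2 * (n + 1) * ∑ o, ‖c' k o x - c o x‖ ^ 2) := by positivity
          have h4 := mul_le_of_le_one_left h3 (trunc_le_one hκ (‖u' k x‖ ^ 2))
          simp only [Pi.add_apply]
          linarith)
    refine m.trans (le_of_eq ?_)
    have e1 := integral_add i1 i4
    refine e1.trans ?_
    rw [integral_const_mul, integral_const_mul, integral_add i2 i3, integral_add (id _ _) (id _ _),
      integral_const_mul, integral_finsetSum _ fun o _ => id (c' k o) (c o), d, d]
    simp only [d]

/-- The Sobolev inequality for the truncations of the difference of two solutions. -/
theorem exists_lintegral_truncCube_le (hn : 2 ≤ n) {B : ℝ} (hB0 : 0 ≤ B) : ∃ K : ℝ, 0 ≤ K ∧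
    ∀ (L : DiffOp n) (R : L2 n →L[ℂ] L2 n) (C : ℝ) (N : Eucl n → ℝ) (N₀ : ℝ), L.B ≤ B →
      IsCore L (-Complex.I) R C → Continuous N → (∀ x, |N x| ≤ N₀) →
      (∀ᵐ x, ∀ o o', |L.pertCoef o o' x| ≤ N x) →
      (∀ᵐ x, ∑ i, ∑ j, |L.pertCoef (some i) (some j) x| ≤ 1 / 2) → ∀ (v v₀ u : L2 n) (κ : ℝ), 0 < κ →
      u = R v - fmul (resSym L.h (-Complex.I)) v₀ →
      ∫⁻ x, ENNReal.ofReal (truncCube κ (‖u x‖ ^ 2)) ^ ((n : ℝ) / (n - 1)) ≤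
        ENNReal.ofReal ((K / L.h * ∫ x, trunc κ (‖u x‖ ^ 2) * sourceL2 N u (v - v₀) (fun o =>
          derivRes (freeDiffOp n L.h L.mem_hRange) (-Complex.I) (lowMono o) v₀) x)
          ^ ((n : ℝ) / (n - 1))) := by
  obtain ⟨C, hC, hS⟩ := exists_sobolev hn
  have hn1 : (1 : ℝ) < n := by exact_mod_cast hn
  set q : ℝ := (n : ℝ) / (n - 1) with hq
  have hq0 : 0 < q := div_pos (by linarith) (by linarith)
  have hE := energyConst_nonneg (n := n) hB0
  refine ⟨C ^ q⁻¹ * (3 * (n + energyConst n B)) * 2, by positivity,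
    fun L R Cc N N₀ hB hR hNc hN₀ hN hm v v₀ u κ hκ hu => ?_⟩
  have hh := L.h_pos
  have hF := (realizes_free (n := n) L.mem_hRange).neg
  set L₀ := freeDiffOp n L.h L.mem_hRange
  have seq : ∀ {w : L2 n} {T : Test n → L2 n}, DenseRange T →
      ∃ ψ : ℕ → Test n, Tendsto (fun k => T (ψ k)) atTop (𝓝 w) := by
    intro w T hT
    obtain ⟨f, hf, hlim⟩ := mem_closure_iff_seq_limit.1 (hT w)
    choose ψ hψ using hf
    exact ⟨ψ, by simpa only [hψ] using hlim⟩
  -- `v` and `v₀` are approximated by images of test functions, for which the energy inequality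
  -- holds; the left-hand side passes to the limit by Fatou's lemma.
  obtain ⟨α, hα⟩ := seq (w := v) hR.dense
  obtain ⟨c, hc⟩ := seq (w := v₀) hF.dense
  have lu : Tendsto (fun k => testLp (α k - c k)) atTop (𝓝 u) := by
    have h1 := ((R.continuous.tendsto v).comp hα).sub
      (((fmul (resSym L.h (-Complex.I))).continuous.tendsto v₀).comp hc)
    rw [← hu] at h1
    refine h1.congr fun k => ?_
    rw [map_sub]
    exact congrArg₂ _ (hR.left_inv _) (hF.left_inv _)
  have lc : ∀ o, Tendsto (fun k => testLp ((lowMono o).act L.h (c k))) atTop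
      (𝓝 (derivRes L₀ (-Complex.I) (lowMono o) v₀)) := fun o => by
    refine (((derivRes L₀ (-Complex.I) (lowMono o)).continuous.tendsto v₀).comp hc).congr fun k => ?_
    exact derivRes_apply hF _ _
  have lZ := hα.sub hc
  obtain ⟨ns, hns, hae⟩ := exists_subseq_ae lu
  have sub := hns.tendsto_atTop
  obtain ⟨b, hb, hle⟩ := exists_source_limit hNc hN₀ hκ (lu.comp sub) (lZ.comp sub)
    (fun o => (lc o).comp sub) hae
  -- the inequality for the approximations
  have main : ∀ k, ∫⁻ x, ENNReal.ofReal (truncCube κ (‖testLp (α (ns k) - c (ns k)) x‖ ^ 2)) ^ q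
      ≤ ENNReal.ofReal (C * (3 / L.h * (n + energyConst n B) * b k) ^ q) := by
    intro k
    set w := α (ns k) - c (ns k) with hw
    have h1 := integral_deriv_truncCube_le L hB hNc hN hm hκ (α := α (ns k)) (c := c (ns k)) (u := w)
      (by rw [hw]; abel) rfl
    have e1 : ∫ x, trunc κ (‖(w : Eucl n → ℂ) x‖ ^ 2) * energySource L.h N w (c (ns k))
        (L.shift (-Complex.I) (α (ns k)) - L₀.shift (-Complex.I) (c (ns k))) x
        = ∫ x, trunc κ (‖testLp w x‖ ^ 2) * sourceL2 N (testLp w)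
          (L.shift (-Complex.I) (α (ns k)) - L₀.shift (-Complex.I) (c (ns k)))
          (fun o => testLp ((lowMono o).act L.h (c (ns k)))) x := by
      refine integral_congr_ae ?_
      have : ∀ᵐ x, ∀ o, testLp ((lowMono o).act L.h (c (ns k))) x
          = ((lowMono o).act L.h (c (ns k)) : Eucl n → ℂ) x := by
        rw [ae_all_iff]; exact fun o => coeFn_testLp _
      filter_upwards [coeFn_testLp w, this] with x k1 k2
      simp only [energySource, sourceL2, k1, k2, lowSum]
    have h2 : 3 / L.h * (n + energyConst n B) * (∫ x, trunc κ (‖(w : Eucl n → ℂ) x‖ ^ 2)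
        * energySource L.h N w (c (ns k))
          (L.shift (-Complex.I) (α (ns k)) - L₀.shift (-Complex.I) (c (ns k))) x)
        ≤ 3 / L.h * (n + energyConst n B) * b k := by
      rw [e1]
      exact mul_le_mul_of_nonneg_left (hle k) (by positivity)
    have hcs : HasCompactSupport fun x => truncCube κ (‖(w : Eucl n → ℂ) x‖ ^ 2) :=
      HasCompactSupport.intro w.hasCompactSupport.isCompact fun x hx => by
        rw [image_eq_zero_of_notMem_tsupport hx]
        exact truncCube_eq_zero (by simpa using hκ.le)
    have h3 := hS _ (contDiff_comp_sq_norm (contDiff_truncCube hκ) w) hcs _ (h1.trans h2)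
    refine le_trans (le_of_eq (lintegral_congr_ae ?_)) h3
    filter_upwards [coeFn_testLp w] with x hx
    rw [hx, abs_of_nonneg (truncCube_nonneg hκ _)]
  have hcube : Continuous (truncCube κ) := (contDiff_truncCube hκ).continuous
  have hcont : Continuous fun t : ℝ => ENNReal.ofReal (truncCube κ (t ^ 2)) ^ q :=
    (ENNReal.continuous_rpow_const).comp (ENNReal.continuous_ofReal.comp
      (hcube.comp (continuous_pow 2)))
  set I := ∫ x, trunc κ (‖u x‖ ^ 2) * sourceL2 N u (v - v₀) (fun o =>
    derivRes L₀ (-Complex.I) (lowMono o) v₀) x with hI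
  have hI0 : 0 ≤ I := integral_nonneg fun x => mul_nonneg (trunc_nonneg hκ _) (by
    unfold sourceL2; positivity)
  have lim : Tendsto (fun k => ENNReal.ofReal (C * (3 / L.h * (n + energyConst n B) * b k) ^ q)) atTop
      (𝓝 (ENNReal.ofReal (C * (3 / L.h * (n + energyConst n B) * (2 * I)) ^ q))) := by
    refine (ENNReal.continuous_ofReal.tendsto _).comp (Tendsto.const_mul C ?_)
    exact ((Real.continuous_rpow_const hq0.le).tendsto _).comp (hb.const_mul _)
  have fatou : ∫⁻ x, ENNReal.ofReal (truncCube κ (‖u x‖ ^ 2)) ^ q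
      ≤ ENNReal.ofReal (C * (3 / L.h * (n + energyConst n B) * (2 * I)) ^ q) := by
    have e1 : ∫⁻ x, ENNReal.ofReal (truncCube κ (‖u x‖ ^ 2)) ^ q
        = ∫⁻ x, liminf (fun k => ENNReal.ofReal
          (truncCube κ (‖testLp (α (ns k) - c (ns k)) x‖ ^ 2)) ^ q) atTop := by
      refine lintegral_congr_ae ?_
      filter_upwards [hae] with x hx
      exact (((hcont.tendsto _).comp hx.norm).liminf_eq).symm
    rw [e1]
    refine (lintegral_liminf_le' fun k => ?_).trans ?_
    · exact (hcont.comp_aestronglyMeasurable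
        (Lp.aestronglyMeasurable (testLp (α (ns k) - c (ns k)))).norm).aemeasurable
    · rw [← lim.liminf_eq]
      exact liminf_le_liminf (Eventually.of_forall main)
  refine fatou.trans (le_of_eq ?_)
  have e2 : C ^ q⁻¹ * (3 * (n + energyConst n B)) * 2 / L.h * I
      = C ^ q⁻¹ * (3 / L.h * (n + energyConst n B) * (2 * I)) := by ring
  have hY : 0 ≤ 3 / L.h * (n + energyConst n B) * (2 * I) := by positivity
  rw [e2, Real.mul_rpow (Real.rpow_nonneg hC _) hY, ← Real.rpow_mul hC, inv_mul_cancel₀ hq0.ne',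
    Real.rpow_one]

/-! ### The levels of a square integrable function -/

/-- The mass `∫_{|u|>k} |u|²` above the level `k`. -/
def level (u : L2 n) (k : ℝ) : ℝ := ∫ x, if k < ‖u x‖ then ‖u x‖ ^ 2 else 0

theorem levelDens_nonneg (u : L2 n) (k : ℝ) (x : Eucl n) :
    0 ≤ if k < ‖u x‖ then ‖u x‖ ^ 2 else 0 := by
  split_ifs <;> positivity

theorem integrable_levelDens (u : L2 n) (k : ℝ) :
    Integrable fun x => if k < ‖u x‖ then ‖u x‖ ^ 2 else 0 := by
  have hm : Measurable fun t : ℝ => if k < t then t ^ 2 else 0 :=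
    Measurable.ite measurableSet_Ioi (measurable_id.pow_const 2) measurable_const
  refine (integrable_sq_norm u).mono'
    (hm.comp_aemeasurable (Lp.aestronglyMeasurable u).norm.aemeasurable).aestronglyMeasurable
    (Eventually.of_forall fun x => ?_)
  rw [Real.norm_of_nonneg (levelDens_nonneg u k x)]
  split_ifs
  · exact le_rfl
  · positivity

theorem level_nonneg (u : L2 n) (k : ℝ) : 0 ≤ level u k :=
  integral_nonneg fun x => levelDens_nonneg u k x

theorem level_anti (u : L2 n) {k l : ℝ} (h : k ≤ l) : level u l ≤ level u k := by
  refine integral_mono (integrable_levelDens u l) (integrable_levelDens u k) fun x => ?_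
  simp only
  split_ifs with h1 h2
  · exact le_rfl
  · exact absurd (h.trans_lt h1) h2
  · positivity
  · exact le_rfl

theorem level_le_norm_sq (u : L2 n) (k : ℝ) : level u k ≤ ‖u‖ ^ 2 := by
  rw [norm_sq_L2]
  refine integral_mono (integrable_levelDens u k) (integrable_sq_norm u) fun x => ?_
  simp only
  split_ifs
  · exact le_rfl
  · positivity

/-- If no mass is left above the level `k`, the function is bounded by `k`. -/
theorem ae_norm_le_of_level_eq_zero {u : L2 n} {k : ℝ} (hk : 0 ≤ k) (h : level u k = 0) :
    ∀ᵐ x, ‖u x‖ ≤ k := by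
  have h1 := (integral_eq_zero_iff_of_nonneg (fun x => levelDens_nonneg u k x)
    (integrable_levelDens u k)).1 h
  filter_upwards [h1] with x hx
  by_contra hlt
  rw [not_le] at hlt
  simp only [if_pos hlt, Pi.zero_apply] at hx
  have : 0 < ‖u x‖ := hk.trans_lt hlt
  exact absurd hx (by positivity)

/-- The truncated source is controlled by the levels. Bounded parts of it are compared with
`|u|²/k²`, which is at least one where the truncation does not vanish. -/
theorem integral_trunc_source_le {N : Eucl n → ℝ} (hNc : Continuous N) {N₀ : ℝ}
    (hN₀ : ∀ x, |N x| ≤ N₀) {u Z : L2 n} {c : Option (Fin n) → L2 n} {E k j : ℝ} (hk : 0 < k)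
    (hE : ∀ᵐ x, |N x * ∑ o, ‖c o x‖| ≤ E) :
    ∫ x, trunc (k ^ 2) (‖u x‖ ^ 2) * sourceL2 N u Z c x
      ≤ level u k * (1 + (E ^ 2 + j ^ 2) / k ^ 2) + level Z j := by
  have hk2 : 0 < k ^ 2 := by positivity
  rw [level, level, ← integral_mul_const, ← integral_add
    ((integrable_levelDens u k).mul_const _) (integrable_levelDens Z j)]
  refine integral_mono_ae (integrable_trunc_mul hk2 (Lp.aestronglyMeasurable u)
    (integrable_sourceL2 hNc hN₀ u Z c)) (((integrable_levelDens u k).mul_const _).add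
    (integrable_levelDens Z j)) ?_
  filter_upwards [hE] with x hx
  have hZ := levelDens_nonneg Z j x
  by_cases h : k < ‖u x‖
  · rw [if_pos h]
    have hS : 0 ≤ sourceL2 N u Z c x := by unfold sourceL2; positivity
    refine (mul_le_of_le_one_left hS (trunc_le_one hk2 _)).trans ?_
    have h1 : 1 ≤ ‖u x‖ ^ 2 / k ^ 2 := by
      rw [one_le_div hk2]
      exact pow_le_pow_left₀ hk.le h.le 2
    have h2 : (N x * ∑ o, ‖c o x‖) ^ 2 ≤ E ^ 2 * (‖u x‖ ^ 2 / k ^ 2) := by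
      have h3 : (N x * ∑ o, ‖c o x‖) ^ 2 ≤ E ^ 2 := by
        rw [← sq_abs]
        exact pow_le_pow_left₀ (abs_nonneg _) hx 2
      exact h3.trans (le_mul_of_one_le_right (sq_nonneg E) h1)
    have h4 : ‖Z x‖ ^ 2 ≤ j ^ 2 * (‖u x‖ ^ 2 / k ^ 2) + if j < ‖Z x‖ then ‖Z x‖ ^ 2 else 0 := by
      split_ifs with hj
      · have : 0 ≤ j ^ 2 * (‖u x‖ ^ 2 / k ^ 2) := by positivity
        linarith
      · rw [add_zero]
        exact (pow_le_pow_left₀ (norm_nonneg _) (not_lt.1 hj) 2).trans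
          (le_mul_of_one_le_right (sq_nonneg j) h1)
    have e1 : ‖u x‖ ^ 2 * (1 + (E ^ 2 + j ^ 2) / k ^ 2)
        = ‖u x‖ ^ 2 + E ^ 2 * (‖u x‖ ^ 2 / k ^ 2) + j ^ 2 * (‖u x‖ ^ 2 / k ^ 2) := by ring
    rw [e1, sourceL2]
    linarith
  · rw [if_neg h, trunc_eq_zero (pow_le_pow_left₀ (norm_nonneg _) (not_lt.1 h) 2)]
    simpa using hZ

/-- Chebyshev's inequality for the function `ρτ³`. -/
theorem ofReal_level_le {q : ℝ} (hq : 1 ≤ q) (u : L2 n) {k l : ℝ} (hk : 0 < k) (hl : k < l) :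
    ENNReal.ofReal (level u l) ≤
      ENNReal.ofReal (l ^ (2 - 2 * q) * ((1 - (k / l) ^ 2)⁻¹ ^ 3) ^ q) *
        ∫⁻ x, ENNReal.ofReal (truncCube (k ^ 2) (‖u x‖ ^ 2)) ^ q := by
  have hl0 : 0 < l := hk.trans hl
  have hk2 : 0 < k ^ 2 := by positivity
  have hq0 : 0 < q := by linarith
  have hr : (k / l) ^ 2 < 1 := by
    rw [sq_lt_one_iff₀ (by positivity), div_lt_one hl0]
    exact hl
  have hg : 0 < 1 - (k / l) ^ 2 := by linarith
  rw [level, ofReal_integral_eq_lintegral_ofReal (integrable_levelDens u l)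
    (Eventually.of_forall fun x => levelDens_nonneg u l x),
    ← lintegral_const_mul' _ _ ENNReal.ofReal_ne_top]
  refine lintegral_mono fun x => ?_
  simp only
  split_ifs with h
  · set U := ‖u x‖
    have hU : 0 < U := hl0.trans h
    rw [ENNReal.ofReal_rpow_of_nonneg (truncCube_nonneg hk2 _) hq0.le,
      ← ENNReal.ofReal_mul (by positivity)]
    refine ENNReal.ofReal_le_ofReal ?_
    rw [truncCube_eq hk2 (pow_le_pow_left₀ hk.le (hl.trans h).le 2), mul_assoc,
      ← Real.mul_rpow (by positivity)]
    · have h1 : 1 - (k / l) ^ 2 ≤ 1 - k ^ 2 / U ^ 2 := by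
        rw [div_pow]
        gcongr
      have h2 : U ^ 2 ≤ (1 - (k / l) ^ 2)⁻¹ ^ 3 * (U ^ 2 * (1 - k ^ 2 / U ^ 2) ^ 3) := by
        have h3 := pow_le_pow_left₀ hg.le h1 3
        rw [inv_pow, inv_mul_eq_div, le_div_iff₀ (by positivity)]
        exact mul_le_mul_of_nonneg_left h3 (sq_nonneg U)
      have h4 : U ^ (2 - 2 * q) ≤ l ^ (2 - 2 * q) :=
        Real.rpow_le_rpow_of_nonpos hl0 h.le (by linarith)
      -- The exponent `2 - 2q` is not positive, so that `U > l` gives `U^{2-2q} ≤ l^{2-2q}`.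
      calc U ^ 2 = U ^ (2 - 2 * q) * (U ^ 2) ^ q := by
            rw [← Real.rpow_natCast, ← Real.rpow_mul hU.le, ← Real.rpow_add hU]
            congr 1
            push_cast
            ring
        _ ≤ _ := mul_le_mul h4 (Real.rpow_le_rpow (sq_nonneg U) h2 hq0.le) (by positivity)
            (by positivity)
    · have h1 : k ^ 2 / U ^ 2 ≤ 1 := by
        rw [div_le_one (by positivity)]
        exact pow_le_pow_left₀ hk.le (hl.trans h).le 2
      have : 0 ≤ 1 - k ^ 2 / U ^ 2 := by linarith
      positivity
  · simp

/-- The nonlinear recursive inequality between the levels of `u` and those of its source. -/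
theorem exists_level_step (hn : 2 ≤ n) {B : ℝ} (hB0 : 0 ≤ B) : ∃ K : ℝ, 0 ≤ K ∧
    ∀ (L : DiffOp n) (R : L2 n →L[ℂ] L2 n) (C : ℝ) (N : Eucl n → ℝ) (N₀ : ℝ), L.B ≤ B →
      IsCore L (-Complex.I) R C → Continuous N → (∀ x, |N x| ≤ N₀) →
      (∀ᵐ x, ∀ o o', |L.pertCoef o o' x| ≤ N x) →
      (∀ᵐ x, ∑ i, ∑ j, |L.pertCoef (some i) (some j) x| ≤ 1 / 2) →
      ∀ (v v₀ u : L2 n) (E k l j : ℝ), 0 < k → k < l →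
      u = R v - fmul (resSym L.h (-Complex.I)) v₀ →
      (∀ᵐ x, |N x * ∑ o, ‖derivRes (freeDiffOp n L.h L.mem_hRange) (-Complex.I) (lowMono o) v₀ x‖|
        ≤ E) →
      level u l ≤ l ^ (2 - 2 * ((n : ℝ) / (n - 1))) * ((1 - (k / l) ^ 2)⁻¹ ^ 3 *
        (K / L.h * (level u k * (1 + (E ^ 2 + j ^ 2) / k ^ 2) + level (v - v₀) j)))
          ^ ((n : ℝ) / (n - 1)) := by
  obtain ⟨K, hK, hb⟩ := exists_lintegral_truncCube_le hn hB0
  refine ⟨K, hK, fun L R C N N₀ hB hR hNc hN₀ hN hm v v₀ u E k l j hk hl hu hE => ?_⟩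
  have hn1 : (1 : ℝ) < n := by exact_mod_cast hn
  set q : ℝ := (n : ℝ) / (n - 1) with hq
  have hq1 : 1 ≤ q := by
    rw [hq, one_le_div (by linarith)]
    linarith
  have hh := L.h_pos
  have hl0 : 0 < l := hk.trans hl
  have hr : (k / l) ^ 2 < 1 := by
    rw [sq_lt_one_iff₀ (by positivity), div_lt_one hl0]
    exact hl
  have hg : 0 < 1 - (k / l) ^ 2 := by linarith
  set I := ∫ x, trunc (k ^ 2) (‖u x‖ ^ 2) * sourceL2 N u (v - v₀) (fun o =>
    derivRes (freeDiffOp n L.h L.mem_hRange) (-Complex.I) (lowMono o) v₀) x with hI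
  have hI0 : 0 ≤ I := integral_nonneg fun x => mul_nonneg (trunc_nonneg (by positivity) _) (by
    unfold sourceL2; positivity)
  have h1 : I ≤ _ := integral_trunc_source_le hNc hN₀ (u := u) (Z := v - v₀) (j := j) hk hE
  have h2 := (ofReal_level_le hq1 u hk hl).trans
    (mul_le_mul_right (hb L R C N N₀ hB hR hNc hN₀ hN hm v v₀ u (k ^ 2) (by positivity) hu) _)
  rw [← ENNReal.ofReal_mul (by positivity), ENNReal.ofReal_le_ofReal_iff (by positivity),
    mul_assoc, ← Real.mul_rpow (by positivity) (by positivity)] at h2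
  refine h2.trans (mul_le_mul_of_nonneg_left (Real.rpow_le_rpow (by positivity) ?_ (by linarith))
    (by positivity))
  exact mul_le_mul_of_nonneg_left (mul_le_mul_of_nonneg_left h1 (by positivity)) (by positivity)

/-! ### The sup bound for small perturbations of the Euclidean metric -/

/-- The powers of `h` and of the size `b` of the data cancel in the recursive inequality for the
levels, because `q = n/(n-1)`. -/
theorem level_scaling (hn : 2 ≤ n) {q h b l : ℝ} (hq : q = (n : ℝ) / (n - 1)) (hh : 0 < h)
    (hb : 0 < b) (hl : 0 < l) {Y : ℝ} (hY : 0 ≤ Y) :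
    (b * h ^ (-(n : ℝ) / 2) * l) ^ (2 - 2 * q) * (b ^ 2 / h * Y) ^ q
      = b ^ 2 * (l ^ (2 - 2 * q) * Y ^ q) := by
  have hn1 : (1 : ℝ) < n := by exact_mod_cast hn
  have e1 : (h ^ (-(n : ℝ) / 2)) ^ (2 - 2 * q) * (h ^ q)⁻¹ = 1 := by
    rw [← Real.rpow_mul hh.le, ← Real.rpow_neg hh.le, ← Real.rpow_add hh]
    have : -(n : ℝ) / 2 * (2 - 2 * q) + -q = 0 := by
      rw [hq]
      have : (n : ℝ) - 1 ≠ 0 := by linarith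
      field_simp
      ring
    rw [this, Real.rpow_zero]
  have e2 : b ^ (2 - 2 * q) * (b ^ 2) ^ q = b ^ 2 := by
    rw [← Real.rpow_natCast, ← Real.rpow_mul hb.le, ← Real.rpow_add hb]
    congr 1
    push_cast
    ring
  have hη : 0 ≤ h ^ (-(n : ℝ) / 2) := Real.rpow_nonneg hh.le _
  rw [Real.mul_rpow (by positivity) hl.le, Real.mul_rpow hb.le hη,
    Real.mul_rpow (by positivity) hY, Real.div_rpow (sq_nonneg b) hh.le]
  calc _ = (b ^ (2 - 2 * q) * (b ^ 2) ^ q) * ((h ^ (-(n : ℝ) / 2)) ^ (2 - 2 * q) * (h ^ q)⁻¹)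
        * (l ^ (2 - 2 * q) * Y ^ q) := by rw [div_eq_mul_inv]; ring
    _ = _ := by rw [e1, e2, mul_one]

/-- The data of the recursive inequality for two consecutive functions of sizes `b` and `√r b`, in
terms of the masses `T` and `T'` relative to the squares of the sizes. -/
theorem level_data_le {T T' r j k G K h b : ℝ} (hK : 0 ≤ K) (hh : 0 < h) (hG : 0 ≤ G) (hT : 0 ≤ T)
    (hT' : 0 ≤ T') (hr : 0 ≤ r) :
    G * (K / h * (b ^ 2 * T * (1 + (1 + r * j ^ 2) / k ^ 2) + r * b ^ 2 * T'))
      ≤ b ^ 2 / h * (G * (K * (1 + r) * (T * (1 + (1 + j ^ 2) / k ^ 2) + T'))) := by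
  have h4 : T * (1 + (1 + r * j ^ 2) / k ^ 2) + r * T'
      ≤ (1 + r) * (T * (1 + (1 + j ^ 2) / k ^ 2) + T') := by
    have h6 : (1 + r) * (T * (1 + (1 + j ^ 2) / k ^ 2) + T')
        - (T * (1 + (1 + r * j ^ 2) / k ^ 2) + r * T')
        = T * (r + r / k ^ 2 + j ^ 2 / k ^ 2) + T' := by ring
    have h7 : 0 ≤ T * (r + r / k ^ 2 + j ^ 2 / k ^ 2) + T' := by positivity
    linarith
  have h9 : 0 ≤ b ^ 2 / h * (G * K) := by positivity
  calc _ = b ^ 2 / h * (G * K) * (T * (1 + (1 + r * j ^ 2) / k ^ 2) + r * T') := by ring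
    _ ≤ b ^ 2 / h * (G * K) * ((1 + r) * (T * (1 + (1 + j ^ 2) / k ^ 2) + T')) :=
      mul_le_mul_of_nonneg_left h4 h9
    _ = _ := by ring

theorem continuous_japanese_rpow (s : ℝ) : Continuous fun x : Eucl n => japanese x ^ s := by
  have h1 : Continuous fun x : Eucl n => japanese x :=
    Real.continuous_sqrt.comp (continuous_const.add (continuous_norm.pow 2))
  exact h1.rpow_const fun x => Or.inl (zero_lt_one.trans_le (one_le_japanese x)).ne'

theorem japanese_rpow_nonneg (s : ℝ) (x : Eucl n) : 0 ≤ japanese x ^ s :=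
  Real.rpow_nonneg (zero_le_one.trans (one_le_japanese x)) s

/-- The weights on the free solution are absorbed by the decay of the coefficients. -/
theorem exists_free_source_bound {φ : ℝ → ℂ} (hφ : ContDiff ℝ ∞ φ) (hc : HasCompactSupport φ)
    {s δ : ℝ} (hs : 0 ≤ s) (hδ : s ≤ δ) : ∃ K : ℝ, 0 ≤ K ∧ ∀ (h : ℝ) (hh : h ∈ hRange) (e : ℝ),
      0 ≤ e → ∀ ε : ℝ, 0 < ε → ε ≤ 1 → ∀ f : L2 n, ∀ᵐ x, |e * japanese x ^ (-δ) * ∑ o,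
        ‖derivRes (freeDiffOp n h hh) (-Complex.I) (lowMono o)
          (funCalc (freeOp n h) (addI φ) (wop n ε s f)) x‖| ≤ K * (e * ‖f‖) * h ^ (-(n : ℝ) / 2) := by
  obtain ⟨K, hK, hb⟩ := exists_free_pointwise (n := n) hφ hc hs
  refine ⟨(n + 1) * K, by positivity, fun h hh e he ε h0 h1 f => ?_⟩
  set c := fun o => derivRes (freeDiffOp n h hh) (-Complex.I) (lowMono o)
    (funCalc (freeOp n h) (addI φ) (wop n ε s f)) with hcdef
  have h2 : ∀ᵐ x, ∀ o, ‖wop n ε (-s) (c o) x‖ ≤ K * h ^ (-(n : ℝ) / 2) * ‖f‖ := by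
    rw [ae_all_iff]
    exact fun o => hb h hh ε h0 h1 f o
  have h3 : ∀ᵐ x, ∀ o, wop n ε (-s) (c o) x = (wt ε (-s) x : ℂ) * c o x := by
    rw [ae_all_iff]
    exact fun o => coeFn_mulOp (bddMeas_wt h0 h1 (-s)) (c o)
  filter_upwards [h2, h3] with x k2 k3
  have hj := japanese_rpow_nonneg (-δ) x
  set X := K * h ^ (-(n : ℝ) / 2) * ‖f‖ with hX
  have hX0 : 0 ≤ X := by have := Real.rpow_nonneg hh.1.le (-(n : ℝ) / 2); positivity
  have k4 : ∀ o, e * japanese x ^ (-δ) * ‖c o x‖ ≤ e * X := by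
    intro o
    have k5 := k2 o
    rw [k3 o, norm_mul, Complex.norm_real, Real.norm_of_nonneg (wt_pos h0 _ x).le] at k5
    have k6 : japanese x ^ (-δ) ≤ wt ε (-s) x := by
      have k7 := wt_le_japanese h0 hs hδ x
      have k8 : wt ε (-s) x * wt ε s x = 1 := by
        rw [← wt_add h0, neg_add_cancel, wt, zero_div, Real.rpow_zero]
      have k9 := japanese_rpow_neg_mul δ x
      have := wt_pos h0 (-s) x
      nlinarith [mul_le_mul_of_nonneg_left k7 (mul_nonneg hj this.le)]
    rw [mul_assoc]
    exact mul_le_mul_of_nonneg_left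
      ((mul_le_mul_of_nonneg_right k6 (norm_nonneg _)).trans k5) he
  rw [abs_of_nonneg (by positivity), Finset.mul_sum]
  refine (Finset.sum_le_sum fun o _ => k4 o).trans (le_of_eq ?_)
  rw [Finset.sum_const, Finset.card_univ, Fintype.card_option, Fintype.card_fin, nsmul_eq_mul, hX]
  push_cast
  ring

/-- The functions `(t + i)^m φ(t)` are smooth and compactly supported. -/
theorem addI_iterate {φ : ℝ → ℂ} (hφ : ContDiff ℝ ∞ φ) (hc : HasCompactSupport φ) (m : ℕ) :
    ContDiff ℝ ∞ (addI^[m] φ) ∧ HasCompactSupport (addI^[m] φ) := by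
  induction m with
  | zero => exact ⟨hφ, hc⟩
  | succ m ih =>
    rw [Function.iterate_succ_apply']
    exact ⟨addI_contDiff ih.1, addI_hasCompactSupport ih.2⟩

/-- The bound from `L²` to `L^∞` if the principal part is close to the Euclidean one. The functions
`u_m = (φ_m(A) - φ_m(P₀))⟨x⟩^s f` with `φ_m(t) = (t + i)^m φ(t)` solve a chain of equations, in each
of which the next function is a source. -/
theorem exists_sup_bound_of_close (hn : 2 ≤ n) {B C : ℝ} (hB : 1 ≤ B) (hC : 2 ≤ C) {s δ : ℝ}
    (hs : 0 ≤ s) (hδ : s ≤ δ) {φ : ℝ → ℂ} (hφ : ContDiff ℝ ∞ φ) (hc : HasCompactSupport φ) :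
    ∃ K : ℝ, 0 ≤ K ∧ ∀ (L : DiffOp n) (A : L2 n →ₗ.[ℂ] L2 n) (R : L2 n →L[ℂ] L2 n) (D e : ℝ),
      0 < e → L.B ≤ B → Realizes L A R C → L.Decay δ D e →
      (∀ᵐ x, ∑ i, ∑ j, |L.pertCoef (some i) (some j) x| ≤ 1 / 2) → ∀ ε : ℝ, 0 < ε → ε ≤ 1 →
        ∀ f : L2 n, ∀ᵐ x, ‖(funCalc A φ - funCalc (freeOp n L.h) φ) (wop n ε s f) x‖
          ≤ K * e * L.h ^ (-(n : ℝ) / 2) * ‖f‖ := by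
  have hn1 : (1 : ℝ) < n := by exact_mod_cast hn
  set q : ℝ := (n : ℝ) / (n - 1) with hq
  have hq1 : 1 < q := by
    rw [hq, one_lt_div (by linarith)]
    linarith
  have hψ := addI_iterate hφ hc
  choose K₁ hK₁ hb₁ using fun m => exists_weighted_funCalc_sub (n := n) (s₁ := 0) (δ := δ) hB hC
    le_rfl hs (by rwa [zero_add]) (hψ m).1 (hψ m).2
  choose K₂ hK₂ hb₂ using fun m => exists_free_source_bound (n := n) (hψ m).1 (hψ m).2 hs hδ
  obtain ⟨K, hK, hstep⟩ := exists_level_step hn (zero_le_one.trans hB)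
  -- `Λ m` bounds the data of the `m`-th equation in terms of `e‖f‖`
  set Λ : ℕ → ℝ := fun m => K₁ m + K₂ m + 1 with hΛ
  have hΛ0 : ∀ m, 0 < Λ m := fun m => by have := hK₁ m; have := hK₂ m; positivity
  set K' : ℕ → ℝ := fun m => K * (1 + (Λ (m + 1) / Λ m) ^ 2) with hK'
  have hK'0 : ∀ m, 0 ≤ K' m := fun m => by positivity
  obtain ⟨M, hM, hzero⟩ := exists_level_eq_zero hq1 hK'0
  refine ⟨M * Λ 0, mul_nonneg hM.le (hΛ0 0).le, fun L A R D e he hL hR hdec hm ε h0 h1 f => ?_⟩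
  have hh := L.h_pos
  have hF := realizes_free (n := n) L.mem_hRange
  rcases eq_or_ne f 0 with rfl | hf
  · have : (funCalc A φ - funCalc (freeOp n L.h) φ) (wop n ε s 0) = 0 := by rw [map_zero, map_zero]
    rw [this]
    filter_upwards [Lp.coeFn_zero ℂ 2 (volume : Measure (Eucl n))] with x hx
    rw [hx]
    simp
  have hf0 : 0 < ‖f‖ := norm_pos_iff.2 hf
  set η : ℝ := L.h ^ (-(n : ℝ) / 2) with hη
  have hη0 : 0 < η := Real.rpow_pos_of_pos hh _
  set g := wop n ε s f with hg
  set u : ℕ → L2 n := fun m =>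
    (funCalc A (addI^[m] φ) - funCalc (freeOp n L.h) (addI^[m] φ)) g with hu
  set b : ℕ → ℝ := fun m => Λ m * (e * ‖f‖) with hb
  have hb0 : ∀ m, 0 < b m := fun m => mul_pos (hΛ0 m) (mul_pos he hf0)
  have norm_u : ∀ m, ‖u m‖ ≤ b m := by
    intro m
    have h2 := hb₁ m L A R D e he.le hL hR hdec ε h0 h1
    rw [wop_zero, one_mul] at h2
    have h3 : ‖u m‖ ≤ K₁ m * e * ‖f‖ := ContinuousLinearMap.le_of_opNorm_le _ h2 f
    refine h3.trans ?_
    rw [hb, mul_assoc]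
    exact mul_le_mul_of_nonneg_right (by have := hK₂ m; simp only [hΛ]; linarith) (by positivity)
  set N : Eucl n → ℝ := fun x => e * japanese x ^ (-δ) with hN
  have hNc : Continuous N := continuous_const.mul (continuous_japanese_rpow _)
  have hN₀ : ∀ x, |N x| ≤ e := fun x => by
    have h2 := japanese_rpow_nonneg (-δ) x
    have h3 : japanese x ^ (-δ) ≤ 1 :=
      Real.rpow_le_one_of_one_le_of_nonpos (one_le_japanese x) (by linarith)
    rw [abs_of_nonneg (mul_nonneg he.le h2)]
    exact mul_le_of_le_one_right he.le h3
  -- Levels are measured in units of `b_m h^{-n/2}`, and masses in units of `b_m²`.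
  have recur : ∀ m k l j, 0 < k → k < l → 0 < j → level (u m) (b m * η * l) ≤
      (b m * η * l) ^ (2 - 2 * q) * ((1 - (k / l) ^ 2)⁻¹ ^ 3 *
        (K / L.h * (level (u m) (b m * η * k) * (1 + ((b m * η) ^ 2 + (b (m + 1) * η * j) ^ 2)
          / (b m * η * k) ^ 2) + level (u (m + 1)) (b (m + 1) * η * j)))) ^ q := by
    intro m k l j hk hl hj
    have ha : 0 < b m * η := mul_pos (hb0 m) hη0
    have e1 : u m = R (funCalc A (addI^[m + 1] φ) g)
        - fmul (resSym L.h (-Complex.I)) (funCalc (freeOp n L.h) (addI^[m + 1] φ) g) := by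
      rw [hu, Function.iterate_succ_apply']
      simp only
      rw [funCalc_eq_mul hR.pair (hψ m).1 (hψ m).2, funCalc_eq_mul hF.pair (hψ m).1 (hψ m).2]
      rfl
    have e2 : ∀ᵐ x, |N x * ∑ o, ‖derivRes (freeDiffOp n L.h L.mem_hRange) (-Complex.I) (lowMono o)
        (funCalc (freeOp n L.h) (addI^[m + 1] φ) g) x‖| ≤ b m * η := by
      rw [Function.iterate_succ_apply']
      filter_upwards [hb₂ m L.h L.mem_hRange e he.le ε h0 h1 f] with x hx
      refine hx.trans (mul_le_mul_of_nonneg_right (mul_le_mul_of_nonneg_right ?_ (by positivity))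
        hη0.le)
      have := hK₁ m
      simp only [hΛ]
      linarith
    have h2 := hstep L R C N e hL hR.neg hNc hN₀ hdec.coef hm _ _ (u m) (b m * η) (b m * η * k)
      (b m * η * l) (b (m + 1) * η * j) (mul_pos ha hk) (mul_lt_mul_of_pos_left hl ha) e1 e2
    rw [mul_div_mul_left _ _ ha.ne'] at h2
    exact h2
  have hT : LevelDecay q K' fun m k => level (u m) (b m * η * k) / b m ^ 2 :=
    { nonneg := fun m k => div_nonneg (level_nonneg _ _) (sq_nonneg _)
      anti := fun m k l _ hkl => by
        have ha : 0 < b m * η := mul_pos (hb0 m) hη0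
        have := hb0 m
        exact div_le_div_of_nonneg_right (level_anti _ (mul_le_mul_of_nonneg_left hkl ha.le))
          (by positivity)
      le_one := fun m k _ => by
        have := hb0 m
        rw [div_le_one (by positivity)]
        exact (level_le_norm_sq _ _).trans (pow_le_pow_left₀ (norm_nonneg _) (norm_u m) 2)
      step := fun m k l j hk hl hj => by
        have hbm := hb0 m
        have hbm' := hb0 (m + 1)
        have hl0 : 0 < l := hk.trans hl
        have hr : (k / l) ^ 2 < 1 := by
          rw [sq_lt_one_iff₀ (by positivity), div_lt_one hl0]
          exact hl
        have hg0 : 0 < 1 - (k / l) ^ 2 := by linarith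
        set T := level (u m) (b m * η * k) / b m ^ 2 with hTdef
        set T' := level (u (m + 1)) (b (m + 1) * η * j) / b (m + 1) ^ 2 with hTdef'
        have hT0 : 0 ≤ T := div_nonneg (level_nonneg _ _) (sq_nonneg _)
        have hT0' : 0 ≤ T' := div_nonneg (level_nonneg _ _) (sq_nonneg _)
        have t1 : level (u m) (b m * η * k) = b m ^ 2 * T := by
          rw [hTdef]; field_simp
        have t2 : level (u (m + 1)) (b (m + 1) * η * j) = b (m + 1) ^ 2 * T' := by
          rw [hTdef']; field_simp
        set r := (Λ (m + 1) / Λ m) ^ 2 with hr'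
        have t3 : b (m + 1) ^ 2 = r * b m ^ 2 := by
          have := (hΛ0 m).ne'
          simp only [hr', hb]
          field_simp
        have hr0 : 0 ≤ r := sq_nonneg _
        have t4 : ((b m * η) ^ 2 + (b (m + 1) * η * j) ^ 2) / (b m * η * k) ^ 2
            = (1 + r * j ^ 2) / k ^ 2 := by
          have : (b (m + 1) * η * j) ^ 2 = r * b m ^ 2 * η ^ 2 * j ^ 2 := by
            rw [← t3]; ring
          rw [this]
          field_simp
        have h2 := recur m k l j hk hl hj
        rw [t1, t2, t3, t4] at h2
        rw [div_le_iff₀' (by positivity)]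
        have h3 : (1 - (k / l) ^ 2)⁻¹ ^ 3 * (K / L.h * (b m ^ 2 * T * (1 + (1 + r * j ^ 2) / k ^ 2)
            + r * b m ^ 2 * T')) ≤ b m ^ 2 / L.h * ((1 - (k / l) ^ 2)⁻¹ ^ 3 * (K' m *
              (T * (1 + (1 + j ^ 2) / k ^ 2) + T'))) :=
          level_data_le hK hh (by positivity) hT0 hT0' hr0
        have hY : 0 ≤ (1 - (k / l) ^ 2)⁻¹ ^ 3 * (K' m * (T * (1 + (1 + j ^ 2) / k ^ 2) + T')) := by
          have := hK'0 m
          positivity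
        rw [← level_scaling hn hq hh hbm hl0 hY]
        refine h2.trans (mul_le_mul_of_nonneg_left (Real.rpow_le_rpow ?_ h3 (by linarith))
          (by positivity))
        positivity }
  have h2 := hzero _ hT
  have h3 : level (u 0) (b 0 * η * M) = 0 := by
    rcases div_eq_zero_iff.1 h2 with h | h
    · exact h
    · exact absurd h (pow_ne_zero 2 (hb0 0).ne')
  have := hb0 0
  filter_upwards [ae_norm_le_of_level_eq_zero (by positivity) h3] with x hx
  refine hx.trans (le_of_eq ?_)
  simp only [hb]
  ring

/-! ### Conclusion -/

theorem DiffOp.Decay.mono {L : DiffOp n} {δ D e D' e' : ℝ} (h : L.Decay δ D e) (hD : D ≤ D')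
    (he : e ≤ e') : L.Decay δ D' e' where
  coef := h.coef.mono fun x hx o o' =>
    (hx o o').trans (mul_le_mul_of_nonneg_right he (japanese_rpow_nonneg _ x))
  da := h.da.mono fun x hx i j =>
    (hx i j).trans (mul_le_mul_of_nonneg_right hD (japanese_rpow_nonneg _ x))
  db := h.db.mono fun x hx j =>
    (hx j).trans (mul_le_mul_of_nonneg_right hD (japanese_rpow_nonneg _ x))

theorem WeightedBound.mono {p : ENNReal} {s₁ s₂ K K' : ℝ} {T : L2 n →ₗ.[ℂ] L2 n}
    (h : WeightedBound p s₁ T s₂ K) (hK : K ≤ K') : WeightedBound p s₁ T s₂ K' := fun f g hg => by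
  obtain ⟨hT, hb⟩ := h f g hg
  exact ⟨hT, hb.trans (ENNReal.ofReal_le_ofReal (mul_le_mul_of_nonneg_right hK (norm_nonneg f)))⟩

/-- The bound from `L²` to `L^∞`. In dimension at most three a perturbation which is not small
satisfies `1 ≤ O(h^ν)`, so that the cruder bound suffices for it. -/
theorem exists_sup_bound (hn : 2 ≤ n) {B C : ℝ} (hB : 1 ≤ B) (hC : 2 ≤ C) {s δ : ℝ}
    (hs : 0 ≤ s) (hδ : s ≤ δ) {φ : ℝ → ℂ} (hφ : ContDiff ℝ ∞ φ) (hc : HasCompactSupport φ)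
    {D : ℝ} (hD : 0 < D) (ν : ℕ) :
    ∃ K : ℝ, 0 ≤ K ∧ ∀ (L : DiffOp n) (A : L2 n →ₗ.[ℂ] L2 n) (R : L2 n →L[ℂ] L2 n),
      L.B ≤ B → Realizes L A R C → L.Decay δ D (D * L.h ^ ν) →
      (4 ≤ n → ∀ᵐ x, ∑ i, ∑ j, |L.pertCoef (some i) (some j) x| ≤ 1 / 2) → ∀ ε : ℝ, 0 < ε → ε ≤ 1 →
        ∀ f : L2 n, ∀ᵐ x, ‖(funCalc A φ - funCalc (freeOp n L.h) φ) (wop n ε s f) x‖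
          ≤ K * L.h ^ ((ν : ℝ) - (n : ℝ) / 2) * ‖f‖ := by
  have hpow : ∀ L : DiffOp n, L.h ^ ((ν : ℝ) - (n : ℝ) / 2) = L.h ^ ν * L.h ^ (-(n : ℝ) / 2) := by
    intro L
    rw [sub_eq_add_neg, Real.rpow_add L.h_pos, Real.rpow_natCast, neg_div]
  obtain ⟨K, hK, hb⟩ := exists_sup_bound_of_close hn hB hC hs hδ hφ hc
  have close : ∀ (L : DiffOp n) (A : L2 n →ₗ.[ℂ] L2 n) (R : L2 n →L[ℂ] L2 n),
      L.B ≤ B → Realizes L A R C → L.Decay δ D (D * L.h ^ ν) →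
      (∀ᵐ x, ∑ i, ∑ j, |L.pertCoef (some i) (some j) x| ≤ 1 / 2) → ∀ ε : ℝ, 0 < ε → ε ≤ 1 →
        ∀ f : L2 n, ∀ᵐ x, ‖(funCalc A φ - funCalc (freeOp n L.h) φ) (wop n ε s f) x‖
          ≤ K * D * L.h ^ ((ν : ℝ) - (n : ℝ) / 2) * ‖f‖ := by
    intro L A R hL hR hdec hm ε h0 h1 f
    have hh := L.h_pos
    filter_upwards [hb L A R D (D * L.h ^ ν) (by positivity) hL hR hdec hm ε h0 h1 f] with x hx
    refine hx.trans (le_of_eq ?_)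
    rw [hpow]
    ring
  by_cases h4 : 4 ≤ n
  · exact ⟨K * D, by positivity, fun L A R hL hR hdec hm => close L A R hL hR hdec (hm h4)⟩
  obtain ⟨K₃, hK₃, hb₃⟩ := exists_sup_bound_of_le_three (by omega : n ≤ 3) hB hC hs hδ hφ hc
  refine ⟨K * D + K₃ * (2 * n ^ 2 * D ^ 2 + D), by positivity,
    fun L A R hL hR hdec _ ε h0 h1 f => ?_⟩
  have hh := L.h_pos
  have hη : 0 ≤ L.h ^ (-(n : ℝ) / 2) := Real.rpow_nonneg hh.le _
  have hp : 0 ≤ L.h ^ ((ν : ℝ) - (n : ℝ) / 2) := Real.rpow_nonneg hh.le _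
  -- If the perturbation is not small, then `1 ≤ 2n²Dh^ν`, so that a constant is `O(h^ν)`.
  by_cases hsmall : (n : ℝ) ^ 2 * (D * L.h ^ ν) ≤ 1 / 2
  · have hm : ∀ᵐ x, ∑ i, ∑ j, |L.pertCoef (some i) (some j) x| ≤ 1 / 2 := by
      filter_upwards [hdec.coef] with x hx
      refine le_trans ?_ hsmall
      have h2 : ∀ i j, |L.pertCoef (some i) (some j) x| ≤ D * L.h ^ ν := fun i j => by
        refine (hx _ _).trans (mul_le_of_le_one_right (by positivity) ?_)
        exact Real.rpow_le_one_of_one_le_of_nonpos (one_le_japanese x) (by linarith)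
      refine (Finset.sum_le_sum fun i _ => Finset.sum_le_sum fun j _ => h2 i j).trans (le_of_eq ?_)
      simp only [Finset.sum_const, Finset.card_univ, Fintype.card_fin, nsmul_eq_mul]
      ring
    filter_upwards [close L A R hL hR hdec hm ε h0 h1 f] with x hx
    refine hx.trans (mul_le_mul_of_nonneg_right (mul_le_mul_of_nonneg_right ?_ hp) (norm_nonneg f))
    have : 0 ≤ K₃ * (2 * (n : ℝ) ^ 2 * D ^ 2 + D) := by positivity
    linarith
  · filter_upwards [hb₃ L A R D (D * L.h ^ ν) hD.le (by positivity) hL hR hdec ε h0 h1 f] with x hx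
    refine hx.trans (mul_le_mul_of_nonneg_right ?_ (norm_nonneg f))
    rw [hpow, ← mul_assoc]
    refine mul_le_mul_of_nonneg_right ?_ hη
    have h2 : D ≤ 2 * (n : ℝ) ^ 2 * D ^ 2 * L.h ^ ν := by
      have h3 : 1 ≤ 2 * ((n : ℝ) ^ 2 * (D * L.h ^ ν)) := by linarith
      calc D = D * 1 := (mul_one D).symm
        _ ≤ D * (2 * ((n : ℝ) ^ 2 * (D * L.h ^ ν))) := mul_le_mul_of_nonneg_left h3 hD.le
        _ = _ := by ring
    have h4 : K₃ * (D + D * L.h ^ ν) ≤ K₃ * ((2 * n ^ 2 * D ^ 2 + D) * L.h ^ ν) :=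
      mul_le_mul_of_nonneg_left (by linarith) hK₃
    have h5 : 0 ≤ K * D * L.h ^ ν := by positivity
    linarith

end SemiclassicalDispersive

end

theorem proposition2p1 (n : ℕ) (hn : 2 ≤ n) :
    ∃ γ₀ : ℝ, 0 < γ₀ ∧
      ∀ (c : Coefficients n) (δ : ℝ) (P : ℝ → L2 n →ₗ.[ℂ] L2 n) (φ : ℝ → ℂ),
        c.Regular → 1 < δ →
        (∀ h ∈ hRange, IsSelfAdjointRealization c h (P h)) →
        Elliptic P →
        c.ShortRange δ →
        (4 ≤ n → c.CloseToEuclidean γ₀) →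
        ContDiff ℝ ∞ φ → HasCompactSupport φ → tsupport φ ⊆ Set.Ioi 0 →
        ∀ s s₁ s₂ : ℝ, 0 ≤ s → s ≤ δ → 0 ≤ s₁ → s₁ ≤ δ → 0 ≤ s₂ → s₂ ≤ δ → s₁ + s₂ ≤ δ →
        ∃ C : ℝ, 0 < C ∧ ∀ h ∈ hRange,
          WeightedBound 2 (-s) (everywhere (funCalc (freeOp n h) φ)) s C ∧
          WeightedBound 2 (-s) (everywhere (funCalc (P h) φ)) s C ∧
          WeightedBound 2 s₁ (everywhere (funCalc (P h) φ - funCalc (freeOp n h) φ)) s₂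
            (C * h ^ c.nu δ) ∧
          WeightedBound 2 s₁
            (sandwich (funCalc (freeOp n h) φ) (P h - freeOp n h) (funCalc (P h) φ)) s₂
            (C * h ^ c.nu δ) ∧
          WeightedBound ⊤ 0 (everywhere (funCalc (P h) φ - funCalc (freeOp n h) φ)) s
            (C * h ^ ((c.nu δ : ℝ) - (n : ℝ) / 2)) := by
  refine ⟨1 / 2, by norm_num, fun c δ P φ hr hδ hP hell hsr hclose hφ hc _ s s₁ s₂ hs hsδ hs₁ _ hs₂ _
    hsum => ?_⟩
  obtain ⟨D, C, hD, hC, hreal⟩ := exists_realizes (by linarith) hr hP hell hsr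
  have hB : (1 : ℝ) ≤ D + 1 := by linarith
  have hB0 : (0 : ℝ) ≤ D + 1 := by linarith
  have hC0 : (0 : ℝ) ≤ C := by linarith
  obtain ⟨K₁, hK₁, hb₁⟩ := exists_weighted_funCalc (n := n) hB0 hC0 hs hφ hc
  obtain ⟨K₂, hK₂, hb₂⟩ := exists_weighted_funCalc_sub (n := n) hB hC hs₁ hs₂ hsum hφ hc
  obtain ⟨K₃, hK₃, hb₃⟩ := exists_weighted_sandwich (n := n) hB hC hs₁ hs₂ hsum hφ hc
  obtain ⟨K₄, hK₄, hb₄⟩ := exists_sup_bound (n := n) hn hB hC hs hsδ hφ hc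
    (by linarith : 0 < D + 1) (c.nu δ)
  refine ⟨K₁ + K₂ * D + K₃ * D + K₄ + 1, by positivity, fun h hh => ?_⟩
  obtain ⟨L, rfl, ha, hLB, hdec, hR⟩ := hreal h hh
  have hh0 := L.h_pos
  have hp : 0 ≤ L.h ^ c.nu δ := by positivity
  have he : 0 ≤ D * L.h ^ c.nu δ := by positivity
  have hF := (realizes_free (n := n) hh).mono hC
  have hKD₂ : 0 ≤ K₂ * D := by positivity
  have hKD₃ : 0 ≤ K₃ * D := by positivity
  refine ⟨?_, ?_, ?_, ?_, ?_⟩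
  · refine (weightedBound_two hs fun ε h0 h1 => (hb₁ _ _ _ ?_ hF ε h0 h1).1).mono (by linarith)
    exact hB
  · exact (weightedBound_two hs fun ε h0 h1 => (hb₁ _ _ _ hLB hR ε h0 h1).1).mono (by linarith)
  · refine (weightedBound_two hs₂ fun ε h0 h1 =>
      hb₂ L (P L.h) _ D _ he hLB hR hdec ε h0 h1).mono ?_
    rw [← mul_assoc]
    exact mul_le_mul_of_nonneg_right (by linarith) hp
  · refine (hb₃ L (P L.h) _ D _ he hLB hR hdec).mono ?_
    rw [← mul_assoc]
    exact mul_le_mul_of_nonneg_right (by linarith) hp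
  · refine (weightedBound_top hs (hb₄ L (P L.h) _ hLB hR (hdec.mono (by linarith)
      (mul_le_mul_of_nonneg_right (by linarith) hp)) fun h4 => ?_)).mono
      (mul_le_mul_of_nonneg_right (by linarith) (Real.rpow_nonneg hh0.le _))
    refine Filter.Eventually.of_forall fun x => ?_
    -- the principal coefficients of `L` are the transposed ones
    rw [Finset.sum_comm]
    refine le_trans (le_of_eq ?_) (hclose h4 L.h hh x)
    refine Finset.sum_congr rfl fun j _ => Finset.sum_congr rfl fun i _ => ?_
    have : Coefficients.aFlat i j = Coefficients.aFlat j i := by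
      simp only [Coefficients.aFlat, eq_comm]
    simp only [DiffOp.pertCoef, ha, this]
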